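/- **Setting.** Let $I=[\alpha,\beta]$ with $\alpha<\beta$. All essential infima and suprema are with respect to Lebesgue measure on $I$, and $\|f\|_\infty=\operatorname{ess\,sup}|f|$. $BV$ is the space of (Lebesgue classes of) functions of bounded variation on $I$; $\operatorname{var}(f)$ is the least variation of a representative, and $\|f\|_{BV}=\operatorname{var}(f)+\|f\|_\infty$. For $j\in\mathbb N$ let $T_j:I\to I$ be a map with a finite partition (mod Leb) of $I$ into intervals on each of which $T_j$ is continuous and strictly monotone, let $H_j\subset I$ (the hole) be a possibly empty finite union of intervals, $X_j=I\setminus H_j$, and let $g_j:I\to(0,\infty)$ have bounded variation. Assume that $T_j$ has a full branch (an interval $Z$ of its partition with $T_j(Z)=I$ up to endpoints) contained in $X_j$. Let $(\Omega,m)$ be a complete probability space, $\sigma:\Omega\to\Omega$ an ergodic, bimeasurable, $m$-preserving bijection, and $\Omega=\bigsqcup_j\Omega_j$ a countable measurable partition; put $T_\omega=T_j$, $H_\omega=H_j$, $X_\omega=X_j$, $g_\omega=g_j$ for $\omega\in\Omega_j$. Let $T^{(n)}_\omega=T_{\sigma^{n-1}\omega}\circ\dots\circ T_\omega$, $g^{(n)}_\omega=\prod_{j<n}g_{\sigma^j\omega}\circ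 T^{(j)}_\omega$ and $X_{\omega,n}=\bigcap_{j<n}(T^{(j)}_\omega)^{-1}X_{\sigma^j\omega}$. Let $\mathring{\mathcal Z}^{(n)}_\omega$ be the coarsest partition (mod Leb) of $X_{\omega,n}$ into nondegenerate intervals each contained in an element of the join of the partitions $(T^{(j)}_\omega)^{-1}(\text{partition of }T_{\sigma^j\omega})$, $j<n$. An element $Z$ of $\mathring{\mathcal Z}^{(n)}_\omega$ is *full* if $T^{(n)}_\omega(Z)=I$ up to a null set. Let $b^{(n)}_\omega$ be the number of full elements, and $\xi^{(n)}_\omega$ the largest number of non-full elements such that the convex hull of their union contains no full element. The transfer operators are $$\mathcal L_\omega f=\sum_{Z\in\mathring{\mathcal Z}^{(1)}_\omega}\mathbf 1_{T_\omega(Z)}\,(fg_\omega)\circ(T_\omega|_Z)^{-1},\qquad \mathcal L^{(n)}_\omega=\mathcal L_{\sigma^{n-1}\omega}\circ\dots\circ\mathcal L_\omega .$$ Put $$d_{\omega,n}=\Big(3+3\sum_{j<n}\tfrac{\operatorname{var}(g_{\sigma^j\omega})}{\|g_{\sigma^j\omega}\|_\infty}\Big)\big(1+2\xi^{(n)}_\omega\big)\frac{\prod_{j<n}\|g_{\sigma^j\omega}\|_\infty}{\operatorname{ess\,inf}_{X_{\omega,n}}g^{(n)}_\omega},\qquad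 c_{\omega,n}=\frac{d_{\omega,n}}{b^{(n)}_\omega}.$$ Assume that $\{\log g_\omega\}$ is *strongly contracting*: $\log\#\mathring{\mathcal Z}^{(1)}_\omega$, $\log\|g_\omega\|_\infty$, $\log\operatorname{ess\,inf}g_\omega$ and $\operatorname{var}(g_\omega)/\|g_\omega\|_\infty$ are in $L^1(m)$ (in particular $\operatorname{ess\,inf}g_\omega>0$ a.s.), and $\int\log c_{\omega,n_*}\,dm<0$ for some $n_*\ge1$. A function $a:\Omega\to\mathbb R$ is *tempered* if $\frac1n\log|a(\sigma^{\pm n}\omega)|\to0$ as $n\to+\infty$ for $m$-a.e. $\omega$. For $a\in\mathbb R$ let $\mathcal C_a=\{f\in BV: f>0\text{ a.e.},\ \operatorname{var}(f)\le a\operatorname{ess\,inf}f\}$. **Theorem.** There are functions $q_\omega\in BV$, Borel measures $\nu_\omega$ on $I$ and numbers $\lambda^\pm_\omega$ $(\omega\in\Omega)$ such that for $m$-a.e. $\omega$ the following hold. 1. $\operatorname{ess\,inf}q_\omega=1$, $\lambda^-_\omega>0$, $\mathcal L_\omega q_\omega=\lambda^-_\omega q_{\sigma\omega}$, and $$q_\omega=\lim_{n\to\infty}\frac{\mathcal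 L^{(n)}_{\sigma^{-n}\omega}1}{\operatorname{ess\,inf}\mathcal L^{(n)}_{\sigma^{-n}\omega}1}\ \text{ in }L^\infty,\qquad \lambda^-_\omega=\operatorname{ess\,inf}\mathcal L_\omega q_\omega=\lim_{n\to\infty}\frac{\operatorname{ess\,inf}\mathcal L^{(n+1)}_{\sigma^{-n}\omega}1}{\operatorname{ess\,inf}\mathcal L^{(n)}_{\sigma^{-n}\omega}1}.$$ 2. $\nu_\omega$ is a non-atomic probability measure with $\nu_\omega(H_\omega)=0$, $\lambda^+_\omega>0$, $\nu_{\sigma\omega}(\mathcal L_\omega f)=\lambda^+_\omega\nu_\omega(f)$ for all $f\in BV$, and $$\nu_\omega(f)=\lim_{n\to\infty}\frac{\operatorname{ess\,inf}\mathcal L^{(n)}_\omega f}{\operatorname{ess\,inf}\mathcal L^{(n)}_\omega1}\ \text{ for all } f\in BV,\ f\ge0,\qquad \lambda^+_\omega=\nu_{\sigma\omega}(\mathcal L_\omega1)=\lim_{n\to\infty}\frac{\operatorname{ess\,inf}\mathcal L^{(n+1)}_\omega1}{\operatorname{ess\,inf}\mathcal L^{(n)}_{\sigma\omega}1}.$$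 3. $\mu_\omega:=q_\omega\nu_\omega/\nu_\omega(q_\omega)$ is a probability measure and $(T_\omega)_*\mu_\omega=\mu_{\sigma\omega}$, that is, $\int f\,d\mu_{\sigma\omega}=\int f\circ T_\omega\,d\mu_\omega$. Moreover, $\log\lambda^+$ and $\log\lambda^-$ are $m$-integrable and $\int\log\lambda^+_\omega\,dm=\int\log\lambda^-_\omega\,dm$. Say that *correlations decay at rate $r$* if there is a measurable, tempered $C:\Omega\to(0,\infty)$ such that for $m$-a.e. $\omega$, all $n\ge0$, $h\in BV$, $f\in L^1(\nu_\omega)$ and $\tilde f\in L^1(\nu_{\sigma^n\omega})$, $$\big|\mu_{\sigma^{-n}\omega}(f\circ T^{(n)}_{\sigma^{-n}\omega}\cdot h)-\mu_\omega(f)\,\mu_{\sigma^{-n}\omega}(h)\big|\le C_\omega\|f\|_{L^1(\nu_\omega)}\|h\|_{BV}\,r^n,$$ $$\big|\mu_\omega(\tilde f\circ T^{(n)}_\omega\cdot h)-\mu_{\sigma^n\omega}(\tilde f)\,\mu_\omega(h)\big|\le C_\omega\|\tilde f\|_{L^1(\nu_{\sigma^n\omega})}\|h\|_{BV}\,r^n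 .$$ Then correlations decay at some rate $r\in(0,1)$. Finally, in the case $n_*=1$ (that is, $\int\log c_{\omega,1}\,dm<0$), the rate may be chosen as follows. Let $0<\gamma<1$ with $\int\log c_{\omega,1}\,dm<\log\gamma$. The series $$a_\omega=\sum_{j\ge0}\gamma^{-j-1}d_{\sigma^{-j-1}\omega,1}\prod_{k=1}^{j}c_{\sigma^{-k}\omega,1}$$ converges for $m$-a.e. $\omega$. Put $\Delta_\omega=2\log\frac{1+\gamma(a_\omega+1)}{1-\gamma}$, and let $D\in\mathbb R$, $0<\varepsilon<1$ with $m(\Delta_\omega\le D)>1-\varepsilon$, and $\tanh(D/4)^{1-\varepsilon}<\vartheta<1$. Then $\vartheta$ is a contraction factor of the cones $\mathcal C_{a_\omega}$: if $\Theta_\omega$ is the Hilbert projective pseudo-metric of $\mathcal C_{a_\omega}$, then for every $k\ge0$ and $m$-a.e. $\omega$, for all sufficiently large $l$, all $f\in\mathcal C_{a_{\sigma^{-l}\omega}}$ and all $h\in\mathcal C_{a_{\sigma^{-(l+k)}\omega}}$, $$\Theta_\omega\big(\mathcal L^{(l)}_{\sigma^{-l}\omega}f,\ \mathcal L^{(l+k)}_{\sigma^{-(l+k)}\omega}h\big)\le\vartheta^{\,l}\,\Theta_{\sigma^{-l}\omega}\big(f,\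 \mathcal L^{(k)}_{\sigma^{-(l+k)}\omega}h\big),$$ and correlations decay at every rate $r>\vartheta$. -/

import Mathlib

open MeasureTheory Filter Topology Set

noncomputable section

namespace RandomInterval

/-- The compact interval `[α, β]`, as a type. It carries the order and the topology
inherited from `ℝ`. -/
abbrev Seg (α β : ℝ) : Type := Set.Icc α β

/-- Lebesgue measure on `[α, β]`. -/
def leb {α β : ℝ} : Measure (Seg α β) := Measure.comap Subtype.val (volume : Measure ℝ)

/-! ### Essential bounds, variation, and the space BV -/

section BV

variable {α β : ℝ}

/-- Essential infimum with respect to Lebesgue measure. -/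
def einf (f : Seg α β → ℝ) : ℝ := essInf f leb

/-- Essential infimum on a set `Z` of positive Lebesgue measure. -/
def einfOn (Z : Set (Seg α β)) (f : Seg α β → ℝ) : ℝ := essInf f (leb.restrict Z)

/-- The norm of `L^∞(Leb)`. -/
def supNorm (f : Seg α β → ℝ) : ℝ := essSup (fun x => |f x|) leb

/-- Functions of bounded variation. Two such functions define the same element of BV when they
agree Lebesgue-a.e. (equivalently, off a countable set). -/
def IsBV (f : Seg α β → ℝ) : Prop := BoundedVariationOn f Set.univ

/-- The variation of the class of `f`: the smallest variation of a representative. -/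
def eVar (f : Seg α β → ℝ) : ENNReal :=
  ⨅ (f' : Seg α β → ℝ) (_ : f' =ᵐ[leb] f), eVariationOn f' Set.univ

/-- The variation of the class of a function of bounded variation, as a real number. -/
def var (f : Seg α β → ℝ) : ℝ := (eVar f).toReal

/-- The BV norm. -/
def bvNorm (f : Seg α β → ℝ) : ℝ := var f + supNorm f

/-- The cone of positive BV functions with `var f ≤ a * einf f`. -/
def cone (a : ℝ) : Set (Seg α β → ℝ) :=
  {f | IsBV f ∧ (∀ᵐ x ∂(leb : Measure (Seg α β)), 0 < f x) ∧ var f ≤ a * einf f}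

/-- The partial order on BV induced by the cone: `h - f` lies in the cone or vanishes. -/
def coneLE (a : ℝ) (f h : Seg α β → ℝ) : Prop :=
  (fun x => h x - f x) ∈ cone a ∨ f =ᵐ[leb] h

/-- `sup {l > 0 : l f ≼ h}` for the order of the cone with aperture `a`. -/
def coneTau (a : ℝ) (f h : Seg α β → ℝ) : ENNReal :=
  ⨆ (l : ℝ) (_ : 0 < l) (_ : coneLE a (fun x => l * f x) h), ENNReal.ofReal l

/-- `inf {l > 0 : h ≼ l f}` for the order of the cone with aperture `a`. -/
def coneRho (a : ℝ) (f h : Seg α β → ℝ) : ENNReal :=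
  ⨅ (l : ℝ) (_ : 0 < l) (_ : coneLE a h (fun x => l * f x)), ENNReal.ofReal l

/-- The Hilbert projective pseudo-metric `log (ρ / τ)` of the cone with aperture `a`; it is
infinite if `ρ = ∞` or `τ = 0`. -/
def hilbertDist (a : ℝ) (f h : Seg α β → ℝ) : EReal :=
  ENNReal.log (coneRho a f h / coneTau a f h)

end BV

/-! ### Weighted piecewise monotone maps with holes -/

section Maps

variable {α β : ℝ}

/-- The map `T` sends `Z` onto the whole interval, up to a Lebesgue null set. (If `Z` is an
interval on which `T` is continuous, only endpoints can be missing.) -/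
def IsFull (T : Seg α β → Seg α β) (Z : Set (Seg α β)) : Prop :=
  T '' Z =ᵐ[leb] (Set.univ : Set (Seg α β))

/-- A piecewise monotone map `T` of `[α, β]` with its finite monotonicity partition (mod Leb)
into intervals, a hole `H` which is a finite (possibly empty) union of intervals, and a positive
weight `g` of bounded variation. At least one full branch is disjoint from the hole. -/
structure WeightedOpenMap (α β : ℝ) where
  T : Seg α β → Seg α β
  atoms : Set (Set (Seg α β))
  finite_atoms : atoms.Finite
  ordConnected_atoms : ∀ Z ∈ atoms, Z.OrdConnected
  disjoint_atoms : atoms.Pairwise (AEDisjoint leb)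
  cover_atoms : ∀ᵐ x ∂(leb : Measure (Seg α β)), x ∈ ⋃₀ atoms
  continuousOn_atoms : ∀ Z ∈ atoms, ContinuousOn T Z
  monotone_atoms : ∀ Z ∈ atoms, StrictMonoOn T Z ∨ StrictAntiOn T Z
  H : Set (Seg α β)
  hole_intervals : ∃ J : Set (Set (Seg α β)),
    J.Finite ∧ (∀ Z ∈ J, Z.OrdConnected) ∧ H = ⋃₀ J
  g : Seg α β → ℝ
  g_pos : ∀ x, 0 < g x
  g_bv : IsBV g
  full_branch : ∃ Z ∈ atoms, IsFull T Z ∧ Z ⊆ Hᶜ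

/-- The coarsest partition (mod Leb) of `X` into nondegenerate intervals each of which is
contained in an element of `P`: the nondegenerate components of the sets `Z ∩ X`, `Z ∈ P`. -/
def intervalPieces (P : Set (Set (Seg α β))) (X : Set (Seg α β)) : Set (Set (Seg α β)) :=
  {C | ∃ Z ∈ P, ∃ x ∈ Z ∩ X, C = Set.ordConnectedComponent (Z ∩ X) x ∧ C.Nontrivial}

namespace WeightedOpenMap

/-- The part of the interval outside the hole. -/
def X (M : WeightedOpenMap α β) : Set (Seg α β) := M.Hᶜ

/-- The branches of the open map. -/
def pieces (M : WeightedOpenMap α β) : Set (Set (Seg α β)) := intervalPieces M.atoms M.X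

open Classical in
/-- `1_{T(Z)} * ((f g) ∘ (T|_Z)⁻¹)`; note that `T` is injective on `Z`. -/
def branchTerm (M : WeightedOpenMap α β) (f : Seg α β → ℝ) (Z : Set (Seg α β))
    (y : Seg α β) : ℝ :=
  if h : ∃ x ∈ Z, M.T x = y then f h.choose * M.g h.choose else 0

/-- The transfer operator. -/
def transfer (M : WeightedOpenMap α β) (f : Seg α β → ℝ) : Seg α β → ℝ :=
  fun y => ∑ᶠ Z ∈ M.pieces, M.branchTerm f Z y

end WeightedOpenMap

end Maps

/-! ### Random compositions -/

section Random

variable {α β : ℝ} {Ω : Type*} [MeasurableSpace Ω]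

/-- `T_ω^{(n)} = T_{σ^{n-1} ω} ∘ ⋯ ∘ T_ω`. -/
def iterT (σ : Ω ≃ᵐ Ω) (M : Ω → WeightedOpenMap α β) : ℕ → Ω → Seg α β → Seg α β
  | 0, _ => id
  | n + 1, ω => (M (σ^[n] ω)).T ∘ iterT σ M n ω

/-- `L_ω^{(n)} = L_{σ^{n-1} ω} ∘ ⋯ ∘ L_ω`. -/
def iterL (σ : Ω ≃ᵐ Ω) (M : Ω → WeightedOpenMap α β) :
    ℕ → Ω → (Seg α β → ℝ) → Seg α β → ℝ
  | 0, _ => id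
  | n + 1, ω => (M (σ^[n] ω)).transfer ∘ iterL σ M n ω

/-- `g_ω^{(n)} = ∏_{j < n} g_{σ^j ω} ∘ T_ω^{(j)}`. -/
def iterG (σ : Ω ≃ᵐ Ω) (M : Ω → WeightedOpenMap α β) (n : ℕ) (ω : Ω) (x : Seg α β) : ℝ :=
  ∏ j ∈ Finset.range n, (M (σ^[j] ω)).g (iterT σ M j ω x)

/-- The survivor set `X_{ω,n} = ⋂_{j < n} (T_ω^{(j)})⁻¹ (X_{σ^j ω})`. -/
def survivor (σ : Ω ≃ᵐ Ω) (M : Ω → WeightedOpenMap α β) (n : ℕ) (ω : Ω) : Set (Seg α β) :=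
  {x | ∀ j < n, iterT σ M j ω x ∈ (M (σ^[j] ω)).X}

/-- The monotonicity partition of `T_ω^{(n)}`: the join of the partitions
`(T_ω^{(j)})⁻¹ (atoms of T_{σ^j ω})`, `j < n`. -/
def iterAtoms (σ : Ω ≃ᵐ Ω) (M : Ω → WeightedOpenMap α β) (n : ℕ) (ω : Ω) :
    Set (Set (Seg α β)) :=
  {Z | ∃ A : ℕ → Set (Seg α β), (∀ j < n, A j ∈ (M (σ^[j] ω)).atoms) ∧
    Z = {x | ∀ j < n, iterT σ M j ω x ∈ A j}}

/-- The branches of the open map `T_ω^{(n)}` restricted to the survivor set. -/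
def iterPieces (σ : Ω ≃ᵐ Ω) (M : Ω → WeightedOpenMap α β) (n : ℕ) (ω : Ω) :
    Set (Set (Seg α β)) :=
  intervalPieces (iterAtoms σ M n ω) (survivor σ M n ω)

/-- The full branches. -/
def fullPieces (σ : Ω ≃ᵐ Ω) (M : Ω → WeightedOpenMap α β) (n : ℕ) (ω : Ω) :
    Set (Set (Seg α β)) :=
  {Z ∈ iterPieces σ M n ω | IsFull (iterT σ M n ω) Z}

/-- The non-full branches. -/
def nonfullPieces (σ : Ω ≃ᵐ Ω) (M : Ω → WeightedOpenMap α β) (n : ℕ) (ω : Ω) :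
    Set (Set (Seg α β)) :=
  {Z ∈ iterPieces σ M n ω | ¬ IsFull (iterT σ M n ω) Z}

/-- The number of full branches. -/
def numFull (σ : Ω ≃ᵐ Ω) (M : Ω → WeightedOpenMap α β) (n : ℕ) (ω : Ω) : ℕ :=
  (fullPieces σ M n ω).ncard

/-- The convex hull of a subset of the interval. -/
def hull (s : Set (Seg α β)) : Set (Seg α β) := {x | ∃ y ∈ s, ∃ z ∈ s, y ≤ x ∧ x ≤ z}

/-- The largest number of contiguous non-full branches, that is, of non-full branches such that
the convex hull of their union contains no full branch. -/
def maxContiguous (σ : Ω ≃ᵐ Ω) (M : Ω → WeightedOpenMap α β) (n : ℕ) (ω : Ω) : ℕ :=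
  sSup {k | ∃ S : Finset (Set (Seg α β)), (S : Set (Set (Seg α β))) ⊆ nonfullPieces σ M n ω ∧
    (∀ F ∈ fullPieces σ M n ω, ¬ F ⊆ hull (⋃₀ (S : Set (Set (Seg α β))))) ∧ S.card = k}

/-- `∑_{j < n} var (g_{σ^j ω}) / ‖g_{σ^j ω}‖_∞`. -/
def varSum (σ : Ω ≃ᵐ Ω) (M : Ω → WeightedOpenMap α β) (n : ℕ) (ω : Ω) : ℝ :=
  ∑ j ∈ Finset.range n, var (M (σ^[j] ω)).g / supNorm (M (σ^[j] ω)).g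

/-- `∏_{j < n} ‖g_{σ^j ω}‖_∞`. -/
def normProd (σ : Ω ≃ᵐ Ω) (M : Ω → WeightedOpenMap α β) (n : ℕ) (ω : Ω) : ℝ :=
  ∏ j ∈ Finset.range n, supNorm (M (σ^[j] ω)).g

/-- The additive coefficient `d_{ω,n}`. -/
def coeffD (σ : Ω ≃ᵐ Ω) (M : Ω → WeightedOpenMap α β) (n : ℕ) (ω : Ω) : ℝ :=
  (3 + 3 * varSum σ M n ω) * (1 + 2 * (maxContiguous σ M n ω : ℝ)) *
    (normProd σ M n ω / einfOn (survivor σ M n ω) (iterG σ M n ω))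

/-- The contraction coefficient `c_{ω,n} = d_{ω,n} / b_{ω,f}^{(n)}`. -/
def coeffC (σ : Ω ≃ᵐ Ω) (M : Ω → WeightedOpenMap α β) (n : ℕ) (ω : Ω) : ℝ :=
  coeffD σ M n ω / (numFull σ M n ω : ℝ)

/-- Random strongly contracting potentials `log g_ω`. (That `log (einf g_ω)` is integrable
contains that `einf g_ω` is positive almost surely.) -/
structure StronglyContracting (m : Measure Ω) (σ : Ω ≃ᵐ Ω) (M : Ω → WeightedOpenMap α β) :
    Prop where
  integrable_log_card : Integrable (fun ω => Real.log ((M ω).pieces.ncard : ℝ)) m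
  integrable_log_sup : Integrable (fun ω => Real.log (supNorm (M ω).g)) m
  einf_pos : ∀ᵐ ω ∂m, 0 < einf (M ω).g
  integrable_log_einf : Integrable (fun ω => Real.log (einf (M ω).g)) m
  integrable_var : Integrable (fun ω => var (M ω).g / supNorm (M ω).g) m
  contracting : ∃ n : ℕ, 0 < n ∧ ∫ ω, Real.log (coeffC σ M n ω) ∂m < 0

/-- Tempered functions: `(1/n) log |a (σ^n ω)| → 0` as `|n| → ∞`, almost surely. -/
def Tempered (m : Measure Ω) (σ : Ω ≃ᵐ Ω) (a : Ω → ℝ) : Prop :=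
  ∀ᵐ ω ∂m, Tendsto (fun n : ℕ => Real.log |a (σ^[n] ω)| / n) atTop (𝓝 0) ∧
    Tendsto (fun n : ℕ => Real.log |a (σ.symm^[n] ω)| / n) atTop (𝓝 0)

/-! ### The random cones (for one-step contraction) -/

/-- The `j`-th term `γ^{-j-1} d_{σ^{-j-1} ω} ∏_{k=1}^{j} c_{σ^{-k} ω}` of the series of the
aperture, with `c = c_{·,1}` and `d = d_{·,1}`. -/
def apertureTerm (σ : Ω ≃ᵐ Ω) (M : Ω → WeightedOpenMap α β) (γ : ℝ) (ω : Ω) (j : ℕ) : ℝ :=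
  (γ ^ (j + 1))⁻¹ * coeffD σ M 1 (σ.symm^[j + 1] ω) *
    ∏ k ∈ Finset.range j, coeffC σ M 1 (σ.symm^[k + 1] ω)

/-- The aperture `a_ω` of the random cone. -/
def aperture (σ : Ω ≃ᵐ Ω) (M : Ω → WeightedOpenMap α β) (γ : ℝ) (ω : Ω) : ℝ :=
  ∑' j : ℕ, apertureTerm σ M γ ω j

/-- The bound `Δ_ω = 2 log ((1 + γ (a_ω + 1)) / (1 - γ))` on the projective diameter. -/
def diamBound (σ : Ω ≃ᵐ Ω) (M : Ω → WeightedOpenMap α β) (γ : ℝ) (ω : Ω) : ℝ :=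
  2 * Real.log ((1 + γ * (aperture σ M γ ω + 1)) / (1 - γ))

/-- The number `ϑ` is an asymptotic contraction factor of the transfer operators on the random
cones with apertures `a`: for every `k` and almost every `ω`, for all large `l`,
`Θ_ω(L_{σ^{-l}ω}^{(l)} f, L_{σ^{-(l+k)}ω}^{(l+k)} h)
  ≤ ϑ^l Θ_{σ^{-l}ω}(f, L_{σ^{-(l+k)}ω}^{(k)} h)`. -/
def ContractsCones (m : Measure Ω) (σ : Ω ≃ᵐ Ω) (M : Ω → WeightedOpenMap α β) (a : Ω → ℝ)
    (ϑ : ℝ) : Prop :=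
  ∀ k : ℕ, ∀ᵐ ω ∂m, ∃ N : ℕ, ∀ l ≥ N,
    ∀ f ∈ (cone (a (σ.symm^[l] ω)) : Set (Seg α β → ℝ)),
    ∀ h ∈ (cone (a (σ.symm^[l + k] ω)) : Set (Seg α β → ℝ)),
      hilbertDist (a ω) (iterL σ M l (σ.symm^[l] ω) f) (iterL σ M (l + k) (σ.symm^[l + k] ω) h)
        ≤ ((ϑ ^ l : ℝ) : EReal) *
          hilbertDist (a (σ.symm^[l] ω)) f (iterL σ M k (σ.symm^[l + k] ω) h)

/-! ### Equivariant densities, conformal measures, invariant measures -/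

/-- The functions `q_ω` are the normalized BV equivariant densities, with multipliers `lam`. -/
def IsDensityFamily (m : Measure Ω) (σ : Ω ≃ᵐ Ω) (M : Ω → WeightedOpenMap α β)
    (q : Ω → Seg α β → ℝ) (lam : Ω → ℝ) : Prop :=
  ∀ᵐ ω ∂m, IsBV (q ω) ∧ einf (q ω) = 1 ∧
    Tendsto (fun n : ℕ => supNorm fun x =>
      iterL σ M n (σ.symm^[n] ω) 1 x / einf (iterL σ M n (σ.symm^[n] ω) 1) - q ω x)
      atTop (𝓝 0) ∧
    0 < lam ω ∧
    (M ω).transfer (q ω) =ᵐ[leb] (fun x => lam ω * q (σ ω) x) ∧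
    lam ω = einf ((M ω).transfer (q ω)) ∧
    Tendsto (fun n : ℕ => einf (iterL σ M (n + 1) (σ.symm^[n] ω) 1) /
      einf (iterL σ M n (σ.symm^[n] ω) 1)) atTop (𝓝 (lam ω))

/-- The measures `ν_ω` are the non-atomic conformal probability measures, which do not charge
the hole, with multipliers `lam`. -/
def IsConformalFamily (m : Measure Ω) (σ : Ω ≃ᵐ Ω) (M : Ω → WeightedOpenMap α β)
    (ν : Ω → Measure (Seg α β)) (lam : Ω → ℝ) : Prop :=
  ∀ᵐ ω ∂m, IsProbabilityMeasure (ν ω) ∧ (∀ x, ν ω {x} = 0) ∧ ν ω (M ω).H = 0 ∧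
    (∀ f : Seg α β → ℝ, IsBV f → 0 ≤ᵐ[leb] f →
      Tendsto (fun n : ℕ => einf (iterL σ M n ω f) / einf (iterL σ M n ω 1))
        atTop (𝓝 (∫ x, f x ∂(ν ω)))) ∧
    0 < lam ω ∧
    (∀ f : Seg α β → ℝ, IsBV f →
      ∫ x, (M ω).transfer f x ∂(ν (σ ω)) = lam ω * ∫ x, f x ∂(ν ω)) ∧
    lam ω = ∫ x, (M ω).transfer 1 x ∂(ν (σ ω)) ∧
    Tendsto (fun n : ℕ => einf (iterL σ M (n + 1) ω 1) / einf (iterL σ M n (σ ω) 1))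
      atTop (𝓝 (lam ω))

/-- The normalized measure `q ν / ν(q)`. -/
def normalized (q : Seg α β → ℝ) (ν : Measure (Seg α β)) : Measure (Seg α β) :=
  (ENNReal.ofReal (∫ x, q x ∂ν))⁻¹ • ν.withDensity (fun x => ENNReal.ofReal (q x))

/-- Exponential decay of correlations of the measures `μ_ω` at rate `r`, in the past and in the
future, for observables in `L^1(ν)` against BV observables, with a measurable tempered
constant. -/
def DecaysAtRate (m : Measure Ω) (σ : Ω ≃ᵐ Ω) (M : Ω → WeightedOpenMap α β)
    (ν μ : Ω → Measure (Seg α β)) (r : ℝ) : Prop :=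
  ∃ C : Ω → ℝ, Measurable C ∧ (∀ ω, 0 < C ω) ∧ Tempered m σ C ∧
    ∀ᵐ ω ∂m, ∀ n : ℕ, ∀ h : Seg α β → ℝ, IsBV h →
      (∀ f : Seg α β → ℝ, Integrable f (ν ω) →
        |(∫ x, f (iterT σ M n (σ.symm^[n] ω) x) * h x ∂(μ (σ.symm^[n] ω))) -
            (∫ x, f x ∂(μ ω)) * ∫ x, h x ∂(μ (σ.symm^[n] ω))|
          ≤ C ω * (∫ x, |f x| ∂(ν ω)) * bvNorm h * r ^ n) ∧
      (∀ f : Seg α β → ℝ, Integrable f (ν (σ^[n] ω)) →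
        |(∫ x, f (iterT σ M n ω x) * h x ∂(μ ω)) -
            (∫ x, f x ∂(μ (σ^[n] ω))) * ∫ x, h x ∂(μ ω)|
          ≤ C ω * (∫ x, |f x| ∂(ν (σ^[n] ω))) * bvNorm h * r ^ n)

end Random

end RandomInterval

end

set_option linter.unusedSectionVars false

noncomputable section
namespace RandomInterval
variable {α β : ℝ} [Fact (α < β)]

/-! ### Variation of sums, multiples and compositions -/

section Variation

variable {ι : Type*} [LinearOrder ι]

/-! The mechanism is Birkhoff contraction of positive operators on cones of functions whose
variation is controlled by their essential infimum.

(1) Lasota–Yorke. Split `L^(n) f` into branches. A full branch adds no boundary jumps and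
contributes to the infimum of the image. A non-full branch adds two jumps, and its size is charged
to neighbouring full branches, at most `ξ` non-full ones per gap (`sum_nonfull_le`). So `L^(n)`
sends aperture `a` to `c a + d` (`var_iterL_le_of_var_le`). The series of the aperture solves `γ a
(σ^n ω) = d ω + c ω a ω` (`tsum_seriesTerm`), hence `L^(n)` maps each cone into a strictly smaller
one of finite projective diameter, and `Sand.contract` contracts ratios by the hyperbolic tangent of
a quarter of the diameter.

(2) Several steps. The power `σ^n` need not be ergodic, so for `n > 1` the series is shown to
converge only on a set of positive measure (`not_ae_not_summable`). This suffices. Take a set `A` of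
positive measure with diameters at most `D`. Almost every `σ`-orbit visits `A` with frequency
`m(A)`, some residue class modulo `n` receives its share of the visits, and between visits
positivity prevents expansion. Two functions of the orbit cone thus acquire a logarithmic ratio of
order `t ^ visits` with `t ^ n = tanh (D / 4)` (`ConeField.exists_ae_le`).

(3) Limits. Forward contraction makes `L^(n) f` asymptotically a multiple `Λ f` of `L^(n) 1`
(`exists_limit_of_mem_cone0`). `Λ` is linear, monotone and conformal, and it is integration against
a Stieltjes measure without atoms, because the mass of the monotonicity intervals tends to zero
(`ae_exists_atomBound_lt`, `exists_represents`). Backward contraction makes the normalized images of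
`1` from the past Cauchy, and their limit is the density (`exists_isDensity`). Duality between
transfer and composition gives invariance of `q ν / ν(q)`.

(4) Rates. A correlation is the `ν`-integral of an observable against the image of a function of
mean zero, so it is bounded by the contraction error times norms of densities
(`Represents.abs_correlation_le`). These norms are tempered: a nonnegative function whose increments
along `σ` are bounded above by an integrable function has an integrable coboundary of mean zero
(`integrable_coboundary`) and grows subexponentially. The same lemma shows that `log λ⁺` and `log
λ⁻`, which differ by the coboundary of `log ν(q)`, have equal integrals.

A technical theme runs through everything. The maps are not assumed nonsingular for Lebesgue
measure. Almost everywhere relations between BV functions are therefore sharpened to relations off a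
countable set (`countable_lt_of_ae_le`), since countable sets are preserved by images and preimages
of maps with finite fibres; pointwise arguments use the canonical representative `rep`. -/

theorem eVariationOn_add_le (f h : ι → ℝ) (s : Set ι) :
    eVariationOn (fun x => f x + h x) s ≤ eVariationOn f s + eVariationOn h s := by
  refine iSup_le fun ⟨n, u, hu, us⟩ => ?_
  calc ∑ i ∈ Finset.range n, edist (f (u (i + 1)) + h (u (i + 1))) (f (u i) + h (u i))
      ≤ ∑ i ∈ Finset.range n, (edist (f (u (i + 1))) (f (u i)) + edist (h (u (i + 1))) (h (u i))) :=
        Finset.sum_le_sum fun i _ => edist_add_add_le _ _ _ _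
    _ ≤ _ := by
        rw [Finset.sum_add_distrib]
        exact add_le_add (eVariationOn.sum_le hu us) (eVariationOn.sum_le hu us)

theorem eVariationOn_comp_lipschitz_le {C : NNReal} {φ : ℝ → ℝ} (hφ : LipschitzWith C φ)
    (f : ι → ℝ) (s : Set ι) : eVariationOn (fun x => φ (f x)) s ≤ C * eVariationOn f s := by
  refine iSup_le fun ⟨n, u, hu, us⟩ => ?_
  calc ∑ i ∈ Finset.range n, edist (φ (f (u (i + 1)))) (φ (f (u i)))
      ≤ ∑ i ∈ Finset.range n, C * edist (f (u (i + 1))) (f (u i)) :=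
        Finset.sum_le_sum fun i _ => hφ _ _
    _ ≤ _ := by
        rw [← Finset.mul_sum]
        gcongr
        exact eVariationOn.sum_le hu us

theorem eVariationOn_const_mul_le (c : ℝ) (f : ι → ℝ) (s : Set ι) :
    eVariationOn (fun x => c * f x) s ≤ ENNReal.ofReal |c| * eVariationOn f s := by
  have h : LipschitzWith ‖c‖₊ (fun y : ℝ => c * y) := by
    refine LipschitzWith.of_dist_le_mul fun x y => ?_
    simp [Real.dist_eq, ← mul_sub, abs_mul]
  refine (eVariationOn_comp_lipschitz_le h f s).trans_eq ?_
  congr 1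
  rw [← Real.norm_eq_abs, ofReal_norm]
  rfl

theorem boundedVariationOn_add {f h : ι → ℝ} {s : Set ι} (hf : BoundedVariationOn f s)
    (hh : BoundedVariationOn h s) : BoundedVariationOn (fun x => f x + h x) s :=
  ((eVariationOn_add_le f h s).trans_lt (ENNReal.add_lt_top.2 ⟨hf.lt_top, hh.lt_top⟩)).ne

theorem boundedVariationOn_const_mul (c : ℝ) {f : ι → ℝ} {s : Set ι}
    (hf : BoundedVariationOn f s) : BoundedVariationOn (fun x => c * f x) s :=
  ((eVariationOn_const_mul_le c f s).trans_lt (ENNReal.mul_lt_top (by simp) hf.lt_top)).ne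

theorem boundedVariationOn_sub {f h : ι → ℝ} {s : Set ι} (hf : BoundedVariationOn f s)
    (hh : BoundedVariationOn h s) : BoundedVariationOn (fun x => f x - h x) s := by
  have := boundedVariationOn_add hf (boundedVariationOn_const_mul (-1) hh)
  simpa [sub_eq_add_neg] using this

theorem boundedVariationOn_sum {κ : Type*} (t : Finset κ) {f : κ → ι → ℝ} {s : Set ι}
    (hf : ∀ k ∈ t, BoundedVariationOn (f k) s) :
    BoundedVariationOn (fun x => ∑ k ∈ t, f k x) s := by
  classical
  induction t using Finset.induction_on with
  | empty =>
    have : eVariationOn (fun _ : ι => (0 : ℝ)) s = 0 :=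
      eVariationOn.constant_on (by rintro _ ⟨a, _, rfl⟩ _ ⟨b, _, rfl⟩; rfl)
    simp [BoundedVariationOn, this]
  | insert a t ha ih =>
    simp only [Finset.sum_insert ha]
    exact boundedVariationOn_add (hf a (by simp)) (ih fun k hk => hf k (by simp [hk]))

end Variation

/-! ### Lebesgue measure on the segment -/

theorem leb_apply (s : Set (Seg α β)) : leb s = volume (Subtype.val '' s : Set ℝ) :=
  (MeasurableEmbedding.subtype_coe measurableSet_Icc).comap_apply _ _

instance : NullSingletonClass (leb : Measure (Seg α β)) :=
  ⟨fun x => by rw [leb_apply]; simp⟩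

theorem fact_lt (α β : ℝ) [h : Fact (α < β)] : α < β := h.out

/-- The open interval is dense in the segment, so a nonempty relatively open set contains a nonempty
open subset of `ℝ`. Sets of full measure are therefore dense, which is how almost everywhere
statements are evaluated at points. -/
instance : (leb : Measure (Seg α β)).IsOpenPosMeasure := by
  refine ⟨fun U hU hne h0 => ?_⟩
  rw [leb_apply] at h0
  obtain ⟨V, hV, rfl⟩ := isOpen_induced_iff.1 hU
  obtain ⟨⟨x, hx⟩, hxV⟩ := hne
  have hx' : x ∈ closure (Ioo α β) := by rwa [closure_Ioo (fact_lt α β).ne]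
  have hne' : (V ∩ Ioo α β).Nonempty := mem_closure_iff.1 hx' V hV hxV
  have hpos := (hV.inter isOpen_Ioo).measure_pos volume hne'
  refine hpos.ne' (measure_mono_null ?_ h0)
  rintro y ⟨hyV, hy⟩
  exact ⟨⟨y, Ioo_subset_Icc_self hy⟩, hyV, rfl⟩

instance : Nonempty (Seg α β) := ⟨⟨α, left_mem_Icc.2 (fact_lt α β).le⟩⟩

instance : NeZero (leb : Measure (Seg α β)) :=
  ⟨fun h => by
    have := isOpen_univ.measure_pos (leb : Measure (Seg α β)) univ_nonempty
    simp [h] at this⟩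

instance : (ae (leb : Measure (Seg α β))).NeBot := ae_neBot.2 (NeZero.ne _)

theorem dense_of_ae {p : Seg α β → Prop} (h : ∀ᵐ x ∂(leb : Measure (Seg α β)), p x) :
    Dense {x | p x} := Measure.dense_of_ae h

theorem ae_of_countable {p : Seg α β → Prop} (h : {x | ¬ p x}.Countable) :
    ∀ᵐ x ∂(leb : Measure (Seg α β)), p x := h.measure_zero leb

/-- The left endpoint. -/
def lo (α β : ℝ) [Fact (α < β)] : Seg α β := ⟨α, left_mem_Icc.2 (fact_lt α β).le⟩

/-- The right endpoint. -/
def hi (α β : ℝ) [Fact (α < β)] : Seg α β := ⟨β, right_mem_Icc.2 (fact_lt α β).le⟩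

theorem lo_le (x : Seg α β) : lo α β ≤ x := x.2.1
theorem le_hi (x : Seg α β) : x ≤ hi α β := x.2.2
theorem lo_lt_hi : lo α β < hi α β := fact_lt α β

instance : DenselyOrdered (Seg α β) := by
  have : OrdConnected (Icc α β) := ordConnected_Icc
  infer_instance

theorem nhdsGT_neBot_of_lt {x : Seg α β} (hx : x < hi α β) : (𝓝[>] x).NeBot :=
  nhdsGT_neBot_of_exists_gt ⟨_, hx⟩

theorem nhdsLT_neBot_of_lt {x : Seg α β} (hx : lo α β < x) : (𝓝[<] x).NeBot :=
  nhdsLT_neBot_of_exists_lt ⟨_, hx⟩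

/-! ### Functions of bounded variation -/

section IsBV

theorem isBV_const (c : ℝ) : IsBV (fun _ : Seg α β => c) := by
  have : eVariationOn (fun _ : Seg α β => c) univ = 0 :=
    eVariationOn.constant_on (by rintro _ ⟨a, _, rfl⟩ _ ⟨b, _, rfl⟩; rfl)
  simp [IsBV, BoundedVariationOn, this]

theorem isBV_one : IsBV (1 : Seg α β → ℝ) := isBV_const 1

variable {f h : Seg α β → ℝ}

theorem IsBV.add (hf : IsBV f) (hh : IsBV h) : IsBV (fun x => f x + h x) :=
  boundedVariationOn_add hf hh

theorem IsBV.sub (hf : IsBV f) (hh : IsBV h) : IsBV (fun x => f x - h x) :=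
  boundedVariationOn_sub hf hh

theorem IsBV.const_mul (c : ℝ) (hf : IsBV f) : IsBV (fun x => c * f x) :=
  boundedVariationOn_const_mul c hf

theorem IsBV.mul (hf : IsBV f) (hh : IsBV h) : IsBV (fun x => f x * h x) :=
  BoundedVariationOn.mul hf hh

theorem boundedVariationOn_bounded {ι : Type*} [LinearOrder ι] {f : ι → ℝ} {s : Set ι}
    (hf : BoundedVariationOn f s) : ∃ K, 0 ≤ K ∧ ∀ x ∈ s, |f x| ≤ K := by
  rcases s.eq_empty_or_nonempty with rfl | ⟨x₀, hx₀⟩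
  · exact ⟨0, le_rfl, by simp⟩
  · refine ⟨|f x₀| + (eVariationOn f s).toReal, by positivity, fun x hx => ?_⟩
    have := hf.dist_le hx hx₀
    rw [Real.dist_eq] at this
    have h2 := abs_sub_abs_le_abs_sub (f x) (f x₀)
    linarith

theorem IsBV.bounded (hf : IsBV f) : ∃ K, 0 ≤ K ∧ ∀ x, |f x| ≤ K := by
  obtain ⟨K, hK, h⟩ := boundedVariationOn_bounded hf
  exact ⟨K, hK, fun x => h x (mem_univ x)⟩

/-- The Jordan decomposition reduces this to monotone functions. -/
theorem boundedVariationOn_countable {f : Seg α β → ℝ} {s : Set (Seg α β)}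
    (hf : BoundedVariationOn f s) : {x ∈ s | ¬ ContinuousWithinAt f s x}.Countable := by
  obtain ⟨p, q, hp, hq, rfl⟩ := hf.locallyBoundedVariationOn.exists_monotoneOn_sub_monotoneOn
  refine (hp.countable_not_continuousWithinAt.union hq.countable_not_continuousWithinAt).mono ?_
  rintro x ⟨hx, hc⟩
  by_contra hcon
  simp only [mem_union, mem_ofPred_eq, not_or, not_and, not_not] at hcon
  exact hc ((hcon.1 hx).sub (hcon.2 hx))

theorem IsBV.countable_not_continuousAt (hf : IsBV f) : {x | ¬ ContinuousAt f x}.Countable := by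
  simpa [continuousWithinAt_univ] using boundedVariationOn_countable hf

theorem IsBV.measurable (hf : IsBV f) : Measurable f :=
  measurable_of_countable_not_continuousAt hf.countable_not_continuousAt

theorem IsBV.finset_sum {κ : Type*} (t : Finset κ) {f : κ → Seg α β → ℝ}
    (hf : ∀ k ∈ t, IsBV (f k)) : IsBV (fun x => ∑ k ∈ t, f k x) :=
  boundedVariationOn_sum t hf

end IsBV

/-- A nontrivial interval around a point is infinite near the point: it meets every neighbourhood
in a set with nonempty interior. -/
theorem exists_Ioo_of_mem_nhdsWithin {Z : Set (Seg α β)} (hZ : Z.OrdConnected)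
    (hZ' : Z.Nontrivial) {x : Seg α β} (hx : x ∈ Z) {U : Set (Seg α β)} (hU : U ∈ 𝓝[Z] x) :
    ∃ u v : Seg α β, u < v ∧ Ioo u v ⊆ Z ∩ U := by
  obtain ⟨V, hV, hVU⟩ := mem_nhdsWithin_iff_exists_mem_nhds_inter.1 hU
  obtain ⟨y, hy, hyx⟩ := hZ'.exists_ne x
  rcases hyx.lt_or_gt with hlt | hlt
  · obtain ⟨l, hl, hlV⟩ := exists_Ioc_subset_of_mem_nhds hV ⟨y, hlt⟩
    refine ⟨max l y, x, max_lt hl hlt, fun z hz => ?_⟩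
    have hz1 : l < z := (le_max_left _ _).trans_lt hz.1
    have hz2 : y < z := (le_max_right _ _).trans_lt hz.1
    have hzZ := hZ.out hy hx ⟨hz2.le, hz.2.le⟩
    exact ⟨hzZ, hVU ⟨hlV ⟨hz1, hz.2.le⟩, hzZ⟩⟩
  · obtain ⟨l, hl, hlV⟩ := exists_Ico_subset_of_mem_nhds hV ⟨y, hlt⟩
    refine ⟨x, min l y, lt_min hl hlt, fun z hz => ?_⟩
    have hz1 : z < l := hz.2.trans_le (min_le_left _ _)
    have hz2 : z < y := hz.2.trans_le (min_le_right _ _)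
    have hzZ := hZ.out hx hy ⟨hz.1.le, hz2.le⟩
    exact ⟨hzZ, hVU ⟨hlV ⟨hz.1.le, hz1⟩, hzZ⟩⟩

theorem exists_mem_Ioo_of_ae {p : Seg α β → Prop} (h : ∀ᵐ x ∂(leb : Measure (Seg α β)), p x)
    {u v : Seg α β} (huv : u < v) : ∃ x ∈ Ioo u v, p x := by
  obtain ⟨x, hx, hx'⟩ := (dense_of_ae h).inter_open_nonempty (Ioo u v) isOpen_Ioo
    (nonempty_Ioo.2 huv)
  exact ⟨x, hx, hx'⟩

/-- Where `f` is continuous relative to `Z`, a value below `c` would persist on a nondegenerate open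
interval, against the almost everywhere bound; only discontinuities remain. Countability is the
point: a piecewise monotone map may send null sets to non-null ones, but images and preimages of
countable sets stay countable. -/
theorem countable_lt_of_ae_le {f : Seg α β → ℝ} {Z : Set (Seg α β)} (hZ : Z.OrdConnected)
    (hZ' : Z.Nontrivial) (hf : BoundedVariationOn f Z) {c : ℝ}
    (h : ∀ᵐ x ∂(leb : Measure (Seg α β)), x ∈ Z → c ≤ f x) : {x ∈ Z | f x < c}.Countable := by
  refine (boundedVariationOn_countable hf).mono ?_
  rintro x ⟨hx, hxc⟩
  refine ⟨hx, fun hcont => ?_⟩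
  obtain ⟨u, v, huv, hsub⟩ := exists_Ioo_of_mem_nhdsWithin hZ hZ' hx
    (hcont.eventually_lt_const hxc)
  obtain ⟨y, hy, hyp⟩ := exists_mem_Ioo_of_ae h huv
  have hy' : y ∈ Z ∧ f y < c := hsub hy
  exact (hyp hy'.1).not_gt hy'.2

theorem univ_nontrivial : (univ : Set (Seg α β)).Nontrivial :=
  ⟨_, mem_univ _, _, mem_univ _, (lo_lt_hi (α := α) (β := β)).ne⟩

theorem IsBV.countable_of_ae_le {f h : Seg α β → ℝ} (hf : IsBV f) (hh : IsBV h)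
    (hle : f ≤ᵐ[leb] h) : {x | ¬ f x ≤ h x}.Countable := by
  have := countable_lt_of_ae_le (f := fun x => h x - f x) (c := 0) ordConnected_univ
    univ_nontrivial (hh.sub hf) (by filter_upwards [hle] with x hx _; linarith)
  refine this.mono fun x hx => ?_
  simp only [mem_ofPred_eq, not_le] at hx ⊢
  exact ⟨mem_univ _, by linarith⟩

theorem IsBV.countable_of_ae_eq {f h : Seg α β → ℝ} (hf : IsBV f) (hh : IsBV h)
    (hle : f =ᵐ[leb] h) : {x | f x ≠ h x}.Countable := by
  refine ((hf.countable_of_ae_le hh hle.le).union (hh.countable_of_ae_le hf hle.symm.le)).mono ?_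
  intro x hx
  by_contra hcon
  simp only [mem_union, mem_ofPred_eq, not_or, not_not] at hcon
  exact hx (le_antisymm hcon.1 hcon.2)

/-! ### The canonical representative -/

/-- The left-continuous representative of a function of bounded variation (right-continuous at
the left endpoint). -/
def rep (f : Seg α β → ℝ) : Seg α β → ℝ := (f.rightLim).leftLim

theorem isBV_rep {f : Seg α β → ℝ} (hf : IsBV f) : IsBV (rep f) :=
  (BoundedVariationOn.rightLim hf).leftLim

theorem rep_of_lo_lt {f : Seg α β → ℝ} (hf : IsBV f) {x : Seg α β} (hx : lo α β < x) :
    rep f x = f.leftLim x :=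
  haveI := nhdsLT_neBot_of_lt hx
  leftLim_rightLim (hf.tendsto_leftLim x)

theorem rep_lo (f : Seg α β → ℝ) : rep f (lo α β) = f.rightLim (lo α β) :=
  leftLim_eq_of_isBot lo_le

theorem rep_ae_eq {f : Seg α β → ℝ} (hf : IsBV f) : rep f =ᵐ[leb] f := by
  refine ae_of_countable ((hf.countable_not_continuousAt.union (countable_singleton (lo α β))).mono
    fun x hx => ?_)
  by_contra hcon
  simp only [mem_union, mem_ofPred_eq, not_or, not_not, mem_singleton_iff] at hcon
  have hlt : lo α β < x := lt_of_le_of_ne (lo_le x) (Ne.symm hcon.2)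
  exact hx ((rep_of_lo_lt hf hlt).trans hcon.1.continuousWithinAt.leftLim_eq)

/-- A one-sided neighbourhood filter (from the right at the left endpoint, from the left elsewhere)
works for all BV functions at once and meets every set of full measure. Almost everywhere
inequalities thus pass to the representatives at every point. -/
theorem exists_filter_rep (x : Seg α β) : ∃ l : Filter (Seg α β),
    (∀ p : Seg α β → Prop, (∀ᵐ y ∂(leb : Measure (Seg α β)), p y) → ∃ᶠ y in l, p y) ∧
    ∀ f : Seg α β → ℝ, IsBV f → Tendsto f l (𝓝 (rep f x)) := by
  rcases (lo_le x).eq_or_lt with rfl | hlt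
  · refine ⟨𝓝[>] (lo α β), fun p hp => ?_, fun f hf => ?_⟩
    · rw [frequently_iff]
      intro U hU
      obtain ⟨u, hu, hsub⟩ := (mem_nhdsGT_iff_exists_Ioo_subset' lo_lt_hi).1 hU
      obtain ⟨y, hy, hpy⟩ := exists_mem_Ioo_of_ae hp hu
      exact ⟨y, hsub hy, hpy⟩
    · rw [rep_lo]
      exact hf.tendsto_rightLim _
  · refine ⟨𝓝[<] x, fun p hp => ?_, fun f hf => ?_⟩
    · rw [frequently_iff]
      intro U hU
      obtain ⟨u, hu, hsub⟩ := (mem_nhdsLT_iff_exists_Ioo_subset' hlt).1 hU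
      obtain ⟨y, hy, hpy⟩ := exists_mem_Ioo_of_ae hp hu
      exact ⟨y, hsub hy, hpy⟩
    · rw [rep_of_lo_lt hf hlt]
      exact hf.tendsto_leftLim _

theorem le_of_tendsto_of_frequently_le {ι : Type*} {l : Filter ι} {u : ι → ℝ} {a c : ℝ}
    (hu : Tendsto u l (𝓝 a)) (h : ∃ᶠ y in l, c ≤ u y) : c ≤ a := by
  by_contra hcon
  push Not at hcon
  exact h ((hu.eventually_lt_const hcon).mono fun y hy => not_le.2 hy)

theorem rep_mono {f h : Seg α β → ℝ} (hf : IsBV f) (hh : IsBV h) (hle : f ≤ᵐ[leb] h)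
    (x : Seg α β) : rep f x ≤ rep h x := by
  obtain ⟨l, hl, hlim⟩ := exists_filter_rep x
  have := le_of_tendsto_of_frequently_le (c := 0) ((hlim h hh).sub (hlim f hf))
    (hl _ (by filter_upwards [hle] with y hy; simpa using hy))
  linarith

theorem rep_congr {f h : Seg α β → ℝ} (hf : IsBV f) (hh : IsBV h) (he : f =ᵐ[leb] h) :
    rep f = rep h :=
  funext fun x => le_antisymm (rep_mono hf hh he.le x) (rep_mono hh hf he.symm.le x)

theorem rep_const (c : ℝ) (x : Seg α β) : rep (fun _ : Seg α β => c) x = c := by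
  obtain ⟨l, hl, hlim⟩ := exists_filter_rep x
  have : l.NeBot := ⟨fun h => by simpa [h] using hl (fun _ => True) (by simp)⟩
  exact tendsto_nhds_unique (hlim _ (isBV_const c)) tendsto_const_nhds

theorem le_rep {f : Seg α β → ℝ} (hf : IsBV f) {c : ℝ}
    (h : ∀ᵐ x ∂(leb : Measure (Seg α β)), c ≤ f x) (x : Seg α β) : c ≤ rep f x := by
  simpa [rep_const] using rep_mono (isBV_const c) hf h x

theorem rep_le {f : Seg α β → ℝ} (hf : IsBV f) {c : ℝ}
    (h : ∀ᵐ x ∂(leb : Measure (Seg α β)), f x ≤ c) (x : Seg α β) : rep f x ≤ c := by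
  simpa [rep_const] using rep_mono hf (isBV_const c) h x

/-- Taking one-sided limits does not increase the variation over the open interval. The
representative is right-continuous at the left end and left-continuous at the right end, so adding
the endpoints costs nothing. -/
theorem eVariationOn_rep_le {f : Seg α β → ℝ} (hf : IsBV f) {Y : Set (Seg α β)}
    (hY : Ioo (lo α β) (hi α β) ⊆ Y) : eVariationOn (rep f) univ ≤ eVariationOn f Y := by
  have h1 : eVariationOn (rep f) (Ioo (lo α β) (hi α β)) ≤ eVariationOn f Y :=
    ((eVariationOn.eVariationOn_leftLim_le isOpen_Ioo).trans
      (eVariationOn.eVariationOn_rightLim_le isOpen_Ioo)).trans (eVariationOn.mono f hY)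
  have hlo : ContinuousWithinAt (rep f) (Ici (lo α β)) (lo α β) := by
    have hne : (𝓝[>] (lo α β)).NeBot := nhdsGT_neBot_of_lt lo_lt_hi
    have hr : (rep f).rightLim (lo α β) = rep f (lo α β) := by
      rw [rep_lo]
      refine (rightLim_leftLim (h' := hne) ((BoundedVariationOn.rightLim hf).tendsto_rightLim _)).trans ?_
      exact rightLim_rightLim (hf.tendsto_rightLim _)
    have := (isBV_rep hf).tendsto_rightLim (lo α β)
    rw [hr] at this
    exact continuousWithinAt_Ioi_iff_Ici.1 this
  have hhi : ContinuousWithinAt (rep f) (Iic (hi α β)) (hi α β) :=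
    BoundedVariationOn.continuousWithinAt_leftLim (BoundedVariationOn.rightLim hf)
  have e1 : eVariationOn (rep f) (Icc (lo α β) (hi α β)) =
      eVariationOn (rep f) (Ioc (lo α β) (hi α β)) :=
    (eVariationOn.eVariationOn_Ioc_eq_Icc_of_continuousWithinAt hlo).symm
  have e2 : eVariationOn (rep f) (Ioo (lo α β) (hi α β)) =
      eVariationOn (rep f) (Ioc (lo α β) (hi α β)) := by
    have hne : (𝓝[Ioi (lo α β) ∩ Iio (hi α β)] (hi α β)).NeBot := by
      rw [inter_comm, nhdsWithin_inter_of_mem']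
      · exact nhdsLT_neBot_of_lt lo_lt_hi
      · exact nhdsWithin_le_nhds (Ioi_mem_nhds lo_lt_hi)
    have := eVariationOn.eVariationOn_inter_Iio_eq_inter_Iic_of_continuousWithinAt
      (f := rep f) hne (hhi.mono inter_subset_right)
    rwa [Ioi_inter_Iio, Ioi_inter_Iic] at this
  have e3 : (univ : Set (Seg α β)) = Icc (lo α β) (hi α β) :=
    (eq_univ_of_forall fun x => mem_Icc.2 ⟨lo_le x, le_hi x⟩).symm
  rw [e3, e1, ← e2]
  exact h1

/-! ### The essential variation -/

theorem eVar_le_of_ae_eq {f h : Seg α β → ℝ} (he : h =ᵐ[leb] f) :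
    eVar f ≤ eVariationOn h univ :=
  iInf₂_le h he

/-- All BV members of a class share the same canonical representative, so its variation is a lower
bound for theirs and the infimum is attained. -/
theorem eVar_eq_rep {f : Seg α β → ℝ} (hf : IsBV f) : eVar f = eVariationOn (rep f) univ := by
  refine le_antisymm (eVar_le_of_ae_eq (rep_ae_eq hf)) (le_iInf₂ fun h he => ?_)
  by_cases hh : IsBV h
  · rw [rep_congr hf hh he.symm]
    exact eVariationOn_rep_le hh (subset_univ _)
  · rw [IsBV, BoundedVariationOn, not_not] at hh
    simp [hh]

/-- The endpoints do not count. Applied to the image of a full branch, which may miss them, this is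
why full branches create no boundary jumps. -/
theorem eVar_le_eVariationOn {f : Seg α β → ℝ} (hf : IsBV f) {Y : Set (Seg α β)}
    (hY : Ioo (lo α β) (hi α β) ⊆ Y) : eVar f ≤ eVariationOn f Y :=
  (eVar_eq_rep hf).trans_le (eVariationOn_rep_le hf hY)

theorem eVar_congr {f h : Seg α β → ℝ} (he : f =ᵐ[leb] h) : eVar f = eVar h := by
  refine le_antisymm (le_iInf₂ fun k hk => ?_) (le_iInf₂ fun k hk => ?_)
  · exact eVar_le_of_ae_eq (hk.trans he.symm)
  · exact eVar_le_of_ae_eq (hk.trans he)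

theorem var_congr {f h : Seg α β → ℝ} (he : f =ᵐ[leb] h) : var f = var h := by
  rw [var, eVar_congr he, var]

theorem IsBV.eVar_ne_top {f : Seg α β → ℝ} (hf : IsBV f) : eVar f ≠ ⊤ :=
  ((eVar_le_of_ae_eq (EventuallyEq.refl _ f)).trans_lt hf.lt_top).ne

theorem var_nonneg (f : Seg α β → ℝ) : 0 ≤ var f := ENNReal.toReal_nonneg

theorem eVar_add_le (f h : Seg α β → ℝ) : eVar (fun x => f x + h x) ≤ eVar f + eVar h := by
  rw [eVar, eVar, eVar]
  simp only [ENNReal.iInf_add, ENNReal.add_iInf, le_iInf_iff]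
  intro h' hh' f' hf'
  exact (iInf₂_le (fun x => f' x + h' x) (hf'.add hh')).trans (eVariationOn_add_le _ _ _)

theorem eVar_finset_sum_le {κ : Type*} (t : Finset κ) (f : κ → Seg α β → ℝ) :
    eVar (fun x => ∑ k ∈ t, f k x) ≤ ∑ k ∈ t, eVar (f k) := by
  classical
  induction t using Finset.induction_on with
  | empty =>
    simp only [Finset.sum_empty]
    exact (eVar_le_of_ae_eq (EventuallyEq.refl _ _)).trans_eq
      (eVariationOn.constant_on (by rintro _ ⟨a, _, rfl⟩ _ ⟨b, _, rfl⟩; rfl))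
  | insert a t ha ih =>
    simp only [Finset.sum_insert ha]
    exact (eVar_add_le _ _).trans (by gcongr)

theorem var_add_le {f h : Seg α β → ℝ} (hf : IsBV f) (hh : IsBV h) :
    var (fun x => f x + h x) ≤ var f + var h := by
  rw [var, var, var, ← ENNReal.toReal_add hf.eVar_ne_top hh.eVar_ne_top]
  exact ENNReal.toReal_mono (ENNReal.add_ne_top.2 ⟨hf.eVar_ne_top, hh.eVar_ne_top⟩)
    (eVar_add_le f h)

theorem eVar_comp_lipschitz_le {C : NNReal} {φ : ℝ → ℝ} (hφ : LipschitzWith C φ)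
    {f : Seg α β → ℝ} (hf : IsBV f) : eVar (fun x => φ (f x)) ≤ C * eVar f := by
  rw [eVar_eq_rep hf]
  refine (eVar_le_of_ae_eq (h := fun x => φ (rep f x)) ?_).trans
    (eVariationOn_comp_lipschitz_le hφ _ _)
  filter_upwards [rep_ae_eq hf] with x hx
  rw [hx]

theorem var_comp_lipschitz_le {C : NNReal} {φ : ℝ → ℝ} (hφ : LipschitzWith C φ)
    {f : Seg α β → ℝ} (hf : IsBV f) : var (fun x => φ (f x)) ≤ C * var f := by
  have := ENNReal.toReal_mono (ENNReal.mul_ne_top ENNReal.coe_ne_top hf.eVar_ne_top)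
    (eVar_comp_lipschitz_le hφ hf)
  simpa [var] using this

theorem var_const_mul_le (c : ℝ) {f : Seg α β → ℝ} (hf : IsBV f) :
    var (fun x => c * f x) ≤ |c| * var f := by
  have h : LipschitzWith ‖c‖₊ (fun y : ℝ => c * y) := by
    refine LipschitzWith.of_dist_le_mul fun x y => ?_
    simp [Real.dist_eq, ← mul_sub, abs_mul]
  simpa using var_comp_lipschitz_le h hf

theorem var_add_const_le {f : Seg α β → ℝ} (hf : IsBV f) (c : ℝ) :
    var (fun x => f x + c) ≤ var f := by
  have h : LipschitzWith 1 (fun y : ℝ => y + c) :=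
    LipschitzWith.of_dist_le_mul fun x y => by simp
  simpa using var_comp_lipschitz_le h hf

theorem var_const (c : ℝ) : var (fun _ : Seg α β => c) = 0 := by
  have : eVariationOn (fun _ : Seg α β => c) univ = 0 :=
    eVariationOn.constant_on (by rintro _ ⟨a, _, rfl⟩ _ ⟨b, _, rfl⟩; rfl)
  have h := eVar_le_of_ae_eq (EventuallyEq.refl (ae leb) (fun _ : Seg α β => c))
  rw [this, nonpos_iff_eq_zero] at h
  simp [var, h]

theorem var_mul_le {f h : Seg α β → ℝ} (hf : IsBV f) (hh : IsBV h) {A B : ℝ} (hA : 0 ≤ A)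
    (hB : 0 ≤ B) (hfA : ∀ᵐ x ∂(leb : Measure (Seg α β)), |f x| ≤ A)
    (hhB : ∀ᵐ x ∂(leb : Measure (Seg α β)), |h x| ≤ B) :
    var (fun x => f x * h x) ≤ A * var h + B * var f := by
  -- For representatives the almost everywhere bounds hold at every point, so the product rule for
  -- ordinary variation applies.
  have key : ∀ {k : Seg α β → ℝ} {C : ℝ}, IsBV k → 0 ≤ C →
      (∀ᵐ x ∂(leb : Measure (Seg α β)), |k x| ≤ C) → ∀ x ∈ univ, ‖rep k x‖ₑ ≤ C.toNNReal := by
    intro k C hk hC hkC x _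
    have h1 : |rep k x| ≤ C := abs_le.2
      ⟨le_rep hk (by filter_upwards [hkC] with y hy using (abs_le.1 hy).1) x,
        rep_le hk (by filter_upwards [hkC] with y hy using (abs_le.1 hy).2) x⟩
    rw [← ofReal_norm, Real.norm_eq_abs]
    exact ENNReal.ofReal_le_ofReal h1
  have h1 := eVariation_mul_le (key hf hA hfA) (key hh hB hhB)
  have h2 : eVar (fun x => f x * h x) ≤ eVariationOn (rep f * rep h) univ :=
    eVar_le_of_ae_eq ((rep_ae_eq hf).mul (rep_ae_eq hh))
  rw [← eVar_eq_rep hf, ← eVar_eq_rep hh] at h1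
  have h3 := ENNReal.toReal_mono (by
    refine ENNReal.add_ne_top.2 ⟨ENNReal.mul_ne_top ENNReal.coe_ne_top hh.eVar_ne_top,
      ENNReal.mul_ne_top ENNReal.coe_ne_top hf.eVar_ne_top⟩) (h2.trans h1)
  rw [ENNReal.toReal_add (ENNReal.mul_ne_top ENNReal.coe_ne_top hh.eVar_ne_top)
      (ENNReal.mul_ne_top ENNReal.coe_ne_top hf.eVar_ne_top)] at h3
  simpa [var, hA, hB] using h3

/-! ### Essential bounds -/

theorem bounded_isBoundedUnder {f : Seg α β → ℝ} {K : ℝ} (h : ∀ x, |f x| ≤ K)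
    (l : Filter (Seg α β)) : IsBoundedUnder (· ≤ ·) l f ∧ IsBoundedUnder (· ≥ ·) l f :=
  ⟨⟨K, eventually_map.2 (Eventually.of_forall fun x => (abs_le.1 (h x)).2)⟩,
    ⟨-K, eventually_map.2 (Eventually.of_forall fun x => (abs_le.1 (h x)).1)⟩⟩

section Bounds

variable {f h : Seg α β → ℝ}

theorem IsBV.ae_einf_le (hf : IsBV f) : ∀ᵐ x ∂(leb : Measure (Seg α β)), einf f ≤ f x := by
  obtain ⟨K, -, hK⟩ := hf.bounded
  exact ae_essInf_le (bounded_isBoundedUnder hK _).2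

theorem IsBV.le_einf (hf : IsBV f) {c : ℝ} (h : ∀ᵐ x ∂(leb : Measure (Seg α β)), c ≤ f x) :
    c ≤ einf f := by
  obtain ⟨K, -, hK⟩ := hf.bounded
  exact le_essInf_of_ae_le c h (bounded_isBoundedUnder hK _).1.isCoboundedUnder_ge

theorem einf_congr (he : f =ᵐ[leb] h) : einf f = einf h := essInf_congr_ae he

theorem einf_const (c : ℝ) : einf (fun _ : Seg α β => c) = c := essInf_const' c

theorem einf_one : einf (1 : Seg α β → ℝ) = 1 := einf_const 1

theorem IsBV.einf_mono (hf : IsBV f) (hh : IsBV h) (hle : f ≤ᵐ[leb] h) : einf f ≤ einf h :=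
  hh.le_einf (by filter_upwards [hle, hf.ae_einf_le] with x h1 h2 using h2.trans h1)

theorem IsBV.einf_add_le (hf : IsBV f) (hh : IsBV h) :
    einf f + einf h ≤ einf (fun x => f x + h x) :=
  (hf.add hh).le_einf (by
    filter_upwards [hf.ae_einf_le, hh.ae_einf_le] with x h1 h2 using add_le_add h1 h2)

theorem IsBV.einf_const_mul (hf : IsBV f) {c : ℝ} (hc : 0 ≤ c) :
    einf (fun x => c * f x) = c * einf f := by
  rcases hc.eq_or_lt with rfl | hc
  · simp [einf_const]
  refine le_antisymm ?_ ((hf.const_mul c).le_einf ?_)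
  · rw [← div_le_iff₀' hc]
    refine hf.le_einf ?_
    filter_upwards [(hf.const_mul c).ae_einf_le] with x hx
    rwa [div_le_iff₀' hc]
  · filter_upwards [hf.ae_einf_le] with x hx
    exact mul_le_mul_of_nonneg_left hx hc.le

theorem IsBV.rep_le_rep_add_var (hf : IsBV f) (x y : Seg α β) : rep f x ≤ rep f y + var f := by
  have := BoundedVariationOn.sub_le (isBV_rep hf) (mem_univ x) (mem_univ y)
  rw [← eVar_eq_rep hf] at this
  rw [var]
  linarith

theorem IsBV.rep_le_einf_add_var (hf : IsBV f) (x : Seg α β) : rep f x ≤ einf f + var f := by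
  have : rep f x - var f ≤ einf f := by
    refine hf.le_einf ?_
    filter_upwards [rep_ae_eq hf] with y hy
    have := hf.rep_le_rep_add_var x y
    rw [hy] at this
    linarith
  linarith

theorem IsBV.einf_le_rep (hf : IsBV f) (x : Seg α β) : einf f ≤ rep f x := le_rep hf hf.ae_einf_le x

theorem IsBV.ae_le_einf_add_var (hf : IsBV f) :
    ∀ᵐ x ∂(leb : Measure (Seg α β)), f x ≤ einf f + var f := by
  filter_upwards [rep_ae_eq hf] with x hx
  rw [← hx]
  exact hf.rep_le_einf_add_var x

theorem IsBV.abs (hf : IsBV f) : IsBV (fun x => |f x|) :=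
  ((eVariationOn_comp_lipschitz_le (C := 1)
    (LipschitzWith.of_dist_le_mul fun x y => by
      simpa [Real.dist_eq] using abs_abs_sub_abs_le_abs_sub x y) f univ).trans_lt
      (by simpa using hf.lt_top)).ne

theorem IsBV.ae_abs_le_supNorm (hf : IsBV f) :
    ∀ᵐ x ∂(leb : Measure (Seg α β)), |f x| ≤ supNorm f := by
  obtain ⟨K, -, hK⟩ := hf.abs.bounded
  exact ae_le_essSup (bounded_isBoundedUnder hK _).1

theorem IsBV.supNorm_le (hf : IsBV f) {c : ℝ}
    (h : ∀ᵐ x ∂(leb : Measure (Seg α β)), |f x| ≤ c) : supNorm f ≤ c := by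
  obtain ⟨K, -, hK⟩ := hf.abs.bounded
  exact essSup_le_of_ae_le c h (bounded_isBoundedUnder hK _).2.isCoboundedUnder_le

theorem IsBV.supNorm_nonneg (hf : IsBV f) : 0 ≤ supNorm f := by
  obtain ⟨x, hx⟩ := (hf.ae_abs_le_supNorm).exists
  exact (abs_nonneg _).trans hx

theorem IsBV.rep_le_supNorm (hf : IsBV f) (x : Seg α β) : rep f x ≤ supNorm f :=
  rep_le hf (by filter_upwards [hf.ae_abs_le_supNorm] with y hy using (le_abs_self _).trans hy) x

theorem IsBV.einf_le_supNorm (hf : IsBV f) : einf f ≤ supNorm f :=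
  (hf.einf_le_rep (lo α β)).trans (hf.rep_le_supNorm _)

theorem IsBV.abs_einf_sub_le (hf : IsBV f) (hh : IsBV h) :
    |einf f - einf h| ≤ supNorm (fun x => f x - h x) := by
  have key : ∀ {f h : Seg α β → ℝ} {c : ℝ}, IsBV f → IsBV h →
      (∀ᵐ x ∂(leb : Measure (Seg α β)), |f x - h x| ≤ c) → einf f - c ≤ einf h := by
    intro f h c hf hh hc
    refine hh.le_einf ?_
    filter_upwards [hc, hf.ae_einf_le] with x h1 h2
    linarith [(abs_le.1 h1).2]
  have hs := (hf.sub hh).ae_abs_le_supNorm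
  rw [abs_le]
  constructor
  · have := key hh hf (by filter_upwards [hs] with x hx; rwa [abs_sub_comm])
    linarith
  · have := key hf hh hs
    linarith

theorem bvNorm_nonneg (hf : IsBV f) : 0 ≤ bvNorm f := add_nonneg (var_nonneg f) hf.supNorm_nonneg

theorem bvNorm_mul_le (hf : IsBV f) (hh : IsBV h) :
    bvNorm (fun x => f x * h x) ≤ bvNorm f * bvNorm h := by
  have h1 := var_mul_le hf hh hf.supNorm_nonneg hh.supNorm_nonneg hf.ae_abs_le_supNorm
    hh.ae_abs_le_supNorm
  have h2 : supNorm (fun x => f x * h x) ≤ supNorm f * supNorm h := by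
    refine (hf.mul hh).supNorm_le ?_
    filter_upwards [hf.ae_abs_le_supNorm, hh.ae_abs_le_supNorm] with x hx hy
    rw [abs_mul]
    gcongr
    exact hf.supNorm_nonneg
  have := var_nonneg f
  have := var_nonneg h
  simp only [bvNorm]
  nlinarith [mul_nonneg (var_nonneg f) (var_nonneg h)]

end Bounds

end RandomInterval
end

noncomputable section
namespace RandomInterval
variable {α β : ℝ} [Fact (α < β)]

/-! ### Variation of indicators and over families of intervals -/

section VariationFamilies

variable {ι : Type*} [LinearOrder ι]

/-- A variation sum sees finitely many points. Finite sets have extremal points, which makes it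
possible to glue adjacent pieces. -/
theorem eVariationOn_le_of_finite {f : ι → ℝ} {s : Set ι} {B : ENNReal}
    (h : ∀ S : Set ι, S.Finite → S ⊆ s → eVariationOn f S ≤ B) : eVariationOn f s ≤ B := by
  refine iSup_le fun ⟨n, u, hu, us⟩ => ?_
  have h1 := h (u '' Iic n) ((finite_Iic n).image u) (by rintro _ ⟨i, _, rfl⟩; exact us i)
  rw [eVariationOn.image_range_of_monotone f hu n] at h1
  simpa only [edist_comm] using h1

theorem eVariationOn_union_finite_le {f : ι → ℝ} {s t : Set ι} (hs : s.Finite) (ht : t.Finite)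
    (hst : ∀ x ∈ s, ∀ y ∈ t, x ≤ y) {c : ENNReal} (hc : ∀ x ∈ s, ∀ y ∈ t, edist (f x) (f y) ≤ c) :
    eVariationOn f (s ∪ t) ≤ eVariationOn f s + c + eVariationOn f t := by
  rcases s.eq_empty_or_nonempty with rfl | hsn
  · simp
  rcases t.eq_empty_or_nonempty with rfl | htn
  · simp
  obtain ⟨x, hx⟩ := hs.exists_maximalFor id s hsn
  obtain ⟨y, hy⟩ := ht.exists_minimalFor id t htn
  have hx' : IsGreatest s x := ⟨hx.1, fun z hz => le_of_not_gt fun hlt =>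
    (hx.2 hz (le_of_lt hlt)).not_gt hlt⟩
  have hy' : IsLeast t y := ⟨hy.1, fun z hz => le_of_not_gt fun hlt =>
    (hy.2 hz (le_of_lt hlt)).not_gt hlt⟩
  rw [eVariationOn.union' f hx' hy' (hst x hx.1 y hy.1)]
  gcongr
  exact hc x hx.1 y hy.1

/-- A finite test set splits into points left of `Y`, in `Y`, and right of `Y`. Outside `Y` the
extension is constantly zero, so apart from the variation inside there is at most one jump of size
`s` on each side. -/
theorem eVariationOn_indicator_le {Y : Set ι} (hY : Y.OrdConnected) {φ : ι → ℝ} {s : ℝ}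
    (h : ∀ y ∈ Y, |φ y| ≤ s) :
    eVariationOn (Y.indicator φ) univ ≤ eVariationOn φ Y + 2 * ENNReal.ofReal s := by
  classical
  rcases Y.eq_empty_or_nonempty with rfl | ⟨y₀, hy₀⟩
  · have : eVariationOn ((∅ : Set ι).indicator φ) univ = 0 :=
      eVariationOn.constant_on (by rintro _ ⟨a, _, rfl⟩ _ ⟨b, _, rfl⟩; simp)
    rw [this]
    exact zero_le
  refine eVariationOn_le_of_finite fun S hS _ => ?_
  set F := Y.indicator φ
  have hzero : ∀ A : Set ι, (∀ x ∈ A, x ∉ Y) → eVariationOn F A = 0 := fun A hA =>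
    eVariationOn.constant_on (by
      rintro _ ⟨a, ha, rfl⟩ _ ⟨b, hb, rfl⟩
      simp [F, hA a ha, hA b hb])
  have hjump : ∀ x ∈ Y, ∀ y ∉ Y, edist (F x) (F y) ≤ ENNReal.ofReal s := by
    intro x hx y hy
    rw [edist_dist, Real.dist_eq]
    exact ENNReal.ofReal_le_ofReal (by simpa [F, hx, hy] using h x hx)
  have hdec : S = ({x ∈ S | x ∉ Y ∧ x < y₀} ∪ (S ∩ Y)) ∪ {x ∈ S | x ∉ Y ∧ y₀ < x} := by
    ext x
    simp only [mem_union, mem_ofPred_eq, mem_inter_iff]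
    constructor
    · intro hx
      by_cases hxY : x ∈ Y
      · exact Or.inl (Or.inr ⟨hx, hxY⟩)
      · rcases lt_trichotomy x y₀ with hlt | rfl | hlt
        · exact Or.inl (Or.inl ⟨hx, hxY, hlt⟩)
        · exact absurd hy₀ hxY
        · exact Or.inr ⟨hx, hxY, hlt⟩
    · tauto
  have hlow : ∀ x, x ∉ Y → x < y₀ → ∀ y ∈ Y, x ≤ y := fun x hx hlt y hy =>
    le_of_not_gt fun hyx => hx (hY.out hy hy₀ ⟨hyx.le, hlt.le⟩)
  have hhigh : ∀ x, x ∉ Y → y₀ < x → ∀ y ∈ Y, y ≤ x := fun x hx hlt y hy =>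
    le_of_not_gt fun hyx => hx (hY.out hy₀ hy ⟨hlt.le, hyx.le⟩)
  have hin : eVariationOn F (S ∩ Y) ≤ eVariationOn φ Y := by
    rw [eVariationOn.congr (g := φ) (fun x hx => by simp [F, hx.2])]
    exact eVariationOn.mono φ inter_subset_right
  have h1 : eVariationOn F ({x ∈ S | x ∉ Y ∧ x < y₀} ∪ (S ∩ Y)) ≤
      0 + ENNReal.ofReal s + eVariationOn φ Y := by
    refine (eVariationOn_union_finite_le (hS.subset (sep_subset _ _)) (hS.subset inter_subset_left)
      (fun x hx y hy => hlow x hx.2.1 hx.2.2 y hy.2)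
      (fun x hx y hy => by rw [edist_comm]; exact hjump y hy.2 x hx.2.1)).trans ?_
    gcongr
    exact (hzero _ fun x hx => hx.2.1).le
  rw [hdec]
  refine (eVariationOn_union_finite_le (c := ENNReal.ofReal s)
    ((hS.subset (sep_subset _ _)).union (hS.subset inter_subset_left))
    (hS.subset (sep_subset _ _)) ?_ ?_).trans ?_
  · intro x hx y hy
    rcases hx with hx | hx
    · exact (hx.2.2.trans hy.2.2).le
    · exact hhigh y hy.2.1 hy.2.2 x hx.2
  · intro x hx y hy
    rcases hx with hx | hx
    · have hx1 : x ∉ Y := hx.2.1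
      have hy1 : y ∉ Y := hy.2.1
      simp [F, hx1, hy1]
    · exact hjump x hx.2 y hy.2.1
  · refine (add_le_add (add_le_add h1 le_rfl)
      (hzero {x ∈ S | x ∉ Y ∧ y₀ < x} fun x hx => hx.2.1).le).trans (le_of_eq ?_)
    ring

/-- The markers `m i` put the sets in order. Inserting them by increasing marker, superadditivity of
variation over consecutive sets applies; neighbours may share an endpoint. -/
theorem sum_eVariationOn_le {κ : Type*} (t : Finset κ) (A : κ → Set ι) (m : κ → ι)
    (hm : InjOn m t)
    (hA : ∀ i ∈ t, ∀ j ∈ t, m i < m j → ∀ x ∈ A i, ∀ y ∈ A j, x ≤ y) (f : ι → ℝ) :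
    ∑ i ∈ t, eVariationOn f (A i) ≤ eVariationOn f (⋃ i ∈ t, A i) := by
  classical
  induction t using Finset.induction_on_max_value m with
  | empty => simp
  | insert a s ha hmax ih =>
    rw [Finset.sum_insert ha, Finset.set_biUnion_insert, union_comm, add_comm]
    refine (add_le_add (ih (hm.mono (by simp)) fun i hi j hj =>
      hA i (by simp [hi]) j (by simp [hj])) le_rfl).trans (eVariationOn.add_le_union f ?_)
    intro x hx y hy
    simp only [mem_iUnion] at hx
    obtain ⟨i, hi, hx⟩ := hx
    refine hA i (by simp [hi]) a (by simp) (lt_of_le_of_ne (hmax i hi) fun he => ?_) x hx y hy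
    have := hm (by simp [hi]) (by simp) he
    exact ha (this ▸ hi)

theorem sum_biUnion_le {κ κ' : Type*} [DecidableEq κ'] (t : Finset κ) (R : κ → Finset κ')
    {f : κ' → ℝ} (hf : ∀ k, 0 ≤ f k) : ∑ k ∈ t.biUnion R, f k ≤ ∑ i ∈ t, ∑ k ∈ R i, f k := by
  classical
  induction t using Finset.induction_on with
  | empty => simp
  | insert a t ha ih =>
    rw [Finset.sum_insert ha, Finset.biUnion_insert]
    calc _ ≤ ∑ k ∈ R a, f k + ∑ k ∈ t.biUnion R, f k := by
          rw [← Finset.sum_union_inter]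
          exact le_add_of_nonneg_right (Finset.sum_nonneg fun k _ => hf k)
      _ ≤ _ := by gcongr

end VariationFamilies

/-! ### Finite families of branches -/

/-- `T` is continuous and strictly monotone on each member of the finite family `P` of
nondegenerate intervals, which overlap at most in endpoints. -/
structure IsBranched (T : Seg α β → Seg α β) (P : Set (Set (Seg α β))) : Prop where
  finite : P.Finite
  ordConnected : ∀ Z ∈ P, Z.OrdConnected
  nontrivial : ∀ Z ∈ P, Z.Nontrivial
  inter_subsingleton : P.Pairwise fun Z W => (Z ∩ W).Subsingleton
  continuousOn : ∀ Z ∈ P, ContinuousOn T Z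
  monotone : ∀ Z ∈ P, StrictMonoOn T Z ∨ StrictAntiOn T Z

theorem exists_interior_point {Z : Set (Seg α β)} (hZ' : Z.Nontrivial) :
    ∃ m : Seg α β, ∃ u ∈ Z, ∃ v ∈ Z, u < m ∧ m < v := by
  obtain ⟨u, hu, v, hv, huv⟩ := hZ'.exists_lt
  obtain ⟨m, h1, h2⟩ := exists_between huv
  exact ⟨m, u, hu, v, hv, h1, h2⟩

open Classical in
/-- A point in the interior of a nondegenerate interval. -/
def mid (Z : Set (Seg α β)) : Seg α β := if h : Z.Nontrivial then (exists_interior_point h).choose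
  else lo α β

theorem mid_spec {Z : Set (Seg α β)} (h : Z.Nontrivial) :
    ∃ u ∈ Z, ∃ v ∈ Z, u < mid Z ∧ mid Z < v := by
  rw [mid, dif_pos h]
  exact (exists_interior_point h).choose_spec

theorem mid_mem {Z : Set (Seg α β)} (hZ : Z.OrdConnected) (h : Z.Nontrivial) : mid Z ∈ Z := by
  obtain ⟨u, hu, v, hv, h1, h2⟩ := mid_spec h
  exact hZ.out hu hv ⟨h1.le, h2.le⟩

/-- If an interior point of `Z` belonged to `W`, moving from it a little towards another point of
`W` would give a second common point. -/
theorem mid_notMem {Z W : Set (Seg α β)} (hZ : Z.OrdConnected) (hZ' : Z.Nontrivial)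
    (hW : W.OrdConnected) (hW' : W.Nontrivial) (hZW : (Z ∩ W).Subsingleton) : mid Z ∉ W := by
  intro hm
  obtain ⟨u, hu, v, hv, h1, h2⟩ := mid_spec hZ'
  obtain ⟨w, hw, hne⟩ := hW'.exists_ne (mid Z)
  rcases hne.lt_or_gt with hlt | hlt
  · have hx : max u w ∈ Z ∩ W :=
      ⟨hZ.out hu (mid_mem hZ hZ') ⟨le_max_left _ _, max_le h1.le hlt.le⟩,
        hW.out hw hm ⟨le_max_right _ _, max_le h1.le hlt.le⟩⟩
    exact (max_lt h1 hlt).ne (hZW hx ⟨mid_mem hZ hZ', hm⟩)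
  · have hx : min v w ∈ Z ∩ W :=
      ⟨hZ.out (mid_mem hZ hZ') hv ⟨le_min h2.le hlt.le, min_le_left _ _⟩,
        hW.out hm hw ⟨le_min h2.le hlt.le, min_le_right _ _⟩⟩
    exact (lt_min h2 hlt).ne' (hZW hx ⟨mid_mem hZ hZ', hm⟩)

/-- Overlap in at most one point lets the order of the chosen interior points decide the order of
the intervals themselves; this lines up the branches from left to right. -/
theorem le_of_mid_lt {Z W : Set (Seg α β)} (hZ : Z.OrdConnected) (hZ' : Z.Nontrivial)
    (hW : W.OrdConnected) (hW' : W.Nontrivial) (hZW : (Z ∩ W).Subsingleton)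
    (hlt : mid Z < mid W) : ∀ x ∈ Z, ∀ y ∈ W, x ≤ y := by
  intro x hx y hy
  by_contra hyx
  push Not at hyx
  have hWZ : (W ∩ Z).Subsingleton := by rwa [inter_comm]
  have h1 : mid Z < y := by
    by_contra hcon
    push Not at hcon
    exact mid_notMem hZ hZ' hW hW' hZW (hW.out hy (mid_mem hW hW') ⟨hcon, hlt.le⟩)
  have h2 : x < mid W := by
    by_contra hcon
    push Not at hcon
    exact mid_notMem hW hW' hZ hZ' hWZ (hZ.out (mid_mem hZ hZ') hx ⟨hlt.le, hcon⟩)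
  have hy' : y ∈ Z ∩ W := ⟨hZ.out (mid_mem hZ hZ') hx ⟨h1.le, hyx.le⟩, hy⟩
  have hx' : x ∈ Z ∩ W := ⟨hx, hW.out hy (mid_mem hW hW') ⟨hyx.le, h2.le⟩⟩
  exact hyx.ne (hZW hy' hx')

open Classical in
/-- `1_{T(Z)} * ((f w) ∘ (T|_Z)⁻¹)`. -/
def branchFn (T : Seg α β → Seg α β) (w f : Seg α β → ℝ) (Z : Set (Seg α β)) (y : Seg α β) : ℝ :=
  if h : ∃ x ∈ Z, T x = y then f h.choose * w h.choose else 0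

theorem branchFn_apply {T : Seg α β → Seg α β} {Z : Set (Seg α β)} (hT : InjOn T Z)
    (w f : Seg α β → ℝ) {x : Seg α β} (hx : x ∈ Z) : branchFn T w f Z (T x) = f x * w x := by
  have h : ∃ x' ∈ Z, T x' = T x := ⟨x, hx, rfl⟩
  have he : h.choose = x := hT h.choose_spec.1 hx h.choose_spec.2
  rw [branchFn, dif_pos h, he]

theorem branchFn_of_notMem {T : Seg α β → Seg α β} {Z : Set (Seg α β)} (w f : Seg α β → ℝ)
    {y : Seg α β} (hy : y ∉ T '' Z) : branchFn T w f Z y = 0 := by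
  rw [branchFn, dif_neg]
  rintro ⟨x, hx, rfl⟩
  exact hy ⟨x, hx, rfl⟩

theorem isPreconnected_of_ordConnected {Z : Set (Seg α β)}
    (hZ : Z.OrdConnected) : IsPreconnected Z := by
  refine (IsInducing.subtypeVal.isPreconnected_image (s := Z)).1 (OrdConnected.isPreconnected ⟨?_⟩)
  rintro _ ⟨x, hx, rfl⟩ _ ⟨y, hy, rfl⟩ z hz
  exact ⟨⟨z, x.2.1.trans hz.1, hz.2.trans y.2.2⟩, hZ.out hx hy ⟨hz.1, hz.2⟩, rfl⟩

namespace IsBranched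

variable {T : Seg α β → Seg α β} {P : Set (Set (Seg α β))} (hP : IsBranched T P)
include hP

theorem injOn {Z : Set (Seg α β)} (hZ : Z ∈ P) : InjOn T Z :=
  (hP.monotone Z hZ).elim StrictMonoOn.injOn StrictAntiOn.injOn

theorem ordConnected_image {Z : Set (Seg α β)} (hZ : Z ∈ P) : (T '' Z).OrdConnected :=
  ((isPreconnected_of_ordConnected (hP.ordConnected Z hZ)).image T (hP.continuousOn Z hZ)).ordConnected

theorem mid_injOn : InjOn mid P := by
  intro Z hZ W hW he
  by_contra hne
  refine mid_notMem (hP.ordConnected Z hZ) (hP.nontrivial Z hZ) (hP.ordConnected W hW)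
    (hP.nontrivial W hW) (hP.inter_subsingleton hZ hW hne) ?_
  rw [he]
  exact mid_mem (hP.ordConnected W hW) (hP.nontrivial W hW)

theorem le_of_mid_lt {Z W : Set (Seg α β)} (hZ : Z ∈ P) (hW : W ∈ P) (hlt : mid Z < mid W) :
    ∀ x ∈ Z, ∀ y ∈ W, x ≤ y :=
  RandomInterval.le_of_mid_lt (hP.ordConnected Z hZ) (hP.nontrivial Z hZ) (hP.ordConnected W hW)
    (hP.nontrivial W hW) (hP.inter_subsingleton hZ hW (by rintro rfl; exact hlt.ne rfl)) hlt

/-- The inverse branch preserves or reverses order, and such a change of variable does not increase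
variation. -/
theorem eVariationOn_branch_image_le {Z : Set (Seg α β)} (hZ : Z ∈ P) (w f : Seg α β → ℝ) :
    eVariationOn (branchFn T w f Z) (T '' Z) ≤ eVariationOn (fun x => f x * w x) Z := by
  set j := Function.invFunOn T Z
  have hj : ∀ x ∈ Z, j (T x) = x := fun x hx => (hP.injOn hZ).leftInvOn_invFunOn hx
  have hmaps : MapsTo j (T '' Z) Z := by
    rintro _ ⟨x, hx, rfl⟩
    rwa [hj x hx]
  have hcongr : EqOn (branchFn T w f Z) ((fun x => f x * w x) ∘ j) (T '' Z) := by
    rintro _ ⟨x, hx, rfl⟩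
    simp [branchFn_apply (hP.injOn hZ) w f hx, hj x hx]
  rw [eVariationOn.congr hcongr]
  rcases hP.monotone Z hZ with hmon | hanti
  · refine eVariationOn.comp_le_of_monotoneOn _ j ?_ hmaps
    rintro _ ⟨x, hx, rfl⟩ _ ⟨y, hy, rfl⟩ hxy
    rw [hj x hx, hj y hy]
    exact (hmon.le_iff_le hx hy).1 hxy
  · refine eVariationOn.comp_le_of_antitoneOn _ j ?_ hmaps
    rintro _ ⟨x, hx, rfl⟩ _ ⟨y, hy, rfl⟩ hxy
    rw [hj x hx, hj y hy]
    exact (hanti.le_iff_ge hx hy).1 hxy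

/-- The branch term vanishes off an interval, the image of the branch; cutting off there costs two
jumps. -/
theorem eVariationOn_branch_le {Z : Set (Seg α β)} (hZ : Z ∈ P) {w f : Seg α β → ℝ} {s : ℝ}
    (hs : ∀ x ∈ Z, |f x * w x| ≤ s) :
    eVariationOn (branchFn T w f Z) univ ≤
      eVariationOn (fun x => f x * w x) Z + 2 * ENNReal.ofReal s := by
  have he : branchFn T w f Z = (T '' Z).indicator (branchFn T w f Z) := by
    ext y
    by_cases hy : y ∈ T '' Z
    · rw [indicator_of_mem hy]
    · rw [indicator_of_notMem hy, branchFn_of_notMem w f hy]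
  rw [he]
  refine (eVariationOn_indicator_le (hP.ordConnected_image hZ) (s := s) ?_).trans ?_
  · rintro _ ⟨x, hx, rfl⟩
    rw [branchFn_apply (hP.injOn hZ) w f hx]
    exact hs x hx
  · gcongr
    exact hP.eVariationOn_branch_image_le hZ w f

theorem isBV_branch {Z : Set (Seg α β)} (hZ : Z ∈ P) {w f : Seg α β → ℝ}
    (hw : BoundedVariationOn w Z) (hf : BoundedVariationOn f Z) : IsBV (branchFn T w f Z) := by
  have hfw : BoundedVariationOn (fun x => f x * w x) Z := BoundedVariationOn.mul hf hw
  obtain ⟨s, -, hs⟩ := boundedVariationOn_bounded hfw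
  refine ((hP.eVariationOn_branch_le hZ hs).trans_lt ?_).ne
  exact ENNReal.add_lt_top.2 ⟨hfw.lt_top, ENNReal.mul_lt_top (by simp) (by simp)⟩

theorem Ioo_subset_of_isFull {Z : Set (Seg α β)} (hZ : Z ∈ P) (hfull : IsFull T Z) :
    Ioo (lo α β) (hi α β) ⊆ T '' Z := by
  intro y hy
  have hae : ∀ᵐ x ∂(leb : Measure (Seg α β)), x ∈ T '' Z := by
    filter_upwards [hfull.mem_iff] with x hx
    exact hx.2 (mem_univ x)
  obtain ⟨u, hu, huZ⟩ := exists_mem_Ioo_of_ae hae hy.1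
  obtain ⟨v, hv, hvZ⟩ := exists_mem_Ioo_of_ae hae hy.2
  exact (hP.ordConnected_image hZ).out huZ hvZ ⟨hu.2.le, hv.1.le⟩

theorem eVar_branch_le_of_isFull {Z : Set (Seg α β)} (hZ : Z ∈ P) (hfull : IsFull T Z)
    {w f : Seg α β → ℝ} (hw : BoundedVariationOn w Z) (hf : BoundedVariationOn f Z) :
    eVar (branchFn T w f Z) ≤ eVariationOn (fun x => f x * w x) Z :=
  (eVar_le_eVariationOn (hP.isBV_branch hZ hw hf) (hP.Ioo_subset_of_isFull hZ hfull)).trans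
    (hP.eVariationOn_branch_image_le hZ w f)

/-- Non-full branches are controlled by the nearest full branches. -/
theorem sum_nonfull_le {E F : Finset (Set (Seg α β))} (hE : (E : Set (Set (Seg α β))) ⊆ P)
    (hF : (F : Set (Set (Seg α β))) ⊆ P) (hEF : Disjoint E F) (hFne : F.Nonempty) {ξ : ℕ}
    (hξ : ∀ S : Finset (Set (Seg α β)), S ⊆ E →
      (∀ W ∈ F, ¬ W ⊆ hull (⋃₀ (S : Set (Set (Seg α β))))) → S.card ≤ ξ)
    {f : Seg α β → ℝ} (hf : IsBV f) (hf0 : ∀ x, 0 ≤ f x) {p : Set (Seg α β) → Seg α β}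
    (hp : ∀ W ∈ F, p W ∈ W) :
    ∑ Z ∈ E, f (mid Z) ≤ 2 * ξ * ((eVariationOn f univ).toReal + ∑ W ∈ F, f (p W)) := by
  classical
  have hmid : ∀ Z ∈ P, mid Z ∈ Z := fun Z hZ => mid_mem (hP.ordConnected Z hZ) (hP.nontrivial Z hZ)
  have hne : ∀ Z ∈ E, ∀ W ∈ F, mid Z ≠ mid W := fun Z hZ W hW he =>
    Finset.disjoint_left.1 hEF hZ (hP.mid_injOn (hE hZ) (hF hW) he ▸ hW)
  have hnot : ∀ Z ∈ E, ∀ W ∈ F, mid W ∉ Z := by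
    intro Z hZ W hW
    have hZW : W ≠ Z := by
      rintro rfl
      exact Finset.disjoint_left.1 hEF hZ hW
    exact mid_notMem (hP.ordConnected W (hF hW)) (hP.nontrivial W (hF hW))
      (hP.ordConnected Z (hE hZ)) (hP.nontrivial Z (hE hZ))
      (hP.inter_subsingleton (hF hW) (hE hZ) hZW)
  set V := (eVariationOn f univ).toReal with hV
  have hV0 : 0 ≤ V := ENNReal.toReal_nonneg
  -- `R W` is the gap just left of the full branch `W`, and `K` is the gap to the right of all full
  -- branches. Neither hull contains a full branch, so each gap has at most `ξ` members.
  set R : Set (Seg α β) → Finset (Set (Seg α β)) := fun W =>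
    E.filter fun Z => mid Z < mid W ∧ ∀ W' ∈ F, ¬ (mid Z < mid W' ∧ mid W' < mid W) with hR
  set K : Finset (Set (Seg α β)) := E.filter fun Z => ∀ W ∈ F, mid W < mid Z with hK
  -- a full branch inside the hull of a set of non-full branches lies strictly between two of them
  have hbetween : ∀ S : Finset (Set (Seg α β)), S ⊆ E → ∀ W ∈ F,
      W ⊆ hull (⋃₀ (S : Set (Set (Seg α β)))) →
      (∃ Z ∈ S, mid Z < mid W) ∧ ∃ Z ∈ S, mid W < mid Z := by
    intro S hS W hW hsub
    obtain ⟨y, ⟨Z₁, hZ₁, hy⟩, z, ⟨Z₂, hZ₂, hz⟩, hyW, hWz⟩ := hsub (hmid W (hF hW))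
    refine ⟨⟨Z₁, hZ₁, ?_⟩, ⟨Z₂, hZ₂, ?_⟩⟩
    · rcases (hne Z₁ (hS hZ₁) W hW).lt_or_gt with h | h
      · exact h
      · have := hP.le_of_mid_lt (hF hW) (hE (hS hZ₁)) h _ (hmid W (hF hW)) y hy
        exact absurd (le_antisymm this hyW ▸ hy) (hnot Z₁ (hS hZ₁) W hW)
    · rcases (hne Z₂ (hS hZ₂) W hW).lt_or_gt with h | h
      · have := hP.le_of_mid_lt (hE (hS hZ₂)) (hF hW) h z hz _ (hmid W (hF hW))
        exact absurd (le_antisymm hWz this ▸ hz) (hnot Z₂ (hS hZ₂) W hW)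
      · exact h
  have hcardR : ∀ W ∈ F, (R W).card ≤ ξ := by
    intro W hW
    refine hξ _ (Finset.filter_subset _ _) fun W' hW' hsub => ?_
    obtain ⟨⟨Z₁, hZ₁, h1⟩, Z₂, hZ₂, h2⟩ := hbetween _ (Finset.filter_subset _ _) W' hW' hsub
    exact (Finset.mem_filter.1 hZ₁).2.2 W' hW' ⟨h1, h2.trans (Finset.mem_filter.1 hZ₂).2.1⟩
  have hcardK : K.card ≤ ξ := by
    refine hξ _ (Finset.filter_subset _ _) fun W' hW' hsub => ?_
    obtain ⟨⟨Z₁, hZ₁, h1⟩, -⟩ := hbetween _ (Finset.filter_subset _ _) W' hW' hsub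
    exact h1.not_gt ((Finset.mem_filter.1 hZ₁).2 W' hW')
  have hcover : E ⊆ F.biUnion R ∪ K := by
    intro Z hZ
    by_cases hex : ∃ W ∈ F, mid Z < mid W
    · have hne' : (F.filter fun W => mid Z < mid W).Nonempty := by
        obtain ⟨W, hW, h⟩ := hex
        exact ⟨W, Finset.mem_filter.2 ⟨hW, h⟩⟩
      obtain ⟨W, hW, hmin⟩ := Finset.exists_min_image _ mid hne'
      rw [Finset.mem_filter] at hW
      refine Finset.mem_union_left _ (Finset.mem_biUnion.2 ⟨W, hW.1, Finset.mem_filter.2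
        ⟨hZ, hW.2, fun W' hW' h => ?_⟩⟩)
      exact (hmin W' (Finset.mem_filter.2 ⟨hW', h.1⟩)).not_gt h.2
    · push Not at hex
      exact Finset.mem_union_right _ (Finset.mem_filter.2 ⟨hZ, fun W hW =>
        lt_of_le_of_ne (hex W hW) (hne Z hZ W hW).symm⟩)
  -- These sets follow the order of the full branches, so their variations add up to at most `V`:
  -- comparing every gap with its own full branch spends the variation of `f` only once.
  set A : Set (Seg α β) → Set (Seg α β) := fun W => insert (p W) (mid '' (R W : Set (Set (Seg α β))))
  have hAle : ∀ W ∈ F, ∀ W' ∈ F, mid W < mid W' → ∀ x ∈ A W, ∀ y ∈ A W', x ≤ y := by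
    intro W hW W' hW' hlt x hx y hy
    have hxW : ∃ z ∈ W, x ≤ z := by
      rcases hx with rfl | ⟨Z, hZ, rfl⟩
      · exact ⟨_, hp W hW, le_rfl⟩
      · have hZ' := Finset.mem_filter.1 hZ
        exact ⟨_, hmid W (hF hW), hZ'.2.1.le⟩
    have hxle : ∀ Z' ∈ P, mid W < mid Z' → ∀ y ∈ Z', x ≤ y := by
      intro Z' hZ' hlt' y hy
      obtain ⟨z, hz, hxz⟩ := hxW
      exact hxz.trans (hP.le_of_mid_lt (hF hW) hZ' hlt' z hz y hy)
    rcases hy with rfl | ⟨Z', hZ', rfl⟩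
    · exact hxle W' (hF hW') hlt _ (hp W' hW')
    · have hZ'' := Finset.mem_filter.1 hZ'
      have hlt' : mid W < mid Z' := by
        rcases (hne Z' hZ''.1 W hW).lt_or_gt with h | h
        · exact absurd ⟨h, hlt⟩ (hZ''.2.2 W hW)
        · exact h
      exact hxle Z' (hE hZ''.1) hlt' _ (hmid Z' (hE hZ''.1))
  have hbv : ∀ s : Set (Seg α β), BoundedVariationOn f s := fun s =>
    BoundedVariationOn.mono hf (subset_univ s)
  have hsumA : ∑ W ∈ F, (eVariationOn f (A W)).toReal ≤ V := by
    rw [← ENNReal.toReal_sum fun W _ => hbv _]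
    refine ENNReal.toReal_mono hf ((sum_eVariationOn_le F A mid
      (hP.mid_injOn.mono hF) hAle f).trans (eVariationOn.mono f (subset_univ _)))
  have hRW : ∀ W ∈ F, ∑ Z ∈ R W, f (mid Z) ≤ ξ * (f (p W) + (eVariationOn f (A W)).toReal) := by
    intro W hW
    calc ∑ Z ∈ R W, f (mid Z) ≤ ∑ _Z ∈ R W, (f (p W) + (eVariationOn f (A W)).toReal) := by
          refine Finset.sum_le_sum fun Z hZ => ?_
          have := (hbv (A W)).sub_le (x := mid Z) (y := p W)
            (mem_insert_of_mem _ (mem_image_of_mem _ hZ)) (mem_insert _ _)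
          linarith
      _ = (R W).card * (f (p W) + (eVariationOn f (A W)).toReal) := by
          rw [Finset.sum_const, nsmul_eq_mul]
      _ ≤ _ := by
          gcongr
          · exact add_nonneg (hf0 _) ENNReal.toReal_nonneg
          · exact_mod_cast hcardR W hW
  have hsF : 0 ≤ ∑ W ∈ F, f (p W) := Finset.sum_nonneg fun W _ => hf0 _
  -- The last gap has no full branch to its right and is compared with an arbitrary one across the
  -- whole segment. This second use of `V` and of the samples explains the factor `2` in the result.
  have hKs : ∑ Z ∈ K, f (mid Z) ≤ ξ * (V + ∑ W ∈ F, f (p W)) := by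
    obtain ⟨W₀, hW₀⟩ := hFne
    calc ∑ Z ∈ K, f (mid Z) ≤ ∑ _Z ∈ K, (V + ∑ W ∈ F, f (p W)) := by
          refine Finset.sum_le_sum fun Z _ => ?_
          have h1 := (hbv univ).sub_le (mem_univ (mid Z)) (mem_univ (p W₀))
          have h2 := Finset.single_le_sum (f := fun W => f (p W)) (fun W _ => hf0 _) hW₀
          linarith
      _ = K.card * (V + ∑ W ∈ F, f (p W)) := by rw [Finset.sum_const, nsmul_eq_mul]
      _ ≤ _ := by
          gcongr
  calc ∑ Z ∈ E, f (mid Z) ≤ ∑ Z ∈ F.biUnion R ∪ K, f (mid Z) :=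
        Finset.sum_le_sum_of_subset_of_nonneg hcover fun _ _ _ => hf0 _
    _ ≤ ∑ Z ∈ F.biUnion R, f (mid Z) + ∑ Z ∈ K, f (mid Z) := by
        rw [← Finset.sum_union_inter]
        exact le_add_of_nonneg_right (Finset.sum_nonneg fun _ _ => hf0 _)
    _ ≤ ∑ W ∈ F, ∑ Z ∈ R W, f (mid Z) + ∑ Z ∈ K, f (mid Z) := by
        gcongr
        exact sum_biUnion_le F R fun _ => hf0 _
    _ ≤ ∑ W ∈ F, ξ * (f (p W) + (eVariationOn f (A W)).toReal) +
          ξ * (V + ∑ W ∈ F, f (p W)) := add_le_add (Finset.sum_le_sum hRW) hKs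
    _ ≤ _ := by
        rw [← Finset.mul_sum, Finset.sum_add_distrib]
        have : (0 : ℝ) ≤ ξ := Nat.cast_nonneg _
        nlinarith

end IsBranched

end RandomInterval
end

noncomputable section
namespace RandomInterval
variable {α β : ℝ} [Fact (α < β)]

/-! ### The Lasota-Yorke inequality for a family of branches -/

namespace IsBranched

variable {T : Seg α β → Seg α β} {P : Set (Set (Seg α β))} (hP : IsBranched T P)
include hP

/-- Product rule on one branch, with the supremum of `f` replaced by a sample value plus the local
variation. The sample point stays free: it will be a near-minimizer on full branches and an interior
point on the others. -/
theorem eVariationOn_mul_weight_le {Z : Set (Seg α β)} {w f : Seg α β → ℝ} {N S : ℝ}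
    (hw0 : ∀ x ∈ Z, 0 ≤ w x) (hwN : ∀ x ∈ Z, w x ≤ N)
    (hwS : eVariationOn w Z ≤ ENNReal.ofReal (N * S)) (hN : 0 ≤ N) (hS : 0 ≤ S)
    (hf : BoundedVariationOn f Z) (hf0 : ∀ x, 0 ≤ f x) {q : Seg α β} (hq : q ∈ Z) :
    eVariationOn (fun x => f x * w x) Z ≤
        ENNReal.ofReal (N * (S * (f q + (eVariationOn f Z).toReal) + (eVariationOn f Z).toReal)) ∧
      ∀ x ∈ Z, |f x * w x| ≤ N * (f q + (eVariationOn f Z).toReal) := by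
  set v := (eVariationOn f Z).toReal with hv
  have hv0 : 0 ≤ v := ENNReal.toReal_nonneg
  have hfs : ∀ x ∈ Z, f x ≤ f q + v := fun x hx => by
    have := hf.sub_le hx hq
    linarith
  have hs0 : 0 ≤ f q + v := add_nonneg (hf0 q) hv0
  refine ⟨?_, fun x hx => ?_⟩
  · have h1 := eVariation_mul_le (f := f) (g := w) (s := Z) (C := (f q + v).toNNReal)
      (D := N.toNNReal)
      (fun x hx => by
        rw [← ofReal_norm, Real.norm_of_nonneg (hf0 x)]
        exact ENNReal.ofReal_le_ofReal (hfs x hx))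
      (fun x hx => by
        rw [← ofReal_norm, Real.norm_of_nonneg (hw0 x hx)]
        exact ENNReal.ofReal_le_ofReal (hwN x hx))
    refine h1.trans ?_
    rw [← ENNReal.ofReal_toReal hf]
    calc _ ≤ ENNReal.ofReal (f q + v) * ENNReal.ofReal (N * S) +
          ENNReal.ofReal N * ENNReal.ofReal v := by gcongr <;> exact le_rfl
      _ = _ := by
        rw [← ENNReal.ofReal_mul hs0, ← ENNReal.ofReal_mul hN,
          ← ENNReal.ofReal_add (by positivity) (by positivity)]
        congr 1
        ring
  · rw [abs_of_nonneg (mul_nonneg (hf0 x) (hw0 x hx)), mul_comm N]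
    exact mul_le_mul (hfs x hx) (hwN x hx) (hw0 x hx) hs0

-- Full branches cost only the product rule. Non-full ones add two jumps each, and their sample
-- values are traded for those on full branches through `sum_nonfull_le`.
open Classical in
theorem eVar_sum_branch_le {w f : Seg α β → ℝ} {N S : ℝ} {ξ : ℕ}
    (hw0 : ∀ Z ∈ P, ∀ x ∈ Z, 0 ≤ w x) (hwN : ∀ Z ∈ P, ∀ x ∈ Z, w x ≤ N)
    (hwS : ∀ Z ∈ P, eVariationOn w Z ≤ ENNReal.ofReal (N * S)) (hN : 0 ≤ N) (hS : 0 ≤ S)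
    (hFne : ∃ Z ∈ P, IsFull T Z)
    (hξ : ∀ Q : Finset (Set (Seg α β)), (Q : Set (Set (Seg α β))) ⊆ {Z ∈ P | ¬ IsFull T Z} →
      (∀ W ∈ {Z ∈ P | IsFull T Z}, ¬ W ⊆ hull (⋃₀ (Q : Set (Set (Seg α β))))) → Q.card ≤ ξ)
    (hf : IsBV f) (hf0 : ∀ x, 0 ≤ f x) {p : Set (Seg α β) → Seg α β}
    (hp : ∀ Z ∈ P, IsFull T Z → p Z ∈ Z) :
    eVar (fun y => ∑ Z ∈ hP.finite.toFinset, branchFn T w f Z y) ≤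
      ENNReal.ofReal (N * ((3 + 3 * S) * (1 + 2 * ξ)) * ((eVariationOn f univ).toReal +
        ∑ Z ∈ hP.finite.toFinset.filter (fun Z => IsFull T Z), f (p Z))) := by
  set Pf := hP.finite.toFinset with hPf
  have hmem : ∀ {Z}, Z ∈ Pf ↔ Z ∈ P := by simp [hPf]
  set F := Pf.filter fun Z => IsFull T Z with hF
  set E := Pf.filter fun Z => ¬ IsFull T Z with hE
  set V := (eVariationOn f univ).toReal with hV
  have hV0 : 0 ≤ V := ENNReal.toReal_nonneg
  have hbv : ∀ s : Set (Seg α β), BoundedVariationOn f s := fun s =>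
    BoundedVariationOn.mono hf (subset_univ s)
  set v : Set (Seg α β) → ℝ := fun Z => (eVariationOn f Z).toReal with hv
  have hv0 : ∀ Z, 0 ≤ v Z := fun Z => ENNReal.toReal_nonneg
  have hsumv : ∑ Z ∈ Pf, v Z ≤ V := by
    rw [← ENNReal.toReal_sum fun W _ => hbv _]
    refine ENNReal.toReal_mono hf ((sum_eVariationOn_le Pf id mid
      (hP.mid_injOn.mono fun Z hZ => hmem.1 hZ) (fun Z hZ W hW hlt =>
        hP.le_of_mid_lt (hmem.1 hZ) (hmem.1 hW) hlt) f).trans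
        (eVariationOn.mono f (subset_univ _)))
  have hwbv : ∀ Z ∈ P, BoundedVariationOn w Z := fun Z hZ =>
    ((hwS Z hZ).trans_lt ENNReal.ofReal_lt_top).ne
  have hfull : ∀ Z ∈ F, eVar (branchFn T w f Z) ≤
      ENNReal.ofReal (N * (S * (f (p Z) + v Z) + v Z)) := by
    intro Z hZ
    obtain ⟨hZP, hZf⟩ := Finset.mem_filter.1 hZ
    rw [hmem] at hZP
    exact (hP.eVar_branch_le_of_isFull hZP hZf (hwbv Z hZP) (hbv Z)).trans
      (hP.eVariationOn_mul_weight_le (hw0 Z hZP) (hwN Z hZP) (hwS Z hZP) hN hS (hbv Z) hf0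
        (hp Z hZP hZf)).1
  have hnonfull : ∀ Z ∈ E, eVar (branchFn T w f Z) ≤
      ENNReal.ofReal (N * (S * (f (mid Z) + v Z) + v Z) + 2 * (N * (f (mid Z) + v Z))) := by
    intro Z hZ
    obtain ⟨hZP, hZf⟩ := Finset.mem_filter.1 hZ
    rw [hmem] at hZP
    have h := hP.eVariationOn_mul_weight_le (hw0 Z hZP) (hwN Z hZP) (hwS Z hZP) hN hS (hbv Z) hf0
      (mid_mem (hP.ordConnected Z hZP) (hP.nontrivial Z hZP))
    have hv0' := hv0 Z
    have hm0 := hf0 (mid Z)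
    refine (eVar_le_of_ae_eq (EventuallyEq.refl _ _)).trans
      ((hP.eVariationOn_branch_le hZP h.2).trans ?_)
    rw [ENNReal.ofReal_add (by positivity) (by positivity), ENNReal.ofReal_mul (by norm_num : (0:ℝ) ≤ 2)]
    refine add_le_add h.1 (le_of_eq ?_)
    rw [ENNReal.ofReal_ofNat]
  have hcomb : ∑ Z ∈ E, f (mid Z) ≤ 2 * ξ * (V + ∑ W ∈ F, f (p W)) := by
    refine hP.sum_nonfull_le (fun Z hZ => hmem.1 (Finset.mem_filter.1 hZ).1)
      (fun Z hZ => hmem.1 (Finset.mem_filter.1 hZ).1) (Finset.disjoint_filter_filter_not _ _ _).symm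
      ?_ (fun Q hQ hQ' => hξ Q (fun Z hZ => ?_) fun W hW => hQ' W ?_) hf hf0 fun W hW => ?_
    · obtain ⟨Z, hZ, h⟩ := hFne
      exact ⟨Z, Finset.mem_filter.2 ⟨hmem.2 hZ, h⟩⟩
    · have := Finset.mem_filter.1 (hQ hZ)
      exact ⟨hmem.1 this.1, this.2⟩
    · exact Finset.mem_filter.2 ⟨hmem.2 hW.1, hW.2⟩
    · have := Finset.mem_filter.1 hW
      exact hp W (hmem.1 this.1) this.2
  have hnn1 : ∀ Z ∈ F, 0 ≤ N * (S * (f (p Z) + v Z) + v Z) := fun Z _ => by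
    have := hv0 Z; have := hf0 (p Z); positivity
  have hnn2 : ∀ Z ∈ E, 0 ≤ N * (S * (f (mid Z) + v Z) + v Z) + 2 * (N * (f (mid Z) + v Z)) :=
    fun Z _ => by
      have := hv0 Z; have := hf0 (mid Z); positivity
  refine (eVar_finset_sum_le _ _).trans ?_
  rw [← Finset.sum_filter_add_sum_filter_not Pf (fun Z => IsFull T Z)]
  refine (add_le_add (Finset.sum_le_sum hfull) (Finset.sum_le_sum hnonfull)).trans ?_
  rw [← ENNReal.ofReal_sum_of_nonneg hnn1, ← ENNReal.ofReal_sum_of_nonneg hnn2,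
    ← ENNReal.ofReal_add (Finset.sum_nonneg hnn1) (Finset.sum_nonneg hnn2)]
  refine ENNReal.ofReal_le_ofReal ?_
  have hsplit : ∑ Z ∈ F, v Z + ∑ Z ∈ E, v Z ≤ V := by
    rwa [hF, hE, Finset.sum_filter_add_sum_filter_not]
  have hvF : 0 ≤ ∑ Z ∈ F, v Z := Finset.sum_nonneg fun Z _ => hv0 Z
  have hvE : 0 ≤ ∑ Z ∈ E, v Z := Finset.sum_nonneg fun Z _ => hv0 Z
  have hsF : 0 ≤ ∑ W ∈ F, f (p W) := Finset.sum_nonneg fun W _ => hf0 _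
  simp only [← Finset.mul_sum, Finset.sum_add_distrib]
  set a := ∑ Z ∈ F, v Z
  set b := ∑ Z ∈ E, v Z
  set c := ∑ W ∈ F, f (p W)
  set d := ∑ Z ∈ E, f (mid Z)
  have hξ0 : (0 : ℝ) ≤ ξ := Nat.cast_nonneg _
  -- The jumps raise the coefficients to `S + 3` for the variation and `S + 2` for the non-full
  -- samples. Both are at most `3 + 3 * S`, a coarse bound that yields the single factor in
  -- `coeffD`.
  calc N * (S * (c + a) + a) + (N * (S * (d + b) + b) + 2 * (N * (d + b)))
      ≤ N * ((S + 3) * (a + b) + S * c + (S + 2) * d) := by nlinarith [mul_nonneg hN hvF]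
    _ ≤ N * ((S + 3) * V + S * c + (S + 2) * (2 * ξ * (V + c))) := by gcongr
    _ ≤ N * (((3 + 3 * S) * (1 + 2 * ξ)) * (V + c)) := by
        refine mul_le_mul_of_nonneg_left ?_ hN
        nlinarith [mul_nonneg hS hV0, mul_nonneg hS hsF, mul_nonneg hξ0 hV0,
          mul_nonneg hξ0 hsF, mul_nonneg (mul_nonneg hξ0 hS) hV0,
          mul_nonneg (mul_nonneg hξ0 hS) hsF]
    _ = _ := by ring

-- For a lower bound the nonnegative terms of non-full branches are dropped, while almost every
-- point has a preimage in each full branch. The exceptions are the two endpoints and the images of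
-- the countable sets on which the weight is below `e`.
open Classical in
theorem ae_le_sum_branch {w f : Seg α β → ℝ} {e : ℝ} {i : Set (Seg α β) → ℝ}
    (hw0 : ∀ Z ∈ P, ∀ x ∈ Z, 0 ≤ w x) (he0 : 0 ≤ e)
    (he : ∀ Z ∈ P, IsFull T Z → {x ∈ Z | w x < e}.Countable)
    (hf0 : ∀ x, 0 ≤ f x) (hi : ∀ Z ∈ P, IsFull T Z → ∀ x ∈ Z, i Z ≤ f x) :
    ∀ᵐ y ∂(leb : Measure (Seg α β)),
      e * ∑ Z ∈ hP.finite.toFinset.filter (fun Z => IsFull T Z), i Z ≤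
        ∑ Z ∈ hP.finite.toFinset, branchFn T w f Z y := by
  set Pf := hP.finite.toFinset with hPf
  have hmem : ∀ {Z}, Z ∈ Pf ↔ Z ∈ P := by simp [hPf]
  have hbad : (⋃ Z ∈ {Z ∈ P | IsFull T Z}, T '' {x ∈ Z | w x < e}).Countable :=
    (hP.finite.subset (sep_subset _ _)).countable.biUnion fun Z hZ => (he Z hZ.1 hZ.2).image T
  have hends : ∀ᵐ y ∂(leb : Measure (Seg α β)), y ∈ Ioo (lo α β) (RandomInterval.hi α β) := by
    refine ae_of_countable ((countable_singleton (lo α β)).union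
      (countable_singleton (RandomInterval.hi α β)) |>.mono fun y hy => ?_)
    by_contra hcon
    simp only [mem_union, mem_singleton_iff, not_or] at hcon
    exact hy ⟨lt_of_le_of_ne (lo_le y) (Ne.symm hcon.1), lt_of_le_of_ne (le_hi y) hcon.2⟩
  filter_upwards [hends, ae_of_countable (p := fun y =>
    y ∉ ⋃ Z ∈ {Z ∈ P | IsFull T Z}, T '' {x ∈ Z | w x < e})
    (hbad.mono fun y hy => not_not.1 hy)] with y hy hyb
  have hnn : ∀ Z ∈ Pf, 0 ≤ branchFn T w f Z y := by
    intro Z hZ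
    by_cases hyZ : y ∈ T '' Z
    · obtain ⟨x, hx, rfl⟩ := hyZ
      rw [branchFn_apply (hP.injOn (hmem.1 hZ)) w f hx]
      exact mul_nonneg (hf0 x) (hw0 Z (hmem.1 hZ) x hx)
    · rw [branchFn_of_notMem w f hyZ]
  rw [Finset.mul_sum]
  refine (Finset.sum_le_sum fun Z hZ => ?_).trans
    (Finset.sum_le_sum_of_subset_of_nonneg (Finset.filter_subset _ _) fun Z hZ _ => hnn Z hZ)
  obtain ⟨hZP, hZf⟩ := Finset.mem_filter.1 hZ
  rw [hmem] at hZP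
  obtain ⟨x, hx, rfl⟩ := hP.Ioo_subset_of_isFull hZP hZf hy
  rw [branchFn_apply (hP.injOn hZP) w f hx, mul_comm]
  have hxe : e ≤ w x := by
    by_contra hcon
    push Not at hcon
    exact hyb (mem_biUnion (show Z ∈ {Z ∈ P | IsFull T Z} from ⟨hZP, hZf⟩) ⟨x, ⟨hx, hcon⟩, rfl⟩)
  exact mul_le_mul (hi Z hZP hZf x hx) hxe he0 (hf0 x)

/-- Away from the image of `B`, each surviving fibre point lies in exactly one branch. Sums over
fibres compose well, sums over branches do not; passing between the two is how the iterated operator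
acquires a branch expansion. -/
theorem sum_branch_eq_finsum {X : Set (Seg α β)} (hX : ∀ Z ∈ P, Z ⊆ X) {B : Set (Seg α β)}
    (hcov : ∀ x ∈ X, x ∉ B → ∃ Z ∈ P, x ∈ Z)
    (hdisj : ∀ Z ∈ P, ∀ W ∈ P, Z ≠ W → Z ∩ W ⊆ B) {y : Seg α β} (hy : y ∉ T '' B)
    (hfin : {x | x ∈ X ∧ T x = y}.Finite) (w f : Seg α β → ℝ) :
    ∑ Z ∈ hP.finite.toFinset, branchFn T w f Z y =
      ∑ᶠ x ∈ {x | x ∈ X ∧ T x = y}, f x * w x := by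
  classical
  rw [finsum_mem_eq_finite_toFinset_sum _ hfin]
  have h1 : ∀ x ∈ hfin.toFinset, f x * w x =
      ∑ Z ∈ hP.finite.toFinset, if x ∈ Z then f x * w x else 0 := by
    intro x hx
    have hx' : x ∈ X ∧ T x = y := by simpa using hx
    have hxB : x ∉ B := fun h => hy ⟨x, h, hx'.2⟩
    obtain ⟨Z, hZ, hxZ⟩ := hcov x hx'.1 hxB
    rw [Finset.sum_eq_single Z]
    · simp [hxZ]
    · intro W hW hne
      rw [if_neg]
      intro hxW
      exact hxB (hdisj W (by simpa using hW) Z hZ hne ⟨hxW, hxZ⟩)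
    · intro h
      exact absurd (by simpa using hZ) h
  rw [Finset.sum_congr rfl h1, Finset.sum_comm]
  refine Finset.sum_congr rfl fun Z hZ => ?_
  have hZP : Z ∈ P := by simpa using hZ
  by_cases hyZ : y ∈ T '' Z
  · obtain ⟨x, hx, hxy⟩ := hyZ
    rw [Finset.sum_eq_single x]
    · rw [if_pos hx, ← hxy, branchFn_apply (hP.injOn hZP) w f hx]
    · intro x' hx' hne
      rw [if_neg]
      intro hx'Z
      have hx'' : x' ∈ X ∧ T x' = y := by simpa using hx'
      exact hne (hP.injOn hZP hx'Z hx (hx''.2.trans hxy.symm))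
    · intro h
      refine absurd ?_ h
      simpa using ⟨hX Z hZP hx, hxy⟩
  · rw [branchFn_of_notMem w f hyZ]
    refine (Finset.sum_eq_zero fun x hx => ?_).symm
    rw [if_neg]
    intro hxZ
    have hx' : x ∈ X ∧ T x = y := by simpa using hx
    exact hyZ ⟨x, hxZ, hx'.2⟩

end IsBranched

/-! ### Finite unions of intervals -/

/-- Finite unions of intervals. -/
def IsFiniteUnionOfIntervals {ι : Type*} [LinearOrder ι] (U : Set ι) : Prop :=
  ∃ J : Set (Set ι), J.Finite ∧ (∀ Z ∈ J, Z.OrdConnected) ∧ U = ⋃₀ J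

namespace IsFiniteUnionOfIntervals

variable {ι : Type*} [LinearOrder ι] {U V : Set ι}

theorem of_ordConnected (h : U.OrdConnected) : IsFiniteUnionOfIntervals U :=
  ⟨{U}, finite_singleton U, by simpa using h, by simp⟩

theorem inter (hU : IsFiniteUnionOfIntervals U) (hV : IsFiniteUnionOfIntervals V) :
    IsFiniteUnionOfIntervals (U ∩ V) := by
  obtain ⟨J, hJ, hJo, rfl⟩ := hU
  obtain ⟨K, hK, hKo, rfl⟩ := hV
  refine ⟨image2 (· ∩ ·) J K, hJ.image2 _ hK, ?_, ?_⟩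
  · rintro _ ⟨A, hA, B, hB, rfl⟩
    exact (hJo A hA).inter (hKo B hB)
  · ext x
    constructor
    · rintro ⟨⟨A, hA, hxA⟩, ⟨B, hB, hxB⟩⟩
      exact ⟨_, ⟨A, hA, B, hB, rfl⟩, hxA, hxB⟩
    · rintro ⟨_, ⟨A, hA, B, hB, rfl⟩, hxA, hxB⟩
      exact ⟨⟨A, hA, hxA⟩, ⟨B, hB, hxB⟩⟩

theorem union (hU : IsFiniteUnionOfIntervals U) (hV : IsFiniteUnionOfIntervals V) :
    IsFiniteUnionOfIntervals (U ∪ V) := by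
  obtain ⟨J, hJ, hJo, rfl⟩ := hU
  obtain ⟨K, hK, hKo, rfl⟩ := hV
  refine ⟨J ∪ K, hJ.union hK, ?_, by rw [sUnion_union]⟩
  rintro A (hA | hA)
  exacts [hJo A hA, hKo A hA]

theorem compl_of_ordConnected (h : U.OrdConnected) : IsFiniteUnionOfIntervals Uᶜ := by
  rcases U.eq_empty_or_nonempty with rfl | ⟨u, hu⟩
  · exact of_ordConnected (by simpa using ordConnected_univ)
  have : Uᶜ = {x | ∀ z ∈ U, x < z} ∪ {x | ∀ z ∈ U, z < x} := by
    ext x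
    constructor
    · intro hx
      rcases lt_trichotomy x u with hlt | rfl | hlt
      · refine Or.inl fun z hz => ?_
        by_contra hcon
        exact hx (h.out hz hu ⟨not_lt.1 hcon, hlt.le⟩)
      · exact absurd hu hx
      · refine Or.inr fun z hz => ?_
        by_contra hcon
        exact hx (h.out hu hz ⟨hlt.le, not_lt.1 hcon⟩)
    · rintro (hx | hx) hxU
      · exact (hx x hxU).false
      · exact (hx x hxU).false
  rw [this]
  refine (of_ordConnected ⟨?_⟩).union (of_ordConnected ⟨?_⟩)
  · intro x _ y hy w hw z hz
    exact hw.2.trans_lt (hy z hz)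
  · intro x hx y _ w hw z hz
    exact (hx z hz).trans_le hw.1

theorem compl (hU : IsFiniteUnionOfIntervals U) : IsFiniteUnionOfIntervals Uᶜ := by
  obtain ⟨J, hJ, hJo, rfl⟩ := hU
  induction J, hJ using Set.Finite.induction_on with
  | empty => simpa using of_ordConnected (ι := ι) ordConnected_univ
  | insert ha hs ih =>
    rw [sUnion_insert, compl_union]
    exact (compl_of_ordConnected (hJo _ (mem_insert _ _))).inter
      (ih fun Z hZ => hJo Z (mem_insert_of_mem _ hZ))

/-- The components of a finite union of intervals. -/
theorem components (hU : IsFiniteUnionOfIntervals U) :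
    {C | ∃ x ∈ U, C = ordConnectedComponent U x}.Finite ∧
      {x ∈ U | ¬ (ordConnectedComponent U x).Nontrivial}.Finite := by
  obtain ⟨J, hJ, hJo, rfl⟩ := hU
  have key : ∀ Z ∈ J, ∀ x ∈ Z, Z ⊆ ordConnectedComponent (⋃₀ J) x := fun Z hZ x hx =>
    haveI := hJo Z hZ
    subset_ordConnectedComponent hx (subset_sUnion_of_mem hZ)
  constructor
  · refine (hJ.biUnion (t := fun Z => {C | ∃ x ∈ Z, C = ordConnectedComponent (⋃₀ J) x})
      fun Z hZ => Set.Subsingleton.finite ?_).subset ?_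
    · rintro _ ⟨x, hx, rfl⟩ _ ⟨y, hy, rfl⟩
      exact ordConnectedComponent_eq (key Z hZ x hx hy)
    · rintro C ⟨x, ⟨Z, hZ, hxZ⟩, rfl⟩
      exact mem_biUnion hZ ⟨x, hxZ, rfl⟩
  · refine (hJ.biUnion (t := fun Z => {x ∈ Z | ¬ (ordConnectedComponent (⋃₀ J) x).Nontrivial})
      fun Z hZ => Set.Subsingleton.finite ?_).subset ?_
    · rintro x ⟨hx, hx'⟩ y ⟨hy, -⟩
      exact (not_nontrivial_iff.1 hx') (key Z hZ x hx hx) (key Z hZ x hx hy)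
    · rintro x ⟨⟨Z, hZ, hxZ⟩, hx⟩
      exact mem_biUnion hZ ⟨hxZ, hx⟩

end IsFiniteUnionOfIntervals

theorem subsingleton_of_leb_eq_zero {Z : Set (Seg α β)} (hZ : Z.OrdConnected) (h : leb Z = 0) :
    Z.Subsingleton := by
  by_contra hcon
  obtain ⟨u, hu, v, hv, huv⟩ := (not_subsingleton_iff.1 hcon).exists_lt
  have hne : (Ioo u v).Nonempty := nonempty_Ioo.2 huv
  exact (isOpen_Ioo.measure_pos leb hne).ne' (measure_mono_null
    (Ioo_subset_Icc_self.trans (hZ.out hu hv)) h)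

/-- Each interval in the union is null, hence at most a point. -/
theorem IsFiniteUnionOfIntervals.finite_of_leb_eq_zero {U : Set (Seg α β)}
    (hU : IsFiniteUnionOfIntervals U) (h : leb U = 0) : U.Finite := by
  obtain ⟨J, hJ, hJo, rfl⟩ := hU
  rw [sUnion_eq_biUnion]
  exact hJ.biUnion fun Z hZ => (subsingleton_of_leb_eq_zero (hJo Z hZ)
    (measure_mono_null (subset_sUnion_of_mem hZ) h)).finite

/-! ### The pieces of a partition restricted to a set -/

theorem ordConnectedComponent_ordConnected {ι : Type*} [LinearOrder ι] (U : Set ι) (x : ι) :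
    (ordConnectedComponent U x).OrdConnected := inferInstance

/-- A finite family of intervals, overlapping at most in endpoints, on which `T` is continuous and
strictly monotone, and whose members meet `X` in finitely many intervals. -/
structure IsMonotonePartition (T : Seg α β → Seg α β) (P : Set (Set (Seg α β)))
    (X : Set (Seg α β)) : Prop where
  finite : P.Finite
  ordConnected : ∀ Z ∈ P, Z.OrdConnected
  inter_subsingleton : P.Pairwise fun Z W => (Z ∩ W).Subsingleton
  continuousOn : ∀ Z ∈ P, ContinuousOn T Z
  monotone : ∀ Z ∈ P, StrictMonoOn T Z ∨ StrictAntiOn T Z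
  inter_intervals : ∀ Z ∈ P, IsFiniteUnionOfIntervals (Z ∩ X)
  finite_compl : (⋃₀ P)ᶜ.Finite
  finite_fiber : ∀ y, {x | T x = y}.Finite

namespace IsMonotonePartition

variable {T : Seg α β → Seg α β} {P : Set (Set (Seg α β))} {X : Set (Seg α β)}
  (hP : IsMonotonePartition T P X)
include hP

theorem finite_pieces : (intervalPieces P X).Finite := by
  refine (hP.finite.biUnion (t := fun Z => {C | ∃ x ∈ Z ∩ X, C = ordConnectedComponent (Z ∩ X) x})
    fun Z hZ => (hP.inter_intervals Z hZ).components.1).subset ?_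
  rintro C ⟨Z, hZ, x, hx, hC, -⟩
  exact mem_biUnion hZ ⟨x, hx, hC⟩

theorem pieces_inter_subsingleton : (intervalPieces P X).Pairwise fun Z W =>
    (Z ∩ W).Subsingleton := by
  rintro C ⟨Z, hZ, x, hx, rfl, hC⟩ D ⟨W, hW, y, hy, rfl, hD⟩ hne
  by_cases hZW : Z = W
  · subst hZW
    rintro u ⟨hu1, hu2⟩
    exact absurd ((ordConnectedComponent_eq hu1).trans (ordConnectedComponent_eq hu2).symm) hne
  · exact (hP.inter_subsingleton hZ hW hZW).anti (inter_subset_inter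
      (ordConnectedComponent_subset.trans inter_subset_left)
      (ordConnectedComponent_subset.trans inter_subset_left))

theorem isBranched : IsBranched T (intervalPieces P X) where
  finite := hP.finite_pieces
  ordConnected := by
    rintro C ⟨Z, hZ, x, hx, rfl, hC⟩
    exact ordConnectedComponent_ordConnected _ _
  nontrivial := by
    rintro C ⟨Z, hZ, x, hx, rfl, hC⟩
    exact hC
  inter_subsingleton := hP.pieces_inter_subsingleton
  continuousOn := by
    rintro C ⟨Z, hZ, x, hx, rfl, hC⟩
    exact (hP.continuousOn Z hZ).mono (ordConnectedComponent_subset.trans inter_subset_left)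
  monotone := by
    rintro C ⟨Z, hZ, x, hx, rfl, hC⟩
    have hsub := (ordConnectedComponent_subset (s := Z ∩ X) (x := x)).trans inter_subset_left
    exact (hP.monotone Z hZ).imp (fun h => h.mono hsub) fun h => h.mono hsub

theorem piece_subset {C : Set (Seg α β)} (hC : C ∈ intervalPieces P X) :
    ∃ Z ∈ P, C ⊆ Z ∩ X := by
  obtain ⟨Z, hZ, x, hx, rfl, hC⟩ := hC
  exact ⟨Z, hZ, ordConnectedComponent_subset⟩

/-- Exceptions have three finite sources: points outside all atoms, degenerate components (which are
not kept as pieces), and endpoints shared by two pieces. -/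
theorem exists_exceptional : ∃ B : Set (Seg α β), B.Finite ∧
    (∀ x ∈ X, x ∉ B → ∃ Z ∈ intervalPieces P X, x ∈ Z) ∧
    ∀ Z ∈ intervalPieces P X, ∀ W ∈ intervalPieces P X, Z ≠ W → Z ∩ W ⊆ B := by
  refine ⟨(⋃₀ P)ᶜ ∪ (⋃ Z ∈ P, {x ∈ Z ∩ X | ¬ (ordConnectedComponent (Z ∩ X) x).Nontrivial}) ∪
    ⋃ p ∈ {p : Set (Seg α β) × Set (Seg α β) | p ∈ intervalPieces P X ×ˢ intervalPieces P X ∧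
      p.1 ≠ p.2}, p.1 ∩ p.2, ?_, ?_, ?_⟩
  · refine (hP.finite_compl.union (hP.finite.biUnion fun Z hZ =>
      (hP.inter_intervals Z hZ).components.2)).union
      (((hP.finite_pieces.prod hP.finite_pieces).subset (sep_subset _ _)).biUnion fun p hp => ?_)
    exact (hP.pieces_inter_subsingleton hp.1.1 hp.1.2 hp.2).finite
  · intro x hx hxB
    simp only [mem_union, not_or, mem_compl_iff, not_not] at hxB
    obtain ⟨⟨⟨Z, hZ, hxZ⟩, h2⟩, -⟩ := hxB
    refine ⟨ordConnectedComponent (Z ∩ X) x, ⟨Z, hZ, x, ⟨hxZ, hx⟩, rfl, ?_⟩,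
      self_mem_ordConnectedComponent.2 ⟨hxZ, hx⟩⟩
    by_contra hcon
    exact h2 (mem_biUnion hZ ⟨⟨hxZ, hx⟩, hcon⟩)
  · intro Z hZ W hW hne x hx
    exact Or.inr (mem_biUnion (show (Z, W) ∈ {p : Set (Seg α β) × Set (Seg α β) |
      p ∈ intervalPieces P X ×ˢ intervalPieces P X ∧ p.1 ≠ p.2} from ⟨⟨hZ, hW⟩, hne⟩) hx)

/-- Off a countable set, the sum over the branches is the sum over the fibre. -/
theorem exists_countable_sum_branch_eq : ∃ E : Set (Seg α β), E.Countable ∧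
    ∀ (w f : Seg α β → ℝ) (y : Seg α β), y ∉ E →
      ∑ Z ∈ hP.isBranched.finite.toFinset, branchFn T w f Z y =
        ∑ᶠ x ∈ {x | x ∈ X ∧ T x = y}, f x * w x := by
  obtain ⟨B, hB, hcov, hdisj⟩ := hP.exists_exceptional
  refine ⟨T '' B, (hB.image T).countable, fun w f y hy => ?_⟩
  exact hP.isBranched.sum_branch_eq_finsum (fun Z hZ => by
    obtain ⟨W, hW, hsub⟩ := hP.piece_subset hZ
    exact hsub.trans inter_subset_right) hcov hdisj hy
    ((hP.finite_fiber y).subset fun x hx => hx.2) w f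

end IsMonotonePartition

end RandomInterval
end

/-! ### Composition of monotone partitions and existence of full branches. -/

noncomputable section
namespace RandomInterval
variable {α β : ℝ} [Fact (α < β)]

theorem ordConnected_inter_preimage {S : Seg α β → Seg α β} {A B : Set (Seg α β)}
    (hA : A.OrdConnected) (hS : StrictMonoOn S A ∨ StrictAntiOn S A) (hB : B.OrdConnected) :
    (A ∩ S ⁻¹' B).OrdConnected := by
  refine ⟨fun x hx y hy z hz => ?_⟩
  have hzA := hA.out hx.1 hy.1 hz
  refine ⟨hzA, ?_⟩
  rcases hS with h | h
  · exact hB.out hx.2 hy.2 ⟨h.monotoneOn hx.1 hzA hz.1, h.monotoneOn hzA hy.1 hz.2⟩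
  · exact hB.out hy.2 hx.2 ⟨h.antitoneOn hzA hy.1 hz.2, h.antitoneOn hx.1 hzA hz.1⟩

theorem Ioo_subset_of_ae_mem {Y : Set (Seg α β)} (hY : Y.OrdConnected)
    (h : ∀ᵐ y ∂(leb : Measure (Seg α β)), y ∈ Y) : Ioo (lo α β) (hi α β) ⊆ Y := by
  intro y hy
  obtain ⟨u, hu, huY⟩ := exists_mem_Ioo_of_ae h hy.1
  obtain ⟨v, hv, hvY⟩ := exists_mem_Ioo_of_ae h hy.2
  exact hY.out huY hvY ⟨hu.2.le, hv.1.le⟩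

theorem isFull_iff {T : Seg α β → Seg α β} {Z : Set (Seg α β)} :
    IsFull T Z ↔ ∀ᵐ y ∂(leb : Measure (Seg α β)), y ∈ T '' Z := by
  rw [IsFull, eventuallyEq_set]
  simp

namespace IsMonotonePartition

variable {S T : Seg α β → Seg α β} {P Q : Set (Set (Seg α β))} {X Y : Set (Seg α β)}

theorem injOn (hP : IsMonotonePartition S P X) {A : Set (Seg α β)} (hA : A ∈ P) : InjOn S A :=
  (hP.monotone A hA).elim StrictMonoOn.injOn StrictAntiOn.injOn

/-- Monotonicity of `S` on an atom makes the preimage of an interval inside it an interval, and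
finite fibres of `S` keep the uncovered set finite. -/
theorem comp (hP : IsMonotonePartition S P X) (hQ : IsMonotonePartition T Q Y) :
    IsMonotonePartition (T ∘ S) (image2 (fun A B => A ∩ S ⁻¹' B) P Q) (X ∩ S ⁻¹' Y) where
  finite := hP.finite.image2 _ hQ.finite
  ordConnected := by
    rintro _ ⟨A, hA, B, hB, rfl⟩
    exact ordConnected_inter_preimage (hP.ordConnected A hA) (hP.monotone A hA)
      (hQ.ordConnected B hB)
  inter_subsingleton := by
    rintro _ ⟨A, hA, B, hB, rfl⟩ _ ⟨A', hA', B', hB', rfl⟩ hne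
    by_cases hAA : A = A'
    · subst hAA
      have hBB : B ≠ B' := by
        rintro rfl
        exact hne rfl
      rintro x ⟨⟨hx1, hx2⟩, -, hx3⟩ y ⟨⟨hy1, hy2⟩, -, hy3⟩
      exact hP.injOn hA hx1 hy1 (hQ.inter_subsingleton hB hB' hBB ⟨hx2, hx3⟩ ⟨hy2, hy3⟩)
    · exact (hP.inter_subsingleton hA hA' hAA).anti
        (inter_subset_inter inter_subset_left inter_subset_left)
  continuousOn := by
    rintro _ ⟨A, hA, B, hB, rfl⟩
    exact (hQ.continuousOn B hB).comp ((hP.continuousOn A hA).mono inter_subset_left)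
      fun x hx => hx.2
  monotone := by
    rintro _ ⟨A, hA, B, hB, rfl⟩
    have hm : MapsTo S (A ∩ S ⁻¹' B) B := fun x hx => hx.2
    rcases hP.monotone A hA with h | h <;> rcases hQ.monotone B hB with h' | h'
    · exact Or.inl (h'.comp (h.mono inter_subset_left) hm)
    · exact Or.inr (h'.comp_strictMonoOn (h.mono inter_subset_left) hm)
    · exact Or.inr (h'.comp_strictAntiOn (h.mono inter_subset_left) hm)
    · exact Or.inl (h'.comp (h.mono inter_subset_left) hm)
  inter_intervals := by
    rintro _ ⟨A, hA, B, hB, rfl⟩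
    have h1 : A ∩ S ⁻¹' B ∩ (X ∩ S ⁻¹' Y) = (A ∩ X) ∩ (A ∩ S ⁻¹' (B ∩ Y)) := by
      ext x
      simp only [mem_inter_iff, mem_preimage]
      tauto
    rw [h1]
    refine (hP.inter_intervals A hA).inter ?_
    obtain ⟨J, hJ, hJo, hJe⟩ := hQ.inter_intervals B hB
    refine ⟨(fun D => A ∩ S ⁻¹' D) '' J, hJ.image _, ?_, ?_⟩
    · rintro _ ⟨D, hD, rfl⟩
      exact ordConnected_inter_preimage (hP.ordConnected A hA) (hP.monotone A hA) (hJo D hD)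
    · rw [hJe]
      ext x
      simp only [mem_inter_iff, mem_preimage, mem_sUnion, mem_image, exists_exists_and_eq_and]
      exact ⟨fun ⟨h, D, hD, hx⟩ => ⟨D, hD, h, hx⟩, fun ⟨D, hD, h, hx⟩ => ⟨h, D, hD, hx⟩⟩
  finite_compl := by
    refine (hP.finite_compl.union (hQ.finite_compl.biUnion fun y _ => hP.finite_fiber y)).subset ?_
    intro x hx
    by_contra hcon
    simp only [mem_union, mem_compl_iff, not_or, not_not, mem_iUnion, not_exists] at hcon
    obtain ⟨⟨A, hA, hxA⟩, h2⟩ := hcon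
    have h3 : S x ∈ ⋃₀ Q := by
      by_contra h
      exact h2 (S x) h rfl
    obtain ⟨B, hB, hxB⟩ := h3
    exact hx ⟨_, ⟨A, hA, B, hB, rfl⟩, hxA, hxB⟩
  finite_fiber := fun y => by
    refine ((hQ.finite_fiber y).biUnion fun z _ => hP.finite_fiber z).subset fun x hx => ?_
    exact mem_biUnion (show S x ∈ {z | T z = y} from hx) rfl

/-- An interval inside one element of the partition and inside `X` that is mapped onto
everything. -/
def HasFull (T : Seg α β → Seg α β) (P : Set (Set (Seg α β))) (X : Set (Seg α β)) : Prop :=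
  ∃ C : Set (Seg α β), C.OrdConnected ∧ (∃ Z ∈ P, C ⊆ Z ∩ X) ∧ IsFull T C

/-- The image of the first full interval contains the open segment, so every interior point of the
second one is reached. Only the values of `T` at the two endpoints have to be discarded. -/
theorem HasFull.comp (hP : IsMonotonePartition S P X)
    (h1 : HasFull S P X) (h2 : HasFull T Q Y) :
    HasFull (T ∘ S) (image2 (fun A B => A ∩ S ⁻¹' B) P Q) (X ∩ S ⁻¹' Y) := by
  obtain ⟨C, hC, ⟨A, hA, hCA⟩, hCf⟩ := h1
  obtain ⟨D, hD, ⟨B, hB, hDB⟩, hDf⟩ := h2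
  have hCA' : C ⊆ A := hCA.trans inter_subset_left
  refine ⟨C ∩ S ⁻¹' D, ordConnected_inter_preimage hC ((hP.monotone A hA).imp
    (fun h => h.mono hCA') fun h => h.mono hCA') hD, ⟨_, ⟨A, hA, B, hB, rfl⟩, ?_⟩, ?_⟩
  · rintro x ⟨hxC, hxD⟩
    exact ⟨⟨(hCA hxC).1, (hDB hxD).1⟩, (hCA hxC).2, (hDB hxD).2⟩
  · rw [isFull_iff] at hCf hDf ⊢
    have hcount : (T '' {lo α β, hi α β}).Countable := ((finite_singleton _).insert _).countable.image T
    filter_upwards [hDf, ae_of_countable (p := fun y => y ∉ T '' {lo α β, hi α β})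
      (hcount.mono fun y hy => not_not.1 hy)] with y hy hy2
    obtain ⟨z, hz, rfl⟩ := hy
    have hoc : (S '' C).OrdConnected := ((isPreconnected_of_ordConnected hC).image S
      ((hP.continuousOn A hA).mono hCA')).ordConnected
    have hzi : z ∈ Ioo (lo α β) (hi α β) := by
      refine ⟨lt_of_le_of_ne (lo_le z) ?_, lt_of_le_of_ne (le_hi z) ?_⟩
      · rintro rfl
        exact hy2 ⟨_, Or.inl rfl, rfl⟩
      · rintro rfl
        exact hy2 ⟨_, Or.inr rfl, rfl⟩
    obtain ⟨x, hx, rfl⟩ := Ioo_subset_of_ae_mem hoc hCf hzi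
    exact ⟨x, ⟨hx, hz⟩, rfl⟩

/-- The full interval lies in a single component, and enlarging it to that component keeps it full.
Two distinct values of `T` on it show that the component is nondegenerate. -/
theorem exists_full_piece (h : HasFull T P X) : ∃ Z ∈ intervalPieces P X, IsFull T Z := by
  obtain ⟨C, hC, ⟨A, hA, hCA⟩, hCf⟩ := h
  rw [isFull_iff] at hCf
  obtain ⟨y₁, -, x₁, hx₁, rfl⟩ := exists_mem_Ioo_of_ae hCf (lo_lt_hi (α := α) (β := β))
  obtain ⟨y₂, hy₂, x₂, hx₂, rfl⟩ : ∃ y, y ≠ T x₁ ∧ y ∈ T '' C := by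
    by_contra hcon
    push Not at hcon
    have h1 : leb {y : Seg α β | y ≠ T x₁} = 0 :=
      measure_mono_null (fun y hy => hcon y hy) hCf
    have h2 : (leb : Measure (Seg α β)) univ = 0 := by
      rw [← compl_union_self {T x₁}]
      exact measure_union_null h1 (measure_singleton _)
    exact NeZero.ne (leb : Measure (Seg α β)) (Measure.measure_univ_eq_zero.1 h2)
  have hsub : C ⊆ ordConnectedComponent (A ∩ X) x₁ := subset_ordConnectedComponent hx₁ hCA
  refine ⟨_, ⟨A, hA, x₁, hCA hx₁, rfl, x₁, hsub hx₁, x₂, hsub hx₂, ?_⟩, ?_⟩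
  · rintro rfl
    exact hy₂ rfl
  · rw [isFull_iff]
    filter_upwards [hCf] with y hy using image_mono hsub hy

/-- The finitely many atoms cover all points close to the right of `x`. One of them accumulates at
`x` and, being an interval, contains a one-sided neighbourhood. This bounds the conformal mass next
to a point by the mass of one atom. -/
theorem exists_Ioo_right_subset (hP : IsMonotonePartition T P X) {x : Seg α β} (hx : x < hi α β) :
    ∃ Z ∈ P, ∃ v, x < v ∧ Ioo x v ⊆ Z := by
  have := nhdsGT_neBot_of_lt hx
  have h1 : ∀ᶠ y in 𝓝[>] x, y ∈ ⋃₀ P := by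
    have h2 : (((⋃₀ P)ᶜ) \ {x})ᶜ ∈ 𝓝 x :=
      (hP.finite_compl.subset sdiff_subset).isClosed.isOpen_compl.mem_nhds (by simp)
    filter_upwards [mem_nhdsWithin_of_mem_nhds h2, self_mem_nhdsWithin] with y hy hxy
    by_contra hcon
    exact hy ⟨hcon, (ne_of_gt hxy : y ≠ x)⟩
  have h2 : ∃ Z ∈ P, ∃ᶠ y in 𝓝[>] x, y ∈ Z := by
    by_contra hcon
    push Not at hcon
    have h3 : ∀ᶠ y in 𝓝[>] x, ∀ Z ∈ P, y ∉ Z :=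
      (eventually_all_finite hP.finite).2 fun Z hZ => hcon Z hZ
    obtain ⟨y, ⟨Z, hZ, hyZ⟩, h⟩ := (h1.and h3).exists
    exact h Z hZ hyZ
  obtain ⟨Z, hZ, hfr⟩ := h2
  obtain ⟨z₀, hz₀Z, hz₀⟩ := (hfr.and_eventually (self_mem_nhdsWithin)).exists
  refine ⟨Z, hZ, z₀, hz₀, fun y hy => ?_⟩
  obtain ⟨z, hzZ, hz⟩ := (hfr.and_eventually (Ioo_mem_nhdsGT hy.1)).exists
  exact (hP.ordConnected Z hZ).out hzZ hz₀Z ⟨hz.2.le, hy.2.le⟩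

theorem exists_Ioo_left_subset (hP : IsMonotonePartition T P X) {x : Seg α β} (hx : lo α β < x) :
    ∃ Z ∈ P, ∃ v, v < x ∧ Ioo v x ⊆ Z := by
  have := nhdsLT_neBot_of_lt hx
  have h1 : ∀ᶠ y in 𝓝[<] x, y ∈ ⋃₀ P := by
    have h2 : (((⋃₀ P)ᶜ) \ {x})ᶜ ∈ 𝓝 x :=
      (hP.finite_compl.subset sdiff_subset).isClosed.isOpen_compl.mem_nhds (by simp)
    filter_upwards [mem_nhdsWithin_of_mem_nhds h2, self_mem_nhdsWithin] with y hy hxy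
    by_contra hcon
    exact hy ⟨hcon, (ne_of_lt hxy : y ≠ x)⟩
  have h2 : ∃ Z ∈ P, ∃ᶠ y in 𝓝[<] x, y ∈ Z := by
    by_contra hcon
    push Not at hcon
    have h3 : ∀ᶠ y in 𝓝[<] x, ∀ Z ∈ P, y ∉ Z :=
      (eventually_all_finite hP.finite).2 fun Z hZ => hcon Z hZ
    obtain ⟨y, ⟨Z, hZ, hyZ⟩, h⟩ := (h1.and h3).exists
    exact h Z hZ hyZ
  obtain ⟨Z, hZ, hfr⟩ := h2
  obtain ⟨z₀, hz₀Z, hz₀⟩ := (hfr.and_eventually (self_mem_nhdsWithin)).exists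
  refine ⟨Z, hZ, z₀, hz₀, fun y hy => ?_⟩
  obtain ⟨z, hzZ, hz⟩ := (hfr.and_eventually (Ioo_mem_nhdsLT hy.2)).exists
  exact (hP.ordConnected Z hZ).out hz₀Z hzZ ⟨hy.1.le, hz.1.le⟩

end IsMonotonePartition

/-! ### One map -/

namespace WeightedOpenMap

variable (M : WeightedOpenMap α β)

/-- A null finite union of intervals is finite. The covering and disjointness that the structure
asserts modulo Lebesgue measure thus hold up to finitely many points, and finite fibres follow. -/
theorem isMonotonePartition : IsMonotonePartition M.T M.atoms M.X := by
  have hcompl : ((⋃₀ M.atoms)ᶜ).Finite :=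
    (IsFiniteUnionOfIntervals.compl ⟨M.atoms, M.finite_atoms, M.ordConnected_atoms, rfl⟩
      ).finite_of_leb_eq_zero M.cover_atoms
  exact {
    finite := M.finite_atoms
    ordConnected := M.ordConnected_atoms
    inter_subsingleton := fun Z hZ W hW hne => subsingleton_of_leb_eq_zero
      ((M.ordConnected_atoms Z hZ).inter (M.ordConnected_atoms W hW)) (M.disjoint_atoms hZ hW hne)
    continuousOn := M.continuousOn_atoms
    monotone := M.monotone_atoms
    inter_intervals := fun Z hZ => (IsFiniteUnionOfIntervals.of_ordConnected
      (M.ordConnected_atoms Z hZ)).inter (IsFiniteUnionOfIntervals.compl M.hole_intervals)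
    finite_compl := hcompl
    finite_fiber := fun y => by
      refine (hcompl.union (M.finite_atoms.biUnion (t := fun Z => {x ∈ Z | M.T x = y})
        fun Z hZ => Set.Subsingleton.finite ?_)).subset ?_
      · intro u hu v hv
        exact (M.monotone_atoms Z hZ).elim StrictMonoOn.injOn StrictAntiOn.injOn hu.1 hv.1
          (hu.2.trans hv.2.symm)
      · intro x hx
        by_cases h : x ∈ ⋃₀ M.atoms
        · obtain ⟨Z, hZ, hxZ⟩ := h
          exact Or.inr (mem_biUnion hZ ⟨hxZ, hx⟩)
        · exact Or.inl h }

theorem hasFull : IsMonotonePartition.HasFull M.T M.atoms M.X := by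
  obtain ⟨Z, hZ, hf, hsub⟩ := M.full_branch
  exact ⟨Z, M.ordConnected_atoms Z hZ, ⟨Z, hZ, subset_inter le_rfl hsub⟩, hf⟩

theorem isBranched : IsBranched M.T M.pieces := M.isMonotonePartition.isBranched

theorem transfer_eq_sum (f : Seg α β → ℝ) (y : Seg α β) :
    M.transfer f y = ∑ Z ∈ M.isBranched.finite.toFinset, branchFn M.T M.g f Z y :=
  finsum_mem_eq_finite_toFinset_sum _ M.isBranched.finite

theorem isBV_transfer {f : Seg α β → ℝ} (hf : IsBV f) : IsBV (M.transfer f) := by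
  have h := IsBV.finset_sum M.isBranched.finite.toFinset
    (f := fun Z => branchFn M.T M.g f Z) fun Z hZ =>
      M.isBranched.isBV_branch ((Set.Finite.mem_toFinset _).1 hZ) (M.g_bv.mono (subset_univ _))
        (hf.mono (subset_univ _))
  simpa only [← transfer_eq_sum] using h

theorem transfer_add (f h : Seg α β → ℝ) :
    M.transfer (fun x => f x + h x) = fun y => M.transfer f y + M.transfer h y := by
  ext y
  simp only [transfer_eq_sum, ← Finset.sum_add_distrib]
  refine Finset.sum_congr rfl fun Z _ => ?_
  unfold branchFn
  split_ifs
  · ring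
  · simp

theorem transfer_const_mul (c : ℝ) (f : Seg α β → ℝ) :
    M.transfer (fun x => c * f x) = fun y => c * M.transfer f y := by
  ext y
  simp only [transfer_eq_sum, Finset.mul_sum]
  refine Finset.sum_congr rfl fun Z _ => ?_
  unfold branchFn
  split_ifs
  · ring
  · simp

/-- The values of `f` that do not lie over `y` do not matter. -/
theorem transfer_congr_of_notMem {f h : Seg α β → ℝ} {y : Seg α β}
    (hy : y ∉ M.T '' {x | f x ≠ h x}) : M.transfer f y = M.transfer h y := by
  simp only [transfer_eq_sum]
  refine Finset.sum_congr rfl fun Z _ => ?_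
  unfold branchFn
  split_ifs with hx
  · have : f hx.choose = h hx.choose := by
      by_contra hne
      exact hy ⟨_, hne, hx.choose_spec.2⟩
    rw [this]
  · rfl

theorem transfer_mono_of_notMem {f h : Seg α β → ℝ} {y : Seg α β}
    (hy : y ∉ M.T '' {x | ¬ f x ≤ h x}) : M.transfer f y ≤ M.transfer h y := by
  simp only [transfer_eq_sum]
  refine Finset.sum_le_sum fun Z _ => ?_
  unfold branchFn
  split_ifs with hx
  · have : f hx.choose ≤ h hx.choose := by
      by_contra hne
      exact hy ⟨_, hne, hx.choose_spec.2⟩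
    exact mul_le_mul_of_nonneg_right this (M.g_pos _).le
  · rfl

/-- The two BV functions differ on a countable set, whose image under `T` is countable. This is
where nonsingularity of `T` would otherwise be required. -/
theorem transfer_congr {f h : Seg α β → ℝ} (hf : IsBV f) (hh : IsBV h) (he : f =ᵐ[leb] h) :
    M.transfer f =ᵐ[leb] M.transfer h :=
  ae_of_countable (((hf.countable_of_ae_eq hh he).image M.T).mono fun y hy => by
    by_contra hcon
    exact hy (M.transfer_congr_of_notMem hcon))

theorem transfer_mono {f h : Seg α β → ℝ} (hf : IsBV f) (hh : IsBV h) (he : f ≤ᵐ[leb] h) :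
    M.transfer f ≤ᵐ[leb] M.transfer h :=
  ae_of_countable (((hf.countable_of_ae_le hh he).image M.T).mono fun y hy => by
    by_contra hcon
    exact hy (M.transfer_mono_of_notMem hcon))

/-- All preimages of `y` carry the same value `φ y`, so no regularity of `φ` is needed. This is the
duality behind invariance and the correlation formula. -/
theorem transfer_comp_mul (φ h : Seg α β → ℝ) :
    M.transfer (fun x => φ (M.T x) * h x) = fun y => φ y * M.transfer h y := by
  ext y
  simp only [transfer_eq_sum, Finset.mul_sum]
  refine Finset.sum_congr rfl fun Z _ => ?_
  unfold branchFn
  split_ifs with hx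
  · dsimp only
    rw [hx.choose_spec.2]
    ring
  · simp

theorem transfer_of_eq_zero {f : Seg α β → ℝ} (hf : ∀ x ∈ M.X, f x = 0) :
    M.transfer f = fun _ => 0 := by
  ext y
  rw [transfer_eq_sum]
  refine Finset.sum_eq_zero fun Z hZ => ?_
  unfold branchFn
  split_ifs with hx
  · obtain ⟨A, hA, hsub⟩ := M.isMonotonePartition.piece_subset ((Set.Finite.mem_toFinset _).1 hZ)
    rw [hf _ (hsub hx.choose_spec.1).2, zero_mul]
  · rfl

theorem transfer_eq_finsum : ∃ E : Set (Seg α β), E.Countable ∧ ∀ (f : Seg α β → ℝ) (y : Seg α β),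
    y ∉ E → M.transfer f y = ∑ᶠ x ∈ {x | x ∈ M.X ∧ M.T x = y}, f x * M.g x := by
  obtain ⟨E, hE, h⟩ := M.isMonotonePartition.exists_countable_sum_branch_eq
  exact ⟨E, hE, fun f y hy => (M.transfer_eq_sum f y).trans (h M.g f y hy)⟩

end WeightedOpenMap

end RandomInterval
end

noncomputable section
namespace RandomInterval
variable {α β : ℝ} [Fact (α < β)]

/-! ### Random compositions -/

section Iterates

variable {Ω : Type*} [MeasurableSpace Ω] (σ : Ω ≃ᵐ Ω) (M : Ω → WeightedOpenMap α β)

theorem iterL_add (n k : ℕ) (ω : Ω) (f : Seg α β → ℝ) :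
    iterL σ M (n + k) ω f = iterL σ M k (σ^[n] ω) (iterL σ M n ω f) := by
  induction k with
  | zero => rfl
  | succ k ih =>
    rw [← add_assoc, iterL, iterL, Function.comp_apply, Function.comp_apply, ih, add_comm n k,
      Function.iterate_add_apply]

theorem iterL_one (ω : Ω) (f : Seg α β → ℝ) : iterL σ M 1 ω f = (M ω).transfer f := rfl

theorem iterG_succ (n : ℕ) (ω : Ω) (x : Seg α β) :
    iterG σ M (n + 1) ω x = iterG σ M n ω x * (M (σ^[n] ω)).g (iterT σ M n ω x) :=
  Finset.prod_range_succ _ _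

theorem survivor_succ (n : ℕ) (ω : Ω) :
    survivor σ M (n + 1) ω = survivor σ M n ω ∩ iterT σ M n ω ⁻¹' (M (σ^[n] ω)).X := by
  ext x
  simp only [survivor, mem_inter_iff, mem_preimage, mem_ofPred_eq, Nat.lt_succ_iff_lt_or_eq]
  exact ⟨fun h => ⟨fun j hj => h j (Or.inl hj), h n (Or.inr rfl)⟩, fun h j hj => by
    rcases hj with hj | rfl
    exacts [h.1 j hj, h.2]⟩

theorem iterAtoms_succ (n : ℕ) (ω : Ω) : iterAtoms σ M (n + 1) ω =
    image2 (fun A B => A ∩ iterT σ M n ω ⁻¹' B) (iterAtoms σ M n ω) (M (σ^[n] ω)).atoms := by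
  ext Z
  constructor
  · rintro ⟨A, hA, rfl⟩
    refine ⟨_, ⟨A, fun j hj => hA j (hj.trans (Nat.lt_succ_self n)), rfl⟩, A n,
      hA n (Nat.lt_succ_self n), ?_⟩
    ext x
    simp only [mem_inter_iff, mem_preimage, mem_ofPred_eq, Nat.lt_succ_iff_lt_or_eq]
    exact ⟨fun h j hj => by
      rcases hj with hj | rfl
      exacts [h.1 j hj, h.2], fun h => ⟨fun j hj => h j (Or.inl hj), h n (Or.inr rfl)⟩⟩
  · rintro ⟨_, ⟨A, hA, rfl⟩, B, hB, rfl⟩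
    refine ⟨fun j => if j < n then A j else B, fun j hj => ?_, ?_⟩
    · rcases Nat.lt_succ_iff_lt_or_eq.1 hj with h | rfl
      · simpa [h] using hA j h
      · simpa using hB
    · ext x
      simp only [mem_inter_iff, mem_preimage, mem_ofPred_eq, Nat.lt_succ_iff_lt_or_eq]
      constructor
      · rintro h j (hj | rfl)
        · simpa [hj] using h.1 j hj
        · simpa using h.2
      · intro h
        exact ⟨fun j hj => by simpa [hj] using h j (Or.inl hj), by simpa using h n (Or.inr rfl)⟩

theorem survivor_zero (ω : Ω) : survivor σ M 0 ω = univ := by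
  ext x
  simp [survivor]

theorem iterAtoms_zero (ω : Ω) : iterAtoms σ M 0 ω = {univ} := by
  ext x
  simp [iterAtoms]

theorem isMonotonePartition_iter (n : ℕ) (ω : Ω) :
    IsMonotonePartition (iterT σ M n ω) (iterAtoms σ M n ω) (survivor σ M n ω) := by
  induction n with
  | zero =>
    rw [survivor_zero, iterAtoms_zero]
    exact {
      finite := finite_singleton _
      ordConnected := by simpa using ordConnected_univ
      inter_subsingleton := pairwise_singleton _ _
      continuousOn := fun Z _ => continuousOn_id
      monotone := fun Z _ => Or.inl (strictMonoOn_id)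
      inter_intervals := fun Z hZ => by
        rw [mem_singleton_iff.1 hZ, inter_univ]
        exact IsFiniteUnionOfIntervals.of_ordConnected ordConnected_univ
      finite_compl := by simp
      finite_fiber := fun y => by simp [iterT] }
  | succ n ih =>
    rw [survivor_succ, iterAtoms_succ]
    exact ih.comp (M (σ^[n] ω)).isMonotonePartition

theorem hasFull_iter (n : ℕ) (ω : Ω) :
    IsMonotonePartition.HasFull (iterT σ M n ω) (iterAtoms σ M n ω) (survivor σ M n ω) := by
  induction n with
  | zero =>
    rw [survivor_zero, iterAtoms_zero]
    refine ⟨univ, ordConnected_univ, ⟨univ, rfl, by simp⟩, ?_⟩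
    rw [isFull_iff]
    simp [iterT]
  | succ n ih =>
    rw [survivor_succ, iterAtoms_succ]
    exact IsMonotonePartition.HasFull.comp (isMonotonePartition_iter σ M n ω) ih
      (M (σ^[n] ω)).hasFull

theorem isBranched_iter (n : ℕ) (ω : Ω) : IsBranched (iterT σ M n ω) (iterPieces σ M n ω) :=
  (isMonotonePartition_iter σ M n ω).isBranched

theorem exists_full (n : ℕ) (ω : Ω) : ∃ Z ∈ iterPieces σ M n ω, IsFull (iterT σ M n ω) Z :=
  IsMonotonePartition.exists_full_piece (hasFull_iter σ M n ω)

theorem finite_fullPieces (n : ℕ) (ω : Ω) : (fullPieces σ M n ω).Finite :=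
  (isBranched_iter σ M n ω).finite.subset (sep_subset _ _)

theorem one_le_numFull (n : ℕ) (ω : Ω) : 1 ≤ numFull σ M n ω := by
  obtain ⟨Z, hZ, hf⟩ := exists_full σ M n ω
  exact (ncard_pos (finite_fullPieces σ M n ω)).2 ⟨Z, hZ, hf⟩

/-- The admissible cardinalities are bounded by the number of branches; without such a bound the
supremum in `ℕ` would be the default value `0`. -/
theorem card_le_maxContiguous (n : ℕ) (ω : Ω) (Q : Finset (Set (Seg α β)))
    (hQ : (Q : Set (Set (Seg α β))) ⊆ nonfullPieces σ M n ω)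
    (hQ' : ∀ W ∈ fullPieces σ M n ω, ¬ W ⊆ hull (⋃₀ (Q : Set (Set (Seg α β))))) :
    Q.card ≤ maxContiguous σ M n ω := by
  refine le_csSup ⟨(iterPieces σ M n ω).ncard, ?_⟩ ⟨Q, hQ, hQ', rfl⟩
  rintro k ⟨S, hS, -, rfl⟩
  rw [← ncard_coe_finset]
  exact ncard_le_ncard (hS.trans (sep_subset _ _)) (isBranched_iter σ M n ω).finite

theorem maxContiguous_le (n : ℕ) (ω : Ω) :
    maxContiguous σ M n ω ≤ (iterPieces σ M n ω).ncard := by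
  refine csSup_le' ?_
  rintro k ⟨S, hS, -, rfl⟩
  rw [← ncard_coe_finset]
  exact ncard_le_ncard (hS.trans (sep_subset _ _)) (isBranched_iter σ M n ω).finite

theorem iterAtoms_one (ω : Ω) : iterAtoms σ M 1 ω = (M ω).atoms := by
  rw [iterAtoms_succ, iterAtoms_zero]
  simp [iterT]

theorem survivor_one (ω : Ω) : survivor σ M 1 ω = (M ω).X := by
  rw [survivor_succ, survivor_zero]
  simp [iterT]

theorem iterPieces_one (ω : Ω) : iterPieces σ M 1 ω = (M ω).pieces := by
  rw [iterPieces, iterAtoms_one, survivor_one, WeightedOpenMap.pieces]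

theorem iterT_monotone_of_atom {n : ℕ} {ω : Ω} {Z : Set (Seg α β)} (hZ : Z ∈ iterAtoms σ M n ω)
    {j : ℕ} (hj : j ≤ n) :
    StrictMonoOn (iterT σ M j ω) Z ∨ StrictAntiOn (iterT σ M j ω) Z := by
  obtain ⟨A, hA, rfl⟩ := hZ
  have h : {x | ∀ i < n, iterT σ M i ω x ∈ A i} ⊆ {x | ∀ i < j, iterT σ M i ω x ∈ A i} :=
    fun x hx i hi => hx i (hi.trans_le hj)
  exact ((isMonotonePartition_iter σ M j ω).monotone _
    ⟨A, fun i hi => hA i (hi.trans_le hj), rfl⟩).imp (fun h' => h'.mono h) fun h' => h'.mono h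

theorem iterT_monotone_of_piece {n : ℕ} {ω : Ω} {Z : Set (Seg α β)} (hZ : Z ∈ iterPieces σ M n ω)
    {j : ℕ} (hj : j ≤ n) :
    StrictMonoOn (iterT σ M j ω) Z ∨ StrictAntiOn (iterT σ M j ω) Z := by
  obtain ⟨A, hA, hsub⟩ := (isMonotonePartition_iter σ M n ω).piece_subset hZ
  exact (iterT_monotone_of_atom σ M hA hj).imp (fun h => h.mono (hsub.trans inter_subset_left))
    fun h => h.mono (hsub.trans inter_subset_left)

theorem countable_preimage_iterT (n : ℕ) (ω : Ω) {D : Set (Seg α β)} (hD : D.Countable) :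
    (iterT σ M n ω ⁻¹' D).Countable := by
  have : iterT σ M n ω ⁻¹' D = ⋃ y ∈ D, {x | iterT σ M n ω x = y} := by
    ext x
    exact ⟨fun h => mem_biUnion (show iterT σ M n ω x ∈ D from h) rfl, fun h => by
      obtain ⟨y, hy, hxy⟩ := mem_iUnion₂.1 h
      rw [mem_preimage, show iterT σ M n ω x = y from hxy]
      exact hy⟩
  rw [this]
  exact hD.biUnion fun y _ => ((isMonotonePartition_iter σ M n ω).finite_fiber y).countable

/-! ### The iterated transfer operator -/

variable {f h : Seg α β → ℝ}

theorem isBV_iterL (n : ℕ) (ω : Ω) (hf : IsBV f) : IsBV (iterL σ M n ω f) := by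
  induction n with
  | zero => exact hf
  | succ n ih => exact (M _).isBV_transfer ih

theorem iterL_add_fun (n : ℕ) (ω : Ω) (f h : Seg α β → ℝ) :
    iterL σ M n ω (fun x => f x + h x) = fun y => iterL σ M n ω f y + iterL σ M n ω h y := by
  induction n with
  | zero => rfl
  | succ n ih =>
    simp only [iterL, Function.comp_apply, ih]
    exact (M _).transfer_add _ _

theorem iterL_const_mul (n : ℕ) (ω : Ω) (c : ℝ) (f : Seg α β → ℝ) :
    iterL σ M n ω (fun x => c * f x) = fun y => c * iterL σ M n ω f y := by
  induction n with
  | zero => rfl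
  | succ n ih =>
    simp only [iterL, Function.comp_apply, ih]
    exact (M _).transfer_const_mul _ _

theorem iterL_sub_fun (n : ℕ) (ω : Ω) (f h : Seg α β → ℝ) :
    iterL σ M n ω (fun x => f x - h x) = fun y => iterL σ M n ω f y - iterL σ M n ω h y := by
  have h1 := iterL_add_fun σ M n ω f (fun x => -1 * h x)
  rw [iterL_const_mul] at h1
  simpa only [neg_mul, one_mul, ← sub_eq_add_neg] using h1

theorem iterL_congr (n : ℕ) (ω : Ω) (hf : IsBV f) (hh : IsBV h) (he : f =ᵐ[leb] h) :
    iterL σ M n ω f =ᵐ[leb] iterL σ M n ω h := by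
  induction n with
  | zero => exact he
  | succ n ih => exact (M _).transfer_congr (isBV_iterL σ M n ω hf) (isBV_iterL σ M n ω hh) ih

theorem iterL_mono (n : ℕ) (ω : Ω) (hf : IsBV f) (hh : IsBV h) (he : f ≤ᵐ[leb] h) :
    iterL σ M n ω f ≤ᵐ[leb] iterL σ M n ω h := by
  induction n with
  | zero => exact he
  | succ n ih => exact (M _).transfer_mono (isBV_iterL σ M n ω hf) (isBV_iterL σ M n ω hh) ih

theorem iterL_zero_fun (n : ℕ) (ω : Ω) : iterL σ M n ω (fun _ => 0) = fun _ => 0 := by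
  simpa using iterL_const_mul σ M n ω 0 (fun _ => 0)

theorem iterL_nonneg (n : ℕ) (ω : Ω) (hf : IsBV f) (hf0 : 0 ≤ᵐ[leb] f) :
    0 ≤ᵐ[leb] iterL σ M n ω f := by
  have := iterL_mono σ M n ω (isBV_const 0) hf hf0
  rwa [iterL_zero_fun] at this

theorem iterL_comp_mul (n : ℕ) (ω : Ω) (φ h : Seg α β → ℝ) :
    iterL σ M n ω (fun x => φ (iterT σ M n ω x) * h x) = fun y => φ y * iterL σ M n ω h y := by
  induction n generalizing φ with
  | zero => rfl
  | succ n ih =>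
    simp only [iterL, Function.comp_apply, iterT]
    rw [ih (fun z => φ ((M (σ^[n] ω)).T z))]
    exact (M _).transfer_comp_mul _ _

/-- The surviving fibre of `n + 1` steps is the disjoint union of the `n`-step fibres over the
preimages of `y` outside the hole. Working with fibres avoids matching the partitions of successive
maps. -/
theorem iterL_eq_finsum (n : ℕ) (ω : Ω) : ∃ E : Set (Seg α β), E.Countable ∧
    ∀ (f : Seg α β → ℝ) (y : Seg α β), y ∉ E → iterL σ M n ω f y =
      ∑ᶠ x ∈ {x | x ∈ survivor σ M n ω ∧ iterT σ M n ω x = y}, f x * iterG σ M n ω x := by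
  induction n with
  | zero =>
    refine ⟨∅, countable_empty, fun f y _ => ?_⟩
    have : {x | x ∈ survivor σ M 0 ω ∧ iterT σ M 0 ω x = y} = {y} := by
      ext x
      simp [survivor_zero, iterT]
    rw [this, finsum_mem_singleton]
    simp [iterL, iterG]
  | succ n ih =>
    obtain ⟨E, hE, ih⟩ := ih
    obtain ⟨E', hE', h'⟩ := (M (σ^[n] ω)).transfer_eq_finsum
    refine ⟨E' ∪ (M (σ^[n] ω)).T '' E, hE'.union (hE.image _), fun f y hy => ?_⟩
    simp only [mem_union, not_or] at hy
    rw [iterL, Function.comp_apply, h' _ y hy.1]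
    set I := {z | z ∈ (M (σ^[n] ω)).X ∧ (M (σ^[n] ω)).T z = y} with hI
    have hIfin : I.Finite := ((M (σ^[n] ω)).isMonotonePartition.finite_fiber y).subset
      fun z hz => hz.2
    have hfib : ∀ z, {x | x ∈ survivor σ M n ω ∧ iterT σ M n ω x = z}.Finite := fun z =>
      ((isMonotonePartition_iter σ M n ω).finite_fiber z).subset fun x hx => hx.2
    have h1 : ∀ z ∈ I, iterL σ M n ω f z * (M (σ^[n] ω)).g z =
        ∑ᶠ x ∈ {x | x ∈ survivor σ M n ω ∧ iterT σ M n ω x = z}, f x * iterG σ M (n + 1) ω x := by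
      intro z hz
      rw [ih f z (fun hzE => hy.2 ⟨z, hzE, hz.2⟩), finsum_mem_mul]
      refine finsum_mem_congr rfl fun x hx => ?_
      rw [iterG_succ, hx.2, mul_assoc]
    rw [finsum_mem_congr rfl h1, ← finsum_mem_biUnion _ hIfin fun z _ => hfib z]
    · refine finsum_mem_congr ?_ fun x _ => rfl
      ext x
      simp only [mem_iUnion, exists_prop, survivor_succ, hI, iterT]
      constructor
      · rintro ⟨z, ⟨hz1, hz2⟩, hx1, rfl⟩
        exact ⟨⟨hx1, hz1⟩, hz2⟩
      · rintro ⟨⟨hx1, hx2⟩, hx3⟩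
        exact ⟨_, ⟨hx2, hx3⟩, hx1, rfl⟩
    · intro z _ z' _ hne
      refine Set.disjoint_left.2 fun x hx hx' => hne ?_
      exact hx.2.symm.trans hx'.2

/-- The iterated transfer operator as a sum over branches; the weight and the function may be
modified on countable sets. -/
theorem iterL_ae_eq_sum_branch (n : ℕ) (ω : Ω) {w f' : Seg α β → ℝ}
    (hw : {x | iterG σ M n ω x ≠ w x}.Countable) (hf : {x | f x ≠ f' x}.Countable) :
    iterL σ M n ω f =ᵐ[leb] fun y => ∑ Z ∈ (isBranched_iter σ M n ω).finite.toFinset,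
      branchFn (iterT σ M n ω) w f' Z y := by
  obtain ⟨E, hE, h⟩ := iterL_eq_finsum σ M n ω
  obtain ⟨E', hE', h'⟩ := (isMonotonePartition_iter σ M n ω).exists_countable_sum_branch_eq
  refine ae_of_countable (((hE.union hE').union ((hw.union hf).image (iterT σ M n ω))).mono ?_)
  intro y hy
  by_contra hcon
  simp only [mem_union, not_or] at hcon
  refine hy ((h f y hcon.1.1).trans ((finsum_mem_congr rfl fun x hx => ?_).trans
    (h' w f' y hcon.1.2).symm))
  have h1 : iterG σ M n ω x = w x := by
    by_contra hne
    exact hcon.2 ⟨x, Or.inl hne, hx.2⟩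
  have h2 : f x = f' x := by
    by_contra hne
    exact hcon.2 ⟨x, Or.inr hne, hx.2⟩
  rw [h1, h2]

/-- The product of the canonical representatives of the weights. -/
def repG (n : ℕ) (ω : Ω) (x : Seg α β) : ℝ :=
  ∏ j ∈ Finset.range n, rep (M (σ^[j] ω)).g (iterT σ M j ω x)

theorem countable_iterG_ne_repG (n : ℕ) (ω : Ω) :
    {x | iterG σ M n ω x ≠ repG σ M n ω x}.Countable := by
  have h : ∀ j ∈ Finset.range n, (iterT σ M j ω ⁻¹' {y | (M (σ^[j] ω)).g y ≠
      rep (M (σ^[j] ω)).g y}).Countable := fun j _ =>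
    countable_preimage_iterT σ M j ω ((M _).g_bv.countable_of_ae_eq (isBV_rep (M _).g_bv)
      (rep_ae_eq (M _).g_bv).symm)
  refine ((Finset.range n).countable_toSet.biUnion h).mono fun x hx => ?_
  by_contra hcon
  refine hx (Finset.prod_congr rfl fun j hj => ?_)
  by_contra hne
  exact hcon (mem_biUnion (show j ∈ (Finset.range n : Set ℕ) from hj) hne)

theorem supNorm_g_pos {ω : Ω} (h : 0 < einf (M ω).g) : 0 < supNorm (M ω).g :=
  h.trans_le (M ω).g_bv.einf_le_supNorm

theorem repG_le (n : ℕ) (ω : Ω) (x : Seg α β) :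
    0 ≤ repG σ M n ω x ∧ repG σ M n ω x ≤ normProd σ M n ω := by
  have h0 : ∀ j, 0 ≤ rep (M (σ^[j] ω)).g (iterT σ M j ω x) := fun _ =>
    le_rep (M _).g_bv (Eventually.of_forall fun x => ((M _).g_pos x).le) _
  exact ⟨Finset.prod_nonneg fun j _ => h0 j,
    Finset.prod_le_prod (fun j _ => h0 j) fun _ _ => (M _).g_bv.rep_le_supNorm _⟩

theorem varSum_nonneg (n : ℕ) (ω : Ω) : 0 ≤ varSum σ M n ω :=
  Finset.sum_nonneg fun _ _ => div_nonneg (var_nonneg _) (M _).g_bv.supNorm_nonneg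

theorem normProd_nonneg (n : ℕ) (ω : Ω) : 0 ≤ normProd σ M n ω :=
  Finset.prod_nonneg fun _ _ => (M _).g_bv.supNorm_nonneg

/-- Product rule, one factor at a time. The iterates are monotone on `Z`, so composing a weight with
them does not increase its variation; dividing by the sup norms turns the terms of the product rule
into `varSum`. -/
theorem eVariationOn_repG_le (n : ℕ) (ω : Ω) (hpos : ∀ j < n, 0 < einf (M (σ^[j] ω)).g)
    {Z : Set (Seg α β)} (hZ : ∀ j < n, StrictMonoOn (iterT σ M j ω) Z ∨
      StrictAntiOn (iterT σ M j ω) Z) :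
    eVariationOn (repG σ M n ω) Z ≤ ENNReal.ofReal (normProd σ M n ω * varSum σ M n ω) := by
  induction n with
  | zero =>
    have : eVariationOn (repG σ M 0 ω) Z = 0 :=
      eVariationOn.constant_on (by rintro _ ⟨a, _, rfl⟩ _ ⟨b, _, rfl⟩; simp [repG])
    rw [this]
    exact zero_le
  | succ n ih =>
    have ih' := ih (fun j hj => hpos j (hj.trans (Nat.lt_succ_self n)))
      (fun j hj => hZ j (hj.trans (Nat.lt_succ_self n)))
    have hrep : repG σ M (n + 1) ω = repG σ M n ω *
        fun x => rep (M (σ^[n] ω)).g (iterT σ M n ω x) := by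
      ext x
      exact Finset.prod_range_succ _ _
    have hg0 : ∀ y, 0 ≤ rep (M (σ^[n] ω)).g y := fun y =>
      le_rep (M _).g_bv (Eventually.of_forall fun x => ((M _).g_pos x).le) _
    have hs := supNorm_g_pos M (hpos n (Nat.lt_succ_self n))
    have hv : eVariationOn (fun x => rep (M (σ^[n] ω)).g (iterT σ M n ω x)) Z ≤
        ENNReal.ofReal (var (M (σ^[n] ω)).g) := by
      rw [var, ENNReal.ofReal_toReal (M _).g_bv.eVar_ne_top, eVar_eq_rep (M _).g_bv]
      rcases hZ n (Nat.lt_succ_self n) with h | h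
      · exact eVariationOn.comp_le_of_monotoneOn _ _ h.monotoneOn (mapsTo_univ _ _)
      · exact eVariationOn.comp_le_of_antitoneOn _ _ h.antitoneOn (mapsTo_univ _ _)
    have h1 := eVariation_mul_le (f := repG σ M n ω)
      (g := fun x => rep (M (σ^[n] ω)).g (iterT σ M n ω x)) (s := Z)
      (C := (normProd σ M n ω).toNNReal) (D := (supNorm (M (σ^[n] ω)).g).toNNReal)
      (fun x _ => by
        rw [← ofReal_norm, Real.norm_of_nonneg (repG_le σ M n ω x).1]
        exact ENNReal.ofReal_le_ofReal (repG_le σ M n ω x).2)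
      (fun x _ => by
        rw [← ofReal_norm, Real.norm_of_nonneg (hg0 _)]
        exact ENNReal.ofReal_le_ofReal ((M _).g_bv.rep_le_supNorm _))
    rw [hrep]
    refine h1.trans ?_
    have hN := normProd_nonneg σ M n ω
    have hS := varSum_nonneg σ M n ω
    calc _ ≤ ENNReal.ofReal (normProd σ M n ω) * ENNReal.ofReal (var (M (σ^[n] ω)).g) +
          ENNReal.ofReal (supNorm (M (σ^[n] ω)).g) *
            ENNReal.ofReal (normProd σ M n ω * varSum σ M n ω) := by
          gcongr <;> exact le_rfl
      _ = _ := by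
        rw [← ENNReal.ofReal_mul hN, ← ENNReal.ofReal_mul hs.le,
          ← ENNReal.ofReal_add (mul_nonneg hN (var_nonneg _)) (by positivity)]
        congr 1
        have e1 : normProd σ M (n + 1) ω = normProd σ M n ω * supNorm (M (σ^[n] ω)).g :=
          Finset.prod_range_succ _ _
        have e2 : varSum σ M (n + 1) ω = varSum σ M n ω +
          var (M (σ^[n] ω)).g / supNorm (M (σ^[n] ω)).g := Finset.sum_range_succ _ _
        rw [e1, e2]
        field_simp
        ring

end Iterates

end RandomInterval
end

/-! ### Lasota–Yorke inequalities for the iterated transfer operators. -/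

noncomputable section
namespace RandomInterval
variable {α β : ℝ} [Fact (α < β)]

section Inequalities

variable {Ω : Type*} [MeasurableSpace Ω] (σ : Ω ≃ᵐ Ω) (M : Ω → WeightedOpenMap α β)
variable {f : Seg α β → ℝ}

theorem einf_g_nonneg (ω : Ω) : 0 ≤ einf (M ω).g :=
  (M ω).g_bv.le_einf (Eventually.of_forall fun x => ((M ω).g_pos x).le)

theorem iterG_pos (n : ℕ) (ω : Ω) (x : Seg α β) : 0 < iterG σ M n ω x :=
  Finset.prod_pos fun _ _ => (M _).g_pos _

theorem piece_subset_survivor {n : ℕ} {ω : Ω} {Z : Set (Seg α β)} (hZ : Z ∈ iterPieces σ M n ω) :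
    Z ⊆ survivor σ M n ω := by
  obtain ⟨A, -, hsub⟩ := (isMonotonePartition_iter σ M n ω).piece_subset hZ
  exact hsub.trans inter_subset_right

theorem ae_einfOn_le (n : ℕ) (ω : Ω) :
    ∀ᵐ x ∂(leb.restrict (survivor σ M n ω)),
      einfOn (survivor σ M n ω) (iterG σ M n ω) ≤ iterG σ M n ω x :=
  ae_essInf_le ⟨0, eventually_map.2 (Eventually.of_forall fun x => (iterG_pos σ M n ω x).le)⟩

/-- The survivor set contains a nondegenerate full branch, so the restricted measure is nonzero and
its essential infimum is meaningful. -/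
theorem prod_einf_le_einfOn (n : ℕ) (ω : Ω) :
    ∏ j ∈ Finset.range n, einf (M (σ^[j] ω)).g ≤
      einfOn (survivor σ M n ω) (iterG σ M n ω) := by
  obtain ⟨Z, hZ, -⟩ := exists_full σ M n ω
  have hne : (ae (leb.restrict (survivor σ M n ω))).NeBot := by
    rw [ae_restrict_neBot]
    intro h0
    exact not_subsingleton_iff.2 ((isBranched_iter σ M n ω).nontrivial Z hZ)
      (subsingleton_of_leb_eq_zero ((isBranched_iter σ M n ω).ordConnected Z hZ)
        (measure_mono_null (piece_subset_survivor σ M hZ) h0))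
  have hK : ∃ K, ∀ x, iterG σ M n ω x ≤ K := by
    choose K hK hK' using fun j => (M (σ^[j] ω)).g_bv.bounded
    exact ⟨∏ j ∈ Finset.range n, K j, fun x => Finset.prod_le_prod (fun j _ => ((M _).g_pos _).le)
      fun j _ => (abs_le.1 (hK' j _)).2⟩
  obtain ⟨K, hK⟩ := hK
  refine le_essInf_of_ae_le _ (ae_restrict_of_ae ?_) (IsBoundedUnder.isCoboundedUnder_ge
    ⟨K, eventually_map.2 (Eventually.of_forall hK)⟩)
  refine ae_of_countable ((countable_iterG_ne_repG σ M n ω).mono fun x hx => ?_)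
  by_contra hcon
  refine hx ?_
  have : iterG σ M n ω x = repG σ M n ω x := not_not.1 hcon
  rw [this]
  exact Finset.prod_le_prod (fun j _ => einf_g_nonneg M _) fun j _ => (M _).g_bv.einf_le_rep _

theorem einfOn_pos (n : ℕ) (ω : Ω) (hpos : ∀ j < n, 0 < einf (M (σ^[j] ω)).g) :
    0 < einfOn (survivor σ M n ω) (iterG σ M n ω) :=
  (Finset.prod_pos fun j hj => hpos j (Finset.mem_range.1 hj)).trans_le (prod_einf_le_einfOn σ M n ω)

theorem boundedVariationOn_repG {n : ℕ} {ω : Ω} (hpos : ∀ j < n, 0 < einf (M (σ^[j] ω)).g)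
    {Z : Set (Seg α β)} (hZ : Z ∈ iterPieces σ M n ω) :
    eVariationOn (repG σ M n ω) Z ≤ ENNReal.ofReal (normProd σ M n ω * varSum σ M n ω) :=
  eVariationOn_repG_le σ M n ω hpos fun _ hj => iterT_monotone_of_piece σ M hZ hj.le

theorem countable_repG_lt {n : ℕ} {ω : Ω} (hpos : ∀ j < n, 0 < einf (M (σ^[j] ω)).g)
    {Z : Set (Seg α β)} (hZ : Z ∈ iterPieces σ M n ω) :
    {x ∈ Z | repG σ M n ω x < einfOn (survivor σ M n ω) (iterG σ M n ω)}.Countable := by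
  have hb := isBranched_iter σ M n ω
  refine countable_lt_of_ae_le (hb.ordConnected Z hZ) (hb.nontrivial Z hZ)
    ((boundedVariationOn_repG σ M hpos hZ).trans_lt ENNReal.ofReal_lt_top).ne ?_
  have h1 := ae_restrict_of_ae_restrict_of_subset (piece_subset_survivor σ M hZ)
    (ae_einfOn_le σ M n ω)
  rw [ae_restrict_iff' (hb.ordConnected Z hZ).measurableSet] at h1
  filter_upwards [h1, ae_of_countable (countable_iterG_ne_repG σ M n ω)] with x hx hx' hxZ
  rw [← hx']
  exact hx hxZ

theorem einfOn_le_normProd (n : ℕ) (ω : Ω) (hpos : ∀ j < n, 0 < einf (M (σ^[j] ω)).g) :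
    einfOn (survivor σ M n ω) (iterG σ M n ω) ≤ normProd σ M n ω := by
  obtain ⟨Z, hZ, -⟩ := exists_full σ M n ω
  have hb := isBranched_iter σ M n ω
  obtain ⟨x, hx, hx'⟩ : ∃ x ∈ Z, ¬ repG σ M n ω x <
      einfOn (survivor σ M n ω) (iterG σ M n ω) := by
    by_contra hcon
    push Not at hcon
    have hc := (countable_repG_lt σ M hpos hZ).mono
      (show Z ⊆ {x ∈ Z | _} from fun x hx => ⟨hx, hcon x hx⟩)
    exact not_subsingleton_iff.2 (hb.nontrivial Z hZ) (subsingleton_of_leb_eq_zero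
      (hb.ordConnected Z hZ) (hc.measure_zero _))
  exact (not_lt.1 hx').trans (repG_le σ M n ω x).2

theorem three_le_coeffD (n : ℕ) (ω : Ω) (hpos : ∀ j < n, 0 < einf (M (σ^[j] ω)).g) :
    3 ≤ coeffD σ M n ω := by
  have h1 := varSum_nonneg σ M n ω
  have h2 : 1 ≤ normProd σ M n ω / einfOn (survivor σ M n ω) (iterG σ M n ω) :=
    (one_le_div (einfOn_pos σ M n ω hpos)).2 (einfOn_le_normProd σ M n ω hpos)
  have h3 : (0 : ℝ) ≤ maxContiguous σ M n ω := Nat.cast_nonneg _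
  rw [coeffD]
  calc (3 : ℝ) = 3 * 1 * 1 := by norm_num
    _ ≤ _ := by gcongr <;> linarith

theorem coeffC_pos (n : ℕ) (ω : Ω) (hpos : ∀ j < n, 0 < einf (M (σ^[j] ω)).g) :
    0 < coeffC σ M n ω :=
  div_pos (by linarith [three_le_coeffD σ M n ω hpos])
    (Nat.cast_pos.2 (one_le_numFull σ M n ω))

open Classical in
theorem card_full (n : ℕ) (ω : Ω) :
    ((isBranched_iter σ M n ω).finite.toFinset.filter fun Z => IsFull (iterT σ M n ω) Z).card =
      numFull σ M n ω := by
  rw [numFull, ← ncard_coe_finset]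
  congr 1
  ext Z
  simp [fullPieces]

theorem iterL_ae_eq_rep (n : ℕ) (ω : Ω) (hf : IsBV f) :
    iterL σ M n ω f =ᵐ[leb] fun y => ∑ Z ∈ (isBranched_iter σ M n ω).finite.toFinset,
      branchFn (iterT σ M n ω) (repG σ M n ω) (rep f) Z y :=
  iterL_ae_eq_sum_branch σ M n ω (countable_iterG_ne_repG σ M n ω)
    (hf.countable_of_ae_eq (isBV_rep hf) (rep_ae_eq hf).symm)

open Classical in
theorem sum_le_einf_iterL {n : ℕ} {ω : Ω} (hpos : ∀ j < n, 0 < einf (M (σ^[j] ω)).g)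
    (hf : IsBV f) (hf0 : 0 ≤ᵐ[leb] f) {i : Set (Seg α β) → ℝ}
    (hi : ∀ Z ∈ iterPieces σ M n ω, IsFull (iterT σ M n ω) Z → ∀ x ∈ Z, i Z ≤ rep f x) :
    einfOn (survivor σ M n ω) (iterG σ M n ω) *
      ∑ Z ∈ (isBranched_iter σ M n ω).finite.toFinset.filter
        (fun Z => IsFull (iterT σ M n ω) Z), i Z ≤ einf (iterL σ M n ω f) := by
  refine (isBV_iterL σ M n ω hf).le_einf ?_
  filter_upwards [iterL_ae_eq_rep σ M n ω hf, (isBranched_iter σ M n ω).ae_le_sum_branch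
    (w := repG σ M n ω) (f := rep f) (fun Z _ x _ => (repG_le σ M n ω x).1)
    (einfOn_pos σ M n ω hpos).le (fun Z hZ _ => countable_repG_lt σ M hpos hZ)
    (le_rep hf hf0) hi] with y h1 h2
  rwa [h1]

theorem mul_einf_le_einf_iterL {n : ℕ} {ω : Ω} (hpos : ∀ j < n, 0 < einf (M (σ^[j] ω)).g)
    (hf : IsBV f) (hf0 : 0 ≤ᵐ[leb] f) :
    einfOn (survivor σ M n ω) (iterG σ M n ω) * numFull σ M n ω * einf f ≤
      einf (iterL σ M n ω f) := by
  classical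
  have := sum_le_einf_iterL σ M hpos hf hf0 (i := fun _ => einf f)
    fun Z _ _ x _ => hf.einf_le_rep x
  rwa [Finset.sum_const, card_full, nsmul_eq_mul, ← mul_assoc] at this

/-- The branchwise variation bound samples `f` once on every full branch. Sampling near the infimum
on the branch makes the sum of samples comparable with the lower bound for the infimum of the image,
so the samples disappear into the second term. -/
theorem var_iterL_le {n : ℕ} {ω : Ω} (hpos : ∀ j < n, 0 < einf (M (σ^[j] ω)).g)
    (hf : IsBV f) (hf0 : 0 ≤ᵐ[leb] f) :
    var (iterL σ M n ω f) ≤ normProd σ M n ω * ((3 + 3 * varSum σ M n ω) *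
      (1 + 2 * (maxContiguous σ M n ω : ℝ))) * var f +
        coeffD σ M n ω * einf (iterL σ M n ω f) := by
  classical
  have hb := isBranched_iter σ M n ω
  have hS := varSum_nonneg σ M n ω
  have hN := normProd_nonneg σ M n ω
  have he := einfOn_pos σ M n ω hpos
  set A := (3 + 3 * varSum σ M n ω) * (1 + 2 * (maxContiguous σ M n ω : ℝ)) with hA
  have hA0 : 0 ≤ A := by positivity
  have hr0 : ∀ x, 0 ≤ rep f x := le_rep hf hf0
  set F := hb.finite.toFinset.filter (fun Z => IsFull (iterT σ M n ω) Z) with hF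
  set i : Set (Seg α β) → ℝ := fun Z => sInf (rep f '' Z) with hi
  have hbdd : ∀ Z, BddBelow (rep f '' Z) := fun Z => ⟨0, by
    rintro _ ⟨x, _, rfl⟩
    exact hr0 x⟩
  have hlow := sum_le_einf_iterL σ M hpos hf hf0 (i := i)
    fun Z _ _ x hx => csInf_le (hbdd Z) (mem_image_of_mem _ hx)
  refine le_of_forall_pos_le_add fun ε hε => ?_
  -- The infimum on a branch need not be attained. With this `δ`, near-minimizers change the final
  -- estimate by at most `ε`.
  set δ := ε / (normProd σ M n ω * A * F.card + 1) with hδ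
  have hδ0 : 0 < δ := by positivity
  have hp : ∀ Z : Set (Seg α β), ∃ x, (Z.Nonempty → x ∈ Z ∧ rep f x ≤ i Z + δ) := by
    intro Z
    rcases Z.eq_empty_or_nonempty with h | h
    · exact ⟨lo α β, fun h' => absurd h h'.ne_empty⟩
    · obtain ⟨_, ⟨x, hx, rfl⟩, hlt⟩ := Real.lt_sInf_add_pos (h.image (rep f)) hδ0
      exact ⟨x, fun _ => ⟨hx, hlt.le⟩⟩
  choose p hp using hp
  have hup := hb.eVar_sum_branch_le (w := repG σ M n ω) (f := rep f) (ξ := maxContiguous σ M n ω)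
    (fun Z _ x _ => (repG_le σ M n ω x).1) (fun Z _ x _ => (repG_le σ M n ω x).2)
    (fun Z hZ => boundedVariationOn_repG σ M hpos hZ) hN hS (exists_full σ M n ω)
    (fun Q hQ hQ' => card_le_maxContiguous σ M n ω Q hQ hQ') (isBV_rep hf) hr0 (p := p)
    (fun Z hZ _ => (hp Z (hb.nontrivial Z hZ).nonempty).1)
  rw [← eVar_congr (iterL_ae_eq_rep σ M n ω hf)] at hup
  have hsum : ∑ Z ∈ F, rep f (p Z) ≤ ∑ Z ∈ F, i Z + F.card * δ := by
    rw [← nsmul_eq_mul, ← Finset.sum_const, ← Finset.sum_add_distrib]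
    refine Finset.sum_le_sum fun Z hZ => ?_
    exact (hp Z (hb.nontrivial Z (by simpa using (Finset.mem_filter.1 hZ).1)).nonempty).2
  have hnn : 0 ≤ ∑ Z ∈ F, rep f (p Z) := Finset.sum_nonneg fun Z _ => hr0 _
  have hvar : var (iterL σ M n ω f) ≤ normProd σ M n ω * A *
      (var f + ∑ Z ∈ F, rep f (p Z)) := by
    have := ENNReal.toReal_le_of_le_ofReal (by positivity) hup
    rwa [← eVar_eq_rep hf] at this
  have hd : coeffD σ M n ω * einf (iterL σ M n ω f) ≥ normProd σ M n ω * A * ∑ Z ∈ F, i Z := by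
    have : coeffD σ M n ω = normProd σ M n ω * A /
        einfOn (survivor σ M n ω) (iterG σ M n ω) := by
      rw [coeffD, ← hA]
      ring
    rw [this, div_mul_eq_mul_div, ge_iff_le, le_div_iff₀ he, mul_assoc, mul_comm (∑ Z ∈ F, i Z)]
    exact mul_le_mul_of_nonneg_left hlow (mul_nonneg hN hA0)
  have hδε : normProd σ M n ω * A * (F.card * δ) ≤ ε := by
    rw [hδ, ← mul_assoc, mul_div_assoc', div_le_iff₀ (by positivity)]
    nlinarith
  calc _ ≤ normProd σ M n ω * A * (var f + ∑ Z ∈ F, rep f (p Z)) := hvar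
    _ ≤ normProd σ M n ω * A * (var f + (∑ Z ∈ F, i Z + F.card * δ)) := by gcongr
    _ = normProd σ M n ω * A * var f + normProd σ M n ω * A * ∑ Z ∈ F, i Z +
        normProd σ M n ω * A * (F.card * δ) := by ring
    _ ≤ _ := by linarith

/-- The Lasota-Yorke inequality on cones. -/
theorem var_iterL_le_of_var_le {n : ℕ} {ω : Ω} (hpos : ∀ j < n, 0 < einf (M (σ^[j] ω)).g)
    (hf : IsBV f) (hf0 : 0 ≤ᵐ[leb] f) {a : ℝ} (ha : 0 ≤ a) (hv : var f ≤ a * einf f) :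
    var (iterL σ M n ω f) ≤ (coeffC σ M n ω * a + coeffD σ M n ω) * einf (iterL σ M n ω f) := by
  have h1 := var_iterL_le σ M hpos hf hf0
  have h2 := mul_einf_le_einf_iterL σ M hpos hf hf0
  have hS := varSum_nonneg σ M n ω
  have hN := normProd_nonneg σ M n ω
  have he := einfOn_pos σ M n ω hpos
  have hb : (0 : ℝ) < numFull σ M n ω := Nat.cast_pos.2 (one_le_numFull σ M n ω)
  set A := (3 + 3 * varSum σ M n ω) * (1 + 2 * (maxContiguous σ M n ω : ℝ)) with hA
  have hA0 : 0 ≤ A := by positivity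
  set e := einfOn (survivor σ M n ω) (iterG σ M n ω)
  set b := (numFull σ M n ω : ℝ)
  have h3 : coeffC σ M n ω = normProd σ M n ω * A / (e * b) := by
    rw [coeffC, coeffD]
    change A * (normProd σ M n ω / e) / b = _
    field_simp
  -- The `b` full branches together enlarge the infimum at least by the factor `e * b`; this
  -- division by `b` is what turns `coeffD` into `coeffC`.
  have h4 : einf f ≤ einf (iterL σ M n ω f) / (e * b) := by
    rw [le_div_iff₀ (by positivity)]
    linarith
  calc _ ≤ normProd σ M n ω * A * (a * einf f) + coeffD σ M n ω * einf (iterL σ M n ω f) :=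
        h1.trans (by gcongr)
    _ ≤ normProd σ M n ω * A * (a * (einf (iterL σ M n ω f) / (e * b))) +
        coeffD σ M n ω * einf (iterL σ M n ω f) := by gcongr
    _ = _ := by
      rw [h3]
      ring

/-! ### Bounds for the transfer operators -/

theorem einf_g_mul_le_einf_transfer {ω : Ω} (hf : IsBV f) (hf0 : 0 ≤ᵐ[leb] f)
    (hpos : 0 < einf (M ω).g) : einf (M ω).g * einf f ≤ einf ((M ω).transfer f) := by
  -- A single step does not involve the base dynamics, so the identity can stand in for `σ`.
  have hpos' : ∀ j < 1, 0 < einf (M ((MeasurableEquiv.refl Ω)^[j] ω)).g := by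
    intro j hj
    obtain rfl : j = 0 := by omega
    exact hpos
  have h1 := mul_einf_le_einf_iterL (MeasurableEquiv.refl Ω) M hpos' hf hf0
  have h2 := prod_einf_le_einfOn (MeasurableEquiv.refl Ω) M 1 ω
  rw [Finset.prod_range_one] at h2
  have h3 : (1 : ℝ) ≤ numFull (MeasurableEquiv.refl Ω) M 1 ω :=
    mod_cast one_le_numFull (MeasurableEquiv.refl Ω) M 1 ω
  have h4 : 0 ≤ einf f := hf.le_einf hf0
  refine le_trans (mul_le_mul_of_nonneg_right ?_ h4) h1
  calc einf (M ω).g = einf (M ω).g * 1 := (mul_one _).symm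
    _ ≤ _ := mul_le_mul h2 h3 zero_le_one (hpos.le.trans h2)

theorem ae_iterL_one_le (n : ℕ) (ω : Ω) : ∀ᵐ y ∂(leb : Measure (Seg α β)),
    iterL σ M n ω 1 y ≤ (iterPieces σ M n ω).ncard * normProd σ M n ω := by
  filter_upwards [iterL_ae_eq_rep σ M n ω isBV_one] with y hy
  rw [hy, ncard_eq_toFinset_card _ (isBranched_iter σ M n ω).finite, ← nsmul_eq_mul,
    ← Finset.sum_const]
  refine Finset.sum_le_sum fun Z hZ => ?_
  unfold branchFn
  split_ifs
  · rw [show rep (1 : Seg α β → ℝ) = fun _ => 1 from funext fun x => rep_const 1 x, one_mul]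
    exact (repG_le σ M n ω _).2
  · exact normProd_nonneg σ M n ω

/-- A function supported in one element of the partition. -/
theorem ae_iterL_indicator_le (n : ℕ) (ω : Ω) {Z J : Set (Seg α β)} (hZ : Z ∈ iterAtoms σ M n ω)
    (hJ : J ⊆ Z) : ∀ᵐ y ∂(leb : Measure (Seg α β)),
      iterL σ M n ω (J.indicator fun _ => 1) y ≤ normProd σ M n ω := by
  obtain ⟨E, hE, h⟩ := iterL_eq_finsum σ M n ω
  refine ae_of_countable ((hE.union ((countable_iterG_ne_repG σ M n ω).image
    (iterT σ M n ω))).mono fun y hy => ?_)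
  by_contra hcon
  simp only [mem_union, not_or] at hcon
  refine hy ?_
  rw [h _ y hcon.1]
  have hinj := (isMonotonePartition_iter σ M n ω).injOn hZ
  have hfin : {x | x ∈ survivor σ M n ω ∧ iterT σ M n ω x = y}.Finite :=
    ((isMonotonePartition_iter σ M n ω).finite_fiber y).subset fun x hx => hx.2
  rw [finsum_mem_eq_finite_toFinset_sum _ hfin]
  have hmem : ∀ x, x ∈ hfin.toFinset ↔ x ∈ survivor σ M n ω ∧ iterT σ M n ω x = y := fun x =>
    Set.Finite.mem_toFinset hfin
  by_cases hx : ∃ x ∈ J, x ∈ hfin.toFinset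
  · obtain ⟨x, hxJ, hx⟩ := hx
    rw [Finset.sum_eq_single_of_mem x hx]
    · rw [indicator_of_mem hxJ, one_mul]
      have : iterG σ M n ω x = repG σ M n ω x := by
        by_contra hne
        exact hcon.2 ⟨x, hne, ((hmem x).1 hx).2⟩
      rw [this]
      exact (repG_le σ M n ω x).2
    · intro x' hx' hne
      rw [indicator_of_notMem, zero_mul]
      intro hx'J
      exact hne (hinj (hJ hx'J) (hJ hxJ) (((hmem x').1 hx').2.trans ((hmem x).1 hx).2.symm))
  · push Not at hx
    rw [Finset.sum_eq_zero fun x hx' => ?_]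
    · exact normProd_nonneg σ M n ω
    · rw [indicator_of_notMem fun hxJ => hx x hxJ hx', zero_mul]

end Inequalities

end RandomInterval
end

noncomputable section
namespace RandomInterval
variable {α β : ℝ} [Fact (α < β)]

/-! ### Cones -/

/-- The cone of aperture `a` together with the null functions. -/
def cone0 (a : ℝ) : Set (Seg α β → ℝ) := {f | IsBV f ∧ var f ≤ a * einf f}

section Cones

variable {a : ℝ} {f h : Seg α β → ℝ}

theorem einf_nonneg_of_mem_cone0 (ha : 0 < a) (hf : f ∈ (cone0 a : Set (Seg α β → ℝ))) :
    0 ≤ einf f :=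
  nonneg_of_mul_nonneg_right ((var_nonneg f).trans hf.2) ha

theorem ae_nonneg_of_mem_cone0 (ha : 0 < a) (hf : f ∈ (cone0 a : Set (Seg α β → ℝ))) :
    0 ≤ᵐ[leb] f := by
  filter_upwards [hf.1.ae_einf_le] with x hx using (einf_nonneg_of_mem_cone0 ha hf).trans hx

theorem cone0_mono {a' : ℝ} (ha : 0 < a) (h : a ≤ a') :
    (cone0 a : Set (Seg α β → ℝ)) ⊆ cone0 a' := fun _ hf =>
  ⟨hf.1, hf.2.trans (mul_le_mul_of_nonneg_right h (einf_nonneg_of_mem_cone0 ha hf))⟩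

theorem cone0_congr (hf : f ∈ (cone0 a : Set (Seg α β → ℝ))) (hh : IsBV h) (he : f =ᵐ[leb] h) :
    h ∈ (cone0 a : Set (Seg α β → ℝ)) :=
  ⟨hh, by rw [← var_congr he, ← einf_congr he]; exact hf.2⟩

theorem cone0_add (ha : 0 < a) (hf : f ∈ (cone0 a : Set (Seg α β → ℝ)))
    (hh : h ∈ (cone0 a : Set (Seg α β → ℝ))) :
    (fun x => f x + h x) ∈ (cone0 a : Set (Seg α β → ℝ)) := by
  refine ⟨hf.1.add hh.1, ?_⟩
  have h1 := var_add_le hf.1 hh.1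
  have h2 := mul_le_mul_of_nonneg_left (hf.1.einf_add_le hh.1) ha.le
  have := hf.2
  have := hh.2
  linarith

theorem cone0_const_mul {c : ℝ} (hc : 0 ≤ c) (hf : f ∈ (cone0 a : Set (Seg α β → ℝ))) :
    (fun x => c * f x) ∈ (cone0 a : Set (Seg α β → ℝ)) := by
  refine ⟨hf.1.const_mul c, ?_⟩
  rw [hf.1.einf_const_mul hc]
  have h1 := var_const_mul_le c hf.1
  rw [abs_of_nonneg hc] at h1
  have := mul_le_mul_of_nonneg_left hf.2 hc
  linarith

theorem const_mem_cone0 (ha : 0 < a) {c : ℝ} (hc : 0 ≤ c) :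
    (fun _ => c) ∈ (cone0 a : Set (Seg α β → ℝ)) :=
  ⟨isBV_const c, by rw [var_const, einf_const]; positivity⟩

theorem ae_eq_zero_of_mem_cone0 (hf : f ∈ (cone0 a : Set (Seg α β → ℝ))) (h0 : einf f = 0) :
    f =ᵐ[leb] fun _ => 0 := by
  have hv : var f = 0 := le_antisymm (by simpa [h0] using hf.2) (var_nonneg f)
  filter_upwards [hf.1.ae_einf_le, hf.1.ae_le_einf_add_var] with x h1 h2
  rw [h0] at h1 h2
  linarith

theorem cone_subset_cone0 : (cone a : Set (Seg α β → ℝ)) ⊆ cone0 a := fun _ hf => ⟨hf.1, hf.2.2⟩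

theorem einf_pos_of_mem_cone (ha : 0 < a) (hf : f ∈ (cone a : Set (Seg α β → ℝ))) :
    0 < einf f := by
  refine lt_of_le_of_ne (einf_nonneg_of_mem_cone0 ha (cone_subset_cone0 hf)) fun h0 => ?_
  obtain ⟨x, h1, h2⟩ :=
    ((ae_eq_zero_of_mem_cone0 (cone_subset_cone0 hf) h0.symm).and hf.2.1).exists
  exact h2.ne' h1

theorem mem_cone_of_einf_pos (hf : f ∈ (cone0 a : Set (Seg α β → ℝ))) (h0 : 0 < einf f) :
    f ∈ (cone a : Set (Seg α β → ℝ)) :=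
  ⟨hf.1, by filter_upwards [hf.1.ae_einf_le] with x hx using h0.trans_le hx, hf.2⟩

/-- An element of `cone0 a` with zero infimum has zero variation, hence is null. Admitting null
functions therefore absorbs the alternative of almost everywhere equality in the order. -/
theorem coneLE_iff (ha : 0 < a) (hf : IsBV f) (hh : IsBV h) :
    coneLE a f h ↔ (fun x => h x - f x) ∈ (cone0 a : Set (Seg α β → ℝ)) := by
  constructor
  · rintro (h1 | h1)
    · exact cone_subset_cone0 h1
    · refine cone0_congr (const_mem_cone0 ha le_rfl) (hh.sub hf) ?_
      filter_upwards [h1] with x hx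
      rw [hx, sub_self]
  · intro h1
    rcases (einf_nonneg_of_mem_cone0 ha h1).eq_or_lt with h0 | h0
    · right
      filter_upwards [ae_eq_zero_of_mem_cone0 h1 h0.symm] with x hx
      linarith
    · exact Or.inl (mem_cone_of_einf_pos h1 h0)

/-- `l f ≼ h ≼ u f` for the order of the cone of aperture `a`. -/
def Sand (a l u : ℝ) (f h : Seg α β → ℝ) : Prop :=
  (fun x => h x - l * f x) ∈ (cone0 a : Set (Seg α β → ℝ)) ∧
    (fun x => u * f x - h x) ∈ (cone0 a : Set (Seg α β → ℝ))

theorem Sand.weaken {l l' u u' : ℝ} (ha : 0 < a) (hf : f ∈ (cone0 a : Set (Seg α β → ℝ)))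
    (h1 : Sand a l u f h) (hl : l' ≤ l) (hu : u ≤ u') : Sand a l' u' f h := by
  constructor
  · have := cone0_add ha h1.1 (cone0_const_mul (sub_nonneg.2 hl) hf)
    convert this using 2
    ring
  · have := cone0_add ha h1.2 (cone0_const_mul (sub_nonneg.2 hu) hf)
    convert this using 2
    ring

theorem Sand.ae_le {l u : ℝ} (ha : 0 < a) (h1 : Sand a l u f h) :
    ∀ᵐ x ∂(leb : Measure (Seg α β)), l * f x ≤ h x ∧ h x ≤ u * f x := by
  filter_upwards [ae_nonneg_of_mem_cone0 ha h1.1, ae_nonneg_of_mem_cone0 ha h1.2] with x h2 h3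
  simp only [Pi.zero_apply] at h2 h3
  constructor <;> linarith

theorem Sand.le {l u : ℝ} (ha : 0 < a) (hf : IsBV f) (hf0 : 0 < einf f) (h1 : Sand a l u f h) :
    l ≤ u := by
  obtain ⟨x, h2, h3⟩ := ((h1.ae_le ha).and hf.ae_einf_le).exists
  exact le_of_mul_le_mul_right (h2.1.trans h2.2) (hf0.trans_le h3)

/-- Two functions that are sandwiched between constants are comparable. -/
theorem comparable_of_sand_one {s t A B : ℝ} (ha : 0 < a) (hs : 0 ≤ s) (ht : 0 ≤ t) (hA : 0 ≤ A)
    (hB : 0 ≤ B) (hf : Sand a (s * A) (t * A) 1 f) (hh : Sand a (s * B) (t * B) 1 h) :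
    (fun x => t * B * f x - s * A * h x) ∈ (cone0 a : Set (Seg α β → ℝ)) := by
  have := cone0_add ha (cone0_const_mul (mul_nonneg ht hB) hf.1)
    (cone0_const_mul (mul_nonneg hs hA) hh.2)
  convert this using 2
  simp only [Pi.one_apply]
  ring

/-- Functions of the smaller cone are comparable to constants. -/
theorem sand_one_of_mem_cone0 {γ : ℝ} (ha : 0 < a)
    (hf : f ∈ (cone0 (γ * a) : Set (Seg α β → ℝ))) :
    Sand a ((1 - γ) * einf f) ((1 + γ * (a + 1)) * einf f) 1 f := by
  have hv := hf.2
  constructor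
  · refine ⟨hf.1.sub (isBV_one.const_mul _), ?_⟩
    have h1 : var (fun x => f x - (1 - γ) * einf f * (1 : Seg α β → ℝ) x) ≤ var f := by
      simpa [sub_eq_add_neg] using var_add_const_le hf.1 (-((1 - γ) * einf f))
    have h2 : γ * einf f ≤ einf (fun x => f x - (1 - γ) * einf f * (1 : Seg α β → ℝ) x) := by
      refine (hf.1.sub (isBV_one.const_mul _)).le_einf ?_
      filter_upwards [hf.1.ae_einf_le] with x hx
      simp only [Pi.one_apply]
      linarith
    nlinarith [mul_le_mul_of_nonneg_left h2 ha.le]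
  · refine ⟨(isBV_one.const_mul _).sub hf.1, ?_⟩
    have h1 : var (fun x => (1 + γ * (a + 1)) * einf f * (1 : Seg α β → ℝ) x - f x) ≤ var f := by
      have h3 := var_add_const_le (hf.1.const_mul (-1)) ((1 + γ * (a + 1)) * einf f)
      have h4 := var_const_mul_le (-1) hf.1
      simp only [neg_mul, one_mul, abs_neg, abs_one] at h3 h4
      refine le_trans (le_of_eq ?_) (h3.trans h4)
      congr 1
      ext x
      simp only [Pi.one_apply]
      ring
    -- The essential supremum of `f` is at most `(1 + γ * a) * einf f`, so this constant leaves room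
    -- `γ * einf f`, just what a variation of at most `γ * a * einf f` requires. The lower constant
    -- `(1 - γ) * einf f` is chosen by the same rule.
    have h2 : γ * einf f ≤
        einf (fun x => (1 + γ * (a + 1)) * einf f * (1 : Seg α β → ℝ) x - f x) := by
      refine ((isBV_one.const_mul _).sub hf.1).le_einf ?_
      filter_upwards [hf.1.ae_le_einf_add_var] with x hx
      simp only [Pi.one_apply]
      linarith
    nlinarith [mul_le_mul_of_nonneg_left h2 ha.le]

/-- The diameter bound: members of the smaller cone are comparable. -/
theorem exists_sand_of_mem_cone0 {γ : ℝ} (ha : 0 < a) (hγ : 0 < γ) (hγ1 : γ < 1)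
    (hf : f ∈ (cone0 (γ * a) : Set (Seg α β → ℝ))) (hh : h ∈ (cone0 (γ * a) : Set (Seg α β → ℝ)))
    (hf0 : 0 < einf f) (hh0 : 0 < einf h) :
    ∃ l u, 0 < l ∧ l ≤ u ∧ Sand a l u f h ∧
      Real.log (u / l) ≤ 2 * Real.log ((1 + γ * (a + 1)) / (1 - γ)) := by
  have hs : 0 < 1 - γ := by linarith
  have ht : 0 < 1 + γ * (a + 1) := by positivity
  have h1 := sand_one_of_mem_cone0 ha hf
  have h2 := sand_one_of_mem_cone0 ha hh
  have hs1 := comparable_of_sand_one ha hs.le ht.le hh0.le hf0.le h2 h1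
  have hs2 := comparable_of_sand_one ha hs.le ht.le hf0.le hh0.le h1 h2
  set s := 1 - γ
  set t := 1 + γ * (a + 1)
  have hsand : Sand a (s * einf h / (t * einf f)) (t * einf h / (s * einf f)) f h := by
    constructor
    · have := cone0_const_mul (c := (t * einf f)⁻¹) (by positivity) hs1
      convert this using 2
      field_simp
    · have := cone0_const_mul (c := (s * einf f)⁻¹) (by positivity) hs2
      convert this using 2
      field_simp
  refine ⟨_, _, by positivity, hsand.le ha hf.1 hf0, hsand, le_of_eq ?_⟩
  rw [← Real.log_rpow (by positivity), Real.rpow_two]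
  congr 1
  field_simp

/-- The scalar core of Birkhoff's theorem. Both sides vanish at `R = 1`, and comparing their
derivatives at `x` comes down to `(A * x - B) ^ 2 ≥ 0`. -/
theorem log_ratio_le {s t A B R : ℝ} (hs : 0 < s) (hst : s ≤ t) (hA : 0 ≤ A) (hB : 0 ≤ B)
    (hAB : 0 < A + B) (hR : 1 ≤ R) :
    Real.log (t * A * R + s * B) - Real.log (t * B + s * A * R) -
      (Real.log (t * A + s * B) - Real.log (t * B + s * A)) ≤ (t - s) / (t + s) * Real.log R := by
  have ht : 0 < t := hs.trans_le hst
  have hpos1 : ∀ x : ℝ, 0 < x → 0 < t * A * x + s * B := fun x hx => by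
    rcases hA.eq_or_lt with h | h
    · rw [← h] at hAB ⊢
      have : 0 < B := by linarith
      simp only [mul_zero, zero_mul, zero_add]
      positivity
    · positivity
  have hpos2 : ∀ x : ℝ, 0 < x → 0 < t * B + s * A * x := fun x hx => by
    rcases hB.eq_or_lt with h | h
    · rw [← h] at hAB ⊢
      have : 0 < A := by linarith
      simp only [mul_zero, zero_add]
      positivity
    · positivity
  set ψ : ℝ → ℝ := fun x => (t - s) / (t + s) * Real.log x -
    (Real.log (t * A * x + s * B) - Real.log (t * B + s * A * x)) with hψ
  have hderiv : ∀ x : ℝ, 0 < x → HasDerivAt ψ ((t - s) / (t + s) * x⁻¹ -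
      (t * A / (t * A * x + s * B) - s * A / (t * B + s * A * x))) x := by
    intro x hx
    have h1 : HasDerivAt (fun x => t * A * x + s * B) (t * A) x := by
      simpa using ((hasDerivAt_id x).const_mul (t * A)).add_const (s * B)
    have h2 : HasDerivAt (fun x => t * B + s * A * x) (s * A) x := by
      simpa using ((hasDerivAt_id x).const_mul (s * A)).const_add (t * B)
    exact ((Real.hasDerivAt_log hx.ne').const_mul _).sub
      ((h1.log (hpos1 x hx).ne').sub (h2.log (hpos2 x hx).ne'))
  have hmono : MonotoneOn ψ (Ici 1) := by
    refine monotoneOn_of_deriv_nonneg (convex_Ici 1) (fun x hx => ?_) (fun x hx => ?_)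
      fun x hx => ?_
    · exact (hderiv x (zero_lt_one.trans_le hx)).continuousAt.continuousWithinAt
    · rw [interior_Ici] at hx
      exact (hderiv x (zero_lt_one.trans hx)).differentiableAt.differentiableWithinAt
    · rw [interior_Ici] at hx
      have hx0 : 0 < x := zero_lt_one.trans hx
      rw [(hderiv x hx0).deriv, sub_nonneg]
      have e1 := hpos1 x hx0
      have e2 := hpos2 x hx0
      rw [div_sub_div _ _ e1.ne' e2.ne', ← div_eq_mul_inv, div_div,
        div_le_div_iff₀ (by positivity) (by positivity)]
      have h3 : t * A * (t * B + s * A * x) - (t * A * x + s * B) * (s * A) =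
          (t - s) * ((t + s) * (A * B)) := by ring
      rw [h3, mul_assoc]
      refine mul_le_mul_of_nonneg_left ?_ (sub_nonneg.2 hst)
      nlinarith [mul_nonneg (mul_nonneg hs.le ht.le) (sq_nonneg (A * x - B))]
  have := hmono (mem_Ici.2 le_rfl) (mem_Ici.2 hR) hR
  simp only [hψ, Real.log_one, mul_zero, mul_one, zero_sub] at this
  linarith

/-- With `k = t / s` this identifies the slope `(t - s) / (t + s)` of `log_ratio_le` as the
hyperbolic tangent of a quarter of the diameter `2 * log (t / s)`. -/
theorem tanh_half_log {k : ℝ} (hk : 0 < k) : Real.tanh (Real.log k / 2) = (k - 1) / (k + 1) := by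
  rw [Real.tanh_eq_sinh_div_cosh, Real.sinh_eq, Real.cosh_eq]
  set e := Real.exp (Real.log k / 2) with he
  have h0 : 0 < e := Real.exp_pos _
  have h1 : e * e = k := by
    rw [he, ← Real.exp_add, add_halves, Real.exp_log hk]
  rw [Real.exp_neg, ← he, ← h1]
  field_simp

variable {Ω : Type*} [MeasurableSpace Ω] (σ : Ω ≃ᵐ Ω) (M : Ω → WeightedOpenMap α β)

theorem iterL_comb (n : ℕ) (ω : Ω) (c d : ℝ) (f h : Seg α β → ℝ) :
    iterL σ M n ω (fun x => c * f x - d * h x) =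
      fun y => c * iterL σ M n ω f y - d * iterL σ M n ω h y := by
  rw [iterL_sub_fun, iterL_const_mul, iterL_const_mul]

theorem Sand.iterL {n : ℕ} {ω : Ω} {a' l u : ℝ}
    (hmap : ∀ v ∈ (cone0 a : Set (Seg α β → ℝ)), iterL σ M n ω v ∈ (cone0 a' : Set _))
    (hs : Sand a l u f h) : Sand a' l u (iterL σ M n ω f) (iterL σ M n ω h) := by
  constructor
  · have := hmap _ hs.1
    have e := iterL_comb σ M n ω 1 l h f
    simp only [one_mul] at e
    rwa [e] at this
  · have := hmap _ hs.2
    have e := iterL_comb σ M n ω u 1 f h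
    simp only [one_mul] at e
    rwa [e] at this

/-- Birkhoff's contraction theorem. -/
theorem Sand.contract {n : ℕ} {ω : Ω} {a' γ l u : ℝ} (ha' : 0 < a') (hγ : 0 < γ) (hγ1 : γ < 1)
    (hmap : ∀ v ∈ (cone0 a : Set (Seg α β → ℝ)), RandomInterval.iterL σ M n ω v ∈ (cone0 (γ * a') : Set _))
    (hl : 0 < l) (hlu : l ≤ u) (hs : Sand a l u f h) :
    ∃ l' u', 0 < l' ∧ l' ≤ u' ∧
      Sand a' l' u' (RandomInterval.iterL σ M n ω f) (RandomInterval.iterL σ M n ω h) ∧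
      Real.log (u' / l') ≤ Real.tanh (2 * Real.log ((1 + γ * (a' + 1)) / (1 - γ)) / 4) *
        Real.log (u / l) := by
  have hγa : 0 < γ * a' := by positivity
  have hs' := hs.iterL σ M hmap
  set F := RandomInterval.iterL σ M n ω f
  set H := RandomInterval.iterL σ M n ω h
  have hA := einf_nonneg_of_mem_cone0 hγa hs'.1
  have hB := einf_nonneg_of_mem_cone0 hγa hs'.2
  have h1 := sand_one_of_mem_cone0 ha' hs'.1
  have h2 := sand_one_of_mem_cone0 ha' hs'.2
  have hz1 := fun h0 => ae_eq_zero_of_mem_cone0 hs'.1 h0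
  set A := einf fun x => H x - l * F x
  set B := einf fun x => u * F x - H x
  have hs0 : 0 < 1 - γ := by linarith
  have hst : 1 - γ ≤ 1 + γ * (a' + 1) := by nlinarith
  have ht : 0 < 1 + γ * (a' + 1) := by positivity
  have hθ : Real.tanh (2 * Real.log ((1 + γ * (a' + 1)) / (1 - γ)) / 4) =
      (1 + γ * (a' + 1) - (1 - γ)) / (1 + γ * (a' + 1) + (1 - γ)) := by
    rw [show 2 * Real.log ((1 + γ * (a' + 1)) / (1 - γ)) / 4 =
      Real.log ((1 + γ * (a' + 1)) / (1 - γ)) / 2 by ring, tanh_half_log (by positivity)]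
    field_simp
  rw [hθ]
  -- The gaps `H - l F` and `u F - H` lie in the smaller cone, so both are comparable with constants
  -- and hence with each other. The two comparisons, solved for `H`, give the improved constants.
  have hc1 := comparable_of_sand_one ha' hs0.le ht.le hA hB h1 h2
  have hc2 := comparable_of_sand_one ha' hs0.le ht.le hB hA h2 h1
  set s := 1 - γ
  set t := 1 + γ * (a' + 1)
  have hu : 0 < u := hl.trans_le hlu
  have hR : 1 ≤ u / l := (one_le_div hl).2 hlu
  rcases (add_nonneg hA hB).eq_or_lt with h0 | h0
  · have hA0 : A = 0 := by linarith
    refine ⟨l, l, hl, le_rfl, ⟨cone0_mono hγa (by nlinarith) hs'.1, ?_⟩, ?_⟩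
    · have h3 : IsBV (fun x => l * F x - H x) := by
        have := hs'.1.1.const_mul (-1)
        simpa using this
      refine cone0_congr (const_mem_cone0 ha' le_rfl) h3 ?_
      filter_upwards [hz1 hA0] with x hx
      linarith
    · rw [div_self hl.ne', Real.log_one]
      exact mul_nonneg (div_nonneg (sub_nonneg.2 hst) (by positivity)) (Real.log_nonneg hR)
  have hp1 : 0 < t * B + s * A := by
    rcases hA.eq_or_lt with h | h
    · have : 0 < B := by linarith
      positivity
    · positivity
  have hp2 : 0 < t * A + s * B := by
    rcases hA.eq_or_lt with h | h
    · have : 0 < B := by linarith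
      positivity
    · positivity
  have hp3 : 0 < t * B * l + s * A * u := by
    rcases hA.eq_or_lt with h | h
    · have : 0 < B := by linarith
      positivity
    · positivity
  have hp4 : 0 < t * A * u + s * B * l := by
    rcases hA.eq_or_lt with h | h
    · have : 0 < B := by linarith
      positivity
    · positivity
  refine ⟨(t * B * l + s * A * u) / (t * B + s * A), (t * A * u + s * B * l) / (t * A + s * B),
    by positivity, ?_, ⟨?_, ?_⟩, ?_⟩
  · rw [div_le_div_iff₀ hp1 hp2]
    nlinarith [mul_nonneg (mul_nonneg (mul_nonneg hA hB) (sub_nonneg.2 hlu))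
      (mul_nonneg (sub_nonneg.2 hst) (add_pos hs0 ht).le)]
  · have := cone0_const_mul (c := (t * B + s * A)⁻¹) (by positivity) hc1
    convert this using 2
    field_simp
    ring
  · have := cone0_const_mul (c := (t * A + s * B)⁻¹) (by positivity) hc2
    convert this using 2
    field_simp
    ring
  · refine le_trans (le_of_eq ?_) (log_ratio_le hs0 hst hA hB h0 hR)
    have e1 : t * A * (u / l) + s * B = (t * A * u + s * B * l) / l := by field_simp
    have e2 : t * B + s * A * (u / l) = (t * B * l + s * A * u) / l := by field_simp
    rw [e1, e2, Real.log_div (by positivity) (by positivity), Real.log_div hp4.ne' hp2.ne',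
      Real.log_div hp3.ne' hp1.ne', Real.log_div hp4.ne' hl.ne', Real.log_div hp3.ne' hl.ne']
    ring

/-! ### The Hilbert metric -/

theorem hilbertDist_le_of_sand {l u : ℝ} (ha : 0 < a) (hl : 0 < l) (hu : 0 < u) (hf : IsBV f)
    (hh : IsBV h) (hs : Sand a l u f h) : hilbertDist a f h ≤ ((Real.log (u / l) : ℝ) : EReal) := by
  have h1 : coneRho a f h ≤ ENNReal.ofReal u :=
    iInf₂_le_of_le u hu (iInf_le _ ((coneLE_iff ha hh (hf.const_mul u)).2 hs.2))
  have h2 : ENNReal.ofReal l ≤ coneTau a f h :=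
    le_iSup₂_of_le l hl (le_iSup_iff.2 fun b hb =>
      hb ((coneLE_iff ha (hf.const_mul l) hh).2 hs.1))
  rw [hilbertDist, ← ENNReal.log_ofReal_of_pos (div_pos hu hl)]
  refine ENNReal.log_monotone ?_
  rw [ENNReal.ofReal_div_of_pos hl]
  exact ENNReal.div_le_div h1 h2

/-- The extremal constants in the Hilbert metric need not be attained, so estimates for near-optimal
ones are passed to the limit. The number `einf h / einf f` separates the two families of constants,
which rules out indeterminate quotients; an infinite distance leaves nothing to prove because `κ >
0`. -/
theorem hilbertDist_le_mul {a' κ : ℝ} {F H : Seg α β → ℝ} (ha : 0 < a)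
    (hf : f ∈ (cone a : Set (Seg α β → ℝ))) (hh : h ∈ (cone a : Set (Seg α β → ℝ))) (hκ : 0 < κ)
    (hyp : ∀ l u, 0 < l → l ≤ u → Sand a l u f h →
      hilbertDist a' F H ≤ ((κ * Real.log (u / l) : ℝ) : EReal)) :
    hilbertDist a' F H ≤ (κ : EReal) * hilbertDist a f h := by
  have hf0 := einf_pos_of_mem_cone ha hf
  have hh0 := einf_pos_of_mem_cone ha hh
  have hlow : ∀ l, 0 < l → coneLE a (fun x => l * f x) h → l ≤ einf h / einf f := by
    intro l hl hle
    rw [coneLE_iff ha (hf.1.const_mul l) hh.1] at hle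
    rw [le_div_iff₀ hf0, ← hf.1.einf_const_mul hl.le]
    refine (hf.1.const_mul l).einf_mono hh.1 ?_
    filter_upwards [ae_nonneg_of_mem_cone0 ha hle] with x hx
    simpa using hx
  have hupp : ∀ u, 0 < u → coneLE a h (fun x => u * f x) → einf h / einf f ≤ u := by
    intro u hu hle
    rw [coneLE_iff ha hh.1 (hf.1.const_mul u)] at hle
    rw [div_le_iff₀ hf0, ← hf.1.einf_const_mul hu.le]
    refine hh.1.einf_mono (hf.1.const_mul u) ?_
    filter_upwards [ae_nonneg_of_mem_cone0 ha hle] with x hx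
    simpa using hx
  have hτ : coneTau a f h ≤ ENNReal.ofReal (einf h / einf f) :=
    iSup₂_le fun l hl => iSup_le fun hle => ENNReal.ofReal_le_ofReal (hlow l hl hle)
  have hρ : ENNReal.ofReal (einf h / einf f) ≤ coneRho a f h :=
    le_iInf₂ fun u hu => le_iInf fun hle => ENNReal.ofReal_le_ofReal (hupp u hu hle)
  have hτtop : coneTau a f h ≠ ⊤ := (hτ.trans_lt ENNReal.ofReal_lt_top).ne
  have hρ0 : coneRho a f h ≠ 0 :=
    ((ENNReal.ofReal_pos.2 (div_pos hh0 hf0)).trans_le hρ).ne'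
  have htop : hilbertDist a f h = ⊤ → hilbertDist a' F H ≤ (κ : EReal) * hilbertDist a f h := by
    intro h
    rw [h, EReal.coe_mul_top_of_pos hκ]
    exact le_top
  by_cases hτ0 : coneTau a f h = 0
  · refine htop ?_
    rw [hilbertDist, hτ0, ENNReal.div_zero hρ0, ENNReal.log_top]
  by_cases hρtop : coneRho a f h = ⊤
  · refine htop ?_
    rw [hilbertDist, hρtop, ENNReal.top_div_of_ne_top hτtop, ENNReal.log_top]
  set τ := (coneTau a f h).toReal with hτd
  set ρ := (coneRho a f h).toReal with hρd
  have hτp : 0 < τ := ENNReal.toReal_pos hτ0 hτtop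
  have hρp : 0 < ρ := ENNReal.toReal_pos hρ0 hρtop
  have hd : hilbertDist a f h = ((Real.log (ρ / τ) : ℝ) : EReal) := by
    rw [hilbertDist, ← ENNReal.log_ofReal_of_pos (div_pos hρp hτp), ENNReal.ofReal_div_of_pos hτp,
      ENNReal.ofReal_toReal hτtop, ENNReal.ofReal_toReal hρtop]
  rw [hd, ← EReal.coe_mul]
  have hτρ : τ ≤ ρ := ENNReal.toReal_mono hρtop (hτ.trans hρ)
  have hf' := cone_subset_cone0 hf
  have key : ∀ n : ℕ, hilbertDist a' F H ≤
      ((κ * (Real.log (ρ / τ) + 2 * (1 / ((n : ℝ) + 1))) : ℝ) : EReal) := by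
    intro n
    set δ : ℝ := 1 / ((n : ℝ) + 1) with hδ
    have hδ0 : 0 < δ := Nat.one_div_pos_of_nat
    have h1 : ENNReal.ofReal (τ * Real.exp (-δ)) < coneTau a f h := by
      rw [← ENNReal.ofReal_toReal hτtop]
      refine (ENNReal.ofReal_lt_ofReal_iff hτp).2 ?_
      have : Real.exp (-δ) < 1 := Real.exp_lt_one_iff.2 (by linarith)
      nlinarith
    have h2 : coneRho a f h < ENNReal.ofReal (ρ * Real.exp δ) := by
      rw [← ENNReal.ofReal_toReal hρtop]
      refine (ENNReal.ofReal_lt_ofReal_iff (by positivity)).2 ?_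
      have : 1 < Real.exp δ := Real.one_lt_exp_iff.2 hδ0
      nlinarith
    simp only [coneTau, lt_iSup_iff] at h1
    simp only [coneRho, iInf_lt_iff] at h2
    obtain ⟨l, hl, hle, hlt⟩ := h1
    obtain ⟨u, hu, hue, hut⟩ := h2
    have hs : Sand a l u f h := ⟨(coneLE_iff ha (hf.1.const_mul l) hh.1).1 hle,
      (coneLE_iff ha hh.1 (hf.1.const_mul u)).1 hue⟩
    have hs' := hs.weaken ha hf' ((ENNReal.ofReal_lt_ofReal_iff hl).1 hlt).le
      ((ENNReal.ofReal_lt_ofReal_iff (by positivity)).1 hut).le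
    refine (hyp _ _ (by positivity) (hs'.le ha hf.1 hf0) hs').trans (le_of_eq ?_)
    congr 2
    rw [Real.log_div (by positivity) (by positivity), Real.log_mul hρp.ne' (Real.exp_pos _).ne',
      Real.log_mul hτp.ne' (Real.exp_pos _).ne', Real.log_exp, Real.log_exp,
      Real.log_div hρp.ne' hτp.ne']
    ring
  refine ge_of_tendsto' (x := atTop) (f := fun n : ℕ =>
    ((κ * (Real.log (ρ / τ) + 2 * (1 / ((n : ℝ) + 1))) : ℝ) : EReal)) ?_ key
  refine (continuous_coe_real_ereal.tendsto _).comp ?_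
  have := ((tendsto_one_div_add_atTop_nhds_zero_nat (𝕜 := ℝ)).const_mul 2).const_add
    (Real.log (ρ / τ)) |>.const_mul κ
  simpa using this

end Cones

end RandomInterval
end

noncomputable section
namespace RandomInterval

/-! ### Ergodic theory -/

section ErgodicTheory

variable {Ω : Type*} [MeasurableSpace Ω] {m : Measure Ω} {τ : Ω → Ω}

theorem integrable_birkhoffSum (hτ : MeasurePreserving τ m m) {φ : Ω → ℝ} (hφ : Integrable φ m)
    (n : ℕ) : Integrable (birkhoffSum τ φ n) m := by
  have : birkhoffSum τ φ n = fun ω => ∑ k ∈ Finset.range n, φ (τ^[k] ω) := rfl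
  rw [this]
  exact integrable_finsetSum _ fun k _ => (hτ.iterate k).integrable_comp_of_integrable hφ

/-- The maximum of the first Birkhoff sums. -/
def maxSum (τ : Ω → Ω) (φ : Ω → ℝ) : ℕ → Ω → ℝ
  | 0, _ => 0
  | n + 1, ω => max (maxSum τ φ n ω) (birkhoffSum τ φ (n + 1) ω)

theorem maxSum_nonneg (φ : Ω → ℝ) (n : ℕ) (ω : Ω) : 0 ≤ maxSum τ φ n ω := by
  induction n with
  | zero => exact le_rfl
  | succ n ih => exact ih.trans (le_max_left _ _)

theorem birkhoffSum_le_maxSum (φ : Ω → ℝ) {k n : ℕ} (hk : k ≤ n) (ω : Ω) :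
    birkhoffSum τ φ k ω ≤ maxSum τ φ n ω := by
  induction n with
  | zero =>
    obtain rfl : k = 0 := by omega
    simp [maxSum]
  | succ n ih =>
    rcases Nat.le_succ_iff.1 hk with h | rfl
    · exact (ih h).trans (le_max_left _ _)
    · exact le_max_right _ _

/-- Garsia's observation: a positive maximum is attained by a nonempty sum, whose first term splits
off, and the rest is a sum for the shifted point. -/
theorem maxSum_le_of_pos (φ : Ω → ℝ) (n : ℕ) (ω : Ω) (h : 0 < maxSum τ φ n ω) :
    maxSum τ φ n ω ≤ φ ω + maxSum τ φ n (τ ω) := by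
  have key : ∀ n, maxSum τ φ n ω = 0 ∨ ∃ k < n, maxSum τ φ n ω = birkhoffSum τ φ (k + 1) ω := by
    intro n
    induction n with
    | zero => exact Or.inl rfl
    | succ n ih =>
      rcases max_choice (maxSum τ φ n ω) (birkhoffSum τ φ (n + 1) ω) with h1 | h1
      · rw [maxSum, h1]
        exact ih.imp id fun ⟨k, hk, he⟩ => ⟨k, hk.trans (Nat.lt_succ_self n), he⟩
      · exact Or.inr ⟨n, Nat.lt_succ_self n, h1⟩
  rcases key n with h0 | ⟨k, hk, he⟩
  · exact absurd h0 h.ne'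
  · rw [he, birkhoffSum_succ']
    gcongr
    exact birkhoffSum_le_maxSum φ hk.le _

theorem integrable_maxSum (hτ : MeasurePreserving τ m m) {φ : Ω → ℝ} (hφ : Integrable φ m)
    (n : ℕ) : Integrable (maxSum τ φ n) m := by
  induction n with
  | zero => exact integrable_zero _ _ _
  | succ n ih => exact ih.sup (integrable_birkhoffSum hτ hφ (n + 1))

/-- A consequence of the maximal ergodic theorem. -/
theorem integral_nonneg_of_exists_birkhoffSum_pos (hτ : MeasurePreserving τ m m) {φ : Ω → ℝ}
    (hφ : Integrable φ m) (h : ∀ᵐ ω ∂m, ∃ n, 0 < birkhoffSum τ φ n ω) : 0 ≤ ∫ ω, φ ω ∂m := by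
  have hlow : ∀ n, 0 ≤ ∫ ω, {ω | 0 < maxSum τ φ n ω}.indicator φ ω ∂m := by
    intro n
    have hM := integrable_maxSum hτ hφ n
    have hMτ : Integrable (fun ω => maxSum τ φ n (τ ω)) m := hτ.integrable_comp_of_integrable hM
    have hs : NullMeasurableSet {ω | 0 < maxSum τ φ n ω} m :=
      nullMeasurableSet_lt aemeasurable_const hM.aemeasurable
    have hz : ∫ ω, (maxSum τ φ n ω - maxSum τ φ n (τ ω)) ∂m = 0 := by
      rw [integral_sub hM hMτ, sub_eq_zero]
      conv_lhs => rw [← hτ.map_eq]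
      rw [integral_map hτ.aemeasurable]
      rw [hτ.map_eq]
      exact hM.aestronglyMeasurable
    refine hz.ge.trans ?_
    -- Where the maximum is positive, `φ` dominates the difference of the maximum and its shift;
    -- elsewhere the maximum is zero and the difference is nonpositive.
    refine integral_mono (hM.sub hMτ) (hφ.indicator₀ hs) fun ω => ?_
    by_cases hω : 0 < maxSum τ φ n ω
    · rw [indicator_of_mem (show ω ∈ {ω | 0 < maxSum τ φ n ω} from hω)]
      have := maxSum_le_of_pos φ n ω hω
      simp only
      linarith
    · rw [indicator_of_notMem (show ω ∉ {ω | 0 < maxSum τ φ n ω} from hω)]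
      have h1 := maxSum_nonneg (τ := τ) φ n (τ ω)
      simp only
      linarith [not_lt.1 hω]
  have hlim : Tendsto (fun n => ∫ ω, {ω | 0 < maxSum τ φ n ω}.indicator φ ω ∂m) atTop
      (𝓝 (∫ ω, φ ω ∂m)) := by
    refine tendsto_integral_of_dominated_convergence (fun ω => |φ ω|) (fun n => ?_) hφ.abs
      (fun n => Eventually.of_forall fun ω => ?_) ?_
    · exact hφ.aestronglyMeasurable.indicator₀
        (nullMeasurableSet_lt aemeasurable_const (integrable_maxSum hτ hφ n).aemeasurable)
    · exact norm_indicator_le_norm_self _ _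
    · filter_upwards [h] with ω ⟨k, hk⟩
      refine tendsto_const_nhds.congr' ?_
      filter_upwards [eventually_ge_atTop k] with n hn
      rw [indicator_of_mem]
      exact hk.trans_le (birkhoffSum_le_maxSum φ hn ω)
  exact ge_of_tendsto' hlim hlow

variable [IsProbabilityMeasure m]

theorem bddAbove_birkhoffSum_shift (φ : Ω → ℝ) (ω : Ω) :
    BddAbove (range fun n => birkhoffSum τ φ n (τ ω)) ↔
      BddAbove (range fun n => birkhoffSum τ φ n ω) := by
  constructor
  · rintro ⟨K, hK⟩
    refine ⟨max 0 (φ ω + K), ?_⟩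
    rintro _ ⟨n, rfl⟩
    cases n with
    | zero => simp
    | succ n =>
      refine le_trans ?_ (le_max_right _ _)
      simp only [birkhoffSum_succ']
      have := hK ⟨n, rfl⟩
      simp only at this
      linarith
  · rintro ⟨K, hK⟩
    refine ⟨K - φ ω, ?_⟩
    rintro _ ⟨n, rfl⟩
    have := hK ⟨n + 1, rfl⟩
    simp only [birkhoffSum_succ'] at this
    simp only
    linarith

theorem not_bddAbove_birkhoffSum {φ : Ω → ℝ} {ω : Ω}
    (h : ¬ BddAbove (range fun n => birkhoffSum τ φ n ω)) : ∃ n, 0 < birkhoffSum τ φ n ω := by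
  by_contra hcon
  push Not at hcon
  exact h ⟨0, by rintro _ ⟨n, rfl⟩; exact hcon n⟩

/-- The Birkhoff sums of a function with negative mean are bounded above with positive
probability. -/
theorem measure_bddAbove_birkhoffSum_ne_zero (hτ : MeasurePreserving τ m m) {φ : Ω → ℝ}
    (hφ : Integrable φ m) (h : ∫ ω, φ ω ∂m < 0) :
    ¬ ∀ᵐ ω ∂m, ¬ BddAbove (range fun n => birkhoffSum τ φ n ω) := fun hcon =>
  (integral_nonneg_of_exists_birkhoffSum_pos hτ hφ
    (hcon.mono fun _ hω => not_bddAbove_birkhoffSum hω)).not_gt h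

theorem nullMeasurableSet_bddAbove (hτ : MeasurePreserving τ m m) {φ : Ω → ℝ}
    (hφ : Integrable φ m) :
    NullMeasurableSet {ω | BddAbove (range fun n => birkhoffSum τ φ n ω)} m := by
  have : {ω | BddAbove (range fun n => birkhoffSum τ φ n ω)} =
      ⋃ K : ℕ, ⋂ n, {ω | birkhoffSum τ φ n ω ≤ K} := by
    ext ω
    simp only [mem_ofPred_eq, mem_iUnion, mem_iInter]
    constructor
    · rintro ⟨K, hK⟩
      obtain ⟨k, hk⟩ := exists_nat_ge K
      exact ⟨k, fun n => (hK ⟨n, rfl⟩).trans hk⟩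
    · rintro ⟨k, hk⟩
      exact ⟨k, by rintro _ ⟨n, rfl⟩; exact hk n⟩
  rw [this]
  exact .iUnion fun K => .iInter fun n =>
    nullMeasurableSet_le (integrable_birkhoffSum hτ hφ n).aemeasurable aemeasurable_const

/-- Boundedness of the sums is unchanged by a shift of the base point, so ergodicity upgrades
positive probability to almost certainty. -/
theorem ae_bddAbove_birkhoffSum (hτ : Ergodic τ m) {φ : Ω → ℝ} (hφ : Integrable φ m)
    (h : ∫ ω, φ ω ∂m < 0) : ∀ᵐ ω ∂m, BddAbove (range fun n => birkhoffSum τ φ n ω) := by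
  set s := {ω | BddAbove (range fun n => birkhoffSum τ φ n ω)} with hs
  have hinv : τ ⁻¹' s = s := by
    ext ω
    exact bddAbove_birkhoffSum_shift φ ω
  rcases hτ.quasiErgodic.ae_empty_or_univ₀
    (nullMeasurableSet_bddAbove hτ.toMeasurePreserving hφ) (EventuallyEq.of_eq hinv) with h0 | h0
  · refine absurd ?_ (measure_bddAbove_birkhoffSum_ne_zero hτ.toMeasurePreserving hφ h)
    filter_upwards [h0.mem_iff] with ω hω hb
    exact (hω.1 hb).elim
  · filter_upwards [h0.mem_iff] with ω hω
    exact hω.2 (mem_univ ω)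

theorem birkhoffSum_sub_const (φ : Ω → ℝ) (c : ℝ) (n : ℕ) (ω : Ω) :
    birkhoffSum τ (fun ω => φ ω - c) n ω = birkhoffSum τ φ n ω - n * c := by
  simp [birkhoffSum, Finset.sum_sub_distrib]

/-- After subtracting slightly more than the mean, the mean is negative and the sums are bounded
above; dividing by `n` removes the bound. -/
theorem ae_eventually_birkhoffSum_le (hτ : Ergodic τ m) {φ : Ω → ℝ} (hφ : Integrable φ m) :
    ∀ᵐ ω ∂m, ∀ k : ℕ, ∀ᶠ n : ℕ in atTop,
      birkhoffSum τ φ n ω / n ≤ ∫ ω, φ ω ∂m + 1 / ((k : ℝ) + 1) := by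
  rw [ae_all_iff]
  intro k
  set ε : ℝ := 1 / ((k : ℝ) + 1) with hε
  have hε0 : 0 < ε := Nat.one_div_pos_of_nat
  have hint : ∫ ω, (φ ω - (∫ ω, φ ω ∂m + ε / 2)) ∂m < 0 := by
    rw [integral_sub hφ (integrable_const _)]
    simp
    linarith
  filter_upwards [ae_bddAbove_birkhoffSum hτ (hφ.sub (integrable_const _)) hint] with ω ⟨K, hK⟩
  obtain ⟨N, hN⟩ := exists_nat_ge (2 * |K| / ε)
  filter_upwards [eventually_ge_atTop (max N 1)] with n hn
  have hn0 : (0 : ℝ) < n := Nat.cast_pos.2 (lt_of_lt_of_le one_pos ((le_max_right _ _).trans hn))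
  have h1 := hK ⟨n, rfl⟩
  change birkhoffSum τ (fun ω => φ ω - (∫ ω, φ ω ∂m + ε / 2)) n ω ≤ K at h1
  rw [birkhoffSum_sub_const] at h1
  rw [div_le_iff₀ hn0]
  have h2 : 2 * |K| ≤ n * ε := by
    rw [div_le_iff₀ hε0] at hN
    refine hN.trans (mul_le_mul_of_nonneg_right ?_ hε0.le)
    exact_mod_cast (le_max_left _ _).trans hn
  have := le_abs_self K
  nlinarith

/-- Birkhoff's ergodic theorem for ergodic maps. -/
theorem ae_tendsto_birkhoffSum (hτ : Ergodic τ m) {φ : Ω → ℝ} (hφ : Integrable φ m) :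
    ∀ᵐ ω ∂m, Tendsto (fun n : ℕ => birkhoffSum τ φ n ω / n) atTop (𝓝 (∫ ω, φ ω ∂m)) := by
  filter_upwards [ae_eventually_birkhoffSum_le hτ hφ, ae_eventually_birkhoffSum_le hτ hφ.neg]
    with ω h1 h2
  rw [Metric.tendsto_atTop']
  intro ε hε
  obtain ⟨k, hk⟩ := exists_nat_one_div_lt hε
  obtain ⟨N, hN⟩ := eventually_atTop.1 ((h1 k).and (h2 k))
  refine ⟨N, fun n hn => ?_⟩
  obtain ⟨h3, h4⟩ := hN n hn.le
  have h5 : birkhoffSum τ (-φ) n ω = -birkhoffSum τ φ n ω := by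
    simp [birkhoffSum]
  simp only [Pi.neg_apply, integral_neg] at h4
  rw [h5, neg_div] at h4
  rw [Real.dist_eq, abs_lt]
  constructor <;> linarith

/-- Up to the factor `(n + 1) / n` this is a difference of consecutive Birkhoff averages. -/
theorem ae_tendsto_div (hτ : Ergodic τ m) {φ : Ω → ℝ} (hφ : Integrable φ m) :
    ∀ᵐ ω ∂m, Tendsto (fun n : ℕ => φ (τ^[n] ω) / n) atTop (𝓝 0) := by
  filter_upwards [ae_tendsto_birkhoffSum hτ hφ] with ω hω
  have h1 : Tendsto (fun n : ℕ => birkhoffSum τ φ (n + 1) ω / ((n + 1 : ℕ) : ℝ) *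
      (((n + 1 : ℕ) : ℝ) / n) - birkhoffSum τ φ n ω / n) atTop (𝓝 ((∫ ω, φ ω ∂m) * 1 -
        ∫ ω, φ ω ∂m)) := by
    refine ((hω.comp (tendsto_add_atTop_nat 1)).mul ?_).sub hω
    have h2 : Tendsto (fun n : ℕ => 1 + 1 / (n : ℝ)) atTop (𝓝 (1 + 0)) :=
      tendsto_one_div_atTop_nhds_zero_nat.const_add 1
    rw [add_zero] at h2
    refine h2.congr' ?_
    filter_upwards [eventually_gt_atTop 0] with n hn
    have : (n : ℝ) ≠ 0 := by positivity
    push_cast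
    field_simp
  rw [mul_one, sub_self] at h1
  refine h1.congr' ?_
  filter_upwards [eventually_gt_atTop 0] with n hn
  have : (n : ℝ) ≠ 0 := by positivity
  have h3 : ((n + 1 : ℕ) : ℝ) ≠ 0 := by positivity
  rw [birkhoffSum_succ]
  field_simp
  ring

/-- A coboundary whose transfer function is nonnegative and which is bounded above by an
integrable function is integrable, with integral zero. -/
theorem integrable_coboundary (hτ : MeasurePreserving τ m m) {ψ Φ : Ω → ℝ}
    (hψ : AEMeasurable ψ m) (hψ0 : ∀ᵐ ω ∂m, 0 ≤ ψ ω) (hΦ : Integrable Φ m)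
    (h : ∀ᵐ ω ∂m, ψ (τ ω) - ψ ω ≤ Φ ω) :
    Integrable (fun ω => ψ (τ ω) - ψ ω) m ∧ ∫ ω, (ψ (τ ω) - ψ ω) ∂m = 0 := by
  have hψτ : AEMeasurable (fun ω => ψ (τ ω)) m :=
    hψ.comp_quasiMeasurePreserving hτ.quasiMeasurePreserving
  set u : Ω → ℝ := fun ω => ψ (τ ω) - ψ ω with hu
  have hum : AEMeasurable u m := hψτ.sub hψ
  -- Truncation gives integrable coboundaries of mean zero without assuming `ψ` integrable. Their
  -- positive parts are dominated by that of `u`, and mean zero then controls the negative parts as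
  -- well; Fatou's lemma makes `u` integrable, and dominated convergence gives its mean.
  set v : ℕ → Ω → ℝ := fun K ω => min (ψ (τ ω)) K - min (ψ ω) K with hv
  have hint : ∀ K : ℕ, Integrable (fun ω => min (ψ ω) (K : ℝ)) m := by
    intro K
    refine Integrable.of_bound (hψ.min aemeasurable_const).aestronglyMeasurable K ?_
    filter_upwards [hψ0] with ω hω
    rw [Real.norm_of_nonneg (le_min hω (Nat.cast_nonneg K))]
    exact min_le_right _ _
  have hintτ : ∀ K : ℕ, Integrable (fun ω => min (ψ (τ ω)) (K : ℝ)) m := fun K =>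
    hτ.integrable_comp_of_integrable (hint K)
  have hvint : ∀ K, Integrable (v K) m := fun K => (hintτ K).sub (hint K)
  have hv0 : ∀ K, ∫ ω, v K ω ∂m = 0 := by
    intro K
    rw [hv]
    simp only
    rw [integral_sub (hintτ K) (hint K), sub_eq_zero]
    conv_rhs => rw [← hτ.map_eq]
    rw [integral_map hτ.aemeasurable]
    rw [hτ.map_eq]
    exact (hint K).aestronglyMeasurable
  have hup : Integrable (fun ω => max (u ω) 0) m := by
    refine hΦ.norm.mono' (hum.max aemeasurable_const).aestronglyMeasurable ?_
    filter_upwards [h] with ω hω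
    rw [Real.norm_of_nonneg (le_max_right _ _)]
    exact max_le (hω.trans (le_abs_self _)) (norm_nonneg _)
  have hvu : ∀ K ω, |v K ω| ≤ |u ω| := fun K ω => by
    have := abs_min_sub_min_le_max (ψ (τ ω)) K (ψ ω) K
    simpa using this
  have hvp : ∀ K ω, max (v K ω) 0 ≤ max (u ω) 0 := by
    intro K ω
    rcases le_total (ψ (τ ω)) (ψ ω) with h1 | h1
    · have : v K ω ≤ 0 := sub_nonpos.2 (min_le_min_right _ h1)
      rw [max_eq_right this]
      exact le_max_right _ _
    · have h2 := hvu K ω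
      have h3 : 0 ≤ v K ω := sub_nonneg.2 (min_le_min_right _ h1)
      have h4 : 0 ≤ u ω := sub_nonneg.2 h1
      rw [abs_of_nonneg h3, abs_of_nonneg h4] at h2
      rw [max_eq_left h3, max_eq_left h4]
      exact h2
  have hlim : ∀ ω, Tendsto (fun K => v K ω) atTop (𝓝 (u ω)) := by
    intro ω
    refine tendsto_const_nhds.congr' ?_
    obtain ⟨N, hN⟩ := exists_nat_ge (max (ψ (τ ω)) (ψ ω))
    filter_upwards [eventually_ge_atTop N] with K hK
    have h1 : max (ψ (τ ω)) (ψ ω) ≤ (K : ℝ) := hN.trans (by exact_mod_cast hK)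
    simp only [hv, hu]
    rw [min_eq_left ((le_max_left _ _).trans h1), min_eq_left ((le_max_right _ _).trans h1)]
  have hnorm : ∀ K, ∫⁻ ω, ‖v K ω‖ₑ ∂m ≤ ENNReal.ofReal (2 * ∫ ω, max (u ω) 0 ∂m) := by
    intro K
    rw [← ofReal_integral_norm_eq_lintegral_enorm (hvint K)]
    refine ENNReal.ofReal_le_ofReal ?_
    have h1 : ∀ ω, ‖v K ω‖ = 2 * max (v K ω) 0 - v K ω := by
      intro ω
      rw [Real.norm_eq_abs]
      rcases le_total (v K ω) 0 with h | h
      · rw [abs_of_nonpos h, max_eq_right h]; ring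
      · rw [abs_of_nonneg h, max_eq_left h]; ring
    simp only [h1]
    have hvp_int : Integrable (fun ω => max (v K ω) 0) m := (hvint K).pos_part
    rw [integral_sub (hvp_int.const_mul 2) (hvint K), hv0 K, sub_zero, integral_const_mul]
    exact mul_le_mul_of_nonneg_left (integral_mono hvp_int hup (hvp K)) zero_le_two
  have huint : Integrable u m := by
    refine ⟨hum.aestronglyMeasurable, ?_⟩
    have h1 : ∫⁻ ω, ‖u ω‖ₑ ∂m ≤ liminf (fun K => ∫⁻ ω, ‖v K ω‖ₑ ∂m) atTop := by
      refine le_trans (le_of_eq ?_) (lintegral_liminf_le' fun K =>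
        (hvint K).aestronglyMeasurable.enorm)
      refine lintegral_congr fun ω => ?_
      exact ((continuous_enorm.tendsto _).comp (hlim ω)).liminf_eq.symm
    refine (h1.trans ?_).trans_lt (ENNReal.ofReal_lt_top (r := 2 * ∫ ω, max (u ω) 0 ∂m))
    exact liminf_le_of_le (by isBoundedDefault) fun b hb => by
      obtain ⟨K, hK⟩ := hb.exists
      exact hK.trans (hnorm K)
  refine ⟨huint, ?_⟩
  have := tendsto_integral_of_dominated_convergence (fun ω => |u ω|)
    (fun K => (hvint K).aestronglyMeasurable) huint.abs
    (fun K => Eventually.of_forall fun ω => hvu K ω) (Eventually.of_forall hlim)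
  simp only [hv0] at this
  exact (tendsto_nhds_unique this tendsto_const_nhds)

theorem birkhoffSum_coboundary (ψ : Ω → ℝ) (n : ℕ) (ω : Ω) :
    birkhoffSum τ (fun ω => ψ (τ ω) - ψ ω) n ω = ψ (τ^[n] ω) - ψ ω := by
  induction n with
  | zero => simp
  | succ n ih =>
    rw [birkhoffSum_succ, ih, Function.iterate_succ_apply']
    ring

theorem tendsto_div_of_coboundary (hτ : Ergodic τ m) {ψ : Ω → ℝ}
    (hint : Integrable (fun ω => ψ (τ ω) - ψ ω) m) (h0 : ∫ ω, (ψ (τ ω) - ψ ω) ∂m = 0) :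
    ∀ᵐ ω ∂m, Tendsto (fun n : ℕ => ψ (τ^[n] ω) / n) atTop (𝓝 0) := by
  filter_upwards [ae_tendsto_birkhoffSum hτ hint] with ω hω
  rw [h0] at hω
  have h1 := hω.add (tendsto_const_div_atTop_nhds_zero_nat (ψ ω))
  rw [add_zero] at h1
  refine h1.congr fun n => ?_
  rw [birkhoffSum_coboundary]
  ring

/-- Subexponential growth of a nonnegative function along orbits, in both directions of time, when
its increments are bounded above by an integrable function. -/
theorem tendsto_div_of_increment_le {σ : Ω ≃ᵐ Ω} (hσ : Ergodic σ m) {ψ Φ : Ω → ℝ}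
    (hψ : AEMeasurable ψ m) (hψ0 : ∀ᵐ ω ∂m, 0 ≤ ψ ω) (hΦ : Integrable Φ m)
    (h : ∀ᵐ ω ∂m, ψ (σ ω) - ψ ω ≤ Φ ω) :
    (∀ᵐ ω ∂m, Tendsto (fun n : ℕ => ψ (σ^[n] ω) / n) atTop (𝓝 0)) ∧
      ∀ᵐ ω ∂m, Tendsto (fun n : ℕ => ψ (σ.symm^[n] ω) / n) atTop (𝓝 0) := by
  obtain ⟨h1, h2⟩ := integrable_coboundary hσ.toMeasurePreserving hψ hψ0 hΦ h
  have hs : Ergodic σ.symm m := hσ.symm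
  refine ⟨tendsto_div_of_coboundary hσ h1 h2, tendsto_div_of_coboundary hs ?_ ?_⟩
  · have := (hs.toMeasurePreserving.integrable_comp_of_integrable h1).neg
    refine this.congr (Eventually.of_forall fun ω => ?_)
    simp
  · have e : (fun ω => ψ (σ.symm ω) - ψ ω) =
        fun ω => -((fun ω => ψ (σ ω) - ψ ω) (σ.symm ω)) := by
      ext ω
      simp
    rw [e, integral_neg, hs.toMeasurePreserving.integral_comp
      σ.symm.measurableEmbedding (fun ω => ψ (σ ω) - ψ ω), h2, neg_zero]

end ErgodicTheory

end RandomInterval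
end

/-! ### Contraction along orbits that visit a set of bounded diameter. -/

noncomputable section
namespace RandomInterval
variable {α β : ℝ} [Fact (α < β)]

theorem tanh_mono {x y : ℝ} (h : x ≤ y) : Real.tanh x ≤ Real.tanh y := by
  rw [Real.tanh_eq_sinh_div_cosh, Real.tanh_eq_sinh_div_cosh,
    div_le_div_iff₀ (Real.cosh_pos x) (Real.cosh_pos y)]
  have := Real.sinh_nonneg_iff.2 (sub_nonneg.2 h)
  rw [Real.sinh_sub] at this
  linarith

theorem tanh_pos {x : ℝ} (h : 0 < x) : 0 < Real.tanh x := by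
  rw [Real.tanh_eq_sinh_div_cosh]
  exact div_pos (Real.sinh_pos_iff.2 h) (Real.cosh_pos x)

section Contraction

variable {Ω : Type*} [MeasurableSpace Ω] (σ : Ω ≃ᵐ Ω) (M : Ω → WeightedOpenMap α β)

/-- The weights have a positive essential infimum along the whole orbit. -/
def Good (ω : Ω) : Prop :=
  (∀ j : ℕ, 0 < einf (M (σ^[j] ω)).g) ∧ ∀ j : ℕ, 0 < einf (M (σ.symm^[j] ω)).g

variable {σ M} {ω : Ω}

theorem Good.apply (h : Good σ M ω) : Good σ M (σ ω) := by
  refine ⟨fun j => h.1 (j + 1), fun j => ?_⟩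
  cases j with
  | zero => exact h.1 1
  | succ j => simpa using h.2 j

theorem Good.symm_apply (h : Good σ M ω) : Good σ M (σ.symm ω) := by
  refine ⟨fun j => ?_, fun j => h.2 (j + 1)⟩
  cases j with
  | zero => exact h.2 1
  | succ j => simpa using h.1 j

theorem Good.iterate (h : Good σ M ω) (j : ℕ) : Good σ M (σ^[j] ω) := by
  induction j with
  | zero => exact h
  | succ j ih =>
    rw [Function.iterate_succ_apply']
    exact ih.apply

theorem Good.symm_iterate (h : Good σ M ω) (j : ℕ) : Good σ M (σ.symm^[j] ω) := by
  induction j with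
  | zero => exact h
  | succ j ih =>
    rw [Function.iterate_succ_apply']
    exact ih.symm_apply

theorem iterate_symm_iterate (σ : Ω ≃ᵐ Ω) (j : ℕ) (ω : Ω) : σ^[j] (σ.symm^[j] ω) = ω :=
  (Function.LeftInverse.iterate (g := σ) (f := σ.symm) (fun x => σ.apply_symm_apply x) j) ω

theorem symm_iterate_iterate (σ : Ω ≃ᵐ Ω) (j : ℕ) (ω : Ω) : σ.symm^[j] (σ^[j] ω) = ω :=
  (Function.LeftInverse.iterate (g := σ.symm) (f := σ) (fun x => σ.symm_apply_apply x) j) ω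

theorem Good.of_iterate {j : ℕ} (h : Good σ M (σ^[j] ω)) : Good σ M ω := by
  have := h.symm_iterate j
  rwa [symm_iterate_iterate] at this

theorem Good.einf_iterL_pos (h : Good σ M ω) (n : ℕ) {f : Seg α β → ℝ} (hf : IsBV f)
    (hf0 : 0 < einf f) : 0 < einf (iterL σ M n ω f) := by
  refine lt_of_lt_of_le ?_ (mul_einf_le_einf_iterL σ M (fun j _ => h.1 j) hf ?_)
  · have h1 := einfOn_pos σ M n ω fun j _ => h.1 j
    have h2 : (0 : ℝ) < numFull σ M n ω := Nat.cast_pos.2 (one_le_numFull σ M n ω)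
    positivity
  · filter_upwards [hf.ae_einf_le] with x hx using hf0.le.trans hx

theorem Good.einf_iterL_one_pos (h : Good σ M ω) (n : ℕ) :
    0 < einf (iterL σ M n ω (1 : Seg α β → ℝ)) :=
  h.einf_iterL_pos n isBV_one (by rw [einf_one]; exact one_pos)

/-- One application of the transfer operator to a cone of aperture at least one. -/
theorem Good.iterL_mem_cone0 (h : Good σ M ω) (n : ℕ) {a : ℝ} (ha : 0 < a) {f : Seg α β → ℝ}
    (hf : f ∈ (cone0 a : Set (Seg α β → ℝ))) :
    iterL σ M n ω f ∈ (cone0 (coeffC σ M n ω * a + coeffD σ M n ω) : Set (Seg α β → ℝ)) :=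
  ⟨isBV_iterL σ M n ω hf.1, var_iterL_le_of_var_le σ M (fun j _ => h.1 j) hf.1
    (ae_nonneg_of_mem_cone0 ha hf) ha.le hf.2⟩

variable (σ M)

/-- The images of the functions of the cone of aperture one. -/
def orbitCone (ω : Ω) : Set (Seg α β → ℝ) :=
  {f | ∃ (k : ℕ) (ω' : Ω), σ^[k] ω' = ω ∧ ∃ h ∈ (cone0 1 : Set (Seg α β → ℝ)), 0 < einf h ∧
    f = iterL σ M k ω' h}

theorem iterL_mem_orbitCone {f : Seg α β → ℝ} (hf : f ∈ orbitCone σ M ω) (n : ℕ) :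
    iterL σ M n ω f ∈ orbitCone σ M (σ^[n] ω) := by
  obtain ⟨k, ω', rfl, h, hh, hh0, rfl⟩ := hf
  refine ⟨k + n, ω', ?_, h, hh, hh0, ?_⟩
  · rw [add_comm, Function.iterate_add_apply]
  · rw [iterL_add]

theorem mem_orbitCone_of_mem_cone0 {f : Seg α β → ℝ} (hf : f ∈ (cone0 1 : Set (Seg α β → ℝ)))
    (hf0 : 0 < einf f) : f ∈ orbitCone σ M ω := ⟨0, ω, rfl, f, hf, hf0, rfl⟩

theorem one_mem_cone0 : (1 : Seg α β → ℝ) ∈ (cone0 1 : Set (Seg α β → ℝ)) :=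
  const_mem_cone0 one_pos zero_le_one

theorem one_mem_orbitCone : (1 : Seg α β → ℝ) ∈ orbitCone σ M ω :=
  mem_orbitCone_of_mem_cone0 σ M one_mem_cone0 (by rw [einf_one]; exact one_pos)

variable {σ M}

theorem isBV_of_mem_orbitCone {f : Seg α β → ℝ} (hf : f ∈ orbitCone σ M ω) : IsBV f := by
  obtain ⟨k, ω', rfl, h, hh, hh0, rfl⟩ := hf
  exact isBV_iterL σ M k ω' hh.1

theorem Good.einf_pos (hω : Good σ M ω) {f : Seg α β → ℝ} (hf : f ∈ orbitCone σ M ω) :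
    0 < einf f := by
  obtain ⟨k, ω', rfl, h, hh, hh0, rfl⟩ := hf
  exact hω.of_iterate.einf_iterL_pos k hh.1 hh0

variable (σ M)

/-- A field of cones over a set `G` that is invariant under `σ^n`, strictly contracted by the
`n`-step transfer operators. -/
structure ConeField (n : ℕ) (γ : ℝ) (a : Ω → ℝ) (G : Set Ω) : Prop where
  n_pos : 0 < n
  pos : 0 < γ
  lt_one : γ < 1
  good : ∀ ω ∈ G, Good σ M ω
  a_pos : ∀ ω ∈ G, 0 < a ω
  invariant : ∀ ω, σ^[n] ω ∈ G ↔ ω ∈ G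
  map : ∀ ω ∈ G, ∀ v ∈ (cone0 (a ω) : Set (Seg α β → ℝ)),
    iterL σ M n ω v ∈ (cone0 (γ * a (σ^[n] ω)) : Set (Seg α β → ℝ))
  entry : ∀ ω, ∀ p < n, σ^[p] ω ∈ G → ∀ v ∈ (cone0 1 : Set (Seg α β → ℝ)),
    iterL σ M p ω v ∈ (cone0 (γ * a (σ^[p] ω)) : Set (Seg α β → ℝ))

/-- The diameter bound of the cones. -/
def diam (γ : ℝ) (a : Ω → ℝ) (ω : Ω) : ℝ := 2 * Real.log ((1 + γ * (a ω + 1)) / (1 - γ))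

open Classical in
/-- The number of visits to `A` before time `N`. -/
def visits (A : Set Ω) (N : ℕ) (ω : Ω) : ℕ := ((Finset.range N).filter fun k => σ^[k] ω ∈ A).card

open Classical in
theorem visits_succ (A : Set Ω) (N : ℕ) (ω : Ω) :
    visits σ A (N + 1) ω = visits σ A N ω + if σ^[N] ω ∈ A then 1 else 0 := by
  rw [visits, visits, Finset.range_add_one, Finset.filter_insert]
  split_ifs with h
  · rw [Finset.card_insert_of_notMem (by simp)]
  · rfl

open Classical in
theorem visits_le (A : Set Ω) (N : ℕ) (ω : Ω) : visits σ A N ω ≤ N :=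
  (Finset.card_filter_le _ _).trans_eq (Finset.card_range N)

theorem visits_add (A : Set Ω) (N k : ℕ) (ω : Ω) :
    visits σ A (N + k) ω = visits σ A N ω + visits σ A k (σ^[N] ω) := by
  classical
  induction k with
  | zero => simp [visits]
  | succ k ih =>
    rw [← add_assoc, visits_succ, ih, visits_succ, add_assoc, add_comm N k,
      Function.iterate_add_apply]

variable {σ M} {n : ℕ} {γ : ℝ} {a : Ω → ℝ} {G A : Set Ω} {D : ℝ}

namespace ConeField

variable (C : ConeField σ M n γ a G)
include C

/-- Blocks of `n` steps are removed backwards from the arrival, each of them mapping a cone into the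
smaller one, until fewer than `n` initial steps remain; those are covered by `entry`. Invariance of
`G` keeps the intermediate base points admissible. -/
theorem mem_cone0 {f : Seg α β → ℝ} (hω : ω ∈ G) (hf : f ∈ orbitCone σ M ω) :
    f ∈ (cone0 (γ * a ω) : Set (Seg α β → ℝ)) := by
  obtain ⟨k, ω', rfl, h, hh, hh0, rfl⟩ := hf
  induction k using Nat.strong_induction_on generalizing ω' with
  | _ k ih =>
  rcases lt_or_ge k n with hk | hk
  · exact C.entry ω' k hk hω h hh
  · obtain ⟨j, rfl⟩ := Nat.exists_eq_add_of_le' hk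
    have e : σ^[j + n] ω' = σ^[n] (σ^[j] ω') := by rw [add_comm, Function.iterate_add_apply]
    have h1 : σ^[j] ω' ∈ G := by
      rw [e] at hω
      exact (C.invariant _).1 hω
    rw [e, iterL_add]
    have h2 := ih j (Nat.lt_add_of_pos_right C.n_pos) ω' h1
    have h3 := C.a_pos _ h1
    refine C.map _ h1 _ (cone0_mono (mul_pos C.pos h3) ?_ h2)
    nlinarith [C.lt_one]

theorem iterate_mem (hω : ω ∈ G) (j : ℕ) : σ^[n * j] ω ∈ G := by
  induction j with
  | zero => simpa using hω
  | succ j ih =>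
    rw [mul_add, mul_one, add_comm, Function.iterate_add_apply]
    exact (C.invariant _).2 ih

theorem mem_of_iterate_mem {j : ℕ} (hω : σ^[n * j] ω ∈ G) : ω ∈ G := by
  induction j with
  | zero => simpa using hω
  | succ j ih =>
    rw [mul_add, mul_one, add_comm, Function.iterate_add_apply] at hω
    exact ih ((C.invariant _).1 hω)

/-- One step of `σ^n`: the logarithmic ratio is contracted by `tanh (D / 4)` if the orbit arrives
in `A`. -/
theorem contract_step (hA : ∀ ω ∈ A, diam γ a ω ≤ D) {f h : Seg α β → ℝ} {l u : ℝ} (hω : ω ∈ G)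
    (hl : 0 < l) (hlu : l ≤ u) (hs : Sand (a ω) l u f h) {t : ℝ} (ht : Real.tanh (D / 4) ≤ t)
    (ht1 : σ^[n] ω ∉ A → 1 ≤ t) :
    ∃ l' u', 0 < l' ∧ l' ≤ u' ∧ Sand (a (σ^[n] ω)) l' u' (iterL σ M n ω f) (iterL σ M n ω h) ∧
      Real.log (u' / l') ≤ t * Real.log (u / l) := by
  have hG := (C.invariant ω).2 hω
  obtain ⟨l', u', hl', hlu', hs', hle⟩ := hs.contract σ M (C.a_pos _ hG) C.pos C.lt_one
    (C.map ω hω) hl hlu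
  refine ⟨l', u', hl', hlu', hs', hle.trans (mul_le_mul_of_nonneg_right ?_
    (Real.log_nonneg ((one_le_div hl).2 hlu)))⟩
  by_cases hmem : σ^[n] ω ∈ A
  · exact (tanh_mono (by have := hA _ hmem; unfold diam at this; linarith)).trans ht
  · exact (Real.tanh_lt_one _).le.trans (ht1 hmem)

open Classical in
/-- Contraction along an orbit of `σ^n` of functions that are comparable from the start. -/
theorem exists_sand (hA : ∀ ω ∈ A, diam γ a ω ≤ D) (hD : 0 < D) {f h : Seg α β → ℝ} {l u : ℝ}
    (hω : ω ∈ G) (hl : 0 < l) (hlu : l ≤ u) (hs : Sand (a ω) l u f h) (J : ℕ) :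
    ∃ l' u', 0 < l' ∧ l' ≤ u' ∧
      Sand (a (σ^[n * J] ω)) l' u' (iterL σ M (n * J) ω f) (iterL σ M (n * J) ω h) ∧
      Real.log (u' / l') ≤ Real.tanh (D / 4) ^
        ((Finset.range J).filter fun j => σ^[n * (j + 1)] ω ∈ A).card * Real.log (u / l) := by
  induction J with
  | zero => exact ⟨l, u, hl, hlu, hs, by simp⟩
  | succ J ih =>
    obtain ⟨l', u', hl', hlu', hs', hle⟩ := ih
    have ht0 : 0 < Real.tanh (D / 4) := tanh_pos (by positivity)
    have e : n * (J + 1) = n * J + n := by ring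
    have e2 : σ^[n * (J + 1)] ω = σ^[n] (σ^[n * J] ω) := by
      rw [e, add_comm, Function.iterate_add_apply]
    obtain ⟨l₂, u₂, h1, h2, h3, h4⟩ := C.contract_step hA (C.iterate_mem hω J) hl' hlu' hs'
      (t := if σ^[n * (J + 1)] ω ∈ A then Real.tanh (D / 4) else 1)
      (by split_ifs; exacts [le_rfl, (Real.tanh_lt_one _).le])
      (fun hn => by rw [if_neg (by rwa [e2])])
    refine ⟨l₂, u₂, h1, h2, ?_, h4.trans ?_⟩
    · rw [e2, e, iterL_add, iterL_add]
      exact h3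
    · rw [Finset.range_add_one, Finset.filter_insert]
      split_ifs with hm
      · rw [Finset.card_insert_of_notMem (by simp), pow_succ', mul_assoc]
        exact mul_le_mul_of_nonneg_left hle ht0.le
      · rwa [one_mul]

open Classical in
/-- Contraction along an orbit of `σ^n`, from the first visit to `A` on. -/
theorem exists_sand_of_visit (hAG : A ⊆ G) (hA : ∀ ω ∈ A, diam γ a ω ≤ D) (hD : 0 < D)
    {f h : Seg α β → ℝ} (hω : ω ∈ G) (hf : f ∈ orbitCone σ M ω) (hh : h ∈ orbitCone σ M ω) (J : ℕ)
    (hJ : 1 ≤ ((Finset.range (J + 1)).filter fun j => σ^[n * j] ω ∈ A).card) :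
    ∃ l u, 0 < l ∧ l ≤ u ∧
      Sand (a (σ^[n * J] ω)) l u (iterL σ M (n * J) ω f) (iterL σ M (n * J) ω h) ∧
      Real.log (u / l) ≤ D * Real.tanh (D / 4) ^
        (((Finset.range (J + 1)).filter fun j => σ^[n * j] ω ∈ A).card - 1) := by
  have ht0 : 0 < Real.tanh (D / 4) := tanh_pos (by positivity)
  -- At a visit to `A` both functions lie in the smaller cone, so their logarithmic ratio is at most
  -- `D`, whatever happened before.
  have hfresh : ∀ J, σ^[n * J] ω ∈ A → ∃ l u, 0 < l ∧ l ≤ u ∧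
      Sand (a (σ^[n * J] ω)) l u (iterL σ M (n * J) ω f) (iterL σ M (n * J) ω h) ∧
      Real.log (u / l) ≤ D := by
    intro J hm
    have hG := hAG hm
    have hgood := C.good _ hG
    have h1 := iterL_mem_orbitCone σ M hf (n * J)
    have h2 := iterL_mem_orbitCone σ M hh (n * J)
    obtain ⟨l, u, hl, hlu, hs, hle⟩ := exists_sand_of_mem_cone0 (C.a_pos _ hG) C.pos C.lt_one
      (C.mem_cone0 hG h1) (C.mem_cone0 hG h2) (hgood.einf_pos h1) (hgood.einf_pos h2)
    exact ⟨l, u, hl, hlu, hs, hle.trans (hA _ hm)⟩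
  induction J with
  | zero =>
    have hm : σ^[n * 0] ω ∈ A := by
      by_contra hcon
      rw [Finset.filter_false_of_mem] at hJ
      · simp at hJ
      · intro j hj
        obtain rfl : j = 0 := by simpa using hj
        exact hcon
    obtain ⟨l, u, hl, hlu, hs, hle⟩ := hfresh 0 hm
    refine ⟨l, u, hl, hlu, hs, hle.trans ?_⟩
    have : ((Finset.range (0 + 1)).filter fun j => σ^[n * j] ω ∈ A).card - 1 = 0 := by
      have := Finset.card_filter_le (Finset.range (0 + 1)) fun j => σ^[n * j] ω ∈ A
      simp only [zero_add, Finset.card_range] at this ⊢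
      omega
    rw [this, pow_zero, mul_one]
  | succ J ih =>
    have e : n * (J + 1) = n * J + n := by ring
    have e2 : σ^[n * (J + 1)] ω = σ^[n] (σ^[n * J] ω) := by
      rw [e, add_comm, Function.iterate_add_apply]
    rw [Finset.range_add_one, Finset.filter_insert] at hJ ⊢
    -- Before any visit there is nothing to carry along, and the first one starts the comparison at
    -- the price `D`. Afterwards every further visit contributes a factor `tanh (D / 4)`, which is
    -- why the exponent is one less than the count.
    rcases Nat.eq_zero_or_pos ((Finset.range (J + 1)).filter fun j => σ^[n * j] ω ∈ A).card with
      h0 | h0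
    · split_ifs at hJ ⊢ with hm
      · obtain ⟨l, u, hl, hlu, hs, hle⟩ := hfresh (J + 1) hm
        refine ⟨l, u, hl, hlu, hs, hle.trans ?_⟩
        rw [Finset.card_insert_of_notMem (by simp), h0, zero_add, Nat.sub_self, pow_zero, mul_one]
      · omega
    · obtain ⟨l', u', hl', hlu', hs', hle⟩ := ih h0
      obtain ⟨l₂, u₂, h1, h2, h3, h4⟩ := C.contract_step hA (C.iterate_mem hω J) hl' hlu' hs'
        (t := if σ^[n * (J + 1)] ω ∈ A then Real.tanh (D / 4) else 1)
        (by split_ifs; exacts [le_rfl, (Real.tanh_lt_one _).le])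
        (fun hn => by rw [if_neg (by rwa [e2])])
      refine ⟨l₂, u₂, h1, h2, ?_, h4.trans ?_⟩
      · rw [e2, e, iterL_add, iterL_add]
        exact h3
      · split_ifs with hm
        · rw [Finset.card_insert_of_notMem (by simp), Nat.add_sub_cancel]
          obtain ⟨c, hc⟩ := Nat.exists_eq_add_of_le' h0
          rw [hc] at hle ⊢
          rw [pow_succ', mul_left_comm]
          exact mul_le_mul_of_nonneg_left hle ht0.le
        · rwa [one_mul]

end ConeField

theorem ae_le_iterL {f h : Seg α β → ℝ} {l u : ℝ} (hf : IsBV f) (hh : IsBV h) (n : ℕ) (ω : Ω)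
    (hs : ∀ᵐ x ∂(leb : Measure (Seg α β)), l * f x ≤ h x ∧ h x ≤ u * f x) :
    ∀ᵐ x ∂(leb : Measure (Seg α β)), l * iterL σ M n ω f x ≤ iterL σ M n ω h x ∧
      iterL σ M n ω h x ≤ u * iterL σ M n ω f x := by
  have h1 := iterL_mono σ M n ω (hf.const_mul l) hh (hs.mono fun x hx => hx.1)
  have h2 := iterL_mono σ M n ω hh (hf.const_mul u) (hs.mono fun x hx => hx.2)
  rw [iterL_const_mul] at h1 h2
  filter_upwards [h1, h2] with x h3 h4 using ⟨h3, h4⟩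

open Classical in
theorem visits_mul (A : Set Ω) (n J : ℕ) (ω : Ω) : visits σ A (n * J) ω =
    ∑ p ∈ Finset.range n, ((Finset.range J).filter fun j => σ^[n * j] (σ^[p] ω) ∈ A).card := by
  induction J with
  | zero => simp [visits]
  | succ J ih =>
    rw [mul_add, mul_one, visits_add, ih]
    have : visits σ A n (σ^[n * J] ω) =
        ∑ p ∈ Finset.range n, if σ^[n * J] (σ^[p] ω) ∈ A then 1 else 0 := by
      rw [visits, Finset.card_filter]
      refine Finset.sum_congr rfl fun p _ => ?_
      rw [← Function.iterate_add_apply, ← Function.iterate_add_apply, add_comm]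
    rw [this, ← Finset.sum_add_distrib]
    refine Finset.sum_congr rfl fun p _ => ?_
    rw [Finset.range_add_one, Finset.filter_insert]
    split_ifs with h
    · rw [Finset.card_insert_of_notMem (by simp)]
    · rfl

/-- After more than `n` visits to `A`, all functions of the orbit cone are comparable. -/
theorem ConeField.exists_ae_le (C : ConeField σ M n γ a G) (hAG : A ⊆ G)
    (hA : ∀ ω ∈ A, diam γ a ω ≤ D) (hD : 0 < D) {t : ℝ} (ht0 : 0 < t) (ht1 : t < 1)
    (htn : t ^ n = Real.tanh (D / 4)) {f h : Seg α β → ℝ} (hf : f ∈ orbitCone σ M ω)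
    (hh : h ∈ orbitCone σ M ω) {N : ℕ} (hN : n < visits σ A N ω) :
    ∃ l u, 0 < l ∧ l ≤ u ∧ (∀ᵐ x ∂(leb : Measure (Seg α β)),
      l * iterL σ M N ω f x ≤ iterL σ M N ω h x ∧ iterL σ M N ω h x ≤ u * iterL σ M N ω f x) ∧
      Real.log (u / l) ≤ D / Real.tanh (D / 4) ^ 2 * t ^ visits σ A N ω := by
  classical
  have hn := C.n_pos
  have hsplit : n * (N / n) + N % n = N := Nat.div_add_mod N n
  have hV : visits σ A N ω ≤ visits σ A (n * (N / n)) ω + n := by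
    conv_lhs => rw [← hsplit]
    rw [visits_add]
    exact Nat.add_le_add_left ((visits_le σ A _ _).trans (Nat.mod_lt N hn).le) _
  set J := N / n
  set c : ℕ → ℕ := fun p => ((Finset.range J).filter fun j => σ^[n * j] (σ^[p] ω) ∈ A).card
  have hsum : visits σ A (n * J) ω = ∑ p ∈ Finset.range n, c p := visits_mul A n J ω
  -- Only blocks of `n` steps contract, so one residue class of times modulo `n` has to be followed.
  -- By the pigeonhole principle some class has at least the average number of visits.
  obtain ⟨p, hp, hpc⟩ : ∃ p ∈ Finset.range n, visits σ A (n * J) ω ≤ n * c p := by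
    by_contra hcon
    push Not at hcon
    have h1 : ∑ p ∈ Finset.range n, n * c p < ∑ _p ∈ Finset.range n, visits σ A (n * J) ω :=
      Finset.sum_lt_sum_of_nonempty ⟨0, Finset.mem_range.2 hn⟩ hcon
    rw [← Finset.mul_sum, ← hsum, Finset.sum_const, Finset.card_range, smul_eq_mul] at h1
    exact h1.false
  have hpn := Finset.mem_range.1 hp
  have hc1 : 1 ≤ c p := by
    by_contra hcon
    obtain h0 : c p = 0 := by omega
    rw [h0, mul_zero] at hpc
    omega
  obtain ⟨J', hJ'⟩ : ∃ J', J = J' + 1 := by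
    refine Nat.exists_eq_add_one.2 (Nat.pos_of_ne_zero fun h0 => ?_)
    simp [c, h0] at hc1
  have hpG : σ^[p] ω ∈ G := by
    obtain ⟨j, hj⟩ := Finset.card_pos.1 hc1
    exact C.mem_of_iterate_mem (hAG (Finset.mem_filter.1 hj).2)
  have hcJ : ((Finset.range (J' + 1)).filter fun j => σ^[n * j] (σ^[p] ω) ∈ A).card = c p := by
    simp only [c, hJ']
  obtain ⟨l, u, hl, hlu, hs, hle⟩ := C.exists_sand_of_visit hAG hA hD hpG
    (iterL_mem_orbitCone σ M hf p) (iterL_mem_orbitCone σ M hh p) J' (by rwa [hcJ])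
  rw [hcJ] at hle
  have hG' := C.iterate_mem hpG J'
  have hb := fun {k : Seg α β → ℝ} (hk : k ∈ orbitCone σ M ω) =>
    isBV_iterL σ M (n * J') (σ^[p] ω) (isBV_iterL σ M p ω (isBV_of_mem_orbitCone hk))
  have hae := ae_le_iterL (σ := σ) (M := M) (hb hf) (hb hh) (N - (p + n * J'))
    (σ^[p + n * J'] ω) (hs.ae_le (C.a_pos _ hG'))
  rw [← iterL_add, ← iterL_add, ← iterL_add, ← iterL_add] at hae
  have hNle : p + n * J' + (N - (p + n * J')) = N := by
    have : n * J = n * J' + n := by rw [hJ']; ring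
    omega
  rw [hNle] at hae
  refine ⟨l, u, hl, hlu, hae, hle.trans ?_⟩
  have htp : 0 < Real.tanh (D / 4) := tanh_pos (by positivity)
  -- Up to time `N` there are at most `n * (c p + 1)` visits, the extra `n` covering the incomplete
  -- last block, while the available exponent is `c p - 1`. The difference of two is the square in
  -- the constant.
  rw [div_mul_eq_mul_div, le_div_iff₀ (by positivity), mul_assoc]
  refine mul_le_mul_of_nonneg_left ?_ hD.le
  rw [← pow_add, ← htn, ← pow_mul]
  refine pow_le_pow_of_le_one ht0.le ht1.le ?_
  have : c p - 1 + 2 = c p + 1 := by omega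
  rw [this, mul_add, mul_one]
  omega

/-- With aperture one, a function lies between its infimum and twice its infimum; two such functions
lose a factor `2` each. -/
theorem exists_ae_le_of_mem_cone0_one {f h : Seg α β → ℝ}
    (hf : f ∈ (cone0 1 : Set (Seg α β → ℝ))) (hh : h ∈ (cone0 1 : Set (Seg α β → ℝ)))
    (hf0 : 0 < einf f) (hh0 : 0 < einf h) : ∃ l u, 0 < l ∧ l ≤ u ∧
      (∀ᵐ x ∂(leb : Measure (Seg α β)), l * f x ≤ h x ∧ h x ≤ u * f x) ∧
      Real.log (u / l) ≤ Real.log 4 := by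
  refine ⟨einf h / (2 * einf f), 2 * einf h / einf f, by positivity, ?_, ?_, ?_⟩
  · rw [div_le_div_iff₀ (by positivity) hf0]
    nlinarith [mul_pos hh0 hf0]
  · have h1 := hf.2
    have h2 := hh.2
    filter_upwards [hf.1.ae_einf_le, hf.1.ae_le_einf_add_var, hh.1.ae_einf_le,
      hh.1.ae_le_einf_add_var] with x h3 h4 h5 h6
    constructor
    · rw [div_mul_eq_mul_div, div_le_iff₀ (by positivity)]
      nlinarith
    · rw [div_mul_eq_mul_div, le_div_iff₀ hf0]
      nlinarith
  · refine le_of_eq (congrArg Real.log ?_)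
    field_simp
    norm_num

/-- Comparability of functions of the cone of aperture one, for all times. -/
theorem ConeField.exists_ae_le_of_mem_cone0 (C : ConeField σ M n γ a G) (hAG : A ⊆ G)
    (hA : ∀ ω ∈ A, diam γ a ω ≤ D) (hD : 0 < D) {t : ℝ} (ht0 : 0 < t) (ht1 : t < 1)
    (htn : t ^ n = Real.tanh (D / 4)) {f h : Seg α β → ℝ}
    (hf : f ∈ (cone0 1 : Set (Seg α β → ℝ))) (hh : h ∈ (cone0 1 : Set (Seg α β → ℝ)))
    (hf0 : 0 < einf f) (hh0 : 0 < einf h) (N : ℕ) :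
    ∃ l u, 0 < l ∧ l ≤ u ∧ (∀ᵐ x ∂(leb : Measure (Seg α β)),
      l * iterL σ M N ω f x ≤ iterL σ M N ω h x ∧ iterL σ M N ω h x ≤ u * iterL σ M N ω f x) ∧
      Real.log (u / l) ≤ (D + Real.log 4) / Real.tanh (D / 4) ^ 2 * t ^ visits σ A N ω := by
  have htp : 0 < Real.tanh (D / 4) := tanh_pos (by positivity)
  have hl4 : 0 < Real.log 4 := Real.log_pos (by norm_num)
  rcases lt_or_ge n (visits σ A N ω) with hN | hN
  · obtain ⟨l, u, hl, hlu, hs, hle⟩ := C.exists_ae_le hAG hA hD ht0 ht1 htn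
      (mem_orbitCone_of_mem_cone0 σ M hf hf0) (mem_orbitCone_of_mem_cone0 σ M hh hh0) hN
    refine ⟨l, u, hl, hlu, hs, hle.trans ?_⟩
    gcongr
    linarith
  · obtain ⟨l, u, hl, hlu, hs, hle⟩ := exists_ae_le_of_mem_cone0_one hf hh hf0 hh0
    refine ⟨l, u, hl, hlu, ae_le_iterL hf.1 hh.1 N ω hs, hle.trans ?_⟩
    rw [div_mul_eq_mul_div, le_div_iff₀ (by positivity)]
    -- With at most `n` visits the power of `t` is still at least `tanh (D / 4)`, so the constant
    -- absorbs the initial bound `log 4`.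
    have h1 : Real.tanh (D / 4) ≤ t ^ visits σ A N ω := by
      rw [← htn]
      exact pow_le_pow_of_le_one ht0.le ht1.le hN
    have h2 : Real.tanh (D / 4) ^ 2 ≤ Real.tanh (D / 4) := by
      nlinarith [Real.tanh_lt_one (D / 4)]
    have h3 : 0 < t ^ visits σ A N ω := by positivity
    nlinarith

end Contraction

end RandomInterval
end

/-! ### The limit functional of the forward iterates. -/

noncomputable section
namespace RandomInterval
variable {α β : ℝ} [Fact (α < β)]

section Functional

variable {Ω : Type*} [MeasurableSpace Ω] (σ : Ω ≃ᵐ Ω) (M : Ω → WeightedOpenMap α β)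

/-- The functional `Λ` describes the growth of `L^{(n)} f` relative to that of `L^{(n)} 1`. -/
structure LimitFunctional (ω : Ω) (ε : ℕ → ℝ) (Λ : (Seg α β → ℝ) → ℝ) : Prop where
  good : Good σ M ω
  nonneg : ∀ N, 0 ≤ ε N
  tendsto : Tendsto ε atTop (𝓝 0)
  approx : ∀ f : Seg α β → ℝ, IsBV f → ∀ N, ∀ᵐ x ∂(leb : Measure (Seg α β)),
    |iterL σ M N ω f x - Λ f * iterL σ M N ω 1 x| ≤ bvNorm f * ε N * iterL σ M N ω 1 x

variable {σ M} {ω : Ω}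

theorem Good.ae_iterL_one_pos (h : Good σ M ω) (n : ℕ) :
    ∀ᵐ x ∂(leb : Measure (Seg α β)), 0 < iterL σ M n ω 1 x := by
  filter_upwards [(isBV_iterL σ M n ω isBV_one).ae_einf_le] with x hx using
    (h.einf_iterL_one_pos n).trans_le hx

theorem IsBV.ae_eq_zero_of_supNorm_le {f : Seg α β → ℝ} (hf : IsBV f) (h : supNorm f ≤ 0) :
    f =ᵐ[leb] fun _ => 0 := by
  filter_upwards [hf.ae_abs_le_supNorm] with x hx
  exact abs_eq_zero.1 (le_antisymm (hx.trans h) (abs_nonneg _))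

/-- Positivity preserves a comparison with `L^(N) 1` at all later times, so every lower constant is
below every upper one; take `v` to be the supremum of the lower constants. At time `N` the constants
differ by at most `l N * (exp (θ N) - 1)`, and `l N ≤ K` because `ψ ≤ K`. -/
theorem Good.exists_limit_of_mem_cone0 (hω : Good σ M ω) {θ : ℕ → ℝ}
    {ψ : Seg α β → ℝ} (hψ : IsBV ψ) {K : ℝ}
    (hK : ∀ᵐ x ∂(leb : Measure (Seg α β)), ψ x ≤ K)
    (hcomp : ∀ N, ∃ l u, 0 < l ∧ l ≤ u ∧ (∀ᵐ x ∂(leb : Measure (Seg α β)),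
        l * iterL σ M N ω 1 x ≤ iterL σ M N ω ψ x ∧
          iterL σ M N ω ψ x ≤ u * iterL σ M N ω 1 x) ∧ Real.log (u / l) ≤ θ N) :
    ∃ v, ∀ N, ∀ᵐ x ∂(leb : Measure (Seg α β)),
      |iterL σ M N ω ψ x - v * iterL σ M N ω 1 x| ≤
        K * (Real.exp (θ N) - 1) * iterL σ M N ω 1 x := by
  choose l u hl hlu hs hθ using hcomp
  have hpush : ∀ N k, ∀ᵐ x ∂(leb : Measure (Seg α β)),
      l N * iterL σ M (N + k) ω 1 x ≤ iterL σ M (N + k) ω ψ x ∧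
        iterL σ M (N + k) ω ψ x ≤ u N * iterL σ M (N + k) ω 1 x := by
    intro N k
    rw [iterL_add, iterL_add]
    exact ae_le_iterL (isBV_iterL σ M N ω isBV_one) (isBV_iterL σ M N ω hψ) k _ (hs N)
  have hcmp : ∀ N N', l N ≤ u N' := by
    intro N N'
    have h2 := hpush N' N
    rw [add_comm] at h2
    obtain ⟨x, h1, h2, h3⟩ := ((hpush N N').and (h2.and (hω.ae_iterL_one_pos (N + N')))).exists
    exact le_of_mul_le_mul_right (h1.1.trans h2.2) h3
  have hlK : ∀ N, l N ≤ K := by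
    intro N
    have h2 := iterL_mono σ M N ω hψ ((isBV_one (α := α) (β := β)).const_mul K)
      (hK.mono fun x hx => by simpa using hx)
    rw [iterL_const_mul] at h2
    obtain ⟨x, h1, h2, h3⟩ := ((hs N).and (h2.and (hω.ae_iterL_one_pos N))).exists
    exact le_of_mul_le_mul_right (h1.1.trans h2) h3
  refine ⟨⨆ N, l N, fun N => ?_⟩
  have hb : BddAbove (range l) := ⟨u 0, by rintro _ ⟨N, rfl⟩; exact hcmp N 0⟩
  have h1 : l N ≤ ⨆ N, l N := le_ciSup hb N
  have h2 : ⨆ N, l N ≤ u N := ciSup_le fun N' => hcmp N' N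
  have hul : u N ≤ l N * Real.exp (θ N) := by
    have := (Real.log_le_iff_le_exp (div_pos ((hl N).trans_le (hlu N)) (hl N))).1 (hθ N)
    rwa [div_le_iff₀' (hl N)] at this
  have hθ0 : 0 ≤ Real.exp (θ N) - 1 := by
    nlinarith [hl N, hlu N]
  have hd : u N - l N ≤ K * (Real.exp (θ N) - 1) :=
    (by linarith : u N - l N ≤ l N * (Real.exp (θ N) - 1)).trans
      (mul_le_mul_of_nonneg_right (hlK N) hθ0)
  filter_upwards [hs N, hω.ae_iterL_one_pos N] with x h3 h4
  rw [abs_le]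
  constructor <;> nlinarith [h3.1, h3.2]

/-- Adding twice its BV norm puts `f` into the cone of aperture one, as the infimum is then at least
the norm and hence at least the variation. The shifted function is at most three times the norm,
whence the `3`. A function of norm zero is null and treated apart. -/
theorem Good.exists_limit (hω : Good σ M ω) {θ : ℕ → ℝ}
    (hcomp : ∀ N, ∀ f ∈ (cone0 1 : Set (Seg α β → ℝ)), ∀ h ∈ (cone0 1 : Set (Seg α β → ℝ)),
      0 < einf f → 0 < einf h → ∃ l u, 0 < l ∧ l ≤ u ∧ (∀ᵐ x ∂(leb : Measure (Seg α β)),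
        l * iterL σ M N ω f x ≤ iterL σ M N ω h x ∧ iterL σ M N ω h x ≤ u * iterL σ M N ω f x) ∧
        Real.log (u / l) ≤ θ N) {f : Seg α β → ℝ} (hf : IsBV f) :
    ∃ v, ∀ N, ∀ᵐ x ∂(leb : Measure (Seg α β)),
      |iterL σ M N ω f x - v * iterL σ M N ω 1 x| ≤
        bvNorm f * (3 * (Real.exp (θ N) - 1)) * iterL σ M N ω 1 x := by
  rcases (bvNorm_nonneg hf).eq_or_lt with h0 | h0
  · have h1 : supNorm f ≤ 0 := by
      have := var_nonneg f
      unfold bvNorm at h0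
      linarith
    refine ⟨0, fun N => ?_⟩
    have h2 := iterL_congr σ M N ω hf (isBV_const 0) (hf.ae_eq_zero_of_supNorm_le h1)
    rw [iterL_zero_fun] at h2
    filter_upwards [h2] with x hx
    rw [hx, ← h0]
    simp
  set c := bvNorm f with hc
  have hψ : IsBV fun x => f x + 2 * c := hf.add (isBV_const _)
  have hle : ∀ᵐ x ∂(leb : Measure (Seg α β)), |f x| ≤ c := by
    filter_upwards [hf.ae_abs_le_supNorm] with x hx
    exact hx.trans (le_add_of_nonneg_left (var_nonneg f))
  have he : c ≤ einf fun x => f x + 2 * c :=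
    hψ.le_einf (hle.mono fun x hx => by linarith [(abs_le.1 hx).1])
  have hmem : (fun x => f x + 2 * c) ∈ (cone0 1 : Set (Seg α β → ℝ)) := by
    refine ⟨hψ, ?_⟩
    rw [one_mul]
    refine (var_add_const_le hf _).trans (le_trans ?_ he)
    exact le_add_of_nonneg_right hf.supNorm_nonneg
  obtain ⟨v, hv⟩ := hω.exists_limit_of_mem_cone0 (θ := θ) hψ (K := 3 * c)
    (hle.mono fun x hx => by linarith [(abs_le.1 hx).2])
    fun N => hcomp N 1 one_mem_cone0 _ hmem (by rw [einf_one]; exact one_pos) (h0.trans_le he)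
  refine ⟨v - 2 * c, fun N => ?_⟩
  have e : iterL σ M N ω (fun x => f x + 2 * c) =
      fun y => iterL σ M N ω f y + 2 * c * iterL σ M N ω 1 y := by
    have := iterL_add_fun σ M N ω f fun x => 2 * c * (1 : Seg α β → ℝ) x
    rw [iterL_const_mul] at this
    simpa using this
  filter_upwards [hv N] with x hx
  rw [e] at hx
  refine le_of_eq_of_le (congrArg _ ?_) (hx.trans_eq ?_) <;> ring

theorem Good.exists_limitFunctional (hω : Good σ M ω) {θ : ℕ → ℝ} (hθ0 : ∀ N, 0 ≤ θ N)
    (hθ : Tendsto θ atTop (𝓝 0))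
    (hcomp : ∀ N, ∀ f ∈ (cone0 1 : Set (Seg α β → ℝ)), ∀ h ∈ (cone0 1 : Set (Seg α β → ℝ)),
      0 < einf f → 0 < einf h → ∃ l u, 0 < l ∧ l ≤ u ∧ (∀ᵐ x ∂(leb : Measure (Seg α β)),
        l * iterL σ M N ω f x ≤ iterL σ M N ω h x ∧ iterL σ M N ω h x ≤ u * iterL σ M N ω f x) ∧
        Real.log (u / l) ≤ θ N) :
    ∃ Λ, LimitFunctional σ M ω (fun N => 3 * (Real.exp (θ N) - 1)) Λ := by
  classical
  refine ⟨fun f => if hf : IsBV f then (hω.exists_limit hcomp hf).choose else 0, hω, fun N => ?_,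
    ?_, fun f hf N => ?_⟩
  · have := Real.one_le_exp (hθ0 N)
    linarith
  · simpa using ((Real.continuous_exp.tendsto 0).comp hθ).sub_const 1 |>.const_mul 3
  · simp only [hf, dif_pos]
    exact (hω.exists_limit hcomp hf).choose_spec N

namespace LimitFunctional

variable {ε : ℕ → ℝ} {Λ : (Seg α β → ℝ) → ℝ} (E : LimitFunctional σ M ω ε Λ) {f h : Seg α β → ℝ}
include E

theorem le_add (hf : IsBV f) {N : ℕ} {C : ℝ} (h : ∀ᵐ x ∂(leb : Measure (Seg α β)),
    iterL σ M N ω f x ≤ C * iterL σ M N ω 1 x) : Λ f ≤ C + bvNorm f * ε N := by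
  obtain ⟨x, h1, h2, h3⟩ := (h.and ((E.approx f hf N).and (E.good.ae_iterL_one_pos N))).exists
  refine le_of_mul_le_mul_right ?_ h3
  linarith [(abs_le.1 h2).1]

theorem sub_le (hf : IsBV f) {N : ℕ} {C : ℝ} (h : ∀ᵐ x ∂(leb : Measure (Seg α β)),
    C * iterL σ M N ω 1 x ≤ iterL σ M N ω f x) : C - bvNorm f * ε N ≤ Λ f := by
  obtain ⟨x, h1, h2, h3⟩ := (h.and ((E.approx f hf N).and (E.good.ae_iterL_one_pos N))).exists
  refine le_of_mul_le_mul_right ?_ h3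
  linarith [(abs_le.1 h2).2]

theorem tendsto_mul (c : ℝ) : Tendsto (fun N => c * ε N) atTop (𝓝 0) := by
  simpa using E.tendsto.const_mul c

/-- An inequality valid at one time persists, and at later times the approximation error tends to
zero, so no error term survives. -/
theorem le_of_ae_le (hf : IsBV f) {N : ℕ} {C : ℝ} (h : ∀ᵐ x ∂(leb : Measure (Seg α β)),
    iterL σ M N ω f x ≤ C * iterL σ M N ω 1 x) : Λ f ≤ C := by
  have h1 : Tendsto (fun k => C + bvNorm f * ε (N + k)) atTop (𝓝 (C + 0)) :=
    ((E.tendsto_mul (bvNorm f)).comp (tendsto_add_atTop_nat N)).const_add C |>.congr fun k => by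
      simp [add_comm]
  rw [add_zero] at h1
  refine ge_of_tendsto' h1 fun k => E.le_add hf ?_
  have h2 := iterL_mono σ M k (σ^[N] ω) (isBV_iterL σ M N ω hf)
    ((isBV_iterL σ M N ω isBV_one).const_mul C) h
  rwa [iterL_const_mul, ← iterL_add, ← iterL_add] at h2

theorem le_of_ae_ge (hf : IsBV f) {N : ℕ} {C : ℝ} (h : ∀ᵐ x ∂(leb : Measure (Seg α β)),
    C * iterL σ M N ω 1 x ≤ iterL σ M N ω f x) : C ≤ Λ f := by
  have h1 : Tendsto (fun k => C - bvNorm f * ε (N + k)) atTop (𝓝 (C - 0)) :=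
    ((E.tendsto_mul (bvNorm f)).comp (tendsto_add_atTop_nat N)).const_sub C |>.congr fun k => by
      simp [add_comm]
  rw [sub_zero] at h1
  refine le_of_tendsto' h1 fun k => E.sub_le hf ?_
  have h2 := iterL_mono σ M k (σ^[N] ω) ((isBV_iterL σ M N ω isBV_one).const_mul C)
    (isBV_iterL σ M N ω hf) h
  rwa [iterL_const_mul, ← iterL_add, ← iterL_add] at h2

/-- Uniqueness of the asymptotic coefficient. Additivity and homogeneity follow by exhibiting the
candidate value. -/
theorem eq_of_ae (hf : IsBV f) {v c : ℝ} (h : ∀ N, ∀ᵐ x ∂(leb : Measure (Seg α β)),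
    |iterL σ M N ω f x - v * iterL σ M N ω 1 x| ≤ c * ε N * iterL σ M N ω 1 x) : Λ f = v := by
  have h1 : Tendsto (fun N => v + c * ε N) atTop (𝓝 (v + 0)) := (E.tendsto_mul c).const_add v
  have h2 : Tendsto (fun N => v - c * ε N) atTop (𝓝 (v - 0)) := (E.tendsto_mul c).const_sub v
  rw [add_zero] at h1
  rw [sub_zero] at h2
  refine le_antisymm (ge_of_tendsto' h1 fun N => E.le_of_ae_le hf (N := N) ?_)
    (le_of_tendsto' h2 fun N => E.le_of_ae_ge hf (N := N) ?_)
  · filter_upwards [h N] with x hx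
    linarith [(abs_le.1 hx).2]
  · filter_upwards [h N] with x hx
    linarith [(abs_le.1 hx).1]

theorem map_one : Λ 1 = 1 :=
  E.eq_of_ae (c := 0) isBV_one fun N => by simp

theorem map_add (hf : IsBV f) (hh : IsBV h) : Λ (fun x => f x + h x) = Λ f + Λ h := by
  refine E.eq_of_ae (c := bvNorm f + bvNorm h) (hf.add hh) fun N => ?_
  filter_upwards [E.approx f hf N, E.approx h hh N] with x h1 h2
  rw [iterL_add_fun]
  refine le_of_eq_of_le ?_ ((abs_add_le _ _).trans (_root_.add_le_add h1 h2) |>.trans_eq ?_)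
  · congr 1
    ring
  · ring

theorem map_const_mul (c : ℝ) (hf : IsBV f) : Λ (fun x => c * f x) = c * Λ f := by
  refine E.eq_of_ae (c := |c| * bvNorm f) (hf.const_mul c) fun N => ?_
  filter_upwards [E.approx f hf N] with x h1
  rw [iterL_const_mul]
  calc _ = |c| * |iterL σ M N ω f x - Λ f * iterL σ M N ω 1 x| := by
        rw [← abs_mul]
        congr 1
        ring
    _ ≤ |c| * (bvNorm f * ε N * iterL σ M N ω 1 x) := mul_le_mul_of_nonneg_left h1 (abs_nonneg c)
    _ = _ := by ring

theorem map_sub (hf : IsBV f) (hh : IsBV h) : Λ (fun x => f x - h x) = Λ f - Λ h := by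
  have := E.map_add hf (hh.const_mul (-1))
  rw [E.map_const_mul (-1) hh] at this
  simpa [sub_eq_add_neg] using this

theorem map_nonneg (hf : IsBV f) (hf0 : 0 ≤ᵐ[leb] f) : 0 ≤ Λ f :=
  E.le_of_ae_ge (N := 0) hf (hf0.mono fun x hx => by simpa [iterL] using hx)

theorem mono (hf : IsBV f) (hh : IsBV h) (hle : f ≤ᵐ[leb] h) : Λ f ≤ Λ h := by
  have := E.map_nonneg (hh.sub hf) (hle.mono fun x hx => sub_nonneg.2 hx)
  rw [E.map_sub hh hf] at this
  linarith

theorem congr (hf : IsBV f) (hh : IsBV h) (he : f =ᵐ[leb] h) : Λ f = Λ h :=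
  le_antisymm (E.mono hf hh he.le) (E.mono hh hf he.symm.le)

theorem map_const (c : ℝ) : Λ (fun _ => c) = c := by
  have := E.map_const_mul c isBV_one
  rw [E.map_one, mul_one] at this
  simpa using this

theorem abs_sub_le (hf : IsBV f) (hh : IsBV h) {δ : ℝ} (hδ : ∀ x, |f x - h x| ≤ δ) :
    |Λ f - Λ h| ≤ δ := by
  rw [← E.map_sub hf hh, abs_le]
  constructor
  · rw [← E.map_const (-δ)]
    exact E.mono (isBV_const _) (hf.sub hh) (ae_of_all _ fun x => (abs_le.1 (hδ x)).1)
  · rw [← E.map_const δ]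
    exact E.mono (hf.sub hh) (isBV_const _) (ae_of_all _ fun x => (abs_le.1 (hδ x)).2)

theorem map_sum {κ : Type*} (t : Finset κ) {F : κ → Seg α β → ℝ} (hF : ∀ i ∈ t, IsBV (F i)) :
    Λ (fun x => ∑ i ∈ t, F i x) = ∑ i ∈ t, Λ (F i) := by
  classical
  induction t using Finset.induction_on with
  | empty => simpa using E.map_const 0
  | insert a t ha ih =>
    have h1 : ∀ i ∈ t, IsBV (F i) := fun i hi => hF i (Finset.mem_insert_of_mem hi)
    simp_rw [Finset.sum_insert ha]
    rw [E.map_add (hF a (Finset.mem_insert_self a t)) (IsBV.finset_sum t h1), ih h1]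

/-- Convergence of the quotients of essential infima. -/
theorem tendsto_ratio (hf : IsBV f) (hf0 : 0 ≤ᵐ[leb] f) :
    Tendsto (fun N => einf (iterL σ M N ω f) / einf (iterL σ M N ω 1)) atTop (𝓝 (Λ f)) := by
  rw [tendsto_iff_norm_sub_tendsto_zero]
  refine squeeze_zero (fun N => norm_nonneg _) (fun N => ?_) (E.tendsto_mul (bvNorm f))
  have h1 := E.good.einf_iterL_one_pos N
  have hb : 0 ≤ bvNorm f * ε N := mul_nonneg (bvNorm_nonneg hf) (E.nonneg N)
  have hΛ := E.map_nonneg hf hf0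
  have hF := isBV_iterL σ M N ω hf
  have hO := isBV_iterL σ M N ω (isBV_one (α := α) (β := β))
  rw [Real.norm_eq_abs, abs_le, ← sub_nonneg, ← sub_nonneg (b := _ - Λ f)]
  have hup : einf (iterL σ M N ω f) ≤ (Λ f + bvNorm f * ε N) * einf (iterL σ M N ω 1) := by
    rw [← hO.einf_const_mul (add_nonneg hΛ hb)]
    refine hF.einf_mono (hO.const_mul _) ((E.approx f hf N).mono fun x hx => ?_)
    linarith [(abs_le.1 hx).2]
  have hlow : (Λ f - bvNorm f * ε N) * einf (iterL σ M N ω 1) ≤ einf (iterL σ M N ω f) := by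
    rcases le_total 0 (Λ f - bvNorm f * ε N) with h2 | h2
    · rw [← hO.einf_const_mul h2]
      refine (hO.const_mul _).einf_mono hF ((E.approx f hf N).mono fun x hx => ?_)
      linarith [(abs_le.1 hx).1]
    · exact (mul_nonpos_of_nonpos_of_nonneg h2 h1.le).trans
        (hF.le_einf (iterL_nonneg σ M N ω hf hf0))
  rw [← le_div_iff₀ h1] at hlow
  rw [← div_le_iff₀ h1] at hup
  constructor <;> linarith

/-- Conformality. -/
theorem map_iterL {n : ℕ} {ε' : ℕ → ℝ} {Λ' : (Seg α β → ℝ) → ℝ}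
    (E' : LimitFunctional σ M (σ^[n] ω) ε' Λ') (hf : IsBV f) :
    Λ' (iterL σ M n ω f) = Λ f * Λ' (iterL σ M n ω 1) := by
  have hF := isBV_iterL σ M n ω hf
  have hO := isBV_iterL σ M n ω (isBV_one (α := α) (β := β))
  obtain ⟨K, hK0, hK⟩ := hO.bounded
  -- Under further iteration `L^(n) f - Λ f * L^(n) 1` becomes small relative to the iterates of
  -- `L^(n) 1`, hence relative to those of the constant `K`. So `Λ'` vanishes on it.
  have hd : ∀ N, ∀ᵐ x ∂(leb : Measure (Seg α β)),
      |iterL σ M N (σ^[n] ω) (fun x => iterL σ M n ω f x - Λ f * iterL σ M n ω 1 x) x| ≤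
        bvNorm f * ε (n + N) * K * iterL σ M N (σ^[n] ω) 1 x := by
    intro N
    have h2 := iterL_mono σ M N (σ^[n] ω) hO (isBV_one.const_mul K)
      (ae_of_all _ fun x => by simpa using (abs_le.1 (hK x)).2)
    rw [iterL_const_mul] at h2
    filter_upwards [E.approx f hf (n + N), h2] with x h3 h4
    rw [iterL_sub_fun, iterL_const_mul, ← iterL_add, ← iterL_add]
    rw [← iterL_add] at h4
    rw [mul_assoc]
    exact h3.trans (mul_le_mul_of_nonneg_left h4 (mul_nonneg (bvNorm_nonneg hf) (E.nonneg _)))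
  have hG := hF.sub (hO.const_mul (Λ f))
  have hlim : Tendsto (fun N => bvNorm f * ε (n + N) * K) atTop (𝓝 0) := by
    have := ((E.tendsto_mul (bvNorm f * K)).comp (tendsto_add_atTop_nat n))
    refine this.congr fun N => ?_
    simp only [Function.comp_apply, add_comm N n]
    ring
  have h1 : Λ' (fun x => iterL σ M n ω f x - Λ f * iterL σ M n ω 1 x) ≤ 0 :=
    ge_of_tendsto' hlim fun N => E'.le_of_ae_le hG ((hd N).mono fun x hx => (abs_le.1 hx).2)
  have h2 : 0 ≤ Λ' (fun x => iterL σ M n ω f x - Λ f * iterL σ M n ω 1 x) := by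
    have hlim' := hlim.neg
    rw [neg_zero] at hlim'
    exact le_of_tendsto' hlim' fun N => E'.le_of_ae_ge hG (N := N)
      ((hd N).mono fun x hx => by linarith [(abs_le.1 hx).1])
  rw [E'.map_sub hF (hO.const_mul _), E'.map_const_mul _ hO] at h1 h2
  linarith

theorem einf_le (hf : IsBV f) : einf f ≤ Λ f := by
  rw [← E.map_const (einf f)]
  exact E.mono (isBV_const _) hf hf.ae_einf_le

end LimitFunctional

end Functional

end RandomInterval
end

/-! ### The conformal measures and duality. -/

noncomputable section
namespace RandomInterval
variable {α β : ℝ} [Fact (α < β)]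

theorem isBV_indicator_of_ordConnected {J : Set (Seg α β)} (hJ : J.OrdConnected) :
    IsBV (J.indicator fun _ => (1 : ℝ)) := by
  have h1 := eVariationOn_indicator_le hJ (φ := fun _ => (1 : ℝ)) (s := 1) fun y _ => by simp
  have h2 : eVariationOn (fun _ : Seg α β => (1 : ℝ)) J ≠ ⊤ :=
    ((isBV_const 1).mono (subset_univ J))
  exact ne_top_of_le_ne_top (ENNReal.add_ne_top.2 ⟨h2, by simp⟩) h1

theorem isBV_indicator {U : Set (Seg α β)} (hU : IsFiniteUnionOfIntervals U) :
    IsBV (U.indicator fun _ => (1 : ℝ)) := by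
  obtain ⟨J, hJ, hJo, rfl⟩ := hU
  induction J, hJ using Set.Finite.induction_on with
  | empty => simpa using isBV_const 0
  | @insert A J ha hs ih =>
    have h1 := isBV_indicator_of_ordConnected (hJo A (mem_insert _ _))
    have h2 := ih fun Z hZ => hJo Z (mem_insert_of_mem _ hZ)
    rw [sUnion_insert]
    convert (h1.add h2).sub (h1.mul h2) using 1
    ext x
    by_cases hx : x ∈ A <;> by_cases hy : x ∈ ⋃₀ J <;>
      simp only [indicator, mem_union, hx, hy] <;> norm_num

theorem exists_Ioo_subset_subset_Icc {J : Set (Seg α β)} (hJ : J.OrdConnected)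
    (hne : J.Nonempty) : ∃ a b, a ≤ b ∧ Ioo a b ⊆ J ∧ J ⊆ Icc a b := by
  set S : Set ℝ := Subtype.val '' J
  have hSne : S.Nonempty := hne.image _
  have hlb : α ∈ lowerBounds S := by rintro _ ⟨x, -, rfl⟩; exact x.2.1
  have hub : β ∈ upperBounds S := by rintro _ ⟨x, -, rfl⟩; exact x.2.2
  obtain ⟨w, hw⟩ := hSne
  have hwI : w ∈ Icc α β := ⟨hlb hw, hub hw⟩
  have h1 := csInf_le ⟨α, hlb⟩ hw
  have h2 := le_csSup ⟨β, hub⟩ hw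
  refine ⟨⟨sInf S, le_csInf ⟨w, hw⟩ hlb, h1.trans hwI.2⟩,
    ⟨sSup S, hwI.1.trans h2, csSup_le ⟨w, hw⟩ hub⟩, h1.trans h2, ?_, ?_⟩
  · rintro x ⟨hx1, hx2⟩
    obtain ⟨_, ⟨y, hy, rfl⟩, hyx⟩ := (csInf_lt_iff ⟨α, hlb⟩ ⟨w, hw⟩).1
      (show sInf S < x.1 from hx1)
    obtain ⟨_, ⟨z, hz, rfl⟩, hxz⟩ := (lt_csSup_iff ⟨β, hub⟩ ⟨w, hw⟩).1
      (show x.1 < sSup S from hx2)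
    exact hJ.out hy hz ⟨hyx.le, hxz.le⟩
  · intro x hx
    exact ⟨csInf_le ⟨α, hlb⟩ (mem_image_of_mem _ hx), le_csSup ⟨β, hub⟩ (mem_image_of_mem _ hx)⟩

/-- Endpoints are irrelevant for a measure without atoms, so its distribution function determines
the mass of every interval. -/
theorem exists_Ioc_ae_eq {J : Set (Seg α β)} (hJ : J.OrdConnected) :
    ∃ a b, a ≤ b ∧ {x | ¬ (x ∈ J ↔ x ∈ Ioc a b)}.Countable := by
  rcases J.eq_empty_or_nonempty with rfl | hne
  · exact ⟨lo α β, lo α β, le_rfl, by simp⟩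
  obtain ⟨a, b, hab, h1, h2⟩ := exists_Ioo_subset_subset_Icc hJ hne
  refine ⟨a, b, hab, (Set.toFinite {a, b}).countable.mono fun x hx => ?_⟩
  by_contra hcon
  simp only [mem_insert_iff, mem_singleton_iff, not_or] at hcon
  refine hx ⟨fun h => ⟨lt_of_le_of_ne (h2 h).1 (Ne.symm hcon.1), (h2 h).2⟩, fun h => ?_⟩
  exact h1 ⟨h.1, lt_of_le_of_ne h.2 hcon.2⟩

/-- Functions of bounded variation are integrable. -/
theorem IsBV.integrable {f : Seg α β → ℝ} (hf : IsBV f) (ν : Measure (Seg α β))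
    [IsFiniteMeasure ν] : Integrable f ν := by
  obtain ⟨K, -, hK⟩ := hf.bounded
  exact Integrable.of_bound hf.measurable.aestronglyMeasurable K (ae_of_all _ hK)

theorem isFiniteUnionOfIntervals_of_finite {U : Set (Seg α β)} (hU : U.Finite) :
    IsFiniteUnionOfIntervals U :=
  ⟨(fun x => {x}) '' U, hU.image _, by rintro _ ⟨x, -, rfl⟩; exact ordConnected_singleton, by simp⟩

theorem IsFiniteUnionOfIntervals.measurableSet {U : Set (Seg α β)}
    (hU : IsFiniteUnionOfIntervals U) : MeasurableSet U := by
  obtain ⟨J, hJ, hJo, rfl⟩ := hU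
  exact MeasurableSet.sUnion hJ.countable fun Z hZ => (hJo Z hZ).measurableSet

theorem IsMonotonePartition.preimage_intervals {T : Seg α β → Seg α β}
    {P : Set (Set (Seg α β))} {X : Set (Seg α β)} (hP : IsMonotonePartition T P X)
    {B : Set (Seg α β)} (hB : B.OrdConnected) : IsFiniteUnionOfIntervals (T ⁻¹' B) := by
  have h1 : IsFiniteUnionOfIntervals (⋃₀ ((fun Z => Z ∩ T ⁻¹' B) '' P)) :=
    ⟨_, hP.finite.image _, by
      rintro _ ⟨Z, hZ, rfl⟩
      exact ordConnected_inter_preimage (hP.ordConnected Z hZ) (hP.monotone Z hZ) hB, rfl⟩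
  have h2 : IsFiniteUnionOfIntervals ((⋃₀ P)ᶜ ∩ T ⁻¹' B) :=
    isFiniteUnionOfIntervals_of_finite (hP.finite_compl.subset inter_subset_left)
  convert h1.union h2 using 1
  ext x
  constructor
  · intro hx
    by_cases hxP : x ∈ ⋃₀ P
    · obtain ⟨Z, hZ, hxZ⟩ := hxP
      exact Or.inl ⟨_, ⟨Z, hZ, rfl⟩, hxZ, hx⟩
    · exact Or.inr ⟨hxP, hx⟩
  · rintro (⟨_, ⟨Z, hZ, rfl⟩, hx⟩ | hx)
    · exact hx.2
    · exact hx.2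

instance : CompactIccSpace (Seg α β) := ⟨fun {_ _} => isClosed_Icc.isCompact⟩

/-- A function of bounded variation is a uniform limit of step functions. -/
theorem IsBV.exists_step {f : Seg α β → ℝ} (hf : IsBV f) {δ : ℝ} (hδ : 0 < δ) :
    ∃ (t : Finset (ℤ × Bool)) (c : ℤ × Bool → ℝ) (J : ℤ × Bool → Set (Seg α β)),
      (∀ i, (J i).OrdConnected) ∧
      ∀ x, |f x - ∑ i ∈ t, c i * (J i).indicator (fun _ => (1 : ℝ)) x| ≤ δ := by
  -- Rounding a monotone function down to multiples of `δ / 2` produces level sets that are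
  -- intervals; the two Jordan components together give the error `δ`.
  have key : ∀ p : Seg α β → ℝ, Monotone p → ∃ t : Finset ℤ, ∃ J : ℤ → Set (Seg α β),
      (∀ i, (J i).OrdConnected) ∧
      ∀ x, |p x - ∑ i ∈ t, δ / 2 * i * (J i).indicator (fun _ => (1 : ℝ)) x| ≤ δ / 2 := by
    intro p hp
    have hmono : Monotone fun x => ⌊p x / (δ / 2)⌋ := fun x y h =>
      Int.floor_mono (div_le_div_of_nonneg_right (hp h) (by positivity))
    refine ⟨Finset.Icc ⌊p (lo α β) / (δ / 2)⌋ ⌊p (hi α β) / (δ / 2)⌋,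
      fun i => {x | ⌊p x / (δ / 2)⌋ = i}, fun i => ?_, fun x => ?_⟩
    · refine ⟨fun x hx y hy z hz => ?_⟩
      exact le_antisymm ((hmono hz.2).trans_eq hy) (hx.symm.trans_le (hmono hz.1))
    · rw [Finset.sum_eq_single ⌊p x / (δ / 2)⌋]
      · rw [indicator_of_mem (by rfl), mul_one]
        have h1 := Int.floor_le (p x / (δ / 2))
        have h2 := (Int.lt_floor_add_one (p x / (δ / 2))).le
        rw [le_div_iff₀ (by positivity)] at h1
        rw [div_le_iff₀ (by positivity)] at h2
        rw [abs_le]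
        constructor <;> linarith
      · intro i _ hi
        have : x ∉ {x | ⌊p x / (δ / 2)⌋ = i} := fun h => hi (Eq.symm h)
        simp only [indicator_of_notMem this, mul_zero]
      · intro h
        exact absurd (Finset.mem_Icc.2 ⟨hmono (lo_le x), hmono (le_hi x)⟩) h
  obtain ⟨p, q, hp, hq, hpq⟩ :=
    hf.locallyBoundedVariationOn.exists_monotoneOn_sub_monotoneOn
  obtain ⟨t, J, hJ, h1⟩ := key p (monotoneOn_univ.1 hp)
  obtain ⟨t', J', hJ', h2⟩ := key q (monotoneOn_univ.1 hq)
  refine ⟨t ×ˢ {true} ∪ t' ×ˢ {false}, fun i => cond i.2 (δ / 2 * i.1) (-(δ / 2 * i.1)),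
    fun i => cond i.2 (J i.1) (J' i.1), ?_, fun x => ?_⟩
  · rintro ⟨i, _ | _⟩
    exacts [hJ' i, hJ i]
  · rw [Finset.sum_union, Finset.sum_product, Finset.sum_product]
    · simp only [Finset.sum_singleton, cond_true, cond_false, neg_mul, Finset.sum_neg_distrib]
      have := abs_sub _ _ |>.trans (add_le_add (h1 x) (h2 x))
      refine le_of_eq_of_le ?_ (this.trans_eq (add_halves δ))
      rw [hpq]
      congr 1
      simp only [Pi.sub_apply]
      ring
    · rw [Finset.disjoint_left]
      rintro ⟨i, b⟩ h h'
      simp only [Finset.mem_product, Finset.mem_singleton] at h h'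
      exact absurd (h.2.symm.trans h'.2) (by simp)

section Functional

variable {Ω : Type*} [MeasurableSpace Ω] {σ : Ω ≃ᵐ Ω} {M : Ω → WeightedOpenMap α β} {ω : Ω}

theorem isFiniteUnionOfIntervals_preimage_iterT (n : ℕ) (ω : Ω) {B : Set (Seg α β)}
    (hB : B.OrdConnected) : IsFiniteUnionOfIntervals (iterT σ M n ω ⁻¹' B) :=
  (isMonotonePartition_iter σ M n ω).preimage_intervals hB

theorem measurable_iterT (n : ℕ) (ω : Ω) : Measurable (iterT σ M n ω) :=
  measurable_of_Iic fun _ =>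
    (isFiniteUnionOfIntervals_preimage_iterT n ω ordConnected_Iic).measurableSet

variable (σ M)

/-- The measure `ν` represents the functional `Λ` on BV. -/
structure Represents (ω : Ω) (ε : ℕ → ℝ) (Λ : (Seg α β → ℝ) → ℝ) (ν : Measure (Seg α β)) :
    Prop where
  functional : LimitFunctional σ M ω ε Λ
  isProbabilityMeasure : IsProbabilityMeasure ν
  measure_singleton : ∀ x, ν {x} = 0
  integral_eq : ∀ f : Seg α β → ℝ, IsBV f → ∫ x, f x ∂ν = Λ f

variable {σ M}

namespace LimitFunctional

variable {ε : ℕ → ℝ} {Λ : (Seg α β → ℝ) → ℝ} (E : LimitFunctional σ M ω ε Λ) {f h : Seg α β → ℝ}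
include E

/-- Within one atom a point has at most one preimage, so the image of the indicator is bounded by
the product of the weights, which is then compared with the infimum of `L^(N) 1`. -/
theorem map_indicator_le {N : ℕ} {Z J : Set (Seg α β)} (hZ : Z ∈ iterAtoms σ M N ω) (hJ : J ⊆ Z)
    (hJo : J.OrdConnected) :
    Λ (J.indicator fun _ => 1) ≤ normProd σ M N ω / einf (iterL σ M N ω 1) := by
  have h0 := E.good.einf_iterL_one_pos N
  refine E.le_of_ae_le (N := N) (isBV_indicator_of_ordConnected hJo) ?_
  filter_upwards [ae_iterL_indicator_le σ M N ω hZ hJ,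
    (isBV_iterL σ M N ω isBV_one).ae_einf_le] with x h1 h2
  refine h1.trans ?_
  rw [div_mul_eq_mul_div, le_div_iff₀ h0]
  exact mul_le_mul_of_nonneg_left h2 (normProd_nonneg σ M N ω)

theorem map_indicator_Ioc {x y : Seg α β} (hxy : x ≤ y) :
    Λ ((Ioc x y).indicator fun _ => 1) =
      Λ ((Iic y).indicator fun _ => 1) - Λ ((Iic x).indicator fun _ => 1) := by
  rw [← E.map_sub (isBV_indicator_of_ordConnected ordConnected_Iic)
    (isBV_indicator_of_ordConnected ordConnected_Iic)]
  congr 1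
  ext z
  by_cases h1 : z ≤ x
  · simp [indicator, h1, h1.trans hxy, not_lt.2 h1]
  · simp [indicator, h1, not_le.1 h1]

theorem monotone_distribution : Monotone fun x => Λ ((Iic x).indicator fun _ => 1) :=
  fun _ _ hxy => E.mono (isBV_indicator_of_ordConnected ordConnected_Iic)
    (isBV_indicator_of_ordConnected ordConnected_Iic) (ae_of_all _ fun z =>
      indicator_le_indicator_of_subset (Iic_subset_Iic.2 hxy) (fun _ => zero_le_one) z)

/-- On either side of a point a one-sided neighbourhood lies in a single atom of level `N`, and the
mass of atoms can be made arbitrarily small. -/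
theorem continuous_distribution (hρ : ∀ δ > 0, ∃ N,
    normProd σ M N ω / einf (iterL σ M N ω 1) < δ) :
    Continuous fun x => Λ ((Iic x).indicator fun _ => 1) := by
  have hsmall : ∀ {N : ℕ} {Z : Set (Seg α β)} {x y : Seg α β}, Z ∈ iterAtoms σ M N ω → x ≤ y →
      Ioo x y ⊆ Z → Λ ((Iic y).indicator fun _ => 1) - Λ ((Iic x).indicator fun _ => 1) ≤
        normProd σ M N ω / einf (iterL σ M N ω 1) := by
    intro N Z x y hZ hxy hsub
    rw [← E.map_indicator_Ioc hxy]
    refine le_of_eq_of_le (E.congr (isBV_indicator_of_ordConnected ordConnected_Ioc)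
      (isBV_indicator_of_ordConnected ordConnected_Ioo) ?_)
      (E.map_indicator_le hZ hsub ordConnected_Ioo)
    exact indicator_ae_eq_of_ae_eq_set Ioo_ae_eq_Ioc.symm
  rw [continuous_iff_continuousAt]
  intro x
  refine (continuousAt_iff_continuous_left'_right').2 ⟨?_, ?_⟩
  · rcases (lo_le x).eq_or_lt with rfl | hx
    · have : Iio (lo α β) = ∅ := by
        ext z
        simpa using lo_le z
      rw [this]
      exact continuousWithinAt_of_notMem_closure (by simp)
    rw [Metric.continuousWithinAt_iff']
    intro δ hδ
    obtain ⟨N, hN⟩ := hρ δ hδ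
    obtain ⟨Z, hZ, v, hv, hsub⟩ := (isMonotonePartition_iter σ M N ω).exists_Ioo_left_subset hx
    filter_upwards [Ioo_mem_nhdsLT hv] with y hy
    rw [Real.dist_eq, abs_sub_comm, abs_of_nonneg (sub_nonneg.2 (E.monotone_distribution hy.2.le))]
    exact (hsmall hZ hy.2.le ((Ioo_subset_Ioo_left hy.1.le).trans hsub)).trans_lt hN
  · rcases (le_hi x).eq_or_lt with rfl | hx
    · have : Ioi (hi α β) = ∅ := by
        ext z
        simpa using le_hi z
      rw [this]
      exact continuousWithinAt_of_notMem_closure (by simp)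
    rw [Metric.continuousWithinAt_iff']
    intro δ hδ
    obtain ⟨N, hN⟩ := hρ δ hδ
    obtain ⟨Z, hZ, v, hv, hsub⟩ := (isMonotonePartition_iter σ M N ω).exists_Ioo_right_subset hx
    filter_upwards [Ioo_mem_nhdsGT hv] with y hy
    rw [Real.dist_eq, abs_of_nonneg (sub_nonneg.2 (E.monotone_distribution hy.1.le))]
    exact (hsmall hZ hy.1.le ((Ioo_subset_Ioo_right hy.2.le).trans hsub)).trans_lt hN

/-- The measure is the Stieltjes measure of the distribution function of `Λ`, and continuity makes
points null. Agreement with `Λ` holds for indicators of intervals, hence for step functions, hence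
for their uniform limits, the BV functions. -/
theorem exists_represents (hρ : ∀ δ > 0, ∃ N,
    normProd σ M N ω / einf (iterL σ M N ω 1) < δ) : ∃ ν, Represents σ M ω ε Λ ν := by
  have hcont := E.continuous_distribution hρ
  let F : StieltjesFunction (Seg α β) :=
    ⟨fun x => Λ ((Iic x).indicator fun _ => 1), E.monotone_distribution,
      fun x => hcont.continuousWithinAt⟩
  have hlo : F (lo α β) = 0 := by
    have : Λ ((Iic (lo α β)).indicator fun _ => 1) = Λ fun _ => 0 := by
      refine E.congr (isBV_indicator_of_ordConnected ordConnected_Iic) (isBV_const 0) ?_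
      refine ae_of_countable ((countable_singleton (lo α β)).mono fun x hx => ?_)
      by_contra hcon
      have : x ∉ Iic (lo α β) := fun h => hcon (le_antisymm h (lo_le x))
      exact hx (indicator_of_notMem this _)
    exact this.trans (E.map_const 0)
  have hhi : F (hi α β) = 1 := by
    have : (Iic (hi α β)).indicator (fun _ => (1 : ℝ)) = 1 := by
      ext x
      simp [indicator, le_hi x]
    exact (congrArg Λ this).trans E.map_one
  have hsing : ∀ x, F.measure {x} = 0 := by
    intro x
    rw [F.measure_singleton, ContinuousWithinAt.leftLim_eq (f := F) hcont.continuousWithinAt]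
    simp
  have hprob : IsProbabilityMeasure F.measure := by
    refine ⟨?_⟩
    have hu : (univ : Set (Seg α β)) = {lo α β} ∪ Ioc (lo α β) (hi α β) := by
      ext x
      simp only [mem_univ, mem_union, mem_singleton_iff, mem_Ioc, true_iff]
      rcases (lo_le x).eq_or_lt with h | h
      · exact Or.inl h.symm
      · exact Or.inr ⟨h, le_hi x⟩
    rw [hu, measure_union (by simp) measurableSet_Ioc, hsing, F.measure_Ioc, hlo, hhi]
    simp
  refine ⟨F.measure, E, hprob, hsing, fun f hf => ?_⟩
  have hJ : ∀ J : Set (Seg α β), J.OrdConnected →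
      ∫ x, J.indicator (fun _ => (1 : ℝ)) x ∂F.measure = Λ (J.indicator fun _ => 1) := by
    intro J hJ
    obtain ⟨a, b, hab, hc⟩ := exists_Ioc_ae_eq hJ
    have hsub : {x | J.indicator (fun _ => (1 : ℝ)) x ≠ (Ioc a b).indicator (fun _ => 1) x} ⊆
        {x | ¬ (x ∈ J ↔ x ∈ Ioc a b)} := by
      intro x hx hcon
      exact hx (by simp only [indicator, hcon])
    have : NullSingletonClass F.measure := ⟨hsing⟩
    rw [integral_congr_ae ((hc.mono hsub).measure_zero F.measure),
      E.congr (isBV_indicator_of_ordConnected hJ) (isBV_indicator_of_ordConnected ordConnected_Ioc)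
        (ae_of_countable (hc.mono hsub)), E.map_indicator_Ioc hab,
      integral_indicator measurableSet_Ioc, setIntegral_const, smul_eq_mul, mul_one,
      measureReal_def, F.measure_Ioc, ENNReal.toReal_ofReal (sub_nonneg.2 (F.mono hab))]
  refine eq_of_forall_dist_le fun δ hδ => ?_
  obtain ⟨t, c, J, hJo, hs⟩ := hf.exists_step (half_pos hδ)
  have hbi : ∀ i ∈ t, IsBV fun x => c i * (J i).indicator (fun _ => (1 : ℝ)) x := fun i _ =>
    (isBV_indicator_of_ordConnected (hJo i)).const_mul _
  have hsBV := IsBV.finset_sum t hbi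
  have h1 := E.abs_sub_le hf hsBV hs
  have h2 : |∫ x, f x ∂F.measure - ∫ x, ∑ i ∈ t, c i * (J i).indicator (fun _ => (1 : ℝ)) x
      ∂F.measure| ≤ δ / 2 := by
    rw [← integral_sub (hf.integrable _) (hsBV.integrable _)]
    have := norm_integral_le_of_norm_le_const (μ := F.measure) (C := δ / 2)
      (ae_of_all _ fun x => (Real.norm_eq_abs _).trans_le (hs x))
    simpa using this
  have h3 : ∫ x, ∑ i ∈ t, c i * (J i).indicator (fun _ => (1 : ℝ)) x ∂F.measure =
      Λ fun x => ∑ i ∈ t, c i * (J i).indicator (fun _ => (1 : ℝ)) x := by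
    rw [integral_finsetSum _ fun i hi => (hbi i hi).integrable _, E.map_sum t hbi]
    refine Finset.sum_congr rfl fun i _ => ?_
    rw [integral_const_mul, hJ _ (hJo i),
      E.map_const_mul _ (isBV_indicator_of_ordConnected (hJo i))]
  rw [Real.dist_eq]
  rw [h3] at h2
  rw [abs_sub_comm] at h1
  exact (_root_.abs_sub_le _ _ _).trans ((_root_.add_le_add h2 h1).trans_eq (add_halves δ))

end LimitFunctional

namespace Represents

variable {ε : ℕ → ℝ} {Λ : (Seg α β → ℝ) → ℝ} {ν : Measure (Seg α β)}
  (R : Represents σ M ω ε Λ ν) {f h : Seg α β → ℝ}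
include R

theorem nullSingletonClass : NullSingletonClass ν := ⟨R.measure_singleton⟩

/-- The inequality fails at most on a countable set, which a non-atomic measure ignores; no absolute
continuity is needed. -/
theorem ae_of_leb (hf : IsBV f) (hh : IsBV h) (hle : f ≤ᵐ[leb] h) : f ≤ᵐ[ν] h := by
  have := R.nullSingletonClass
  have h1 := (hf.countable_of_ae_le hh hle).measure_zero ν
  refine measure_mono_null (fun x hx => ?_) h1
  exact hx

theorem ae_eq_of_leb (hf : IsBV f) (hh : IsBV h) (he : f =ᵐ[leb] h) : f =ᵐ[ν] h :=
  (R.ae_of_leb hf hh he.le).antisymm (R.ae_of_leb hh hf he.symm.le)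

/-- The transfer operator annihilates functions supported in the hole, so after one step the
functional is seen to vanish on them. -/
theorem measure_hole : ν (M ω).H = 0 := by
  have := R.isProbabilityMeasure
  obtain ⟨J, hJ, hJo, hH⟩ := (M ω).hole_intervals
  rw [hH, sUnion_eq_biUnion, measure_biUnion_null_iff hJ.countable]
  intro Z hZ
  have h1 : Λ (Z.indicator fun _ => 1) ≤ 0 := by
    refine R.functional.le_of_ae_le (N := 1) (isBV_indicator_of_ordConnected (hJo Z hZ)) ?_
    rw [iterL_one, (M ω).transfer_of_eq_zero fun x hx => ?_]
    · simp
    · refine indicator_of_notMem (fun hxZ => hx ?_) _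
      rw [hH]
      exact mem_sUnion_of_mem hxZ hZ
  rw [← R.integral_eq _ (isBV_indicator_of_ordConnected (hJo Z hZ)),
    integral_indicator (hJo Z hZ).measurableSet, setIntegral_const, smul_eq_mul, mul_one] at h1
  exact (measureReal_eq_zero_iff).1 (le_antisymm h1 measureReal_nonneg)

theorem integral_iterL {n : ℕ} {ε' : ℕ → ℝ} {Λ' : (Seg α β → ℝ) → ℝ} {ν' : Measure (Seg α β)}
    (R' : Represents σ M (σ^[n] ω) ε' Λ' ν') (hf : IsBV f) :
    ∫ x, iterL σ M n ω f x ∂ν' = (∫ x, iterL σ M n ω 1 x ∂ν') * ∫ x, f x ∂ν := by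
  rw [R'.integral_eq _ (isBV_iterL σ M n ω hf), R'.integral_eq _ (isBV_iterL σ M n ω isBV_one),
    R.integral_eq _ hf, R.functional.map_iterL R'.functional hf, mul_comm]

theorem einf_le_integral (hf : IsBV f) : einf f ≤ ∫ x, f x ∂ν := by
  rw [R.integral_eq f hf]
  exact R.functional.einf_le hf

theorem integral_iterL_one_pos {n : ℕ} {ε' : ℕ → ℝ} {Λ' : (Seg α β → ℝ) → ℝ}
    {ν' : Measure (Seg α β)} (R' : Represents σ M (σ^[n] ω) ε' Λ' ν') :
    0 < ∫ x, iterL σ M n ω 1 x ∂ν' :=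
  (R.functional.good.einf_iterL_one_pos n).trans_le
    (R'.einf_le_integral (isBV_iterL σ M n ω isBV_one))

/-- The push-forward of a density under the maps is given by the transfer operators. -/
theorem map_withDensity {n : ℕ} {ε' : ℕ → ℝ} {Λ' : (Seg α β → ℝ) → ℝ} {ν' : Measure (Seg α β)}
    (R' : Represents σ M (σ^[n] ω) ε' Λ' ν') (hf : IsBV f) (hf0 : ∀ x, 0 ≤ f x) :
    (ν.withDensity fun x => ENNReal.ofReal (f x)).map (iterT σ M n ω) =
      ν'.withDensity fun x => ENNReal.ofReal
        ((∫ x, iterL σ M n ω 1 x ∂ν')⁻¹ * iterL σ M n ω f x) := by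
  have := R.isProbabilityMeasure
  have := R'.isProbabilityMeasure
  have hpos := R.integral_iterL_one_pos R'
  have hF := isBV_iterL σ M n ω hf
  have hF0 : ∀ᵐ x ∂ν', 0 ≤ (∫ x, iterL σ M n ω 1 x ∂ν')⁻¹ * iterL σ M n ω f x := by
    filter_upwards [R'.ae_of_leb (isBV_const 0) hF
      (iterL_nonneg σ M n ω hf (ae_of_all _ hf0))] with x hx
    exact mul_nonneg (inv_nonneg.2 hpos.le) hx
  have : IsFiniteMeasure (ν.withDensity fun x => ENNReal.ofReal (f x)) :=
    isFiniteMeasure_withDensity_ofReal (hf.integrable ν).2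
  refine Measure.ext_of_Iic _ _ fun b => ?_
  rw [Measure.map_apply (measurable_iterT n ω) measurableSet_Iic,
    withDensity_apply _ measurableSet_Iic,
    withDensity_apply _ (measurable_iterT n ω measurableSet_Iic),
    ← ofReal_integral_eq_lintegral_ofReal ((hF.const_mul _).integrable ν').integrableOn
      (ae_restrict_of_ae hF0),
    ← ofReal_integral_eq_lintegral_ofReal (hf.integrable ν).integrableOn
      (ae_of_all _ hf0), ← integral_indicator measurableSet_Iic,
    ← integral_indicator (measurable_iterT n ω measurableSet_Iic)]
  congr 1
  have h1 : (iterT σ M n ω ⁻¹' Iic b).indicator (fun x => f x) =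
      fun x => (Iic b).indicator (fun _ => (1 : ℝ)) (iterT σ M n ω x) * f x := by
    ext x
    by_cases hx : iterT σ M n ω x ≤ b <;> simp [indicator, hx]
  -- The preimage of a half-line is a finite union of intervals, so this product is BV and
  -- conformality applies to it. Half-lines determine the measures.
  have h2 : IsBV fun x => (Iic b).indicator (fun _ => (1 : ℝ)) (iterT σ M n ω x) * f x :=
    (isBV_indicator (isFiniteUnionOfIntervals_preimage_iterT n ω ordConnected_Iic)).mul hf
  have h3 := R.integral_iterL R' h2
  rw [iterL_comp_mul] at h3
  rw [h1, eq_comm, ← mul_right_inj' hpos.ne', ← h3, ← integral_const_mul]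
  refine integral_congr_ae (ae_of_all _ fun x => ?_)
  by_cases hx : x ≤ b
  · simp only [indicator, mem_Iic, hx, if_true]
    field_simp
  · simp [indicator, hx]

/-- The identity of push-forward measures carries the duality from BV observables over to all
integrable ones. -/
theorem integral_comp_mul_of_nonneg {n : ℕ} {ε' : ℕ → ℝ} {Λ' : (Seg α β → ℝ) → ℝ}
    {ν' : Measure (Seg α β)} (R' : Represents σ M (σ^[n] ω) ε' Λ' ν') (hf : IsBV f)
    (hf0 : ∀ x, 0 ≤ f x) {φ : Seg α β → ℝ} (hφ : Integrable φ ν') :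
    Integrable (fun x => φ (iterT σ M n ω x) * f x) ν ∧
    ∫ x, φ (iterT σ M n ω x) * f x ∂ν =
      (∫ x, iterL σ M n ω 1 x ∂ν')⁻¹ * ∫ x, φ x * iterL σ M n ω f x ∂ν' := by
  have := R'.isProbabilityMeasure
  have hpos := R.integral_iterL_one_pos R'
  have hF := isBV_iterL σ M n ω hf
  have hF0 : ∀ᵐ x ∂ν', 0 ≤ (∫ x, iterL σ M n ω 1 x ∂ν')⁻¹ * iterL σ M n ω f x := by
    filter_upwards [R'.ae_of_leb (isBV_const 0) hF
      (iterL_nonneg σ M n ω hf (ae_of_all _ hf0))] with x hx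
    exact mul_nonneg (inv_nonneg.2 hpos.le) hx
  have hmap := R.map_withDensity R' hf hf0
  obtain ⟨K, hK0, hK⟩ := hF.bounded
  have hint : Integrable (fun x => φ x * iterL σ M n ω f x) ν' :=
    hφ.mul_bdd hF.measurable.aestronglyMeasurable (ae_of_all _ hK)
  have hfm := hf.measurable.ennreal_ofReal
  have hFm := ((hF.const_mul (∫ x, iterL σ M n ω 1 x ∂ν')⁻¹).measurable).ennreal_ofReal
  have hi1 : Integrable φ (ν'.withDensity fun x => ENNReal.ofReal
        ((∫ x, iterL σ M n ω 1 x ∂ν')⁻¹ * iterL σ M n ω f x)) := by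
    rw [integrable_withDensity_iff_integrable_smul' hFm (ae_of_all _ fun _ => ENNReal.ofReal_lt_top)]
    refine (hint.const_mul (∫ x, iterL σ M n ω 1 x ∂ν')⁻¹).congr ?_
    filter_upwards [hF0] with x hx
    rw [ENNReal.toReal_ofReal hx, smul_eq_mul]
    ring
  rw [← hmap, integrable_map_measure (hmap ▸ hi1.aestronglyMeasurable)
    (measurable_iterT n ω).aemeasurable,
    integrable_withDensity_iff_integrable_smul' hfm (ae_of_all _ fun _ => ENNReal.ofReal_lt_top)]
    at hi1
  have e1 : ∀ x, (ENNReal.ofReal (f x)).toReal • (φ ∘ iterT σ M n ω) x =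
      φ (iterT σ M n ω x) * f x := fun x => by
    rw [ENNReal.toReal_ofReal (hf0 x), smul_eq_mul, mul_comm, Function.comp_apply]
  simp only [e1] at hi1
  refine ⟨hi1, ?_⟩
  have h2 : ∫ y, φ y ∂((ν.withDensity fun x => ENNReal.ofReal (f x)).map (iterT σ M n ω)) =
      ∫ x, φ (iterT σ M n ω x) * f x ∂ν := by
    rw [integral_map (measurable_iterT n ω).aemeasurable,
      integral_withDensity_eq_integral_toReal_smul hfm (ae_of_all _ fun _ => ENNReal.ofReal_lt_top)]
    · exact integral_congr_ae (ae_of_all _ fun x => e1 x)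
    · rw [hmap]
      refine AEStronglyMeasurable.mono_ac (withDensity_absolutelyContinuous _ _)
        hφ.aestronglyMeasurable
  rw [← h2, hmap, integral_withDensity_eq_integral_toReal_smul hFm
    (ae_of_all _ fun _ => ENNReal.ofReal_lt_top), ← integral_const_mul]
  refine integral_congr_ae ?_
  filter_upwards [hF0] with x hx
  rw [ENNReal.toReal_ofReal hx, smul_eq_mul]
  ring

theorem integral_comp_mul {n : ℕ} {ε' : ℕ → ℝ} {Λ' : (Seg α β → ℝ) → ℝ}
    {ν' : Measure (Seg α β)} (R' : Represents σ M (σ^[n] ω) ε' Λ' ν') (hf : IsBV f)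
    {φ : Seg α β → ℝ} (hφ : Integrable φ ν') :
    ∫ x, φ (iterT σ M n ω x) * f x ∂ν =
      (∫ x, iterL σ M n ω 1 x ∂ν')⁻¹ * ∫ x, φ x * iterL σ M n ω f x ∂ν' := by
  have := R'.isProbabilityMeasure
  -- Writing `f` as `(f + K) - K` reduces to nonnegative BV functions.
  obtain ⟨K, hK0, hK⟩ := hf.bounded
  obtain ⟨h1, h2⟩ := R.integral_comp_mul_of_nonneg R' (hf.add (isBV_const K))
    (fun x => by linarith [(abs_le.1 (hK x)).1]) hφ
  obtain ⟨h3, h4⟩ := R.integral_comp_mul_of_nonneg R' (isBV_const K) (fun _ => hK0) hφ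
  have e : ∀ x, φ (iterT σ M n ω x) * f x =
      φ (iterT σ M n ω x) * (f x + K) - φ (iterT σ M n ω x) * K := fun x => by ring
  simp only [e]
  have hb : ∀ {k : Seg α β → ℝ}, IsBV k → Integrable (fun x => φ x * iterL σ M n ω k x) ν' := by
    intro k hk
    obtain ⟨K', -, hK'⟩ := (isBV_iterL σ M n ω hk).bounded
    exact hφ.mul_bdd (isBV_iterL σ M n ω hk).measurable.aestronglyMeasurable (ae_of_all _ hK')
  rw [integral_sub h1 h3, h2, h4, ← mul_sub,
    ← integral_sub (hb (hf.add (isBV_const K))) (hb (isBV_const K))]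
  congr 1
  refine integral_congr_ae (ae_of_all _ fun x => ?_)
  simp only [iterL_add_fun]
  ring

end Represents

end Functional

end RandomInterval
end

/-! ### The equivariant densities as limits from the past. -/

noncomputable section
namespace RandomInterval
variable {α β : ℝ} [Fact (α < β)]

theorem abs_rep_sub_rep_le {f h : Seg α β → ℝ} (hf : IsBV f) (hh : IsBV h) {δ : ℝ}
    (hδ : ∀ᵐ x ∂(leb : Measure (Seg α β)), |f x - h x| ≤ δ) (x : Seg α β) :
    |rep f x - rep h x| ≤ δ := by
  obtain ⟨l, hl, hlim⟩ := exists_filter_rep x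
  have := le_of_tendsto_of_frequently_le (c := -δ) ((hlim f hf).sub (hlim h hh)).abs.neg
    (hl _ (hδ.mono fun y hy => neg_le_neg hy))
  linarith

theorem IsBV.var_eq (f : Seg α β → ℝ) (hf : IsBV f) : eVariationOn (rep f) univ =
    ENNReal.ofReal (var f) := by
  rw [var, ENNReal.ofReal_toReal hf.eVar_ne_top, eVar_eq_rep hf]

theorem IsBV.var_le_of_eVariationOn_le {f : Seg α β → ℝ} {B : ℝ} (hB : 0 ≤ B)
    (h : eVariationOn f univ ≤ ENNReal.ofReal B) : IsBV f ∧ var f ≤ B := by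
  have h1 : IsBV f := ne_top_of_le_ne_top ENNReal.ofReal_ne_top h
  refine ⟨h1, ?_⟩
  rw [var]
  refine ENNReal.toReal_le_of_le_ofReal hB (le_trans ?_ h)
  exact eVar_le_of_ae_eq (EventuallyEq.refl _ _)

/-- Limits of functions of bounded variation. -/
theorem eVariationOn_le_of_tendsto_rep {F : ℕ → Seg α β → ℝ} (hF : ∀ N, IsBV (F N)) {B : ℝ}
    (hB : ∀ N, var (F N) ≤ B) {f : Seg α β → ℝ}
    (hlim : ∀ x, Tendsto (fun N => rep (F N) x) atTop (𝓝 (f x))) :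
    eVariationOn f univ ≤ ENNReal.ofReal B := by
  by_contra hcon
  obtain ⟨N, hN⟩ := (eVariationOn.lowerSemicontinuous_aux (F := fun N => rep (F N)) (p := atTop)
    (s := univ) (fun x _ => hlim x) (not_le.1 hcon)).exists
  rw [IsBV.var_eq _ (hF N)] at hN
  exact absurd (ENNReal.ofReal_le_ofReal (hB N)) (not_le.2 hN)

section Density

variable {Ω : Type*} [MeasurableSpace Ω] (σ : Ω ≃ᵐ Ω) (M : Ω → WeightedOpenMap α β)

/-- The normalized image of `1` from time `-N`. -/
def pastDensity (ω : Ω) (N : ℕ) : Seg α β → ℝ := fun x =>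
  iterL σ M N (σ.symm^[N] ω) 1 x / einf (iterL σ M N (σ.symm^[N] ω) 1)

/-- `q` is the limit of the normalized images of `1` from the past. -/
structure IsDensity (ω : Ω) (q : Seg α β → ℝ) : Prop where
  isBV : IsBV q
  einf_eq : einf q = 1
  tendsto : Tendsto (fun N => supNorm fun x => pastDensity σ M ω N x - q x) atTop (𝓝 0)

variable {σ M} {ω : Ω}

theorem pastDensity_eq (ω : Ω) (N : ℕ) : pastDensity σ M ω N = fun x =>
    (einf (iterL σ M N (σ.symm^[N] ω) 1))⁻¹ * iterL σ M N (σ.symm^[N] ω) 1 x :=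
  funext fun _ => div_eq_inv_mul _ _

theorem isBV_pastDensity (ω : Ω) (N : ℕ) : IsBV (pastDensity σ M ω N) := by
  rw [pastDensity_eq]
  exact (isBV_iterL σ M N _ isBV_one).const_mul _

theorem einf_pastDensity (hω : Good σ M ω) (N : ℕ) : einf (pastDensity σ M ω N) = 1 := by
  have h := (hω.symm_iterate N).einf_iterL_one_pos N
  rw [pastDensity_eq, (isBV_iterL σ M N _ isBV_one).einf_const_mul (inv_nonneg.2 h.le),
    inv_mul_cancel₀ h.ne']

theorem var_pastDensity_le (hω : Good σ M ω) (N : ℕ) {B : ℝ}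
    (hB : iterL σ M N (σ.symm^[N] ω) 1 ∈ (cone0 B : Set (Seg α β → ℝ))) :
    var (pastDensity σ M ω N) ≤ B := by
  have h := (hω.symm_iterate N).einf_iterL_one_pos N
  rw [pastDensity_eq]
  refine (cone0_const_mul (inv_nonneg.2 h.le) hB).2.trans_eq ?_
  rw [hB.1.einf_const_mul (inv_nonneg.2 h.le), inv_mul_cancel₀ h.ne', mul_one]

theorem transfer_pastDensity (hω : Good σ M ω) (N : ℕ) :
    einf ((M ω).transfer (pastDensity σ M ω N)) = einf (iterL σ M (N + 1) (σ.symm^[N] ω) 1) /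
      einf (iterL σ M N (σ.symm^[N] ω) 1) ∧
    (M ω).transfer (pastDensity σ M ω N) = fun x =>
      einf ((M ω).transfer (pastDensity σ M ω N)) * pastDensity σ M (σ ω) (N + 1) x := by
  have h := (hω.symm_iterate N).einf_iterL_one_pos N
  have h' := (hω.symm_iterate N).einf_iterL_one_pos (N + 1)
  have e : (M ω).transfer (pastDensity σ M ω N) = fun x =>
      (einf (iterL σ M N (σ.symm^[N] ω) 1))⁻¹ * iterL σ M (N + 1) (σ.symm^[N] ω) 1 x := by
    rw [pastDensity_eq, iterL_add, iterate_symm_iterate, ← iterL_one σ M, iterL_const_mul]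
  have e1 : einf ((M ω).transfer (pastDensity σ M ω N)) =
      einf (iterL σ M (N + 1) (σ.symm^[N] ω) 1) / einf (iterL σ M N (σ.symm^[N] ω) 1) := by
    rw [e, (isBV_iterL σ M (N + 1) _ isBV_one).einf_const_mul (inv_nonneg.2 h.le), div_eq_inv_mul]
  refine ⟨e1, ?_⟩
  rw [e1, e]
  ext x
  rw [pastDensity, Function.iterate_succ_apply, σ.symm_apply_apply]
  field_simp

/-- The normalized images started at times `-N` and `-(N + k)` both result from the last `N` steps,
applied to functions of the orbit cone. Having equal infima, they differ by a factor of at most `exp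
(θ N)` in either direction. With the uniform variation bound this is a Cauchy property in the sup
norm, and lower semicontinuity of variation keeps the limit in BV. -/
theorem exists_isDensity (hω : Good σ M ω) {θ : ℕ → ℝ} (hθ : Tendsto θ atTop (𝓝 0))
    (hcomp : ∀ᶠ N in atTop, ∀ f ∈ orbitCone σ M (σ.symm^[N] ω),
      ∀ h ∈ orbitCone σ M (σ.symm^[N] ω), ∃ l u, 0 < l ∧ l ≤ u ∧
      (∀ᵐ x ∂(leb : Measure (Seg α β)), l * iterL σ M N (σ.symm^[N] ω) f x ≤
          iterL σ M N (σ.symm^[N] ω) h x ∧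
        iterL σ M N (σ.symm^[N] ω) h x ≤ u * iterL σ M N (σ.symm^[N] ω) f x) ∧
      Real.log (u / l) ≤ θ N)
    {B : ℝ} (hB : ∀ N, var (pastDensity σ M ω N) ≤ B) : ∃ q, IsDensity σ M ω q := by
  have hB0 : 0 ≤ B := (var_nonneg _).trans (hB 0)
  have hbv := isBV_pastDensity (σ := σ) (M := M) ω
  have hcauchy : ∀ᶠ N in atTop, ∀ k, ∀ᵐ x ∂(leb : Measure (Seg α β)),
      |pastDensity σ M ω (N + k) x - pastDensity σ M ω N x| ≤
        (1 + B) * (Real.exp (θ N) - 1) := by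
    filter_upwards [hcomp] with N hN k
    have e : σ^[k] (σ.symm^[N + k] ω) = σ.symm^[N] ω := by
      rw [add_comm, Function.iterate_add_apply, iterate_symm_iterate]
    have hmem := iterL_mem_orbitCone σ M (one_mem_orbitCone σ M (ω := σ.symm^[N + k] ω)) k
    rw [e] at hmem
    obtain ⟨l, u, hl, hlu, hs, hle⟩ := hN 1 (one_mem_orbitCone σ M) _ hmem
    have e2 : iterL σ M N (σ.symm^[N] ω) (iterL σ M k (σ.symm^[N + k] ω) 1) =
        iterL σ M (N + k) (σ.symm^[N + k] ω) 1 := by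
      rw [add_comm N k, iterL_add, add_comm k N, e]
    rw [e2] at hs
    have h1 := (hω.symm_iterate N).einf_iterL_one_pos N
    have h2 := (hω.symm_iterate (N + k)).einf_iterL_one_pos (N + k)
    have hb1 := isBV_iterL σ M N (σ.symm^[N] ω) (isBV_one (α := α) (β := β))
    have hb2 := isBV_iterL σ M (N + k) (σ.symm^[N + k] ω) (isBV_one (α := α) (β := β))
    have hu : 0 < u := hl.trans_le hlu
    have h3 : l * einf (iterL σ M N (σ.symm^[N] ω) 1) ≤
        einf (iterL σ M (N + k) (σ.symm^[N + k] ω) 1) := by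
      rw [← hb1.einf_const_mul hl.le]
      exact (hb1.const_mul l).einf_mono hb2 (hs.mono fun x hx => hx.1)
    have h4 : einf (iterL σ M (N + k) (σ.symm^[N + k] ω) 1) ≤
        u * einf (iterL σ M N (σ.symm^[N] ω) 1) := by
      rw [← hb1.einf_const_mul hu.le]
      exact hb2.einf_mono (hb1.const_mul u) (hs.mono fun x hx => hx.2)
    have hexp : u / l ≤ Real.exp (θ N) := (Real.log_le_iff_le_exp (div_pos hu hl)).1 hle
    have hvar := hB N
    filter_upwards [hs, (hbv N).ae_le_einf_add_var, (hbv N).ae_einf_le] with x h5 h6 h7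
    rw [einf_pastDensity hω] at h6 h7
    have hq : pastDensity σ M ω N x ≤ 1 + B := by linarith
    have hup : pastDensity σ M ω (N + k) x ≤ u / l * pastDensity σ M ω N x := by
      unfold pastDensity at h7 ⊢
      rw [div_mul_div_comm, div_le_div_iff₀ h2 (by positivity)]
      have h8 : 0 < iterL σ M N (σ.symm^[N] ω) 1 x := by
        rw [le_div_iff₀ h1] at h7
        linarith
      calc _ ≤ (u * iterL σ M N (σ.symm^[N] ω) 1 x) *
            (l * einf (iterL σ M N (σ.symm^[N] ω) 1)) :=
            mul_le_mul_of_nonneg_right h5.2 (by positivity)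
        _ ≤ _ := mul_le_mul_of_nonneg_left h3 (by positivity)
    have hlow : pastDensity σ M ω N x ≤ u / l * pastDensity σ M ω (N + k) x := by
      unfold pastDensity at h7 ⊢
      rw [div_mul_div_comm, div_le_div_iff₀ h1 (by positivity)]
      have h8 : 0 < iterL σ M N (σ.symm^[N] ω) 1 x := by
        rw [le_div_iff₀ h1] at h7
        linarith
      calc _ ≤ iterL σ M N (σ.symm^[N] ω) 1 x *
            (l * (u * einf (iterL σ M N (σ.symm^[N] ω) 1))) :=
            mul_le_mul_of_nonneg_left (mul_le_mul_of_nonneg_left h4 hl.le) h8.le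
        _ = u * (l * iterL σ M N (σ.symm^[N] ω) 1 x) *
            einf (iterL σ M N (σ.symm^[N] ω) 1) := by ring
        _ ≤ _ := mul_le_mul_of_nonneg_right (mul_le_mul_of_nonneg_left h5.1 hu.le) h1.le
    have hul : 1 ≤ u / l := (one_le_div hl).2 hlu
    have hd : u / l - 1 ≤ Real.exp (θ N) - 1 := by linarith
    have hprod : (u / l - 1) * pastDensity σ M ω N x ≤ (1 + B) * (Real.exp (θ N) - 1) := by
      rw [mul_comm]
      exact mul_le_mul hq hd (by linarith) (by linarith)
    rw [abs_le]
    constructor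
    · rcases le_total (pastDensity σ M ω N x) (pastDensity σ M ω (N + k) x) with h9 | h9
      · nlinarith
      · nlinarith
    · linarith
  set δ : ℕ → ℝ := fun N => (1 + B) * (Real.exp (θ N) - 1) with hδdef
  have hδ : Tendsto δ atTop (𝓝 0) := by
    simpa using ((Real.continuous_exp.tendsto 0).comp hθ).sub_const 1 |>.const_mul (1 + B)
  have hrep : ∀ᶠ N in atTop, ∀ x, ∀ k,
      |rep (pastDensity σ M ω (N + k)) x - rep (pastDensity σ M ω N) x| ≤ δ N := by
    filter_upwards [hcauchy] with N hN x k
    exact abs_rep_sub_rep_le (hbv _) (hbv _) (hN k) x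
  -- For canonical representatives the estimates hold at every point, so the limit is defined
  -- everywhere.
  have hlim : ∀ x, ∃ y, Tendsto (fun N => rep (pastDensity σ M ω N) x) atTop (𝓝 y) := by
    intro x
    refine cauchySeq_tendsto_of_complete (Metric.cauchySeq_iff'.2 fun ε hε => ?_)
    obtain ⟨N, h1, h2⟩ := (hrep.and (hδ.eventually_lt_const hε)).exists
    refine ⟨N, fun n hn => ?_⟩
    obtain ⟨k, rfl⟩ := Nat.exists_eq_add_of_le hn
    exact (h1 x k).trans_lt h2
  choose q hq using hlim
  obtain ⟨hqbv, -⟩ := IsBV.var_le_of_eVariationOn_le hB0 (eVariationOn_le_of_tendsto_rep hbv hB hq)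
  have hsup : ∀ᶠ N in atTop, supNorm (fun x => pastDensity σ M ω N x - q x) ≤ δ N := by
    filter_upwards [hrep] with N hN
    refine ((hbv N).sub hqbv).supNorm_le ?_
    filter_upwards [rep_ae_eq (hbv N)] with x hx
    rw [← hx, abs_sub_comm]
    have h1 : Tendsto (fun k => |rep (pastDensity σ M ω (N + k)) x -
        rep (pastDensity σ M ω N) x|) atTop (𝓝 |q x - rep (pastDensity σ M ω N) x|) :=
      (((hq x).comp (tendsto_add_atTop_nat N)).congr fun k => by
        simp [add_comm]).sub_const _ |>.abs
    exact le_of_tendsto' h1 fun k => hN x k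
  have htend : Tendsto (fun N => supNorm fun x => pastDensity σ M ω N x - q x) atTop (𝓝 0) :=
    squeeze_zero' (Eventually.of_forall fun N => ((hbv N).sub hqbv).supNorm_nonneg) hsup hδ
  refine ⟨q, hqbv, ?_, htend⟩
  have h1 : Tendsto (fun N => |einf (pastDensity σ M ω N) - einf q|) atTop (𝓝 0) :=
    squeeze_zero (fun N => abs_nonneg _) (fun N => (hbv N).abs_einf_sub_le hqbv) htend
  simp_rw [einf_pastDensity hω] at h1
  have h2 := tendsto_nhds_unique h1 tendsto_const_nhds
  linarith [abs_eq_zero.1 h2.symm]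

namespace IsDensity

variable {q q' : Seg α β → ℝ} (hq : IsDensity σ M ω q)
include hq

theorem var_le {B : ℝ} (hB : ∀ N, var (pastDensity σ M ω N) ≤ B) : var q ≤ B := by
  have hB0 : 0 ≤ B := (var_nonneg _).trans (hB 0)
  have hbv := isBV_pastDensity (σ := σ) (M := M) ω
  have h1 : ∀ x, Tendsto (fun N => rep (pastDensity σ M ω N) x) atTop (𝓝 (rep q x)) := by
    intro x
    rw [tendsto_iff_norm_sub_tendsto_zero]
    exact squeeze_zero (fun N => norm_nonneg _) (fun N => abs_rep_sub_rep_le (hbv N) hq.isBV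
      ((hbv N).sub hq.isBV).ae_abs_le_supNorm x) hq.tendsto
  rw [← var_congr (rep_ae_eq hq.isBV)]
  exact (IsBV.var_le_of_eVariationOn_le hB0 (eVariationOn_le_of_tendsto_rep hbv hB h1)).2

theorem ae_one_le : ∀ᵐ x ∂(leb : Measure (Seg α β)), 1 ≤ q x := by
  filter_upwards [hq.isBV.ae_einf_le] with x hx
  rwa [hq.einf_eq] at hx

/-- Equivariance. -/
theorem transfer_eq (hω : Good σ M ω) (hq' : IsDensity σ M (σ ω) q') :
    (M ω).transfer q =ᵐ[leb] (fun x => einf ((M ω).transfer q) * q' x) ∧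
    0 < einf ((M ω).transfer q) ∧
    Tendsto (fun n : ℕ => einf (iterL σ M (n + 1) (σ.symm^[n] ω) 1) /
      einf (iterL σ M n (σ.symm^[n] ω) 1)) atTop (𝓝 (einf ((M ω).transfer q))) := by
  have hbv := isBV_pastDensity (σ := σ) (M := M) ω
  have hbv' := isBV_pastDensity (σ := σ) (M := M) (σ ω)
  have hL : ∀ {f : Seg α β → ℝ}, IsBV f → IsBV ((M ω).transfer f) := fun {f} hf => by
    rw [← iterL_one σ M]
    exact isBV_iterL σ M 1 ω hf
  obtain ⟨K, hK0, hK⟩ := (hL (isBV_one (α := α) (β := β))).bounded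
  -- By positivity, a uniform error `s` before the transfer becomes at most `s` times the image of
  -- `1` after it.
  have hd : ∀ N, ∀ᵐ x ∂(leb : Measure (Seg α β)), |(M ω).transfer (pastDensity σ M ω N) x -
      (M ω).transfer q x| ≤ supNorm (fun x => pastDensity σ M ω N x - q x) * K := by
    intro N
    set s := supNorm (fun x => pastDensity σ M ω N x - q x)
    have hs0 : 0 ≤ s := ((hbv N).sub hq.isBV).supNorm_nonneg
    have h1 := iterL_mono σ M 1 ω ((hbv N).sub hq.isBV) ((isBV_one (α := α) (β := β)).const_mul s)
      (((hbv N).sub hq.isBV).ae_abs_le_supNorm.mono fun x hx => by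
        simpa using (abs_le.1 hx).2)
    have h2 := iterL_mono σ M 1 ω ((isBV_one (α := α) (β := β)).const_mul (-s))
      ((hbv N).sub hq.isBV) (((hbv N).sub hq.isBV).ae_abs_le_supNorm.mono fun x hx => by
        simpa using (abs_le.1 hx).1)
    rw [iterL_const_mul, iterL_sub_fun] at h1 h2
    simp only [iterL_one] at h1 h2
    filter_upwards [h1, h2] with x h3 h4
    have h5 := mul_le_mul_of_nonneg_left ((le_abs_self _).trans (hK x)) hs0
    rw [abs_le]
    constructor <;> linarith
  have hlim : Tendsto (fun N => supNorm (fun x => pastDensity σ M ω N x - q x) * K) atTop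
      (𝓝 0) := by simpa using hq.tendsto.mul_const K
  have hr : Tendsto (fun N => einf ((M ω).transfer (pastDensity σ M ω N))) atTop
      (𝓝 (einf ((M ω).transfer q))) := by
    rw [tendsto_iff_norm_sub_tendsto_zero]
    refine squeeze_zero (fun N => norm_nonneg _) (fun N => ?_) hlim
    exact ((hL (hbv N)).abs_einf_sub_le (hL hq.isBV)).trans
      (((hL (hbv N)).sub (hL hq.isBV)).supNorm_le (hd N))
  refine ⟨?_, ?_, hr.congr fun N => (transfer_pastDensity hω N).1⟩
  · have h1 := ae_all_iff.2 hd
    have h2 := ae_all_iff.2 fun N => ((hbv' (N + 1)).sub hq'.isBV).ae_abs_le_supNorm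
    filter_upwards [h1, h2] with x h3 h4
    have h5 : Tendsto (fun N => (M ω).transfer (pastDensity σ M ω N) x) atTop
        (𝓝 ((M ω).transfer q x)) := by
      rw [tendsto_iff_norm_sub_tendsto_zero]
      exact squeeze_zero (fun N => norm_nonneg _) h3 hlim
    have h6 : Tendsto (fun N => pastDensity σ M (σ ω) (N + 1) x) atTop (𝓝 (q' x)) := by
      rw [tendsto_iff_norm_sub_tendsto_zero]
      exact squeeze_zero (fun N => norm_nonneg _) h4 (hq'.tendsto.comp (tendsto_add_atTop_nat 1))
    refine tendsto_nhds_unique h5 ((hr.mul h6).congr fun N => ?_)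
    exact (congrFun (transfer_pastDensity hω N).2 x).symm
  · have h0 := hω.1 0
    refine lt_of_lt_of_le (mul_pos h0 ?_) (einf_g_mul_le_einf_transfer M hq.isBV
      (hq.ae_one_le.mono fun x hx => zero_le_one.trans hx) h0)
    rw [hq.einf_eq]
    exact one_pos

end IsDensity

end Density

end RandomInterval
end

/-! ### Invariant measures and correlations. -/

noncomputable section
namespace RandomInterval
variable {α β : ℝ} [Fact (α < β)]

section Correlations

variable {Ω : Type*} [MeasurableSpace Ω] {σ : Ω ≃ᵐ Ω} {M : Ω → WeightedOpenMap α β} {ω : Ω}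

namespace Represents

variable {ε : ℕ → ℝ} {Λ : (Seg α β → ℝ) → ℝ} {ν : Measure (Seg α β)}
  (R : Represents σ M ω ε Λ ν) {f h q : Seg α β → ℝ}
include R

theorem ae_one_le (hq : IsBV q) (hq1 : ∀ᵐ x ∂(leb : Measure (Seg α β)), 1 ≤ q x) :
    ∀ᵐ x ∂ν, 1 ≤ q x :=
  R.ae_of_leb (isBV_const 1) hq hq1

theorem one_le_integral (hq : IsBV q) (hq1 : ∀ᵐ x ∂(leb : Measure (Seg α β)), 1 ≤ q x) :
    1 ≤ ∫ x, q x ∂ν :=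
  (hq.le_einf hq1).trans (R.einf_le_integral hq)

theorem integral_normalized (hq : IsBV q) (hq1 : ∀ᵐ x ∂(leb : Measure (Seg α β)), 1 ≤ q x)
    (f : Seg α β → ℝ) :
    ∫ x, f x ∂(normalized q ν) = (∫ x, q x ∂ν)⁻¹ * ∫ x, f x * q x ∂ν := by
  have hZ := R.one_le_integral hq hq1
  rw [normalized, integral_smul_measure, ENNReal.toReal_inv,
    ENNReal.toReal_ofReal (zero_le_one.trans hZ), smul_eq_mul,
    integral_withDensity_eq_integral_toReal_smul hq.measurable.ennreal_ofReal
      (ae_of_all _ fun _ => ENNReal.ofReal_lt_top)]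
  congr 1
  refine integral_congr_ae ?_
  filter_upwards [R.ae_one_le hq hq1] with x hx
  rw [ENNReal.toReal_ofReal (zero_le_one.trans hx), smul_eq_mul, mul_comm]

theorem isProbabilityMeasure_normalized (hq : IsBV q)
    (hq1 : ∀ᵐ x ∂(leb : Measure (Seg α β)), 1 ≤ q x) : IsProbabilityMeasure (normalized q ν) := by
  have := R.isProbabilityMeasure
  have hZ := R.one_le_integral hq hq1
  refine ⟨?_⟩
  rw [normalized, Measure.smul_apply, withDensity_apply _ MeasurableSet.univ, setLIntegral_univ,
    ← ofReal_integral_eq_lintegral_ofReal (hq.integrable ν)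
      ((R.ae_one_le hq hq1).mono fun x hx => zero_le_one.trans hx), smul_eq_mul]
  exact ENNReal.inv_mul_cancel (by simpa using one_pos.trans_le hZ) ENNReal.ofReal_ne_top

variable {n : ℕ} {ε' : ℕ → ℝ} {Λ' : (Seg α β → ℝ) → ℝ} {ν' : Measure (Seg α β)}
  (R' : Represents σ M (σ^[n] ω) ε' Λ' ν') {q' : Seg α β → ℝ} {lam : ℝ}
  (hq : IsBV q) (hq1 : ∀ᵐ x ∂(leb : Measure (Seg α β)), 1 ≤ q x)
  (hq' : IsBV q') (hq1' : ∀ᵐ x ∂(leb : Measure (Seg α β)), 1 ≤ q' x)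
  (he : iterL σ M n ω q =ᵐ[leb] fun x => lam * q' x)
include R' hq hq' he

/-- The relation between the two multipliers. -/
theorem mul_integral_eq : lam * ∫ x, q' x ∂ν' =
    (∫ x, iterL σ M n ω 1 x ∂ν') * ∫ x, q x ∂ν := by
  rw [← R.integral_iterL R' hq, ← integral_const_mul]
  exact (integral_congr_ae (R'.ae_eq_of_leb (isBV_iterL σ M n ω hq) (hq'.const_mul lam) he)).symm

include hq1 hq1'

/-- Duality moves the composition onto `q`, equivariance replaces the image of `q` by `lam * q'`,
and the relation between the multipliers cancels the constants. -/
theorem integral_comp_normalized (hφ : Integrable f ν') :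
    ∫ x, f (iterT σ M n ω x) ∂(normalized q ν) = ∫ x, f x ∂(normalized q' ν') := by
  have hpos := R.integral_iterL_one_pos R'
  have hZ := R.one_le_integral hq hq1
  have hZ' := R'.one_le_integral hq' hq1'
  have hrel := R.mul_integral_eq R' hq hq' he
  rw [R.integral_normalized hq hq1, R'.integral_normalized hq' hq1',
    R.integral_comp_mul R' hq hφ]
  have h1 : ∫ x, f x * iterL σ M n ω q x ∂ν' = lam * ∫ x, f x * q' x ∂ν' := by
    rw [← integral_const_mul]
    refine integral_congr_ae ?_
    filter_upwards [R'.ae_eq_of_leb (isBV_iterL σ M n ω hq) (hq'.const_mul lam) he] with x hx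
    rw [hx]
    ring
  rw [h1]
  have h2 : (∫ x, q x ∂ν)⁻¹ * ((∫ x, iterL σ M n ω 1 x ∂ν')⁻¹ * lam) = (∫ x, q' x ∂ν')⁻¹ := by
    have : (∫ x, q x ∂ν) ≠ 0 := by linarith
    have : (∫ x, q' x ∂ν') ≠ 0 := by linarith
    field_simp
    linarith
  rw [← h2]
  ring

theorem measurePreserving_normalized :
    MeasurePreserving (iterT σ M n ω) (normalized q ν) (normalized q' ν') := by
  have := R'.isProbabilityMeasure
  have := R.isProbabilityMeasure_normalized hq hq1
  have := R'.isProbabilityMeasure_normalized hq' hq1'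
  have hT := measurable_iterT (σ := σ) (M := M) n ω
  refine ⟨hT, ?_⟩
  refine Measure.ext_of_Iic _ _ fun b => ?_
  rw [Measure.map_apply hT measurableSet_Iic, ← measureReal_eq_measureReal_iff]
  have h1 := R.integral_comp_normalized R' hq hq1 hq' hq1' he
    ((isBV_indicator_of_ordConnected (ordConnected_Iic (a := b))).integrable ν')
  rw [integral_indicator measurableSet_Iic, setIntegral_const, smul_eq_mul, mul_one] at h1
  rw [← h1]
  have h2 : (fun x => (Iic b).indicator (fun _ => (1 : ℝ)) (iterT σ M n ω x)) =
      (iterT σ M n ω ⁻¹' Iic b).indicator fun _ => 1 := rfl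
  rw [h2, integral_indicator (hT measurableSet_Iic), setIntegral_const, smul_eq_mul, mul_one]

/-- Decay of correlations in terms of the rate of convergence to the conformal measure. -/
theorem abs_correlation_le (hlam : 0 < lam) (hh : IsBV h) (hf : Integrable f ν') :
    |(∫ x, f (iterT σ M n ω x) * h x ∂(normalized q ν)) -
      (∫ x, f x ∂(normalized q' ν')) * ∫ x, h x ∂(normalized q ν)| ≤
        2 * bvNorm q * supNorm q' * ε n * (∫ x, |f x| ∂ν') * bvNorm h := by
  have := R.isProbabilityMeasure
  have := R'.isProbabilityMeasure
  have hpos := R.integral_iterL_one_pos R'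
  have hZ := R.one_le_integral hq hq1
  have hZ' := R'.one_le_integral hq' hq1'
  have hrel := R.mul_integral_eq R' hq hq' he
  have hhq := hh.mul hq
  set Z := ∫ x, q x ∂ν with hZdef
  set Z' := ∫ x, q' x ∂ν'
  set L1 := ∫ x, iterL σ M n ω 1 x ∂ν'
  set k := ∫ x, h x * q x ∂ν with hk
  have hZ0 : 0 < Z := by linarith
  have hZ0' : 0 < Z' := by linarith
  have hk' : |k| ≤ bvNorm h * Z := by
    rw [hk, hZdef, ← integral_const_mul]
    refine abs_integral_le_integral_abs.trans
      (integral_mono_ae (hhq.integrable ν).abs ((hq.integrable ν).const_mul _) ?_)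
    filter_upwards [R.ae_one_le hq hq1, R.ae_of_leb hh.abs (isBV_const (supNorm h))
      hh.ae_abs_le_supNorm] with x h1 h2
    rw [abs_mul, abs_of_nonneg (zero_le_one.trans h1)]
    exact mul_le_mul_of_nonneg_right (h2.trans (le_add_of_nonneg_left (var_nonneg h)))
      (zero_le_one.trans h1)
  have hb1 := isBV_iterL σ M n ω hhq
  have hb2 := isBV_iterL σ M n ω hq
  have hn0 := R.functional.nonneg n
  have hq0 := bvNorm_nonneg hq
  have hh0 := bvNorm_nonneg hh
  set c := 2 * bvNorm q * bvNorm h * ε n * (lam * supNorm q') with hc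
  -- The function `h q - (k / Z) q` has `ν`-mean zero, so its image is small relative to `L^(n) 1`,
  -- which in turn is at most `L^(n) q = lam * q'` because `q ≥ 1`.
  have hE : ∀ᵐ x ∂ν', |iterL σ M n ω (fun x => h x * q x) x - k / Z * iterL σ M n ω q x| ≤ c := by
    refine R'.ae_of_leb ((hb1.sub (hb2.const_mul _)).abs) (isBV_const c) ?_
    have h1 := iterL_mono σ M n ω isBV_one hq hq1
    filter_upwards [R.functional.approx _ hhq n, R.functional.approx _ hq n, he, h1,
      hq'.ae_abs_le_supNorm] with x h2 h3 h4 h5 h6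
    rw [← R.integral_eq _ hhq] at h2
    rw [← R.integral_eq _ hq] at h3
    have h7 : iterL σ M n ω 1 x ≤ lam * supNorm q' :=
      h5.trans (h4.le.trans (mul_le_mul_of_nonneg_left ((le_abs_self _).trans h6) hlam.le))
    have h8 : |k / Z| ≤ bvNorm h := by
      rw [abs_div, abs_of_pos hZ0, div_le_iff₀ hZ0]
      exact hk'
    have h9 : |k / Z * (iterL σ M n ω q x - Z * iterL σ M n ω 1 x)| ≤
        bvNorm h * (bvNorm q * ε n * iterL σ M n ω 1 x) := by
      rw [abs_mul]
      exact mul_le_mul h8 h3 (abs_nonneg _) hh0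
    have h10 : iterL σ M n ω (fun x => h x * q x) x - k / Z * iterL σ M n ω q x =
        (iterL σ M n ω (fun x => h x * q x) x - k * iterL σ M n ω 1 x) -
          k / Z * (iterL σ M n ω q x - Z * iterL σ M n ω 1 x) := by
      field_simp
      ring
    have h11 : 0 ≤ ε n * iterL σ M n ω 1 x := by
      by_contra hcon
      push Not at hcon
      have := (abs_nonneg _).trans h3
      rcases hq0.eq_or_lt with h0 | h0
      · have := hq.einf_le_supNorm
        have := hq.le_einf hq1
        have := var_nonneg q
        unfold bvNorm at h0
        linarith
      · nlinarith
    calc |iterL σ M n ω (fun x => h x * q x) x - k / Z * iterL σ M n ω q x|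
        ≤ bvNorm (fun x => h x * q x) * ε n * iterL σ M n ω 1 x +
            bvNorm h * (bvNorm q * ε n * iterL σ M n ω 1 x) := by
          rw [h10]
          exact (abs_sub _ _).trans (add_le_add h2 h9)
      _ ≤ bvNorm h * bvNorm q * (ε n * iterL σ M n ω 1 x) +
            bvNorm h * (bvNorm q * ε n * iterL σ M n ω 1 x) := by
          rw [mul_assoc]
          gcongr
          exact bvNorm_mul_le hh hq
      _ = 2 * bvNorm q * bvNorm h * ε n * iterL σ M n ω 1 x := by ring
      _ ≤ c := mul_le_mul_of_nonneg_left h7 (by positivity)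
  obtain ⟨K1, -, hK1⟩ := hb1.bounded
  obtain ⟨K2, -, hK2⟩ := hb2.bounded
  have hi1 : Integrable (fun x => f x * iterL σ M n ω (fun x => h x * q x) x) ν' :=
    hf.mul_bdd hb1.measurable.aestronglyMeasurable (ae_of_all _ hK1)
  have hi2 : Integrable (fun x => f x * iterL σ M n ω q x) ν' :=
    hf.mul_bdd hb2.measurable.aestronglyMeasurable (ae_of_all _ hK2)
  have e1 : ∫ x, f (iterT σ M n ω x) * h x ∂(normalized q ν) =
      Z⁻¹ * (L1⁻¹ * ∫ x, f x * iterL σ M n ω (fun x => h x * q x) x ∂ν') := by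
    rw [R.integral_normalized hq hq1, ← R.integral_comp_mul R' hhq hf]
    simp only [mul_assoc]
    rfl
  have e2 : ∫ x, f x ∂(normalized q' ν') = Z⁻¹ * (L1⁻¹ * ∫ x, f x * iterL σ M n ω q x ∂ν') := by
    rw [← R.integral_comp_normalized R' hq hq1 hq' hq1' he hf, R.integral_normalized hq hq1,
      ← R.integral_comp_mul R' hq hf]
  rw [e1, e2, R.integral_normalized hq hq1 h]
  have e3 : Z⁻¹ * (L1⁻¹ * ∫ x, f x * iterL σ M n ω (fun x => h x * q x) x ∂ν') -
      Z⁻¹ * (L1⁻¹ * ∫ x, f x * iterL σ M n ω q x ∂ν') * (Z⁻¹ * k) =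
      Z⁻¹ * L1⁻¹ * ∫ x, f x * (iterL σ M n ω (fun x => h x * q x) x -
        k / Z * iterL σ M n ω q x) ∂ν' := by
    have : ∀ x, f x * (iterL σ M n ω (fun x => h x * q x) x - k / Z * iterL σ M n ω q x) =
        f x * iterL σ M n ω (fun x => h x * q x) x - k / Z * (f x * iterL σ M n ω q x) :=
      fun x => by ring
    simp_rw [this]
    rw [integral_sub hi1 (hi2.const_mul _), integral_const_mul]
    ring
  rw [e3, abs_mul, abs_of_pos (by positivity : 0 < Z⁻¹ * L1⁻¹)]
  have h1 : |∫ x, f x * (iterL σ M n ω (fun x => h x * q x) x - k / Z * iterL σ M n ω q x) ∂ν'| ≤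
      c * ∫ x, |f x| ∂ν' := by
    rw [← integral_const_mul]
    refine abs_integral_le_integral_abs.trans (integral_mono_of_nonneg
      (ae_of_all _ fun x => abs_nonneg _) (hf.abs.const_mul c) ?_)
    filter_upwards [hE] with x hx
    rw [abs_mul, mul_comm]
    exact mul_le_mul_of_nonneg_right hx (abs_nonneg _)
  have hf0 : 0 ≤ ∫ x, |f x| ∂ν' := integral_nonneg fun x => abs_nonneg _
  have hs0 : 0 ≤ supNorm q' := hq'.supNorm_nonneg
  -- By the relation between the multipliers this factor equals `1 / Z'`, and `Z' ≥ 1`.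
  have h2 : Z⁻¹ * L1⁻¹ * lam ≤ 1 := by
    rw [← mul_inv, mul_comm Z, ← hrel, mul_inv, mul_comm, ← mul_assoc, mul_inv_cancel₀ hlam.ne',
      one_mul]
    exact inv_le_one_of_one_le₀ hZ'
  calc Z⁻¹ * L1⁻¹ * |∫ x, f x * (iterL σ M n ω (fun x => h x * q x) x -
        k / Z * iterL σ M n ω q x) ∂ν'| ≤ Z⁻¹ * L1⁻¹ * (c * ∫ x, |f x| ∂ν') :=
        mul_le_mul_of_nonneg_left h1 (by positivity)
    _ = Z⁻¹ * L1⁻¹ * lam * (2 * bvNorm q * supNorm q' * ε n * (∫ x, |f x| ∂ν') * bvNorm h) := by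
        rw [hc]
        ring
    _ ≤ _ := mul_le_of_le_one_left (by positivity) h2

end Represents

end Correlations

end RandomInterval
end

/-! ### Measurability in the base point. -/

noncomputable section
namespace RandomInterval
variable {α β : ℝ} [Fact (α < β)]

section Measurability

variable {Ω : Type*} [MeasurableSpace Ω] {σ : Ω ≃ᵐ Ω} {M : Ω → WeightedOpenMap α β}

theorem iterT_congr {n : ℕ} {ω ω' : Ω} (h : ∀ j < n, M (σ^[j] ω) = M (σ^[j] ω')) :
    iterT σ M n ω = iterT σ M n ω' := by
  induction n with
  | zero => rfl
  | succ n ih =>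
    rw [iterT, iterT, ih fun j hj => h j (hj.trans n.lt_succ_self), h n n.lt_succ_self]

theorem iterL_congr_left {n : ℕ} {ω ω' : Ω} (h : ∀ j < n, M (σ^[j] ω) = M (σ^[j] ω')) :
    iterL σ M n ω = iterL σ M n ω' := by
  induction n with
  | zero => rfl
  | succ n ih =>
    rw [iterL, iterL, ih fun j hj => h j (hj.trans n.lt_succ_self), h n n.lt_succ_self]

theorem coeff_congr {n : ℕ} {ω ω' : Ω} (h : ∀ j < n, M (σ^[j] ω) = M (σ^[j] ω')) :
    coeffD σ M n ω = coeffD σ M n ω' ∧ numFull σ M n ω = numFull σ M n ω' := by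
  have hT : ∀ j < n, iterT σ M j ω = iterT σ M j ω' := fun j hj =>
    iterT_congr fun i hi => h i (hi.trans hj)
  have hG : iterG σ M n ω = iterG σ M n ω' := by
    ext x
    refine Finset.prod_congr rfl fun j hj => ?_
    rw [h j (Finset.mem_range.1 hj), hT j (Finset.mem_range.1 hj)]
  have hS : survivor σ M n ω = survivor σ M n ω' := by
    ext x
    refine forall₂_congr fun j hj => ?_
    rw [h j hj, hT j hj]
  have hA : iterAtoms σ M n ω = iterAtoms σ M n ω' := by
    ext Z
    refine exists_congr fun A => and_congr (forall₂_congr fun j hj => by rw [h j hj]) ?_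
    have : {x | ∀ j < n, iterT σ M j ω x ∈ A j} = {x | ∀ j < n, iterT σ M j ω' x ∈ A j} := by
      ext x
      exact forall₂_congr fun j hj => by rw [hT j hj]
    rw [this]
  have hP : iterPieces σ M n ω = iterPieces σ M n ω' := by
    rw [iterPieces, iterPieces, hA, hS]
  have hF : fullPieces σ M n ω = fullPieces σ M n ω' := by
    rw [fullPieces, fullPieces, hP, iterT_congr h]
  have hN : nonfullPieces σ M n ω = nonfullPieces σ M n ω' := by
    rw [nonfullPieces, nonfullPieces, hP, iterT_congr h]
  have hV : varSum σ M n ω = varSum σ M n ω' :=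
    Finset.sum_congr rfl fun j hj => by rw [h j (Finset.mem_range.1 hj)]
  have hQ : normProd σ M n ω = normProd σ M n ω' :=
    Finset.prod_congr rfl fun j hj => by rw [h j (Finset.mem_range.1 hj)]
  refine ⟨?_, by rw [numFull, numFull, hF]⟩
  rw [coeffD, coeffD, hG, hS, hV, hQ, maxContiguous, maxContiguous, hF, hN]

variable {sys : ℕ → WeightedOpenMap α β} {idx : Ω → ℕ} (hidx : Measurable idx)
  (hM : ∀ ω, M ω = sys (idx ω))
include hidx hM

/-- Functions that depend only on finitely many maps of the orbit are measurable. -/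
theorem measurable_of_finite_orbit {X : Type*} [MeasurableSpace X] [Nonempty X] (n : ℕ)
    {F : Ω → X} (hF : ∀ ω ω', (∀ j < n, M (σ^[j] ω) = M (σ^[j] ω')) → F ω = F ω') :
    Measurable F := by
  have hπ : Measurable fun ω (j : Fin n) => idx (σ^[j] ω) :=
    measurable_pi_lambda _ fun j => hidx.comp (σ.measurable.iterate j)
  -- Only countably many maps occur, so `F` factors through the discrete space of index words of
  -- length `n`, on which every function is measurable.
  have hfac : F.FactorsThrough fun ω (j : Fin n) => idx (σ^[j] ω) := by
    intro ω ω' h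
    refine hF ω ω' fun j hj => ?_
    rw [hM, hM]
    exact congrArg sys (congrFun h ⟨j, hj⟩)
  rw [← hfac.extend_comp fun _ => Classical.arbitrary X]
  exact (Measurable.of_discrete).comp hπ

theorem measurable_coeffD (n : ℕ) : Measurable (coeffD σ M n) :=
  measurable_of_finite_orbit hidx hM n fun _ _ h => (coeff_congr h).1

theorem measurable_coeffC (n : ℕ) : Measurable (coeffC σ M n) :=
  measurable_of_finite_orbit hidx hM n fun _ _ h => by
    rw [coeffC, coeffC, (coeff_congr h).1, (coeff_congr h).2]

theorem measurable_iterL (n : ℕ) (F : (Seg α β → ℝ) → ℝ) (f : Seg α β → ℝ) :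
    Measurable fun ω => F (iterL σ M n ω f) :=
  measurable_of_finite_orbit hidx hM n fun ω ω' h => by rw [iterL_congr_left h]

theorem measurable_of_map {X : Type*} [MeasurableSpace X] (F : WeightedOpenMap α β → X) :
    Measurable fun ω => F (M ω) := by
  simp only [hM]
  exact (Measurable.of_discrete (f := fun j => F (sys j))).comp hidx

theorem measurable_var_pastDensity (N : ℕ) : Measurable fun ω => var (pastDensity σ M ω N) :=
  (measurable_iterL hidx hM N (fun u => var fun x => u x / einf u) 1).comp
    (σ.symm.measurable.iterate N)

theorem measurableSet_good : MeasurableSet {ω | Good σ M ω} := by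
  have h : MeasurableSet {ω | 0 < einf (M ω).g} :=
    measurableSet_lt measurable_const (measurable_of_map hidx hM fun W => einf W.g)
  have : {ω | Good σ M ω} = (⋂ j : ℕ, σ^[j] ⁻¹' {ω | 0 < einf (M ω).g}) ∩
      ⋂ j : ℕ, σ.symm^[j] ⁻¹' {ω | 0 < einf (M ω).g} := by
    ext ω
    simp [Good]
  rw [this]
  exact (MeasurableSet.iInter fun j => σ.measurable.iterate j h).inter
    (MeasurableSet.iInter fun j => σ.symm.measurable.iterate j h)

/-- The integral of an equivariant density with respect to the conformal measure depends
measurably on `ω`. -/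
theorem aemeasurable_integral_density {m : Measure Ω} {q : Ω → Seg α β → ℝ}
    {ν : Ω → Measure (Seg α β)} (hq : ∀ᵐ ω ∂m, IsDensity σ M ω (q ω))
    (hν : ∀ᵐ ω ∂m, ∃ ε Λ, Represents σ M ω ε Λ (ν ω)) :
    AEMeasurable (fun ω => ∫ x, q ω x ∂(ν ω)) m := by
  refine aemeasurable_of_tendsto_metrizable_ae atTop
    (f := fun N ω => ∫ x, pastDensity σ M ω N x ∂(ν ω)) (fun N => ?_) ?_
  -- For a fixed approximation of the density, the integral is itself a limit of quotients of infima
  -- that depend on finitely many maps. No measurability of `q` or `ν` in `ω` is used.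
  · refine aemeasurable_of_tendsto_metrizable_ae atTop (f := fun k ω =>
      einf (fun y => (einf (iterL σ M N (σ.symm^[N] ω) 1))⁻¹ *
        iterL σ M (N + k) (σ.symm^[N] ω) 1 y) / einf (iterL σ M k ω 1)) (fun k => ?_) ?_
    · have hm : Measurable fun ω => einf (fun y => (einf (iterL σ M N ω 1))⁻¹ *
          iterL σ M (N + k) ω 1 y) :=
        measurable_of_finite_orbit hidx hM (N + k) fun ω ω' h => by
          rw [iterL_congr_left h, iterL_congr_left fun j hj => h j (hj.trans_le (N.le_add_right k))]
      exact ((hm.comp (σ.symm.measurable.iterate N)).div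
        (measurable_iterL hidx hM k einf 1)).aemeasurable
    · filter_upwards [hν] with ω ⟨ε, Λ, R⟩
      have hbv := isBV_pastDensity (σ := σ) (M := M) ω N
      have hge := R.functional.good
      have h0 : 0 ≤ᵐ[leb] pastDensity σ M ω N := by
        filter_upwards [hbv.ae_einf_le] with x hx
        rw [einf_pastDensity hge] at hx
        exact zero_le_one.trans hx
      rw [R.integral_eq _ hbv]
      refine (R.functional.tendsto_ratio hbv h0).congr fun k => ?_
      rw [pastDensity_eq, iterL_const_mul, iterL_add, iterate_symm_iterate]
  · filter_upwards [hq, hν] with ω hqω ⟨ε, Λ, R⟩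
    have := R.isProbabilityMeasure
    have hbv := isBV_pastDensity (σ := σ) (M := M) ω
    rw [tendsto_iff_norm_sub_tendsto_zero]
    refine squeeze_zero (fun N => norm_nonneg _) (fun N => ?_) hqω.tendsto
    rw [← integral_sub ((hbv N).integrable _) (hqω.isBV.integrable _)]
    refine (norm_integral_le_of_norm_le_const (C := supNorm fun x =>
      pastDensity σ M ω N x - q ω x) ?_).trans_eq (by simp)
    have hd := (hbv N).sub hqω.isBV
    exact R.ae_of_leb hd.abs (isBV_const _) hd.ae_abs_le_supNorm

end Measurability

end RandomInterval
end

/-! ### Integrability of the logarithmic coefficients. -/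

noncomputable section
namespace RandomInterval
variable {α β : ℝ} [Fact (α < β)]

section Integrability

variable {Ω : Type*} [MeasurableSpace Ω] {m : Measure Ω} {σ : Ω ≃ᵐ Ω}
  {M : Ω → WeightedOpenMap α β} {ω : Ω}

theorem ae_forall_iterate {τ : Ω → Ω} (hτ : MeasurePreserving τ m m) {p : Ω → Prop}
    (h : ∀ᵐ ω ∂m, p ω) : ∀ᵐ ω ∂m, ∀ j : ℕ, p (τ^[j] ω) :=
  ae_all_iff.2 fun j => (hτ.iterate j).quasiMeasurePreserving.ae h

theorem ergodic_symm (hσ : Ergodic σ m) : Ergodic σ.symm m := hσ.symm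

theorem ae_good (hσ : Ergodic σ m) (h : ∀ᵐ ω ∂m, 0 < einf (M ω).g) :
    ∀ᵐ ω ∂m, Good σ M ω := by
  filter_upwards [ae_forall_iterate hσ.toMeasurePreserving h,
    ae_forall_iterate (ergodic_symm hσ).toMeasurePreserving h] with ω h1 h2 using ⟨h1, h2⟩

theorem one_le_card_pieces (ω : Ω) : 1 ≤ ((M ω).pieces.ncard : ℝ) := by
  obtain ⟨Z, hZ, -⟩ := (M ω).full_branch
  obtain ⟨W, hW, -⟩ := exists_full (MeasurableEquiv.refl Ω) M 1 ω
  rw [iterPieces_one] at hW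
  have hfin : (M ω).pieces.Finite := by
    have := (isBranched_iter (MeasurableEquiv.refl Ω) M 1 ω).finite
    rwa [iterPieces_one] at this
  exact_mod_cast (Set.ncard_pos hfin).2 ⟨W, hW⟩

/-- The logarithm of a bound for the transfer operator of one map. -/
def logBound (W : WeightedOpenMap α β) : ℝ := Real.log (W.pieces.ncard : ℝ) + Real.log (supNorm W.g)

theorem ae_transfer_one_le (h : 0 < einf (M ω).g) : ∀ᵐ x ∂(leb : Measure (Seg α β)),
    (M ω).transfer 1 x ≤ Real.exp (logBound (M ω)) := by
  have h1 := ae_iterL_one_le (MeasurableEquiv.refl Ω) M 1 ω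
  rw [iterL_one, iterPieces_one, normProd, Finset.prod_range_one, Function.iterate_zero, id] at h1
  rwa [logBound, Real.exp_add, Real.exp_log (one_pos.trans_le (one_le_card_pieces ω)),
    Real.exp_log (supNorm_g_pos M h)]

theorem Good.ae_iterL_one_le_exp (hω : Good σ M ω) (n : ℕ) : ∀ᵐ x ∂(leb : Measure (Seg α β)),
    iterL σ M n ω 1 x ≤ Real.exp (birkhoffSum σ (fun ω => logBound (M ω)) n ω) := by
  induction n with
  | zero => simp [iterL]
  | succ n ih =>
    have h1 := iterL_mono σ M 1 (σ^[n] ω) (isBV_iterL σ M n ω isBV_one)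
      ((isBV_one (α := α) (β := β)).const_mul _) (ih.mono fun x hx => by simpa using hx)
    rw [iterL_const_mul, iterL_one, iterL_one] at h1
    filter_upwards [h1, ae_transfer_one_le (hω.1 n)] with x h2 h3
    rw [iterL_add, iterL_one, birkhoffSum_succ, Real.exp_add]
    exact h2.trans (mul_le_mul_of_nonneg_left h3 (Real.exp_pos _).le)

/-- The additive coefficient is bounded by the contraction coefficient, up to an exponential. -/
theorem Good.log_coeffD_le (hω : Good σ M ω) (n : ℕ) :
    Real.log (coeffD σ M n ω) ≤ Real.log (coeffC σ M n ω) +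
      birkhoffSum σ (fun ω => logBound (M ω) - Real.log (einf (M ω).g)) n ω := by
  have hd : 0 < coeffD σ M n ω :=
    three_pos.trans_le (three_le_coeffD σ M n ω fun j _ => hω.1 j)
  have hb : (0 : ℝ) < numFull σ M n ω := Nat.cast_pos.2 (one_le_numFull σ M n ω)
  have hp : 0 < ∏ j ∈ Finset.range n, einf (M (σ^[j] ω)).g := Finset.prod_pos fun j _ => hω.1 j
  have h1 := mul_einf_le_einf_iterL σ M (n := n) (fun j _ => hω.1 j)
    (isBV_one (α := α) (β := β)) (ae_of_all _ fun _ => zero_le_one)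
  rw [einf_one, mul_one] at h1
  have h2 : einf (iterL σ M n ω (1 : Seg α β → ℝ)) ≤
      Real.exp (birkhoffSum σ (fun ω => logBound (M ω)) n ω) := by
    rw [← einf_const (α := α) (β := β) (Real.exp _)]
    exact (isBV_iterL σ M n ω isBV_one).einf_mono (isBV_const _) (hω.ae_iterL_one_le_exp n)
  -- Every full branch contributes to the infimum of `L^(n) 1`, whose size is controlled. This
  -- bounds the number of full branches, the only quantity separating `coeffD` from `coeffC`.
  have h3 : (∏ j ∈ Finset.range n, einf (M (σ^[j] ω)).g) * numFull σ M n ω ≤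
      Real.exp (birkhoffSum σ (fun ω => logBound (M ω)) n ω) :=
    (mul_le_mul_of_nonneg_right (prod_einf_le_einfOn σ M n ω) hb.le).trans (h1.trans h2)
  have h4 := Real.log_le_log (mul_pos hp hb) h3
  rw [Real.log_exp, Real.log_mul hp.ne' hb.ne', Real.log_prod fun j _ => (hω.1 j).ne'] at h4
  rw [coeffC, Real.log_div hd.ne' hb.ne']
  have h5 : birkhoffSum σ (fun ω => logBound (M ω) - Real.log (einf (M ω).g)) n ω =
      birkhoffSum σ (fun ω => logBound (M ω)) n ω -
        ∑ j ∈ Finset.range n, Real.log (einf (M (σ^[j] ω)).g) := by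
    simp only [birkhoffSum, Finset.sum_sub_distrib]
  rw [h5]
  linarith

/-- The number of non-full branches is at most the number of all branches, which is at least one;
hence one `log 3`, the other coming from `3 + 3 * varSum`. The variation enters through `log (1 + v)
≤ v`, so its integrability suffices. -/
theorem Good.log_coeffD_one_le (hω : Good σ M ω) : Real.log (coeffD σ M 1 ω) ≤
    2 * Real.log 3 + var (M ω).g / supNorm (M ω).g + logBound (M ω) -
      Real.log (einf (M ω).g) := by
  have he : 0 < einf (M ω).g := hω.1 0
  have hs := supNorm_g_pos M he
  have hN := one_le_card_pieces (M := M) ω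
  have hv : 0 ≤ var (M ω).g / supNorm (M ω).g := div_nonneg (var_nonneg _) hs.le
  have hξ : (maxContiguous σ M 1 ω : ℝ) ≤ (M ω).pieces.ncard := by
    rw [← iterPieces_one σ M]
    exact_mod_cast maxContiguous_le σ M 1 ω
  have he' : einf (M ω).g ≤ einfOn (survivor σ M 1 ω) (iterG σ M 1 ω) := by
    simpa using prod_einf_le_einfOn σ M 1 ω
  have hd : coeffD σ M 1 ω ≤ 3 * (1 + var (M ω).g / supNorm (M ω).g) *
      (3 * (M ω).pieces.ncard) * (supNorm (M ω).g / einf (M ω).g) := by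
    rw [coeffD]
    have e1 : varSum σ M 1 ω = var (M ω).g / supNorm (M ω).g := by simp [varSum]
    have e2 : normProd σ M 1 ω = supNorm (M ω).g := by simp [normProd]
    rw [e1, e2]
    have h1 : supNorm (M ω).g / einfOn (survivor σ M 1 ω) (iterG σ M 1 ω) ≤
        supNorm (M ω).g / einf (M ω).g := div_le_div_of_nonneg_left hs.le he he'
    have h2 : (0 : ℝ) ≤ maxContiguous σ M 1 ω := Nat.cast_nonneg _
    refine mul_le_mul (mul_le_mul (by linarith) (by linarith) (by linarith) (by linarith)) h1
      (div_nonneg hs.le (he.le.trans he')) (by positivity)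
  refine (Real.log_le_log (three_pos.trans_le (three_le_coeffD σ M 1 ω fun j _ => hω.1 j))
    hd).trans ?_
  have hN0 : (0 : ℝ) < (M ω).pieces.ncard := one_pos.trans_le hN
  have hv1 : 0 < 1 + var (M ω).g / supNorm (M ω).g := by linarith
  rw [Real.log_mul (by positivity) (by positivity), Real.log_mul (by positivity) (by positivity),
    Real.log_mul (by norm_num) hv1.ne', Real.log_mul (by norm_num) hN0.ne',
    Real.log_div hs.ne' he.ne', logBound]
  have := Real.log_le_sub_one_of_pos hv1
  linarith

variable [IsProbabilityMeasure m] (hσ : Ergodic σ m) {sys : ℕ → WeightedOpenMap α β}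
  {idx : Ω → ℕ} (hidx : Measurable idx) (hM : ∀ ω, M ω = sys (idx ω))
  (hc : StronglyContracting m σ M)

theorem integrable_logBound (hc : StronglyContracting m σ M) :
    Integrable (fun ω => logBound (M ω)) m :=
  hc.integrable_log_card.add hc.integrable_log_sup

include hσ hidx hM hc

/-- Since `coeffD` is at least `3` at good points, its logarithm is nonnegative there and an upper
bound is enough. -/
theorem integrable_log_coeffD_of_le (n : ℕ) {Φ : Ω → ℝ} (hΦ : Integrable Φ m)
    (h : ∀ᵐ ω ∂m, Real.log (coeffD σ M n ω) ≤ Φ ω) :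
    Integrable (fun ω => Real.log (coeffD σ M n ω)) m := by
  refine hΦ.mono' (Real.measurable_log.comp (measurable_coeffD hidx hM n)).aestronglyMeasurable ?_
  filter_upwards [h, ae_good hσ hc.einf_pos] with ω h1 h2
  have := three_le_coeffD σ M n ω fun j _ => h2.1 j
  rwa [Real.norm_eq_abs, abs_of_nonneg (Real.log_nonneg (by linarith))]

theorem integrable_log_coeffD_one : Integrable (fun ω => Real.log (coeffD σ M 1 ω)) m :=
  integrable_log_coeffD_of_le hσ hidx hM hc 1
    ((((integrable_const (2 * Real.log 3)).add hc.integrable_var).add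
      (integrable_logBound hc)).sub hc.integrable_log_einf)
    ((ae_good hσ hc.einf_pos).mono fun _ h => h.log_coeffD_one_le)

theorem integrable_log_coeffD {n : ℕ}
    (h : Integrable (fun ω => Real.log (coeffC σ M n ω)) m) :
    Integrable (fun ω => Real.log (coeffD σ M n ω)) m :=
  integrable_log_coeffD_of_le hσ hidx hM hc n
    (h.add (integrable_birkhoffSum hσ.toMeasurePreserving
      ((integrable_logBound hc).sub hc.integrable_log_einf) n))
    ((ae_good hσ hc.einf_pos).mono fun _ h => h.log_coeffD_le n)

end Integrability

end RandomInterval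
end

/-! ### The aperture series and the invariant cone field. -/

noncomputable section
namespace RandomInterval
variable {α β : ℝ} [Fact (α < β)]

section Aperture

variable {Ω : Type*} [MeasurableSpace Ω] {m : Measure Ω} (σ : Ω ≃ᵐ Ω)
  (M : Ω → WeightedOpenMap α β) (n : ℕ) (d : Ω → ℝ) (γ : ℝ)

/-- The terms of the series of the aperture, for the `n`-step maps. -/
def seriesTerm (ω : Ω) (j : ℕ) : ℝ :=
  (γ ^ (j + 1))⁻¹ * d ((σ.symm^[n])^[j + 1] ω) *
    ∏ k ∈ Finset.range j, coeffC σ M n ((σ.symm^[n])^[k + 1] ω)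

theorem apertureTerm_eq : apertureTerm σ M γ = seriesTerm σ M 1 (coeffD σ M 1) γ := by
  ext ω j
  simp only [apertureTerm, seriesTerm, Function.iterate_one]

/-- Coefficients that dominate the additive coefficients of the first `n` steps. -/
structure IsStepBound : Prop where
  coeffD_le : ∀ ω, Good σ M ω → coeffD σ M n ω ≤ d ω
  entry : ∀ ω, Good σ M ω → ∀ p < n, ∀ v ∈ (cone0 1 : Set (Seg α β → ℝ)),
    iterL σ M p (σ^[n - p] ω) v ∈ (cone0 (d ω) : Set (Seg α β → ℝ))

variable {σ M n d γ} {ω : Ω}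

theorem isStepBound_one : IsStepBound σ M 1 (coeffD σ M 1) where
  coeffD_le _ _ := le_rfl
  entry ω hω p hp v hv := by
    obtain rfl : p = 0 := by omega
    exact cone0_mono one_pos (by linarith [three_le_coeffD σ M 1 ω fun j _ => hω.1 j]) hv

theorem coeffC_le_coeffD (hω : Good σ M ω) (n : ℕ) : coeffC σ M n ω ≤ coeffD σ M n ω :=
  div_le_self (by linarith [three_le_coeffD σ M n ω fun j _ => hω.1 j])
    (by exact_mod_cast one_le_numFull σ M n ω)

/-- One step takes aperture `P` to `c * P + d`, and `c ≤ d` together with `P ≥ 1` bounds this by `2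
* d * P`. -/
theorem Good.iterL_mem_prod (hω : Good σ M ω) (p : ℕ) {v : Seg α β → ℝ}
    (hv : v ∈ (cone0 1 : Set (Seg α β → ℝ))) : iterL σ M p ω v ∈
      (cone0 (∏ j ∈ Finset.range p, 2 * coeffD σ M 1 (σ^[j] ω)) : Set (Seg α β → ℝ)) ∧
      1 ≤ ∏ j ∈ Finset.range p, 2 * coeffD σ M 1 (σ^[j] ω) := by
  induction p with
  | zero => simpa [iterL] using hv
  | succ p ih =>
    have h3 := three_le_coeffD σ M 1 (σ^[p] ω) fun j _ => (hω.iterate p).1 j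
    have hc := coeffC_le_coeffD (hω.iterate p) 1
    have hcp := coeffC_pos σ M 1 (σ^[p] ω) fun j _ => (hω.iterate p).1 j
    rw [Finset.prod_range_succ]
    have h1 := ih.2
    refine ⟨?_, one_le_mul_of_one_le_of_one_le h1 (by linarith)⟩
    rw [iterL_add]
    set P := ∏ j ∈ Finset.range p, 2 * coeffD σ M 1 (σ^[j] ω)
    refine cone0_mono (add_pos (mul_pos hcp (one_pos.trans_le h1)) (by linarith)) ?_
      ((hω.iterate p).iterL_mem_cone0 1 (one_pos.trans_le h1) ih.1)
    have h4 := mul_le_mul_of_nonneg_right hc (zero_le_one.trans h1)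
    have h5 := le_mul_of_one_le_right (by linarith : 0 ≤ coeffD σ M 1 (σ^[p] ω)) h1
    linarith

/-- The product controls initial stretches of fewer than `n` steps. Each stretch uses only the last
`p` factors, and the product of the remaining ones is at least one. -/
theorem isStepBound_prod : IsStepBound σ M n fun ω =>
    coeffD σ M n ω + ∏ j ∈ Finset.range n, 2 * coeffD σ M 1 (σ^[j] ω) where
  coeffD_le ω hω := by
    have := (hω.iterL_mem_prod n (one_mem_cone0 (α := α) (β := β))).2
    linarith
  entry ω hω p hp v hv := by
    have h1 := (hω.iterate (n - p)).iterL_mem_prod p hv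
    refine cone0_mono (one_pos.trans_le h1.2) ?_ h1.1
    have h3 := three_le_coeffD σ M n ω fun j _ => hω.1 j
    have h4 : ∏ j ∈ Finset.range n, 2 * coeffD σ M 1 (σ^[j] ω) =
        (∏ j ∈ Finset.range (n - p), 2 * coeffD σ M 1 (σ^[j] ω)) *
          ∏ j ∈ Finset.range p, 2 * coeffD σ M 1 (σ^[j] (σ^[n - p] ω)) := by
      conv_lhs => rw [← Nat.sub_add_cancel hp.le, Finset.prod_range_add]
      congr 1
      refine Finset.prod_congr rfl fun j _ => ?_
      rw [← Function.iterate_add_apply, add_comm]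
    rw [h4]
    have h5 := (hω.iterL_mem_prod (n - p) (one_mem_cone0 (α := α) (β := β))).2
    have h6 := le_mul_of_one_le_left (zero_le_one.trans h1.2) h5
    linarith

theorem seriesTerm_zero (ω : Ω) : seriesTerm σ M n d γ (σ^[n] ω) 0 = γ⁻¹ * d ω := by
  simp [seriesTerm, symm_iterate_iterate]

theorem seriesTerm_succ (ω : Ω) (j : ℕ) : seriesTerm σ M n d γ (σ^[n] ω) (j + 1) =
    γ⁻¹ * coeffC σ M n ω * seriesTerm σ M n d γ ω j := by
  rw [seriesTerm, seriesTerm, Finset.prod_range_succ', Function.iterate_succ_apply,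
    symm_iterate_iterate]
  have : ∏ k ∈ Finset.range j, coeffC σ M n ((σ.symm^[n])^[k + 1 + 1] (σ^[n] ω)) =
      ∏ k ∈ Finset.range j, coeffC σ M n ((σ.symm^[n])^[k + 1] ω) :=
    Finset.prod_congr rfl fun k _ => by
      rw [Function.iterate_succ_apply _ (k + 1), symm_iterate_iterate]
  rw [this, Function.iterate_succ_apply _ 0, symm_iterate_iterate, Function.iterate_zero, id,
    pow_succ γ (j + 1), mul_inv]
  ring

/-- Apart from its first term, the series at `σ^n ω` is a nonzero multiple of the series at `ω`.
This makes the domain of the cone field invariant. -/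
theorem summable_seriesTerm_iff (hγ : 0 < γ) (hω : Good σ M ω) :
    Summable (seriesTerm σ M n d γ (σ^[n] ω)) ↔ Summable (seriesTerm σ M n d γ ω) := by
  rw [← summable_nat_add_iff 1]
  simp only [seriesTerm_succ]
  exact summable_mul_left_iff (mul_pos (inv_pos.2 hγ)
    (coeffC_pos σ M n ω fun j _ => hω.1 j)).ne'

/-- The equation for which the series is designed. With the Lasota–Yorke inequality it says that the
cone at `ω` is mapped into the cone at `σ^n ω` whose aperture is reduced by the factor `γ`. -/
theorem tsum_seriesTerm (hs : Summable (seriesTerm σ M n d γ (σ^[n] ω))) :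
    ∑' j, seriesTerm σ M n d γ (σ^[n] ω) j =
      γ⁻¹ * (d ω + coeffC σ M n ω * ∑' j, seriesTerm σ M n d γ ω j) := by
  rw [hs.tsum_eq_zero_add]
  simp only [seriesTerm_succ, seriesTerm_zero, tsum_mul_left]
  ring

theorem Good.iterate_symm_iterate (hω : Good σ M ω) (n j : ℕ) :
    Good σ M ((σ.symm^[n])^[j] ω) := by
  rw [← Function.iterate_mul]
  exact hω.symm_iterate _

theorem seriesTerm_pos (hd : IsStepBound σ M n d) (hγ : 0 < γ) (hω : Good σ M ω) (j : ℕ) :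
    0 < seriesTerm σ M n d γ ω j := by
  refine mul_pos (mul_pos (by positivity) ?_) (Finset.prod_pos fun k _ => ?_)
  · have h := hω.iterate_symm_iterate n (j + 1)
    exact three_pos.trans_le ((three_le_coeffD σ M n _ fun j _ => h.1 j).trans (hd.coeffD_le _ h))
  · exact coeffC_pos σ M n _ fun j _ => (hω.iterate_symm_iterate n (k + 1)).1 j

/-- Contraction is the aperture equation. For `entry`, the first term of the series already gives `γ
a ≥ d` evaluated `n` steps earlier, and `d` dominates short initial stretches. -/
theorem coneField_of_stepBound (hn : 0 < n) (hd : IsStepBound σ M n d) (hγ : 0 < γ) (hγ1 : γ < 1) :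
    ConeField σ M n γ (fun ω => ∑' j, seriesTerm σ M n d γ ω j)
      {ω | Good σ M ω ∧ Summable (seriesTerm σ M n d γ ω)} where
  n_pos := hn
  pos := hγ
  lt_one := hγ1
  good _ hω := hω.1
  a_pos ω hω := hω.2.tsum_pos (fun j => (seriesTerm_pos hd hγ hω.1 j).le) 0
    (seriesTerm_pos hd hγ hω.1 0)
  invariant ω := by
    constructor
    · rintro ⟨h1, h2⟩
      exact ⟨h1.of_iterate, (summable_seriesTerm_iff hγ h1.of_iterate).1 h2⟩
    · rintro ⟨h1, h2⟩
      exact ⟨h1.iterate n, (summable_seriesTerm_iff hγ h1).2 h2⟩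
  map ω hω v hv := by
    have ha : 0 < ∑' j, seriesTerm σ M n d γ ω j :=
      hω.2.tsum_pos (fun j => (seriesTerm_pos hd hγ hω.1 j).le) 0 (seriesTerm_pos hd hγ hω.1 0)
    have h1 := hω.1.iterL_mem_cone0 n ha hv
    rw [tsum_seriesTerm ((summable_seriesTerm_iff hγ hω.1).2 hω.2), mul_inv_cancel_left₀ hγ.ne']
    have hc := coeffC_pos σ M n ω fun j _ => hω.1.1 j
    have h3 := three_le_coeffD σ M n ω fun j _ => hω.1.1 j
    refine cone0_mono (by positivity) ?_ h1
    linarith [hd.coeffD_le ω hω.1]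
  entry ω p hp hω v hv := by
    have h1 := hω.1.symm_iterate n
    have e : σ^[n - p] (σ.symm^[n] (σ^[p] ω)) = ω := by
      conv_lhs => rw [← Nat.sub_add_cancel hp.le, Function.iterate_add_apply σ.symm,
        symm_iterate_iterate, Nat.add_sub_cancel, RandomInterval.iterate_symm_iterate]
    have h2 := hd.entry _ h1 p hp v hv
    rw [e] at h2
    refine cone0_mono (three_pos.trans_le ((three_le_coeffD σ M n _ fun j _ => h1.1 j).trans
      (hd.coeffD_le _ h1))) ?_ h2
    have h4 : seriesTerm σ M n d γ (σ^[p] ω) 0 ≤ ∑' j, seriesTerm σ M n d γ (σ^[p] ω) j :=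
      hω.2.le_tsum 0 fun j _ => (seriesTerm_pos hd hγ hω.1 j).le
    have h5 := mul_le_mul_of_nonneg_left h4 hγ.le
    refine le_trans (le_of_eq ?_) h5
    simp [seriesTerm, hγ.ne']

variable [IsProbabilityMeasure m]

/-- With sums bounded by `B`, the product of the coefficients `c` is at most `exp (B + j * (log γ -
2 * δ))`. Integrability of `log d` lets the factor `d` grow at most like `exp (δ * (j + 1))`, so one
`δ` per step is left for a geometric majorant. -/
theorem ae_summable_of_bddAbove (hσ : Ergodic σ m) (hn : 0 < n) (hd : IsStepBound σ M n d)
    (hγ : 0 < γ) (hgood : ∀ᵐ ω ∂m, Good σ M ω) (hdi : Integrable (fun ω => Real.log (d ω)) m)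
    {δ : ℝ} (hδ : 0 < δ) : ∀ᵐ ω ∂m,
      BddAbove (range fun j => birkhoffSum (σ.symm^[n])
        (fun ω => Real.log (coeffC σ M n (σ.symm^[n] ω)) - (Real.log γ - 2 * δ)) j ω) →
      Summable (seriesTerm σ M n d γ ω) := by
  filter_upwards [hgood, ae_tendsto_div (ergodic_symm hσ) hdi] with ω hω hlim ⟨B, hB⟩
  have hn' : (0 : ℝ) < n := Nat.cast_pos.2 hn
  have h1 : ∀ᶠ N : ℕ in atTop, Real.log (d (σ.symm^[N] ω)) ≤ δ / n * N := by
    filter_upwards [hlim.eventually_le_const (by positivity : (0 : ℝ) < δ / n),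
      eventually_gt_atTop 0] with N h1 h2
    rwa [div_le_iff₀ (Nat.cast_pos.2 h2)] at h1
  have h2 : ∀ᶠ j : ℕ in atTop, Real.log (d ((σ.symm^[n])^[j + 1] ω)) ≤ δ * (j + 1) := by
    have ht : Tendsto (fun j : ℕ => n * (j + 1)) atTop atTop :=
      tendsto_atTop_mono (fun j => (Nat.le_succ j).trans (Nat.le_mul_of_pos_left _ hn)) tendsto_id
    filter_upwards [ht.eventually h1] with j hj
    rw [← Function.iterate_mul]
    refine hj.trans_eq ?_
    push_cast
    field_simp
  refine Summable.of_norm_bounded_eventually_nat (g := fun j =>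
    γ⁻¹ * Real.exp (B + δ) * Real.exp (-δ) ^ j)
    ((summable_geometric_of_lt_one (Real.exp_pos _).le (by simpa using hδ)).mul_left _) ?_
  filter_upwards [h2] with j hj
  rw [Real.norm_of_nonneg (seriesTerm_pos hd hγ hω j).le]
  have hcp : ∀ k, 0 < coeffC σ M n ((σ.symm^[n])^[k + 1] ω) := fun k =>
    coeffC_pos σ M n _ fun j _ => (hω.iterate_symm_iterate n (k + 1)).1 j
  have hdp : 0 < d ((σ.symm^[n])^[j + 1] ω) := by
    have h := hω.iterate_symm_iterate n (j + 1)
    exact three_pos.trans_le ((three_le_coeffD σ M n _ fun j _ => h.1 j).trans (hd.coeffD_le _ h))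
  have hS := hB ⟨j, rfl⟩
  simp only [birkhoffSum, Finset.sum_sub_distrib, Finset.sum_const, Finset.card_range,
    nsmul_eq_mul, ← Function.iterate_succ_apply' (σ.symm^[n])] at hS
  have hprod : ∏ k ∈ Finset.range j, coeffC σ M n ((σ.symm^[n])^[k + 1] ω) =
      Real.exp (∑ k ∈ Finset.range j, Real.log (coeffC σ M n ((σ.symm^[n])^[k + 1] ω))) := by
    rw [Real.exp_sum]
    exact Finset.prod_congr rfl fun k _ => (Real.exp_log (hcp k)).symm
  have hγj : (γ ^ (j + 1))⁻¹ = γ⁻¹ * Real.exp (-(j * Real.log γ)) := by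
    rw [Real.exp_neg, mul_comm (j : ℝ), Real.exp_mul, Real.exp_log hγ, Real.rpow_natCast,
      pow_succ, mul_inv, mul_comm]
  rw [seriesTerm, hprod, hγj, ← Real.exp_log hdp, ← Real.exp_nat_mul]
  have e : γ⁻¹ * Real.exp (-(j * Real.log γ)) * Real.exp (Real.log (d ((σ.symm^[n])^[j + 1] ω))) *
      Real.exp (∑ k ∈ Finset.range j, Real.log (coeffC σ M n ((σ.symm^[n])^[k + 1] ω))) =
      γ⁻¹ * Real.exp (-(j * Real.log γ) + Real.log (d ((σ.symm^[n])^[j + 1] ω)) +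
        ∑ k ∈ Finset.range j, Real.log (coeffC σ M n ((σ.symm^[n])^[k + 1] ω))) := by
    rw [Real.exp_add, Real.exp_add]
    ring
  rw [Real.exp_log hdp] at e
  rw [Real.exp_log hdp, e, mul_assoc, ← Real.exp_add]
  refine mul_le_mul_of_nonneg_left (Real.exp_le_exp.2 ?_) (inv_pos.2 hγ).le
  linarith

section Series

variable (hσ : Ergodic σ m) (hn : 0 < n) (hd : IsStepBound σ M n d) (hγ : 0 < γ)
  (hgood : ∀ᵐ ω ∂m, Good σ M ω) (hdi : Integrable (fun ω => Real.log (d ω)) m)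
  (hci : Integrable (fun ω => Real.log (coeffC σ M n ω)) m)
  (hlt : ∫ ω, Real.log (coeffC σ M n ω) ∂m < Real.log γ)
include hσ hn hd hγ hgood hdi hci hlt

theorem exists_integral_neg : ∃ δ > 0,
    Integrable (fun ω => Real.log (coeffC σ M n (σ.symm^[n] ω)) - (Real.log γ - 2 * δ)) m ∧
    ∫ ω, (Real.log (coeffC σ M n (σ.symm^[n] ω)) - (Real.log γ - 2 * δ)) ∂m < 0 := by
  have hs : MeasurePreserving (σ.symm^[n]) m m := (ergodic_symm hσ).toMeasurePreserving.iterate n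
  have hi : Integrable (fun ω => Real.log (coeffC σ M n (σ.symm^[n] ω))) m :=
    hs.integrable_comp_of_integrable hci
  -- A quarter of the gap: subtracting `log γ - 2 * δ` uses up half of it and leaves a negative
  -- mean.
  refine ⟨(Real.log γ - ∫ ω, Real.log (coeffC σ M n ω) ∂m) / 4, by linarith,
    hi.sub (integrable_const _), ?_⟩
  rw [integral_sub hi (integrable_const _), integral_const, probReal_univ, one_smul]
  have : ∫ ω, Real.log (coeffC σ M n (σ.symm^[n] ω)) ∂m = ∫ ω, Real.log (coeffC σ M n ω) ∂m := by
    have hs' : MeasurableEmbedding (σ.symm^[n]) := by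
      clear hs hi hn hd hlt hci hdi
      induction n with
      | zero => exact MeasurableEmbedding.id
      | succ n ih =>
        rw [Function.iterate_succ]
        exact ih.comp σ.symm.measurableEmbedding
    exact hs.integral_comp hs' fun ω => Real.log (coeffC σ M n ω)
  rw [this]
  linarith

/-- Since `σ^n` need not be ergodic, a negative mean makes the Birkhoff sums bounded above only with
positive probability, so convergence is obtained only on a set of positive measure. For `n = 1`
ergodicity gives it almost surely. -/
theorem not_ae_not_summable : ¬ ∀ᵐ ω ∂m, ¬ (Good σ M ω ∧ Summable (seriesTerm σ M n d γ ω)) := by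
  obtain ⟨δ, hδ, hi, hneg⟩ := exists_integral_neg hσ hn hd hγ hgood hdi hci hlt
  intro hcon
  refine measure_bddAbove_birkhoffSum_ne_zero
    ((ergodic_symm hσ).toMeasurePreserving.iterate n) hi hneg ?_
  filter_upwards [hcon, hgood, ae_summable_of_bddAbove hσ hn hd hγ hgood hdi hδ] with ω h1 h2 h3 h4
  exact h1 ⟨h2, h3 h4⟩

end Series

theorem ae_summable_apertureTerm (hσ : Ergodic σ m) (hγ : 0 < γ)
    (hgood : ∀ᵐ ω ∂m, Good σ M ω) (hdi : Integrable (fun ω => Real.log (coeffD σ M 1 ω)) m)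
    (hci : Integrable (fun ω => Real.log (coeffC σ M 1 ω)) m)
    (hlt : ∫ ω, Real.log (coeffC σ M 1 ω) ∂m < Real.log γ) :
    ∀ᵐ ω ∂m, Summable (seriesTerm σ M 1 (coeffD σ M 1) γ ω) := by
  obtain ⟨δ, hδ, hi, hneg⟩ :=
    exists_integral_neg hσ one_pos isStepBound_one hγ hgood hdi hci hlt
  have h1 := ae_summable_of_bddAbove hσ one_pos isStepBound_one hγ hgood hdi hδ
  have h2 := ae_bddAbove_birkhoffSum (τ := σ.symm^[1]) (ergodic_symm hσ) hi hneg
  filter_upwards [h1, h2] with ω h3 h4 using h3 h4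

end Aperture

end RandomInterval
end

/-! ### Visit frequencies and existence of the limits. -/

noncomputable section
namespace RandomInterval
variable {α β : ℝ} [Fact (α < β)]

section Existence

variable {Ω : Type*} [MeasurableSpace Ω] {m : Measure Ω} {σ : Ω ≃ᵐ Ω}
  {M : Ω → WeightedOpenMap α β} {ω : Ω} {A : Set Ω}

theorem visits_eq_birkhoffSum (A : Set Ω) (N : ℕ) (ω : Ω) :
    (visits σ A N ω : ℝ) = birkhoffSum σ (A.indicator fun _ => (1 : ℝ)) N ω := by
  classical
  rw [visits, Finset.card_filter, birkhoffSum]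
  push_cast
  rfl

theorem visits_symm_eq_birkhoffSum (A : Set Ω) (N : ℕ) (ω : Ω) :
    (visits σ A N (σ.symm^[N] ω) : ℝ) =
      birkhoffSum σ.symm (fun ω => A.indicator (fun _ => (1 : ℝ)) (σ.symm ω)) N ω := by
  induction N with
  | zero => rw [visits, Finset.range_zero, Finset.filter_empty]; simp
  | succ N ih =>
    rw [birkhoffSum_succ, ← ih, add_comm N 1, visits_add, Nat.cast_add, visits_eq_birkhoffSum A 1,
      birkhoffSum_one, Function.iterate_one, add_comm 1 N, Function.iterate_succ_apply' _ N,
      σ.apply_symm_apply, add_comm]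

theorem tendsto_atTop_of_tendsto_div {u : ℕ → ℕ} {l : ℝ} (hl : 0 < l)
    (h : Tendsto (fun N : ℕ => (u N : ℝ) / N) atTop (𝓝 l)) : Tendsto u atTop atTop := by
  rw [← tendsto_natCast_atTop_iff (R := ℝ)]
  refine tendsto_atTop_mono' atTop ?_
    ((tendsto_natCast_atTop_atTop (R := ℝ)).const_mul_atTop (half_pos hl))
  filter_upwards [h.eventually_const_lt (half_lt_self hl), eventually_gt_atTop 0] with N h1 h2
  rw [lt_div_iff₀ (Nat.cast_pos.2 h2)] at h1
  exact h1.le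

section Visits

variable [IsProbabilityMeasure m] (hσ : Ergodic σ m) (hAm : MeasurableSet A)
include hσ hAm

theorem ae_tendsto_visits : ∀ᵐ ω ∂m,
    Tendsto (fun N : ℕ => (visits σ A N ω : ℝ) / N) atTop (𝓝 (m.real A)) ∧
    Tendsto (fun N : ℕ => (visits σ A N (σ.symm^[N] ω) : ℝ) / N) atTop (𝓝 (m.real A)) := by
  have hi : Integrable (A.indicator fun _ => (1 : ℝ)) m := (integrable_const 1).indicator hAm
  have h0 : ∫ ω, A.indicator (fun _ => (1 : ℝ)) ω ∂m = m.real A := by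
    rw [integral_indicator hAm, setIntegral_const, smul_eq_mul, mul_one]
  have hs := (ergodic_symm hσ).toMeasurePreserving
  have h1 : ∫ ω, A.indicator (fun _ => (1 : ℝ)) (σ.symm ω) ∂m = m.real A := by
    rw [← h0]
    exact hs.integral_comp σ.symm.measurableEmbedding _
  filter_upwards [ae_tendsto_birkhoffSum hσ hi,
    ae_tendsto_birkhoffSum (ergodic_symm hσ) (hs.integrable_comp_of_integrable hi)] with ω h2 h3
  rw [h0] at h2
  simp only [Function.comp_def] at h3
  rw [h1] at h3
  simp_rw [visits_eq_birkhoffSum A _ ω, visits_symm_eq_birkhoffSum]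
  exact ⟨h2, h3⟩

theorem ae_tendsto_visits_atTop (hA : m A ≠ 0) : ∀ᵐ ω ∂m,
    Tendsto (fun N : ℕ => visits σ A N ω) atTop atTop ∧
    Tendsto (fun N : ℕ => visits σ A N (σ.symm^[N] ω)) atTop atTop := by
  have hpos : 0 < m.real A := ENNReal.toReal_pos hA (measure_ne_top m A)
  filter_upwards [ae_tendsto_visits hσ hAm] with ω h
  exact ⟨tendsto_atTop_of_tendsto_div hpos h.1, tendsto_atTop_of_tendsto_div hpos h.2⟩

end Visits

theorem exists_mem_of_visits_pos {N : ℕ} (h : 0 < visits σ A N ω) : ∃ k < N, σ^[k] ω ∈ A := by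
  classical
  obtain ⟨k, hk⟩ := Finset.card_pos.1 h
  rw [Finset.mem_filter, Finset.mem_range] at hk
  exact ⟨k, hk.1, hk.2⟩

/-! ### Decay of the mass of the monotonicity intervals -/

variable (σ M) in
/-- A bound for the mass of the atoms of the partition of level `N`. -/
def atomBound (N : ℕ) (ω : Ω) : ℝ :=
  normProd σ M N ω / einf (iterL σ M N ω (1 : Seg α β → ℝ))

theorem Good.atomBound_nonneg (hω : Good σ M ω) (N : ℕ) : 0 ≤ atomBound σ M N ω :=
  div_nonneg (normProd_nonneg σ M N ω) (hω.einf_iterL_one_pos N).le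

/-- The numerator is multiplicative, while by positivity the infimum of the iterates of `1` is
supermultiplicative. -/
theorem Good.atomBound_add_le (hω : Good σ M ω) (N k : ℕ) :
    atomBound σ M (N + k) ω ≤ atomBound σ M N ω * atomBound σ M k (σ^[N] ω) := by
  have h1 := hω.einf_iterL_one_pos N
  have h2 := (hω.iterate N).einf_iterL_one_pos k
  have hP : normProd σ M (N + k) ω = normProd σ M N ω * normProd σ M k (σ^[N] ω) := by
    rw [normProd, normProd, normProd, Finset.prod_range_add]
    congr 1
    refine Finset.prod_congr rfl fun j _ => ?_
    rw [← Function.iterate_add_apply, add_comm]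
  rw [atomBound, atomBound, atomBound, hP, div_mul_div_comm]
  refine div_le_div_of_nonneg_left (mul_nonneg (normProd_nonneg σ M _ _)
    (normProd_nonneg σ M _ _)) (mul_pos h1 h2) ?_
  have hb := isBV_iterL σ M N ω (isBV_one (α := α) (β := β))
  have hb' := isBV_iterL σ M k (σ^[N] ω) (isBV_one (α := α) (β := β))
  rw [← hb'.einf_const_mul h1.le, iterL_add, ← iterL_const_mul]
  refine (isBV_iterL σ M k _ (isBV_one.const_mul _)).einf_mono (isBV_iterL σ M k _ hb)
    (iterL_mono σ M k _ (isBV_one.const_mul _) hb ?_)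
  filter_upwards [hb.ae_einf_le] with x hx
  simpa using hx

theorem Good.atomBound_le_coeffC (hω : Good σ M ω) (n : ℕ) :
    atomBound σ M n ω ≤ coeffC σ M n ω := by
  have he := einfOn_pos σ M n ω fun j _ => hω.1 j
  have hb : (0 : ℝ) < numFull σ M n ω := Nat.cast_pos.2 (one_le_numFull σ M n ω)
  have hP := normProd_nonneg σ M n ω
  have h1 := mul_einf_le_einf_iterL σ M (n := n) (fun j _ => hω.1 j)
    (isBV_one (α := α) (β := β)) (ae_of_all _ fun _ => zero_le_one)
  rw [einf_one, mul_one] at h1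
  refine (div_le_div_of_nonneg_left hP (mul_pos he hb) h1).trans ?_
  rw [coeffC, ← div_div]
  refine div_le_div_of_nonneg_right ?_ hb.le
  have hv := varSum_nonneg σ M n ω
  have hξ : (0 : ℝ) ≤ maxContiguous σ M n ω := Nat.cast_nonneg _
  exact le_mul_of_one_le_left (div_nonneg hP he.le)
    (one_le_mul_of_one_le_of_one_le (by linarith) (by linarith))

/-- By submultiplicativity and comparison with `coeffC`, the bound decays exponentially along `σ^n`
from any point at which the Birkhoff sums, corrected by half of their negative drift, are bounded.
Such points have positive measure only, but almost every `σ`-orbit reaches one, and the waiting time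
costs a fixed factor. Completeness makes this set measurable. -/
theorem ae_exists_atomBound_lt [IsProbabilityMeasure m] [m.IsComplete] (hσ : Ergodic σ m) {n : ℕ}
    (hgood : ∀ᵐ ω ∂m, Good σ M ω) (hci : Integrable (fun ω => Real.log (coeffC σ M n ω)) m)
    (hlt : ∫ ω, Real.log (coeffC σ M n ω) ∂m < 0) :
    ∀ᵐ ω ∂m, ∀ δ > 0, ∃ N, atomBound σ M N ω < δ := by
  have hτ := hσ.toMeasurePreserving.iterate n
  set δ₀ := -(∫ ω, Real.log (coeffC σ M n ω) ∂m) / 2 with hδ₀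
  have hδ₀pos : 0 < δ₀ := by
    rw [hδ₀]
    linarith
  have hφ : Integrable (fun ω => Real.log (coeffC σ M n ω) - -δ₀) m :=
    hci.sub (integrable_const _)
  have hneg : ∫ ω, (Real.log (coeffC σ M n ω) - -δ₀) ∂m < 0 := by
    rw [integral_sub hci (integrable_const _), integral_const, probReal_univ, one_smul]
    linarith
  set B := {ω | BddAbove (range fun j =>
    birkhoffSum (σ^[n]) (fun ω => Real.log (coeffC σ M n ω) - -δ₀) j ω)}
  have hBm : MeasurableSet B := (nullMeasurableSet_bddAbove hτ hφ).measurable_of_complete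
  have hB : m B ≠ 0 := fun h0 =>
    measure_bddAbove_birkhoffSum_ne_zero hτ hφ hneg (measure_eq_zero_iff_ae_notMem.1 h0)
  filter_upwards [hgood, ae_tendsto_visits_atTop hσ hBm hB] with ω hω hv δ hδ
  obtain ⟨N₀, hN₀⟩ := (hv.1.eventually_gt_atTop 0).exists
  obtain ⟨N, -, K, hK⟩ := exists_mem_of_visits_pos hN₀
  have hstep : ∀ j : ℕ, atomBound σ M (N + n * j) ω ≤
      atomBound σ M N ω * Real.exp (K - δ₀ * j) := by
    have hprod : ∀ j : ℕ, atomBound σ M (N + n * j) ω ≤ atomBound σ M N ω *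
        ∏ i ∈ Finset.range j, coeffC σ M n ((σ^[n])^[i] (σ^[N] ω)) := by
      intro j
      induction j with
      | zero => simp
      | succ j ih =>
        have hg := hω.iterate (N + n * j)
        rw [mul_add, mul_one, ← add_assoc, Finset.prod_range_succ, ← mul_assoc,
          ← Function.iterate_mul, ← Function.iterate_add_apply, add_comm (n * j) N]
        refine (hω.atomBound_add_le (N + n * j) n).trans ?_
        exact mul_le_mul ih (hg.atomBound_le_coeffC n) (hg.atomBound_nonneg n)
          ((hω.atomBound_nonneg _).trans ih)
    intro j
    refine (hprod j).trans (mul_le_mul_of_nonneg_left ?_ (hω.atomBound_nonneg N))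
    have hpos : ∀ i, 0 < coeffC σ M n ((σ^[n])^[i] (σ^[N] ω)) := fun i => by
      rw [← Function.iterate_mul]
      exact coeffC_pos σ M n _ fun j _ => ((hω.iterate N).iterate (n * i)).1 j
    rw [← Real.log_le_iff_le_exp (Finset.prod_pos fun i _ => hpos i),
      Real.log_prod fun i _ => (hpos i).ne']
    have := hK ⟨j, rfl⟩
    simp only [birkhoffSum, Finset.sum_sub_distrib, Finset.sum_const, Finset.card_range,
      nsmul_eq_mul] at this
    linarith
  have hlim : Tendsto (fun j : ℕ => atomBound σ M N ω * Real.exp (K - δ₀ * j)) atTop (𝓝 0) := by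
    have h1 : Tendsto (fun j : ℕ => K - δ₀ * j) atTop atBot :=
      tendsto_atBot_add_const_left _ K (tendsto_neg_atTop_atBot.comp
        (tendsto_natCast_atTop_atTop.const_mul_atTop hδ₀pos))
    simpa using (Real.tendsto_exp_atBot.comp h1).const_mul (atomBound σ M N ω)
  obtain ⟨j, hj⟩ := (hlim.eventually_lt_const hδ).exists
  exact ⟨N + n * j, (hstep j).trans_lt hj⟩

theorem bddAbove_range_of_eventually {u : ℕ → ℝ} (h : ∃ K, ∀ᶠ N in atTop, u N ≤ K) :
    BddAbove (range u) := by
  obtain ⟨K, hK⟩ := h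
  exact (isBoundedUnder_of_eventually_le hK).bddAbove_range

/-! ### Existence of the conformal measures and of the densities -/

variable {n : ℕ} {γ : ℝ} {a : Ω → ℝ} {G : Set Ω} {D t : ℝ}

variable (σ A D t) in
/-- The bound for the logarithmic ratios after `N` steps. -/
def ratioBound (ω : Ω) (N : ℕ) : ℝ :=
  (D + Real.log 4) / Real.tanh (D / 4) ^ 2 * t ^ visits σ A N ω

theorem ratioBound_nonneg (hD : 0 < D) (ht0 : 0 < t) (N : ℕ) : 0 ≤ ratioBound σ A D t ω N := by
  have hl4 : 0 < Real.log 4 := Real.log_pos (by norm_num)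
  unfold ratioBound
  positivity

theorem tendsto_ratioBound (ht0 : 0 < t) (ht1 : t < 1)
    (h : Tendsto (fun N : ℕ => visits σ A N ω) atTop atTop) :
    Tendsto (ratioBound σ A D t ω) atTop (𝓝 0) := by
  unfold ratioBound
  simpa using ((tendsto_pow_atTop_nhds_zero_of_lt_one ht0.le ht1).comp h).const_mul
    ((D + Real.log 4) / Real.tanh (D / 4) ^ 2)

/-- The approximation property determines the functional, so a measure found with one error sequence
may be used with any other. -/
theorem Represents.of_limitFunctional {ε ε' : ℕ → ℝ} {Λ Λ' : (Seg α β → ℝ) → ℝ}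
    {ν : Measure (Seg α β)} (R : Represents σ M ω ε Λ ν) (E : LimitFunctional σ M ω ε' Λ') :
    Represents σ M ω ε' Λ' ν := by
  refine ⟨E, R.isProbabilityMeasure, R.measure_singleton, fun f hf => ?_⟩
  rw [R.integral_eq f hf]
  have h1 := E.tendsto_mul (bvNorm f)
  refine le_antisymm (ge_of_tendsto' (by simpa using h1.const_add (Λ' f)) fun N =>
    R.functional.le_of_ae_le (N := N) hf ?_) (le_of_tendsto' (by simpa using h1.const_sub (Λ' f))
      fun N => R.functional.le_of_ae_ge (N := N) hf ?_)
  · filter_upwards [E.approx f hf N] with x hx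
    linarith [(abs_le.1 hx).2]
  · filter_upwards [E.approx f hf N] with x hx
    linarith [(abs_le.1 hx).1]

namespace ConeField

variable (C : ConeField σ M n γ a G) (hAG : A ⊆ G) (hA : ∀ ω ∈ A, diam γ a ω ≤ D) (hD : 0 < D)
  (ht0 : 0 < t) (ht1 : t < 1) (htn : t ^ n = Real.tanh (D / 4))
include C hAG hA hD ht0 ht1 htn

theorem exists_limitFunctional (hω : Good σ M ω)
    (h : Tendsto (fun N : ℕ => visits σ A N ω) atTop atTop) :
    ∃ Λ, LimitFunctional σ M ω (fun N => 3 * (Real.exp (ratioBound σ A D t ω N) - 1)) Λ :=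
  hω.exists_limitFunctional (ratioBound_nonneg hD ht0) (tendsto_ratioBound ht0 ht1 h)
    fun N _ hf _ hh hf0 hh0 => C.exists_ae_le_of_mem_cone0 hAG hA hD ht0 ht1 htn hf hh hf0 hh0 N

/-- Fix one visit to `A` in the past, at time `-(k + 1)`. Images of `1` from any earlier time lie in
one fixed cone when they arrive there, and the remaining `k + 1` steps change the aperture by a
fixed amount. -/
theorem bddAbove_var_pastDensity (hω : Good σ M ω)
    (h : Tendsto (fun N : ℕ => visits σ A N (σ.symm^[N] ω)) atTop atTop) :
    BddAbove (range fun N => var (pastDensity σ M ω N)) := by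
  obtain ⟨N₀, hN₀⟩ := (h.eventually_gt_atTop 0).exists
  obtain ⟨j, hj, hjA⟩ := exists_mem_of_visits_pos hN₀
  obtain ⟨k, rfl⟩ := Nat.exists_eq_add_of_lt hj
  have e : σ^[j] (σ.symm^[j + k + 1] ω) = σ.symm^[k + 1] ω := by
    rw [add_assoc, Function.iterate_add_apply, iterate_symm_iterate]
  rw [e] at hjA
  have hG := hAG hjA
  have ha : 0 < γ * a (σ.symm^[k + 1] ω) := mul_pos C.pos (C.a_pos _ hG)
  refine (bddAbove_range_of_eventually ?_)
  refine ⟨coeffC σ M (k + 1) (σ.symm^[k + 1] ω) * (γ * a (σ.symm^[k + 1] ω)) +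
    coeffD σ M (k + 1) (σ.symm^[k + 1] ω), ?_⟩
  filter_upwards [eventually_ge_atTop (k + 1)] with N hN
  refine var_pastDensity_le hω N ?_
  obtain ⟨i, rfl⟩ := Nat.exists_eq_add_of_le' hN
  have e2 : σ^[i] (σ.symm^[i + (k + 1)] ω) = σ.symm^[k + 1] ω := by
    rw [Function.iterate_add_apply, iterate_symm_iterate]
  have h1 := iterL_mem_orbitCone σ M (one_mem_orbitCone σ M (ω := σ.symm^[i + (k + 1)] ω)) i
  rw [e2] at h1
  rw [iterL_add, e2]
  exact (hω.symm_iterate (k + 1)).iterL_mem_cone0 (k + 1) ha (C.mem_cone0 hG h1)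

theorem exists_isDensity (hω : Good σ M ω)
    (h : Tendsto (fun N : ℕ => visits σ A N (σ.symm^[N] ω)) atTop atTop) :
    ∃ q, IsDensity σ M ω q := by
  obtain ⟨B, hB⟩ := C.bddAbove_var_pastDensity hAG hA hD ht0 ht1 htn hω h
  refine RandomInterval.exists_isDensity hω
    (θ := fun N => D / Real.tanh (D / 4) ^ 2 * t ^ visits σ A N (σ.symm^[N] ω)) ?_ ?_
    fun N => hB ⟨N, rfl⟩
  · simpa using ((tendsto_pow_atTop_nhds_zero_of_lt_one ht0.le ht1).comp h).const_mul
      (D / Real.tanh (D / 4) ^ 2)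
  · filter_upwards [h.eventually_gt_atTop n] with N hN f hf h hh
    exact C.exists_ae_le hAG hA hD ht0 ht1 htn hf hh hN

end ConeField

end Existence

end RandomInterval
end

/-! ### Tempered constants and decay of correlations. -/

noncomputable section
namespace RandomInterval
variable {α β : ℝ} [Fact (α < β)]

section Supremum

variable {Ω : Type*} [MeasurableSpace Ω] {m : Measure Ω} [IsProbabilityMeasure m]

/-- The largest value along the orbit, discounted by Birkhoff sums. -/
def orbitSup (τ : Ω → Ω) (ψ b : Ω → ℝ) (ω : Ω) : ℝ :=
  ⨆ n : ℕ, (ψ (τ^[n] ω) + birkhoffSum τ b n ω)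

theorem measurable_orbitSup {τ : Ω → Ω} (hτ : Measurable τ) {ψ b : Ω → ℝ} (hψ : Measurable ψ)
    (hb : Measurable b) : Measurable (orbitSup τ ψ b) :=
  Measurable.iSup fun n => (hψ.comp (hτ.iterate n)).add
    (Finset.measurable_fun_sum _ fun k _ => hb.comp (hτ.iterate k))

/-- Discounted suprema along orbits are finite and grow subexponentially. -/
theorem orbitSup_spec (τ : Ω ≃ᵐ Ω) (hτ : Ergodic τ m) {ψ b : Ω → ℝ} (hψ : Measurable ψ)
    (hb : Measurable b) (hψ0 : ∀ᵐ ω ∂m, 0 ≤ ψ ω)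
    (hlim : ∀ᵐ ω ∂m, Tendsto (fun n : ℕ => ψ (τ^[n] ω) / n) atTop (𝓝 0))
    (hbi : Integrable b m) (hneg : ∫ ω, b ω ∂m < 0) :
    (∀ᵐ ω ∂m, ∀ n : ℕ, ψ (τ^[n] ω) + birkhoffSum τ b n ω ≤ orbitSup τ ψ b ω) ∧
    (∀ᵐ ω ∂m, Tendsto (fun n : ℕ => orbitSup τ ψ b (τ^[n] ω) / n) atTop (𝓝 0)) ∧
    ∀ᵐ ω ∂m, Tendsto (fun n : ℕ => orbitSup τ ψ b (τ.symm^[n] ω) / n) atTop (𝓝 0) := by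
  have hbdd : ∀ᵐ ω ∂m, BddAbove (range fun n : ℕ => ψ (τ^[n] ω) + birkhoffSum τ b n ω) := by
    filter_upwards [hlim, ae_tendsto_birkhoffSum hτ hbi] with ω h1 h2
    refine bddAbove_range_of_eventually ⟨0, ?_⟩
    have h3 := h1.add h2
    rw [zero_add] at h3
    filter_upwards [h3.eventually_lt_const hneg, eventually_gt_atTop 0] with n h4 h5
    rw [← add_div, div_lt_iff₀ (Nat.cast_pos.2 h5), zero_mul] at h4
    exact h4.le
  have hle : ∀ᵐ ω ∂m, ∀ n : ℕ, ψ (τ^[n] ω) + birkhoffSum τ b n ω ≤ orbitSup τ ψ b ω := by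
    filter_upwards [hbdd] with ω h n
    exact le_ciSup h n
  refine ⟨hle, tendsto_div_of_increment_le hτ
    (measurable_orbitSup τ.measurable hψ hb).aemeasurable ?_ hbi.neg ?_⟩
  · filter_upwards [hle, hψ0] with ω h1 h2
    have := h1 0
    simp only [Function.iterate_zero, id_eq, birkhoffSum_zero, add_zero] at this
    exact h2.trans this
  -- Splitting off the first step shows that the supremum at `τ ω` is at most the one at `ω` minus
  -- `b ω`. An increment bounded above by an integrable function forces subexponential growth.
  · filter_upwards [hle] with ω h
    rw [Pi.neg_apply, sub_le_iff_le_add, neg_add_eq_sub]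
    refine ciSup_le fun n => ?_
    have := h (n + 1)
    rw [birkhoffSum_succ', Function.iterate_succ_apply] at this
    linarith

end Supremum

section Decay

variable {Ω : Type*} [MeasurableSpace Ω] {m : Measure Ω} {σ : Ω ≃ᵐ Ω}
  {M : Ω → WeightedOpenMap α β} {ω : Ω} {A : Set Ω}

variable (σ M) in
/-- The largest variation of the normalized images of `1` from the past. -/
def pastVar (ω : Ω) : ℝ := ⨆ N, var (pastDensity σ M ω N)

theorem pastVar_nonneg (ω : Ω) : 0 ≤ pastVar σ M ω := Real.iSup_nonneg fun _ => var_nonneg _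

theorem mem_cone0_of_var_pastDensity_le (hω : Good σ M ω) (N : ℕ) {B : ℝ}
    (h : var (pastDensity σ M ω N) ≤ B) :
    iterL σ M N (σ.symm^[N] ω) 1 ∈ (cone0 B : Set (Seg α β → ℝ)) := by
  have h1 := (hω.symm_iterate N).einf_iterL_one_pos N
  have h2 : pastDensity σ M ω N ∈ (cone0 B : Set (Seg α β → ℝ)) :=
    ⟨isBV_pastDensity ω N, by rwa [einf_pastDensity hω, mul_one]⟩
  have h3 := cone0_const_mul h1.le h2
  have e : (fun x => einf (iterL σ M N (σ.symm^[N] ω) 1) * pastDensity σ M ω N x) =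
      iterL σ M N (σ.symm^[N] ω) 1 := by
    ext x
    exact mul_div_cancel₀ _ h1.ne'
  rwa [e] at h3

/-- One Lasota–Yorke step bounds the logarithmic increment of the uniform variation bound by an
integrable function. That makes the norms of the densities tempered without any integrability of
their logarithms. -/
theorem one_add_pastVar_le (hω : Good σ M ω)
    (hb : BddAbove (range fun N => var (pastDensity σ M ω N))) :
    1 + pastVar σ M (σ ω) ≤ 3 * coeffD σ M 1 ω * (1 + pastVar σ M ω) := by
  have hd := three_le_coeffD σ M 1 ω fun j _ => hω.1 j
  have hcp := coeffC_pos σ M 1 ω fun j _ => hω.1 j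
  have hc := coeffC_le_coeffD hω 1
  have hQ := pastVar_nonneg (σ := σ) (M := M) ω
  have h1 : pastVar σ M (σ ω) ≤ coeffC σ M 1 ω * (1 + pastVar σ M ω) + coeffD σ M 1 ω := by
    refine ciSup_le fun N => var_pastDensity_le hω.apply N ?_
    cases N with
    | zero => exact const_mem_cone0 (by positivity) zero_le_one
    | succ N =>
      rw [iterL_add, Function.iterate_succ_apply, σ.symm_apply_apply, iterate_symm_iterate]
      refine hω.iterL_mem_cone0 1 (by positivity) (mem_cone0_of_var_pastDensity_le hω N ?_)
      exact (le_ciSup hb N).trans (le_add_of_nonneg_left zero_le_one)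
  have h2 := mul_le_mul_of_nonneg_right hc (by linarith : 0 ≤ 1 + pastVar σ M ω)
  nlinarith

variable (σ M) in
/-- The logarithm of a bound for the norms of the densities. -/
def logNormBound (ω : Ω) : ℝ := Real.log (2 * (1 + pastVar σ M ω))

theorem logNormBound_nonneg (ω : Ω) : 0 ≤ logNormBound σ M ω :=
  Real.log_nonneg (by linarith [pastVar_nonneg (σ := σ) (M := M) ω])

theorem IsDensity.norm_le {q : Seg α β → ℝ} (hq : IsDensity σ M ω q)
    (hb : BddAbove (range fun N => var (pastDensity σ M ω N))) :
    bvNorm q ≤ Real.exp (logNormBound σ M ω) ∧ supNorm q ≤ Real.exp (logNormBound σ M ω) := by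
  have hQ := pastVar_nonneg (σ := σ) (M := M) ω
  have hv : var q ≤ pastVar σ M ω := hq.var_le fun N => le_ciSup hb N
  have hs : supNorm q ≤ 1 + pastVar σ M ω := by
    refine hq.isBV.supNorm_le ?_
    filter_upwards [hq.ae_one_le, hq.isBV.ae_le_einf_add_var] with x h1 h2
    rw [hq.einf_eq] at h2
    rw [abs_of_nonneg (zero_le_one.trans h1)]
    linarith
  rw [logNormBound, Real.exp_log (by linarith), bvNorm]
  constructor <;> linarith

variable (σ M) in
/-- The base points at which the density and the conformal measure exist. -/
structure Regular (A : Set Ω) (q : Ω → Seg α β → ℝ) (ν : Ω → Measure (Seg α β)) (ω : Ω) : Prop where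
  good : Good σ M ω
  density : IsDensity σ M ω (q ω)
  represents : ∃ ε Λ, Represents σ M ω ε Λ (ν ω)
  visits : Tendsto (fun N : ℕ => visits σ A N ω) atTop atTop
  bddAbove : BddAbove (range fun N => var (pastDensity σ M ω N))

variable {q : Ω → Seg α β → ℝ} {ν : Ω → Measure (Seg α β)}

theorem exists_iterL_density_eq (h : ∀ j : ℕ, Good σ M (σ^[j] ω) ∧
    IsDensity σ M (σ^[j] ω) (q (σ^[j] ω))) (n : ℕ) : ∃ lam : ℝ, 0 < lam ∧
      iterL σ M n ω (q ω) =ᵐ[leb] fun x => lam * q (σ^[n] ω) x := by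
  induction n with
  | zero => exact ⟨1, one_pos, by simp [iterL]⟩
  | succ n ih =>
    obtain ⟨lam, h0, h1⟩ := ih
    have hd := (h (n + 1)).2
    rw [Function.iterate_succ_apply'] at hd ⊢
    have h2 := (h n).2.transfer_eq (h n).1 hd
    refine ⟨lam * _, mul_pos h0 h2.2.1, ?_⟩
    have h3 := iterL_congr σ M 1 (σ^[n] ω) (isBV_iterL σ M n ω (h 0).2.isBV)
      ((h n).2.isBV.const_mul lam) h1
    rw [iterL_const_mul, iterL_one, iterL_one] at h3
    filter_upwards [h3, h2.1] with x h4 h5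
    rw [iterL_add, iterL_one]
    simp only [Function.iterate_zero, id_eq] at h4
    rw [h4, h5]
    ring

variable {n : ℕ} {γ : ℝ} {a : Ω → ℝ} {G : Set Ω} {D t : ℝ}

variable (D) in
/-- The constant in front of the correlation estimate. -/
def decayConst : ℝ :=
  6 * ((D + Real.log 4) / Real.tanh (D / 4) ^ 2) *
    Real.exp ((D + Real.log 4) / Real.tanh (D / 4) ^ 2)

theorem decayConst_pos (hD : 0 < D) : 0 < decayConst D := by
  have hl4 : 0 < Real.log 4 := Real.log_pos (by norm_num)
  have := tanh_pos (by positivity : 0 < D / 4)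
  unfold decayConst
  positivity

theorem exp_sub_one_le {x y : ℝ} (hy : x ≤ y) (hx : 0 ≤ x) :
    Real.exp x - 1 ≤ x * Real.exp y := by
  have h1 := Real.add_one_le_exp (-x)
  have h2 := mul_le_mul_of_nonneg_left h1 (Real.exp_pos x).le
  rw [← Real.exp_add, add_neg_cancel, Real.exp_zero] at h2
  have h3 := mul_le_mul_of_nonneg_left (Real.exp_le_exp.2 hy) hx
  linarith

theorem ratioBound_error_le (hD : 0 < D) (ht0 : 0 < t) (ht1 : t < 1) (N : ℕ) :
    2 * (3 * (Real.exp (ratioBound σ A D t ω N) - 1)) ≤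
      decayConst D * Real.exp (visits σ A N ω * Real.log t) := by
  have hl4 : 0 < Real.log 4 := Real.log_pos (by norm_num)
  have := tanh_pos (by positivity : 0 < D / 4)
  have ht : t ^ visits σ A N ω = Real.exp (visits σ A N ω * Real.log t) := by
    rw [mul_comm, Real.exp_mul, Real.exp_log ht0, Real.rpow_natCast]
  have h1 : ratioBound σ A D t ω N ≤ (D + Real.log 4) / Real.tanh (D / 4) ^ 2 :=
    mul_le_of_le_one_right (by positivity) (pow_le_one₀ ht0.le ht1.le)
  have h2 := exp_sub_one_le h1 (ratioBound_nonneg hD ht0 N)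
  rw [decayConst, ← ht]
  unfold ratioBound at h2 ⊢
  linarith

namespace ConeField

variable (C : ConeField σ M n γ a G) (hAG : A ⊆ G) (hA : ∀ ω ∈ A, diam γ a ω ≤ D) (hD : 0 < D)
  (ht0 : 0 < t) (ht1 : t < 1) (htn : t ^ n = Real.tanh (D / 4))
include C hAG hA hD ht0 ht1 htn

theorem abs_correlation_le (h : ∀ j : ℕ, Regular σ M A q ν (σ^[j] ω)) (N : ℕ)
    {h₁ f : Seg α β → ℝ} (hh : IsBV h₁) (hf : Integrable f (ν (σ^[N] ω))) :
    |(∫ x, f (iterT σ M N ω x) * h₁ x ∂(normalized (q ω) (ν ω))) -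
      (∫ x, f x ∂(normalized (q (σ^[N] ω)) (ν (σ^[N] ω)))) *
        ∫ x, h₁ x ∂(normalized (q ω) (ν ω))| ≤
      decayConst D * Real.exp (logNormBound σ M ω + logNormBound σ M (σ^[N] ω) +
        visits σ A N ω * Real.log t) * (∫ x, |f x| ∂(ν (σ^[N] ω))) * bvNorm h₁ := by
  have h0 : Regular σ M A q ν ω := h 0
  have hN := h N
  obtain ⟨lam, hlam, he⟩ := exists_iterL_density_eq
    (fun j => ⟨(h j).good, (h j).density⟩) N
  obtain ⟨Λ, E⟩ := C.exists_limitFunctional hAG hA hD ht0 ht1 htn h0.good h0.visits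
  obtain ⟨ε, Λ₀, R₀⟩ := h0.represents
  obtain ⟨ε', Λ', R'⟩ := hN.represents
  -- The family `ν` comes with unspecified error sequences; here the explicit one of the cone
  -- contraction is attached.
  have R := R₀.of_limitFunctional E
  have h1 := R.abs_correlation_le R' h0.density.isBV h0.density.ae_one_le hN.density.isBV
    hN.density.ae_one_le he hlam hh hf
  refine h1.trans (mul_le_mul_of_nonneg_right (mul_le_mul_of_nonneg_right ?_
    (integral_nonneg fun x => abs_nonneg _)) (bvNorm_nonneg hh))
  have h2 := (h0.density.norm_le h0.bddAbove).1
  have h3 := (hN.density.norm_le hN.bddAbove).2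
  have h4 := ratioBound_error_le (σ := σ) (A := A) (ω := ω) hD ht0 ht1 N
  have h5 : 0 ≤ 2 * (3 * (Real.exp (ratioBound σ A D t ω N) - 1)) := by
    have := Real.one_le_exp (ratioBound_nonneg (σ := σ) (A := A) (ω := ω) hD ht0 N)
    linarith
  have h6 := bvNorm_nonneg h0.density.isBV
  have h7 := hN.density.isBV.supNorm_nonneg
  calc 2 * bvNorm (q ω) * supNorm (q (σ^[N] ω)) *
        (3 * (Real.exp (ratioBound σ A D t ω N) - 1)) =
        bvNorm (q ω) * supNorm (q (σ^[N] ω)) *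
          (2 * (3 * (Real.exp (ratioBound σ A D t ω N) - 1))) := by ring
    _ ≤ Real.exp (logNormBound σ M ω) * Real.exp (logNormBound σ M (σ^[N] ω)) *
        (decayConst D * Real.exp (visits σ A N ω * Real.log t)) := by gcongr
    _ = _ := by
      rw [Real.exp_add, Real.exp_add]
      ring

end ConeField

variable [IsProbabilityMeasure m] (hσ : Ergodic σ m) {sys : ℕ → WeightedOpenMap α β}
  {idx : Ω → ℕ} (hidx : Measurable idx) (hM : ∀ ω, M ω = sys (idx ω))
  (hc : StronglyContracting m σ M)
include hσ hidx hM hc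

theorem logNormBound_spec
    (hb : ∀ᵐ ω ∂m, BddAbove (range fun N => var (pastDensity σ M ω N))) :
    Measurable (logNormBound σ M) ∧
    (∀ᵐ ω ∂m, Tendsto (fun n : ℕ => logNormBound σ M (σ^[n] ω) / n) atTop (𝓝 0)) ∧
    ∀ᵐ ω ∂m, Tendsto (fun n : ℕ => logNormBound σ M (σ.symm^[n] ω) / n) atTop (𝓝 0) := by
  have hmeas : Measurable (logNormBound σ M) :=
    Real.measurable_log.comp (((Measurable.iSup fun N =>
      measurable_var_pastDensity hidx hM N).const_add 1).const_mul 2)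
  refine ⟨hmeas, tendsto_div_of_increment_le hσ hmeas.aemeasurable
    (ae_of_all _ fun ω => logNormBound_nonneg ω)
    ((integrable_const (Real.log 3)).add (integrable_log_coeffD_one hσ hidx hM hc)) ?_⟩
  filter_upwards [hb, ae_good hσ hc.einf_pos] with ω h1 h2
  have h3 := one_add_pastVar_le h2 h1
  have hd := three_le_coeffD σ M 1 ω fun j _ => h2.1 j
  have hQ := pastVar_nonneg (σ := σ) (M := M) ω
  have hQ' := pastVar_nonneg (σ := σ) (M := M) (σ ω)
  rw [Pi.add_apply, logNormBound, logNormBound, ← Real.log_div (by linarith) (by linarith),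
    ← Real.log_mul (by norm_num) (by linarith)]
  refine Real.log_le_log (by positivity) ?_
  rw [div_le_iff₀ (by linarith)]
  linarith

/-- Exponential decay of correlations from visits to a set of positive measure. -/
theorem ConeField.decaysAtRate (C : ConeField σ M n γ a G) (hAG : A ⊆ G)
    (hA : ∀ ω ∈ A, diam γ a ω ≤ D) (hD : 0 < D) (ht0 : 0 < t) (ht1 : t < 1)
    (htn : t ^ n = Real.tanh (D / 4)) (hAm : MeasurableSet A)
    (hreg : ∀ᵐ ω ∂m, Regular σ M A q ν ω) {r : ℝ} (htr : t ^ (m.real A) < r) :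
    DecaysAtRate m σ M ν (fun ω => normalized (q ω) (ν ω)) r := by
  have hr : 0 < r := (Real.rpow_pos_of_pos ht0 _).trans htr
  obtain ⟨hψm, hψ1, hψ2⟩ := logNormBound_spec hσ hidx hM hc (hreg.mono fun ω h => h.bddAbove)
  set ψ := logNormBound σ M with hψ
  -- A visit contributes `log t`, while the target rate asks for `log r` per step; the mean drift is
  -- negative because `t ^ m(A) < r`. The suprema of norm growth plus accumulated drift, over the
  -- future and over the past, then serve as tempered constants.
  set b : Ω → ℝ := fun ω => A.indicator (fun _ => (1 : ℝ)) ω * Real.log t - Real.log r with hbdef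
  have hi : Integrable (A.indicator fun _ => (1 : ℝ)) m := (integrable_const 1).indicator hAm
  have hbm : Measurable b := ((measurable_const.indicator hAm).mul_const _).sub_const _
  have hbi : Integrable b m := (hi.mul_const _).sub (integrable_const _)
  have hneg : ∫ ω, b ω ∂m < 0 := by
    rw [hbdef, integral_sub (hi.mul_const _) (integrable_const _), integral_mul_const,
      integral_indicator hAm, setIntegral_const, smul_eq_mul, mul_one, integral_const,
      probReal_univ, one_smul, ← Real.log_rpow ht0, sub_neg]
    exact Real.log_lt_log (Real.rpow_pos_of_pos ht0 _) htr
  have hσ' := ergodic_symm hσ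
  have hneg' : ∫ ω, b (σ.symm ω) ∂m < 0 := by
    rwa [hσ'.toMeasurePreserving.integral_comp σ.symm.measurableEmbedding]
  have hψ0 : ∀ᵐ ω ∂m, 0 ≤ ψ ω := ae_of_all _ fun ω => logNormBound_nonneg ω
  obtain ⟨hW1, hW2, hW3⟩ := orbitSup_spec σ hσ hψm hbm hψ0 hψ1 hbi hneg
  obtain ⟨hV1, hV2, hV3⟩ := orbitSup_spec σ.symm hσ' hψm (hbm.comp σ.symm.measurable) hψ0 hψ2
    (hσ'.toMeasurePreserving.integrable_comp_of_integrable hbi) hneg'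
  set W := orbitSup σ ψ b
  set V := orbitSup σ.symm ψ (b ∘ σ.symm)
  have hWm : Measurable W := measurable_orbitSup σ.measurable hψm hbm
  have hVm : Measurable V := measurable_orbitSup σ.symm.measurable hψm (hbm.comp σ.symm.measurable)
  have hK := decayConst_pos hD
  have hWsum : ∀ (N : ℕ) (ω : Ω), birkhoffSum σ b N ω =
      visits σ A N ω * Real.log t - N * Real.log r := by
    intro N ω
    rw [visits_eq_birkhoffSum, hbdef, birkhoffSum_sub_const]
    simp only [birkhoffSum, Finset.sum_mul]
  have hVsum : ∀ (N : ℕ) (ω : Ω), birkhoffSum σ.symm (b ∘ σ.symm) N ω =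
      visits σ A N (σ.symm^[N] ω) * Real.log t - N * Real.log r := by
    intro N ω
    have : b ∘ σ.symm = fun ω => A.indicator (fun _ => (1 : ℝ)) (σ.symm ω) * Real.log t -
      Real.log r := rfl
    rw [visits_symm_eq_birkhoffSum, this, birkhoffSum_sub_const]
    simp only [birkhoffSum, Finset.sum_mul]
  have hrN : ∀ N : ℕ, r ^ N = Real.exp (N * Real.log r) := fun N => by
    rw [mul_comm, Real.exp_mul, Real.exp_log hr, Real.rpow_natCast]
  have hfinal : ∀ {c₁ c₂ : ℝ} (F H : ℝ) (N : ℕ), 0 ≤ F → 0 ≤ H → c₁ ≤ c₂ + N * Real.log r →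
      decayConst D * Real.exp c₁ * F * H ≤ decayConst D * Real.exp c₂ * F * H * r ^ N := by
    intro c₁ c₂ F H N hF hH hcc
    rw [hrN]
    have : decayConst D * Real.exp c₂ * F * H * Real.exp (N * Real.log r) =
        decayConst D * Real.exp (c₂ + N * Real.log r) * F * H := by
      rw [Real.exp_add]
      ring
    rw [this]
    gcongr
  refine ⟨fun ω => decayConst D * Real.exp (ψ ω + W ω + V ω),
    (Real.measurable_exp.comp ((hψm.add hWm).add hVm)).const_mul _,
    fun ω => mul_pos hK (Real.exp_pos _), ?_, ?_⟩
  · have hlog : ∀ ω, Real.log |decayConst D * Real.exp (ψ ω + W ω + V ω)| =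
        Real.log (decayConst D) + (ψ ω + W ω + V ω) := fun ω => by
      rw [abs_of_pos (mul_pos hK (Real.exp_pos _)), Real.log_mul hK.ne' (Real.exp_pos _).ne',
        Real.log_exp]
    filter_upwards [hψ1, hψ2, hW2, hW3, hV2, hV3] with ω h1 h2 h3 h4 h5 h6
    have h0 : Tendsto (fun n : ℕ => Real.log (decayConst D) / n) atTop (𝓝 0) :=
      tendsto_const_div_atTop_nhds_zero_nat _
    simp only [hlog]
    constructor
    · have := h0.add ((h1.add h3).add h6)
      simp only [add_zero] at this
      refine this.congr fun N => ?_
      simp only [add_div]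
      rfl
    · have := h0.add ((h2.add h4).add h5)
      simp only [add_zero] at this
      refine this.congr fun N => ?_
      simp only [add_div]
  · filter_upwards [hW1, hV1, ae_forall_iterate hσ.toMeasurePreserving hreg,
      ae_forall_iterate hσ'.toMeasurePreserving hreg, hW1, hV1] with ω h1 h2 h3 h4 h5 h6 N h hh
    have hψω := logNormBound_nonneg (σ := σ) (M := M) ω
    have hWω : 0 ≤ W ω := by
      have := h1 0
      simp only [Function.iterate_zero, id_eq, birkhoffSum_zero, add_zero] at this
      exact hψω.trans this
    have hVω : 0 ≤ V ω := by
      have := h2 0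
      simp only [Function.iterate_zero, id_eq, birkhoffSum_zero, add_zero] at this
      exact hψω.trans this
    have hH := bvNorm_nonneg hh
    constructor
    · intro f hf
      -- The forward orbit of `σ^{-N} ω` runs through past iterates of `ω` and then through its
      -- future ones.
      have hback : ∀ j : ℕ, Regular σ M A q ν (σ^[j] (σ.symm^[N] ω)) := by
        intro j
        rcases le_total j N with hj | hj
        · obtain ⟨i, rfl⟩ := Nat.exists_eq_add_of_le hj
          rw [Function.iterate_add_apply, iterate_symm_iterate]
          exact h4 i
        · obtain ⟨i, rfl⟩ := Nat.exists_eq_add_of_le' hj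
          rw [Function.iterate_add_apply, iterate_symm_iterate]
          exact h3 i
      have key := C.abs_correlation_le hAG hA hD ht0 ht1 htn hback N hh (f := f)
        (by rwa [iterate_symm_iterate])
      rw [iterate_symm_iterate] at key
      refine key.trans (hfinal _ _ N (integral_nonneg fun x => abs_nonneg _) hH ?_)
      have := h2 N
      rw [hVsum] at this
      linarith
    · intro f hf
      have key := C.abs_correlation_le hAG hA hD ht0 ht1 htn h3 N hh hf
      refine key.trans (hfinal _ _ N (integral_nonneg fun x => abs_nonneg _) hH ?_)
      have := h1 N
      rw [hWsum] at this
      linarith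

end Decay

end RandomInterval
end

noncomputable section
namespace RandomInterval
variable {α β : ℝ} [Fact (α < β)]

section Final

variable {Ω : Type*} [MeasurableSpace Ω] {m : Measure Ω} {σ : Ω ≃ᵐ Ω}
  {M : Ω → WeightedOpenMap α β} {ω : Ω} {A G : Set Ω} {n : ℕ} {d : Ω → ℝ} {γ D t : ℝ} {a : Ω → ℝ}

/-! ### The contraction factor of the cones of one-step contraction -/

theorem ConeField.iterL_mem (C : ConeField σ M 1 γ a G) (hω : ω ∈ G) (k : ℕ) {v : Seg α β → ℝ}
    (hv : v ∈ (cone0 (a ω) : Set (Seg α β → ℝ))) : σ^[k] ω ∈ G ∧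
    iterL σ M k ω v ∈ (cone0 (a (σ^[k] ω)) : Set (Seg α β → ℝ)) := by
  induction k with
  | zero => exact ⟨hω, hv⟩
  | succ k ih =>
    have h1 := C.map _ ih.1 _ ih.2
    have h2 := (C.invariant _).2 ih.1
    rw [iterL_add]
    rw [Function.iterate_one] at h1 h2
    rw [Function.iterate_succ_apply']
    have h3 := C.a_pos _ h2
    refine ⟨h2, cone0_mono (mul_pos C.pos h3) ?_ h1⟩
    nlinarith [C.lt_one]

theorem ConeField.mem_iff_iterate (C : ConeField σ M 1 γ a G) (k : ℕ) : σ^[k] ω ∈ G ↔ ω ∈ G := by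
  have h : σ^[k] ω = σ^[1 * k] ω := by rw [one_mul]
  rw [h]
  exact ⟨C.mem_of_iterate_mem, fun hω => C.iterate_mem hω k⟩

/-- Among the last `l` arrivals before `ω`, a proportion above `1 - ε` lies in `A`. Each of these
contracts ratios by `tanh (D / 4)` and the others do not expand; `hilbertDist_le_mul` passes from
ratios to the metric. -/
theorem ConeField.contractsCones [IsProbabilityMeasure m] (hσ : Ergodic σ m)
    (C : ConeField σ M 1 γ a G) (hA : ∀ ω ∈ A, diam γ a ω ≤ D)
    (hD : 0 < D) (hAm : MeasurableSet A) (hG : ∀ᵐ ω ∂m, ω ∈ G) {ε ϑ : ℝ} (hε : 1 - ε < m.real A)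
    (hϑ : Real.tanh (D / 4) ^ (1 - ε) < ϑ) : ContractsCones m σ M a ϑ := by
  classical
  intro k
  have ht0 : 0 < Real.tanh (D / 4) := tanh_pos (by positivity)
  filter_upwards [hG, hσ.toMeasurePreserving.quasiMeasurePreserving.ae
    (ae_tendsto_visits hσ hAm)] with ω hω hv
  obtain ⟨N, hN⟩ := eventually_atTop.1
    ((hv.2.eventually_const_lt hε).and (eventually_gt_atTop 0))
  refine ⟨N, fun l hl f hf h hh => ?_⟩
  obtain ⟨h1, hl0⟩ := hN l hl
  have hl0' : (0 : ℝ) < l := Nat.cast_pos.2 hl0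
  set ω₀ := σ.symm^[l] ω with hω₀
  have hω₀' : σ^[l] ω₀ = ω := iterate_symm_iterate σ l ω
  have e1 : σ^[k] (σ.symm^[l + k] ω) = ω₀ := by
    rw [add_comm, Function.iterate_add_apply, iterate_symm_iterate]
  have e2 : iterL σ M (l + k) (σ.symm^[l + k] ω) h =
      iterL σ M l ω₀ (iterL σ M k (σ.symm^[l + k] ω) h) := by
    rw [add_comm l k, iterL_add, add_comm k l, e1]
  rw [e2]
  have hG₀ : ω₀ ∈ G := by
    rw [← C.mem_iff_iterate l, hω₀']
    exact hω
  have hGk : σ.symm^[l + k] ω ∈ G := by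
    rw [← C.mem_iff_iterate k, e1]
    exact hG₀
  have ha := C.a_pos _ hG₀
  have hh0 := (C.good _ hGk).einf_iterL_pos k hh.1 (einf_pos_of_mem_cone (C.a_pos _ hGk) hh)
  have hmem := (C.iterL_mem hGk k (cone_subset_cone0 hh)).2
  rw [e1] at hmem
  -- Contraction is credited on arrival, at times `1` to `l` after `ω₀`. This shifts the window by
  -- one, which is why visit frequencies were taken at `σ ω`.
  have hcount : ((Finset.range l).filter fun j => σ^[1 * (j + 1)] ω₀ ∈ A).card =
      visits σ A l (σ.symm^[l] (σ ω)) := by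
    have e3 : σ.symm^[l] (σ ω) = σ ω₀ := by
      rw [← hω₀', ← Function.iterate_succ_apply' σ, Function.iterate_succ_apply,
        symm_iterate_iterate]
    rw [e3, visits]
    simp only [one_mul, Function.iterate_succ_apply]
  have hκ : Real.tanh (D / 4) ^ visits σ A l (σ.symm^[l] (σ ω)) ≤ ϑ ^ l := by
    have h2 : (1 - ε) * l ≤ visits σ A l (σ.symm^[l] (σ ω)) := by
      rw [lt_div_iff₀ hl0'] at h1
      exact h1.le
    calc _ = Real.tanh (D / 4) ^ (visits σ A l (σ.symm^[l] (σ ω)) : ℝ) :=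
          (Real.rpow_natCast _ _).symm
      _ ≤ Real.tanh (D / 4) ^ ((1 - ε) * l) :=
          Real.rpow_le_rpow_of_exponent_ge ht0 (Real.tanh_lt_one _).le h2
      _ = (Real.tanh (D / 4) ^ (1 - ε)) ^ l := by rw [Real.rpow_mul ht0.le, Real.rpow_natCast]
      _ ≤ ϑ ^ l := pow_le_pow_left₀ (Real.rpow_nonneg ht0.le _) hϑ.le l
  refine hilbertDist_le_mul ha hf (mem_cone_of_einf_pos hmem hh0)
    ((pow_pos ht0 _).trans_le hκ) fun x y hx hxy hs => ?_
  obtain ⟨l', u', hl', hlu', hs', hle⟩ := C.exists_sand hA hD hG₀ hx hxy hs l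
  rw [hcount] at hle
  simp only [one_mul] at hs' hle
  rw [hω₀'] at hs'
  refine (hilbertDist_le_of_sand (C.a_pos _ hω) hl' (hl'.trans_le hlu')
    (isBV_iterL σ M l ω₀ hf.1) (isBV_iterL σ M l ω₀ hmem.1) hs').trans ?_
  exact EReal.coe_le_coe_iff.2 (hle.trans (mul_le_mul_of_nonneg_right hκ
    (Real.log_nonneg ((one_le_div hx).2 hxy))))

/-! ### The sets of bounded aperture -/

theorem summable_iff_tsum_ofReal {u : ℕ → ℝ} (hu : ∀ j, 0 ≤ u j) :
    Summable u ↔ ∑' j, ENNReal.ofReal (u j) ≠ ⊤ := by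
  refine ⟨fun h => h.tsum_ofReal_ne_top, fun h => ?_⟩
  exact (ENNReal.summable_toReal h).congr fun j => ENNReal.toReal_ofReal (hu j)

theorem measurable_seriesTerm (hdm : Measurable d) (hcm : Measurable (coeffC σ M n)) (j : ℕ) :
    Measurable fun ω => seriesTerm σ M n d γ ω j := by
  have hs : Measurable (σ.symm^[n]) := σ.symm.measurable.iterate n
  exact ((hdm.comp (hs.iterate (j + 1))).const_mul _).mul
    (Finset.measurable_fun_prod _ fun k _ => hcm.comp (hs.iterate (k + 1)))

/-- The real sum takes a default value on divergent series. It is replaced by the sum in `[0, ∞]`,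
which is measurable and, the terms being positive at good points, detects convergence. -/
theorem measurableSet_diam_le (hd : IsStepBound σ M n d) (hγ : 0 < γ) (hdm : Measurable d)
    (hcm : Measurable (coeffC σ M n)) (hgm : MeasurableSet {ω | Good σ M ω}) (D : ℝ) :
    MeasurableSet {ω | (Good σ M ω ∧ Summable (seriesTerm σ M n d γ ω)) ∧
      diam γ (fun ω => ∑' j, seriesTerm σ M n d γ ω j) ω ≤ D} := by
  have hm : Measurable fun ω => ∑' j, ENNReal.ofReal (seriesTerm σ M n d γ ω j) :=
    Measurable.tsum fun j => (measurable_seriesTerm hdm hcm j).ennreal_ofReal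
  have : {ω | (Good σ M ω ∧ Summable (seriesTerm σ M n d γ ω)) ∧
      diam γ (fun ω => ∑' j, seriesTerm σ M n d γ ω j) ω ≤ D} =
      ({ω | Good σ M ω} ∩ {ω | ∑' j, ENNReal.ofReal (seriesTerm σ M n d γ ω j) ≠ ⊤}) ∩
        {ω | diam γ (fun ω => (∑' j, ENNReal.ofReal (seriesTerm σ M n d γ ω j)).toReal) ω ≤ D} := by
    ext ω
    change ((_ ∧ _) ∧ _) ↔ ((_ ∧ _) ∧ _)
    by_cases hω : Good σ M ω
    · have h0 := fun j => (seriesTerm_pos hd hγ hω j).le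
      have e : (∑' j, ENNReal.ofReal (seriesTerm σ M n d γ ω j)).toReal =
          ∑' j, seriesTerm σ M n d γ ω j := by
        rw [ENNReal.tsum_toReal_eq fun j => ENNReal.ofReal_ne_top]
        exact tsum_congr fun j => ENNReal.toReal_ofReal (h0 j)
      have e' : diam γ (fun ω => (∑' j, ENNReal.ofReal (seriesTerm σ M n d γ ω j)).toReal) ω =
          diam γ (fun ω => ∑' j, seriesTerm σ M n d γ ω j) ω := by simp only [diam, e]
      rw [summable_iff_tsum_ofReal h0, ← e']
      rfl
    · exact ⟨fun h => absurd h.1.1 hω, fun h => absurd h.1.1 hω⟩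
  rw [this]
  refine (hgm.inter (measurableSet_eq_fun hm measurable_const).compl).inter
    (measurableSet_le ?_ measurable_const)
  exact (Real.measurable_log.comp (((((ENNReal.measurable_toReal.comp hm).add_const 1).const_mul
    γ).const_add 1).div_const (1 - γ))).const_mul 2

theorem diam_pos (C : ConeField σ M n γ a G) (hω : ω ∈ G) : 0 < diam γ a ω := by
  have h1 := C.a_pos ω hω
  have h2 := C.pos
  have h3 := C.lt_one
  refine mul_pos two_pos (Real.log_pos ?_)
  rw [one_lt_div (by linarith)]
  nlinarith

/-- Diameters are finite wherever the series converges, so some sublevel set has positive measure.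
Taking the `n`-th root for `t` accounts for following only one of the `n` residue classes of times.
-/
theorem exists_visit_set (hn : 0 < n) (hd : IsStepBound σ M n d) (hγ : 0 < γ) (hγ1 : γ < 1)
    (hdm : Measurable d) (hcm : Measurable (coeffC σ M n)) (hgm : MeasurableSet {ω | Good σ M ω})
    (hpos : ¬ ∀ᵐ ω ∂m, ¬ (Good σ M ω ∧ Summable (seriesTerm σ M n d γ ω))) :
    ∃ (a : Ω → ℝ) (G A : Set Ω) (D t : ℝ), ConeField σ M n γ a G ∧ A ⊆ G ∧
      (∀ ω ∈ A, diam γ a ω ≤ D) ∧ 0 < D ∧ 0 < t ∧ t < 1 ∧ t ^ n = Real.tanh (D / 4) ∧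
      MeasurableSet A ∧ m A ≠ 0 := by
  have C := coneField_of_stepBound hn hd hγ hγ1
  have hex : ∃ K : ℕ, m {ω | (Good σ M ω ∧ Summable (seriesTerm σ M n d γ ω)) ∧
      diam γ (fun ω => ∑' j, seriesTerm σ M n d γ ω j) ω ≤ K} ≠ 0 := by
    by_contra hcon
    push Not at hcon
    refine hpos (measure_eq_zero_iff_ae_notMem.1 (measure_mono_null (fun ω hω => ?_)
      (measure_iUnion_null hcon)))
    obtain ⟨K, hK⟩ := exists_nat_ge (diam γ (fun ω => ∑' j, seriesTerm σ M n d γ ω j) ω)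
    exact mem_iUnion.2 ⟨K, hω, hK⟩
  obtain ⟨K, hK⟩ := hex
  have hD : (0 : ℝ) < K := by
    obtain ⟨ω, hω⟩ := nonempty_of_measure_ne_zero hK
    exact (diam_pos C hω.1).trans_le hω.2
  have ht := tanh_pos (by positivity : 0 < (K : ℝ) / 4)
  refine ⟨_, _, _, K, Real.tanh ((K : ℝ) / 4) ^ ((n : ℝ)⁻¹), C, fun ω hω => hω.1,
    fun ω hω => hω.2, hD, Real.rpow_pos_of_pos ht _,
    Real.rpow_lt_one ht.le (Real.tanh_lt_one _) (by positivity),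
    Real.rpow_inv_natCast_pow ht.le hn.ne',
    measurableSet_diam_le hd hγ hdm hcm hgm K, hK⟩

section Global

variable [IsProbabilityMeasure m] (hσ : Ergodic σ m) {sys : ℕ → WeightedOpenMap α β}
  {idx : Ω → ℕ} (hidx : Measurable idx) (hM : ∀ ω, M ω = sys (idx ω))
  (hc : StronglyContracting m σ M)
include hσ hidx hM hc

theorem integrable_log_stepBound {n : ℕ}
    (hci : Integrable (fun ω => Real.log (coeffC σ M n ω)) m) :
    Measurable (fun ω => coeffD σ M n ω + ∏ j ∈ Finset.range n, 2 * coeffD σ M 1 (σ^[j] ω)) ∧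
    Integrable (fun ω => Real.log
      (coeffD σ M n ω + ∏ j ∈ Finset.range n, 2 * coeffD σ M 1 (σ^[j] ω))) m := by
  have hmeas : Measurable
      (fun ω => coeffD σ M n ω + ∏ j ∈ Finset.range n, 2 * coeffD σ M 1 (σ^[j] ω)) :=
    (measurable_coeffD hidx hM n).add (Finset.measurable_fun_prod _ fun j _ =>
      ((measurable_coeffD hidx hM 1).comp (σ.measurable.iterate j)).const_mul 2)
  refine ⟨hmeas, ?_⟩
  have h1 := integrable_log_coeffD hσ hidx hM hc hci
  have h2 := integrable_birkhoffSum hσ.toMeasurePreserving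
    ((integrable_const (Real.log 2)).add (integrable_log_coeffD_one hσ hidx hM hc)) n
  refine (((integrable_const (Real.log 2)).add h1).add h2).mono'
    (Real.measurable_log.comp hmeas).aestronglyMeasurable ?_
  filter_upwards [ae_good hσ hc.einf_pos] with ω hω
  have h3 := three_le_coeffD σ M n ω fun j _ => hω.1 j
  have h4 := (hω.iterL_mem_prod n (one_mem_cone0 (α := α) (β := β))).2
  have h5 : ∀ j : ℕ, 0 < coeffD σ M 1 (σ^[j] ω) := fun j =>
    three_pos.trans_le (three_le_coeffD σ M 1 _ fun i _ => (hω.iterate j).1 i)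
  have h6 : Real.log (∏ j ∈ Finset.range n, 2 * coeffD σ M 1 (σ^[j] ω)) = birkhoffSum σ
      ((fun _ => Real.log 2) + fun ω => Real.log (coeffD σ M 1 ω)) n ω := by
    rw [Real.log_prod fun j _ => (mul_pos two_pos (h5 j)).ne']
    exact Finset.sum_congr rfl fun j _ => Real.log_mul two_ne_zero (h5 j).ne'
  simp only [Pi.add_apply]
  rw [Real.norm_of_nonneg (Real.log_nonneg (by linarith)), ← h6,
    ← Real.log_mul two_ne_zero (by linarith), ← Real.log_mul (by positivity) (by linarith)]
  refine Real.log_le_log (by linarith) ?_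
  nlinarith

theorem exists_coneField : ∃ (n : ℕ) (γ : ℝ) (a : Ω → ℝ) (G A : Set Ω) (D t : ℝ),
    Integrable (fun ω => Real.log (coeffC σ M n ω)) m ∧
    ∫ ω, Real.log (coeffC σ M n ω) ∂m < 0 ∧ ConeField σ M n γ a G ∧ A ⊆ G ∧
      (∀ ω ∈ A, diam γ a ω ≤ D) ∧ 0 < D ∧ 0 < t ∧ t < 1 ∧ t ^ n = Real.tanh (D / 4) ∧
      MeasurableSet A ∧ m A ≠ 0 := by
  obtain ⟨n, hn, hneg⟩ := hc.contracting
  -- A nonintegrable function has integral zero by convention, so a negative integral already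
  -- contains integrability.
  have hci : Integrable (fun ω => Real.log (coeffC σ M n ω)) m :=
    not_imp_comm.1 integral_undef hneg.ne
  -- Half of the negative mean serves as `log γ`: it lies strictly between the mean and zero.
  have hγ1 : Real.exp ((∫ ω, Real.log (coeffC σ M n ω) ∂m) / 2) < 1 :=
    Real.exp_lt_one_iff.2 (by linarith)
  obtain ⟨hdm, hdi⟩ := integrable_log_stepBound hσ hidx hM hc hci
  have hpos := not_ae_not_summable hσ hn isStepBound_prod (Real.exp_pos _)
    (ae_good hσ hc.einf_pos) hdi hci
    (γ := Real.exp ((∫ ω, Real.log (coeffC σ M n ω) ∂m) / 2)) (by rw [Real.log_exp]; linarith)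
  obtain ⟨a, G, A, D, t, h⟩ := exists_visit_set hn isStepBound_prod (Real.exp_pos _) hγ1 hdm
    (measurable_coeffC hidx hM n) (measurableSet_good hidx hM) hpos
  exact ⟨n, _, a, G, A, D, t, hci, hneg, h⟩

/-! ### The multipliers -/

/-- The conformal multiplier lies between the infimum of the weight and a bound for the image of
`1`. By duality the logarithms of the two multipliers differ by the coboundary of `log ν(q) ≥ 0`.
Since the density multiplier is at least the infimum of the weight, this coboundary is bounded above
by an integrable function, and `integrable_coboundary` applies. -/
theorem integrable_log_multipliers {q : Ω → Seg α β → ℝ} {ν : Ω → Measure (Seg α β)}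
    (hq : ∀ᵐ ω ∂m, IsDensity σ M ω (q ω)) (hν : ∀ᵐ ω ∂m, ∃ ε Λ, Represents σ M ω ε Λ (ν ω)) :
    Integrable (fun ω => Real.log (∫ x, (M ω).transfer 1 x ∂(ν (σ ω)))) m ∧
    Integrable (fun ω => Real.log (einf ((M ω).transfer (q ω)))) m ∧
    ∫ ω, Real.log (∫ x, (M ω).transfer 1 x ∂(ν (σ ω))) ∂m =
      ∫ ω, Real.log (einf ((M ω).transfer (q ω))) ∂m := by
  have hσq := hσ.toMeasurePreserving.quasiMeasurePreserving
  have hgood := ae_good hσ hc.einf_pos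
  have hpack : ∀ᵐ ω ∂m, Good σ M ω ∧ IsDensity σ M ω (q ω) ∧ IsDensity σ M (σ ω) (q (σ ω)) ∧
      (∃ ε Λ, Represents σ M ω ε Λ (ν ω)) ∧
      ∃ ε Λ, Represents σ M (σ^[1] ω) ε Λ (ν (σ ω)) := by
    filter_upwards [hgood, hq, hσq.ae hq, hν, hσq.ae hν] with ω h1 h2 h3 h4 h5
    exact ⟨h1, h2, h3, h4, h5⟩
  have hplus : Integrable (fun ω => Real.log (∫ x, (M ω).transfer 1 x ∂(ν (σ ω)))) m := by
    refine ((hc.integrable_log_einf.abs).add (integrable_logBound hc).abs).mono' ?_ ?_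
    · refine (Real.measurable_log.comp_aemeasurable (aemeasurable_of_tendsto_metrizable_ae atTop
        (f := fun k ω => einf (iterL σ M (1 + k) ω 1) / einf (iterL σ M k (σ ω) 1))
        (fun k => ?_) ?_)).aestronglyMeasurable
      · exact ((measurable_iterL hidx hM (1 + k) einf 1).div
          ((measurable_iterL hidx hM k einf 1).comp σ.measurable)).aemeasurable
      · filter_upwards [hpack] with ω ⟨h1, _, _, _, ε, Λ, R'⟩
        have hb := isBV_iterL σ M 1 ω (isBV_one (α := α) (β := β))
        have h2 := R'.functional.tendsto_ratio hb
          (iterL_nonneg σ M 1 ω isBV_one (ae_of_all _ fun _ => zero_le_one))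
        rw [← R'.integral_eq _ hb, iterL_one] at h2
        refine h2.congr fun k => ?_
        rw [iterL_add, iterL_one]
        rfl
    · filter_upwards [hpack] with ω ⟨h1, _, _, _, ε, Λ, R'⟩
      have hb := isBV_iterL σ M 1 ω (isBV_one (α := α) (β := β))
      rw [iterL_one] at hb
      have h0 := h1.1 0
      simp only [Function.iterate_zero, id_eq] at h0
      have h3 := einf_g_mul_le_einf_transfer M (ω := ω) (isBV_one (α := α) (β := β))
        (ae_of_all _ fun _ => zero_le_one) h0
      rw [einf_one, mul_one] at h3
      have h4 := h3.trans (R'.einf_le_integral hb)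
      have h5 : ∫ x, (M ω).transfer 1 x ∂(ν (σ ω)) ≤ Real.exp (logBound (M ω)) := by
        rw [R'.integral_eq _ hb, ← R'.functional.map_const (Real.exp (logBound (M ω)))]
        exact R'.functional.mono hb (isBV_const _) (ae_transfer_one_le h0)
      have h6 := Real.log_le_log h0 h4
      have h7 := Real.log_le_log (h0.trans_le h4) h5
      rw [Real.log_exp] at h7
      rw [Real.norm_eq_abs, Pi.add_apply, abs_le]
      have h8 := neg_abs_le (Real.log (einf (M ω).g))
      have h9 := le_abs_self (logBound (M ω))
      have h10 := abs_nonneg (Real.log (einf (M ω).g))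
      have h11 := abs_nonneg (logBound (M ω))
      constructor <;> linarith
  have hψm : AEMeasurable (fun ω => Real.log (∫ x, q ω x ∂(ν ω))) m :=
    Real.measurable_log.comp_aemeasurable (aemeasurable_integral_density hidx hM hq hν)
  have hrel : ∀ᵐ ω ∂m, Real.log (einf ((M ω).transfer (q ω))) =
      Real.log (∫ x, (M ω).transfer 1 x ∂(ν (σ ω))) -
        (Real.log (∫ x, q (σ ω) x ∂(ν (σ ω))) - Real.log (∫ x, q ω x ∂(ν ω))) := by
    filter_upwards [hpack] with ω ⟨h1, h2, h3, ⟨ε, Λ, R⟩, ε', Λ', R'⟩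
    have he := h2.transfer_eq h1 h3
    have h4 := R.mul_integral_eq R' h2.isBV h3.isBV (by rw [iterL_one]; exact he.1)
    have h5 := R.one_le_integral h2.isBV h2.ae_one_le
    have h6 := R'.one_le_integral h3.isBV h3.ae_one_le
    have h7 := R.integral_iterL_one_pos R'
    rw [iterL_one] at h4 h7
    have h8 := congrArg Real.log h4
    rw [Real.log_mul he.2.1.ne' (by linarith), Real.log_mul h7.ne' (by linarith)] at h8
    linarith
  have hψ0 : ∀ᵐ ω ∂m, 0 ≤ Real.log (∫ x, q ω x ∂(ν ω)) := by
    filter_upwards [hpack] with ω ⟨_, h2, _, ⟨ε, Λ, R⟩, _⟩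
    exact Real.log_nonneg (R.one_le_integral h2.isBV h2.ae_one_le)
  have hcob := integrable_coboundary hσ.toMeasurePreserving hψm hψ0
    (hplus.sub hc.integrable_log_einf) (by
      filter_upwards [hpack, hrel] with ω ⟨h1, h2, h3, _, _⟩ h4
      have h0 := h1.1 0
      simp only [Function.iterate_zero, id_eq] at h0
      have h5 := einf_g_mul_le_einf_transfer M h2.isBV
        (h2.ae_one_le.mono fun x hx => zero_le_one.trans hx) h0
      rw [h2.einf_eq, mul_one] at h5
      have h6 := Real.log_le_log h0 h5
      rw [h4] at h6
      simp only [Pi.sub_apply]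
      linarith)
  refine ⟨hplus, (hplus.sub hcob.1).congr (hrel.mono fun ω h => h.symm), ?_⟩
  rw [integral_congr_ae hrel, integral_sub hplus hcob.1, hcob.2, sub_zero]

end Global

end Final

end RandomInterval
end

/-! ### Assembly of the densities, measures and rates. -/

noncomputable section
namespace RandomInterval
variable {α β : ℝ} [Fact (α < β)]

section Families

variable {Ω : Type*} [MeasurableSpace Ω] {m : Measure Ω} [IsProbabilityMeasure m] {σ : Ω ≃ᵐ Ω}
  {M : Ω → WeightedOpenMap α β} {A : Set Ω} (hσ : Ergodic σ m)
  {q : Ω → Seg α β → ℝ} {ν : Ω → Measure (Seg α β)}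

include hσ

theorem isDensityFamily_of_ae (hgood : ∀ᵐ ω ∂m, Good σ M ω)
    (hq : ∀ᵐ ω ∂m, IsDensity σ M ω (q ω)) :
    IsDensityFamily m σ M q fun ω => einf ((M ω).transfer (q ω)) := by
  filter_upwards [hgood, hq, hσ.toMeasurePreserving.quasiMeasurePreserving.ae hq]
    with ω h1 h2 h3
  obtain ⟨h4, h5, h6⟩ := h2.transfer_eq h1 h3
  exact ⟨h2.isBV, h2.einf_eq, h2.tendsto, h5, h4, rfl, h6⟩

theorem isConformalFamily_of_ae (hν : ∀ᵐ ω ∂m, ∃ ε Λ, Represents σ M ω ε Λ (ν ω)) :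
    IsConformalFamily m σ M ν fun ω => ∫ x, (M ω).transfer 1 x ∂(ν (σ ω)) := by
  filter_upwards [hν, hσ.toMeasurePreserving.quasiMeasurePreserving.ae hν]
    with ω ⟨ε, Λ, R⟩ ⟨ε', Λ', R'⟩
  have R₁ : Represents σ M (σ^[1] ω) ε' Λ' (ν (σ ω)) := R'
  refine ⟨R.isProbabilityMeasure, R.measure_singleton, R.measure_hole, fun f hf hf0 => ?_,
    R.integral_iterL_one_pos R₁, fun f hf => R.integral_iterL R₁ hf, rfl, ?_⟩
  · rw [R.integral_eq f hf]
    exact R.functional.tendsto_ratio hf hf0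
  · have hb := isBV_iterL σ M 1 ω (isBV_one (α := α) (β := β))
    have h := R'.functional.tendsto_ratio hb
      (iterL_nonneg σ M 1 ω isBV_one (ae_of_all _ fun _ => zero_le_one))
    rw [← R'.integral_eq _ hb, iterL_one] at h
    refine h.congr fun k => ?_
    rw [add_comm k 1, iterL_add, iterL_one]
    rfl

theorem ae_measurePreserving_normalized (hgood : ∀ᵐ ω ∂m, Good σ M ω)
    (hq : ∀ᵐ ω ∂m, IsDensity σ M ω (q ω)) (hν : ∀ᵐ ω ∂m, ∃ ε Λ, Represents σ M ω ε Λ (ν ω)) :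
    ∀ᵐ ω ∂m, IsProbabilityMeasure (normalized (q ω) (ν ω)) ∧ MeasurePreserving (M ω).T
      (normalized (q ω) (ν ω)) (normalized (q (σ ω)) (ν (σ ω))) := by
  have hs := hσ.toMeasurePreserving.quasiMeasurePreserving
  filter_upwards [hgood, hq, hs.ae hq, hν, hs.ae hν] with ω h1 h2 h3 ⟨ε, Λ, R⟩ ⟨ε', Λ', R'⟩
  have R₁ : Represents σ M (σ^[1] ω) ε' Λ' (ν (σ ω)) := R'
  exact ⟨R.isProbabilityMeasure_normalized h2.isBV h2.ae_one_le,
    R.measurePreserving_normalized R₁ h2.isBV h2.ae_one_le h3.isBV h3.ae_one_le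
      (h2.transfer_eq h1 h3).1⟩

variable {n : ℕ} {γ : ℝ} {a : Ω → ℝ} {G : Set Ω} {D t : ℝ}

theorem ConeField.ae_regular (C : ConeField σ M n γ a G) (hAG : A ⊆ G)
    (hA : ∀ ω ∈ A, diam γ a ω ≤ D) (hD : 0 < D) (ht0 : 0 < t) (ht1 : t < 1)
    (htn : t ^ n = Real.tanh (D / 4)) (hAm : MeasurableSet A) (hA0 : m A ≠ 0)
    (hgood : ∀ᵐ ω ∂m, Good σ M ω) (hq : ∀ᵐ ω ∂m, IsDensity σ M ω (q ω))
    (hν : ∀ᵐ ω ∂m, ∃ ε Λ, Represents σ M ω ε Λ (ν ω)) : ∀ᵐ ω ∂m, Regular σ M A q ν ω := by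
  filter_upwards [hgood, hq, hν, ae_tendsto_visits_atTop hσ hAm hA0] with ω h1 h2 h3 h4
  exact ⟨h1, h2, h3, h4.1, C.bddAbove_var_pastDensity hAG hA hD ht0 ht1 htn h1 h4.2⟩

variable {sys : ℕ → WeightedOpenMap α β} {idx : Ω → ℕ} (hidx : Measurable idx)
  (hM : ∀ ω, M ω = sys (idx ω)) (hc : StronglyContracting m σ M)
include hidx hM hc

/-- Density and measure are selected by choice at almost every base point. No measurable selection
is made; what is needed is recovered from approximations that depend on finitely many maps. -/
theorem exists_density_measure [m.IsComplete] :
    ∃ (q : Ω → Seg α β → ℝ) (ν : Ω → Measure (Seg α β)),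
      (∀ᵐ ω ∂m, IsDensity σ M ω (q ω)) ∧ (∀ᵐ ω ∂m, ∃ ε Λ, Represents σ M ω ε Λ (ν ω)) ∧
      ∃ r : ℝ, 0 < r ∧ r < 1 ∧
        DecaysAtRate m σ M ν (fun ω => normalized (q ω) (ν ω)) r := by
  obtain ⟨n, γ, a, G, A, D, t, hci, hlt, C, hAG, hA, hD, ht0, ht1, htn, hAm, hA0⟩ :=
    exists_coneField hσ hidx hM hc
  have hgood := ae_good hσ hc.einf_pos
  have hv := ae_tendsto_visits_atTop hσ hAm hA0
  have h1 : ∀ᵐ ω ∂m, ∃ p : (Seg α β → ℝ) × Measure (Seg α β), IsDensity σ M ω p.1 ∧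
      ∃ ε Λ, Represents σ M ω ε Λ p.2 := by
    filter_upwards [hgood, hv, ae_exists_atomBound_lt hσ hgood hci hlt] with ω h2 h3 h4
    obtain ⟨q, hq⟩ := C.exists_isDensity hAG hA hD ht0 ht1 htn h2 h3.2
    obtain ⟨Λ, E⟩ := C.exists_limitFunctional hAG hA hD ht0 ht1 htn h2 h3.1
    obtain ⟨ν, R⟩ := E.exists_represents h4
    exact ⟨(q, ν), hq, _, _, R⟩
  obtain ⟨p, hp⟩ := h1.choice
  have hq : ∀ᵐ ω ∂m, IsDensity σ M ω (p ω).1 := hp.mono fun ω h => h.1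
  have hν : ∀ᵐ ω ∂m, ∃ ε Λ, Represents σ M ω ε Λ (p ω).2 := hp.mono fun ω h => h.2
  -- Any rate above `t ^ m(A)` works, and `m(A) > 0` keeps this number below one.
  obtain ⟨r, hr, hr1⟩ := exists_between (Real.rpow_lt_one ht0.le ht1
    (ENNReal.toReal_pos hA0 (measure_ne_top m A) : 0 < m.real A))
  exact ⟨_, _, hq, hν, r, (Real.rpow_pos_of_pos ht0 _).trans hr, hr1,
    C.decaysAtRate hσ hidx hM hc hAG hA hD ht0 ht1 htn hAm
      (C.ae_regular hσ hAG hA hD ht0 ht1 htn hAm hA0 hgood hq hν) hr⟩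

/-- The contraction of the random cones of a system contracting in one step. -/
theorem one_step_contraction (hq : ∀ᵐ ω ∂m, IsDensity σ M ω (q ω))
    (hν : ∀ᵐ ω ∂m, ∃ ε Λ, Represents σ M ω ε Λ (ν ω)) (hγ : 0 < γ) (hγ1 : γ < 1)
    (hlt : ∫ ω, Real.log (coeffC σ M 1 ω) ∂m < Real.log γ) :
    (∀ᵐ ω ∂m, Summable (apertureTerm σ M γ ω)) ∧
    ∀ D ε ϑ : ℝ, 0 < ε → ε < 1 → 1 - ε < m.real {ω | diamBound σ M γ ω ≤ D} →
      Real.tanh (D / 4) ^ (1 - ε) < ϑ → ϑ < 1 → ContractsCones m σ M (aperture σ M γ) ϑ ∧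
      ∀ r : ℝ, ϑ < r → DecaysAtRate m σ M ν (fun ω => normalized (q ω) (ν ω)) r := by
  have hneg := hlt.trans (Real.log_neg hγ hγ1)
  have hci : Integrable (fun ω => Real.log (coeffC σ M 1 ω)) m :=
    not_imp_comm.1 integral_undef hneg.ne
  have hgood := ae_good hσ hc.einf_pos
  have hs := ae_summable_apertureTerm hσ hγ hgood (integrable_log_coeffD_one hσ hidx hM hc) hci hlt
  refine ⟨by rwa [apertureTerm_eq], fun D ε ϑ hε hε1 hm hϑ hϑ1 => ?_⟩
  have C := coneField_of_stepBound one_pos isStepBound_one hγ hγ1 (σ := σ) (M := M)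
  have ha : (fun ω => ∑' j, seriesTerm σ M 1 (coeffD σ M 1) γ ω j) = aperture σ M γ := by
    rw [← apertureTerm_eq]
    rfl
  have hAm := measurableSet_diam_le (σ := σ) isStepBound_one hγ (measurable_coeffD hidx hM 1)
    (measurable_coeffC hidx hM 1) (measurableSet_good hidx hM) D
  rw [ha] at C hAm
  set G := {ω | Good σ M ω ∧ Summable (seriesTerm σ M 1 (coeffD σ M 1) γ ω)}
  set A := {ω | (Good σ M ω ∧ Summable (seriesTerm σ M 1 (coeffD σ M 1) γ ω)) ∧
    diam γ (aperture σ M γ) ω ≤ D}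
  have hG : ∀ᵐ ω ∂m, ω ∈ G := by
    filter_upwards [hgood, hs] with ω h1 h2 using ⟨h1, h2⟩
  -- Almost every base point is good with a convergent series, so intersecting with `G` changes the
  -- sublevel set by a null set only.
  have hAD : m.real {ω | diamBound σ M γ ω ≤ D} = m.real A := by
    refine measureReal_congr (Filter.eventuallyEq_set.2 ?_)
    filter_upwards [hG] with ω h
    exact ⟨fun h' => ⟨h, h'⟩, fun h' => h'.2⟩
  rw [hAD] at hm
  have hA0 : m A ≠ 0 := fun h => by
    rw [measureReal_def, h, ENNReal.toReal_zero] at hm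
    linarith
  have hAG : A ⊆ G := fun ω h => h.1
  have hA : ∀ ω ∈ A, diam γ (aperture σ M γ) ω ≤ D := fun ω h => h.2
  have hD : 0 < D := by
    obtain ⟨ω, hω⟩ := nonempty_of_measure_ne_zero hA0
    exact (diam_pos C hω.1).trans_le hω.2
  have ht0 : 0 < Real.tanh (D / 4) := tanh_pos (by positivity)
  have ht1 := Real.tanh_lt_one (D / 4)
  -- Since `m(A) > 1 - ε` and the base is below one, `tanh (D / 4) ^ m(A)` is at most `tanh (D / 4)
  -- ^ (1 - ε)`, hence below every `r > ϑ`.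
  exact ⟨C.contractsCones hσ hA hD hAm hG hm hϑ, fun r hr =>
    C.decaysAtRate hσ hidx hM hc hAG hA hD ht0 ht1 (pow_one _) hAm
      (C.ae_regular hσ hAG hA hD ht0 ht1 (pow_one _) hAm hA0 hgood hq hν)
      ((Real.rpow_le_rpow_of_exponent_ge ht0 ht1.le hm.le).trans_lt (hϑ.trans hr))⟩

end Families

end RandomInterval
end

theorem mainTheorem1 (α β : ℝ) (hαβ : α < β)
    {Ω : Type*} [MeasurableSpace Ω] (m : MeasureTheory.Measure Ω)
    [MeasureTheory.IsProbabilityMeasure m] [m.IsComplete]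
    (σ : Ω ≃ᵐ Ω) (hσ : Ergodic σ m)
    (sys : ℕ → RandomInterval.WeightedOpenMap α β)
    (idx : Ω → ℕ) (hidx : Measurable idx)
    (M : Ω → RandomInterval.WeightedOpenMap α β) (hM : ∀ ω, M ω = sys (idx ω))
    (hcontr : RandomInterval.StronglyContracting m σ M) :
    ∃ (q : Ω → RandomInterval.Seg α β → ℝ)
      (ν μ : Ω → MeasureTheory.Measure (RandomInterval.Seg α β))
      (lamMinus lamPlus : Ω → ℝ),
      -- equivariant densities and conformal measures
      RandomInterval.IsDensityFamily m σ M q lamMinus ∧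
      RandomInterval.IsConformalFamily m σ M ν lamPlus ∧
      -- equality of the integrated multipliers
      MeasureTheory.Integrable (fun ω => Real.log (lamPlus ω)) m ∧
      MeasureTheory.Integrable (fun ω => Real.log (lamMinus ω)) m ∧
      ∫ ω, Real.log (lamPlus ω) ∂m = ∫ ω, Real.log (lamMinus ω) ∂m ∧
      -- equivariant probability measures
      (∀ ω, μ ω = RandomInterval.normalized (q ω) (ν ω)) ∧
      (∀ᵐ ω ∂m, MeasureTheory.IsProbabilityMeasure (μ ω) ∧
        MeasureTheory.MeasurePreserving (M ω).T (μ ω) (μ (σ ω))) ∧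
      -- exponential decay of correlations
      (∃ r : ℝ, 0 < r ∧ r < 1 ∧ RandomInterval.DecaysAtRate m σ M ν μ r) ∧
      -- one-step contraction: any rate above the contraction factor of the random cones
      (∀ γ : ℝ, 0 < γ → γ < 1 →
        ∫ ω, Real.log (RandomInterval.coeffC σ M 1 ω) ∂m < Real.log γ →
        (∀ᵐ ω ∂m, Summable (RandomInterval.apertureTerm σ M γ ω)) ∧
        ∀ D ε ϑ : ℝ, 0 < ε → ε < 1 →
          1 - ε < m.real {ω | RandomInterval.diamBound σ M γ ω ≤ D} →
          Real.tanh (D / 4) ^ (1 - ε) < ϑ → ϑ < 1 →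
          RandomInterval.ContractsCones m σ M (RandomInterval.aperture σ M γ) ϑ ∧
          ∀ r : ℝ, ϑ < r → RandomInterval.DecaysAtRate m σ M ν μ r) := by
  have : Fact (α < β) := ⟨hαβ⟩
  have hgood := RandomInterval.ae_good hσ hcontr.einf_pos
  obtain ⟨q, ν, hq, hν, r, hr, hr1, hdecay⟩ :=
    RandomInterval.exists_density_measure hσ hidx hM hcontr
  obtain ⟨hplus, hminus, heq⟩ :=
    RandomInterval.integrable_log_multipliers hσ hidx hM hcontr hq hν
  exact ⟨q, ν, fun ω => RandomInterval.normalized (q ω) (ν ω), _, _,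
    RandomInterval.isDensityFamily_of_ae hσ hgood hq, RandomInterval.isConformalFamily_of_ae hσ hν,
    hplus, hminus, heq, fun ω => rfl,
    RandomInterval.ae_measurePreserving_normalized hσ hgood hq hν, ⟨r, hr, hr1, hdecay⟩,
    fun γ hγ hγ1 hlt =>
      RandomInterval.one_step_contraction hσ hidx hM hcontr hq hν hγ hγ1 hlt⟩
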